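/- **Conventions.** Let $\Omega=[0,1]$ or $\Omega=[0,\infty)$ with Lebesgue measure $\mu$, and let $L_0$ be the space of real-valued measurable functions on $\Omega$ modulo a.e. equality, with the topology of convergence in measure on sets of finite measure. A *Köthe function space* is a Banach space $X\subset L_0$ containing $\chi_B$ whenever $\mu(B)<\infty$, such that $\|f\|_X\le\|g\|_X$ whenever $|f|\le|g|$ a.e., and such that $\{f:\|f\|_X\le 1\}$ is closed in $L_0$; here $\|f\|_X=\infty$ for $f\notin X$. It is an *r.i. space* if $\|f\|_X=\|f^*\|_X$ for all $f\in L_0$, where $f^*(t)=\inf\{s\ge 0:\mu(|f|>s)\le t\}$ is the decreasing rearrangement. For $1\le r<\infty$, $X$ is *$r$-concave* if there is $M$ such that $\left(\sum_{k=1}^n\|f_k\|_X^r\right)^{1/r}\le M\left\|\left(\sum_{k=1}^n|f_k|^r\right)^{1/r}\right\|_X$ for all $n$ and all $f_1,\dots,f_n\in X$. For Köthe function spaces $X,Y$ on $\Omega$ put $K(t,f)=\inf\{\|x\|_X+t\|y\|_Y: x+y=f\}$. The pair $(X,Y)$ is a *Calderón couple* if for all $f,g\in X+Y$ with $K(t,f)\le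 K(t,g)$ for all $t>0$ there is a linear operator $T:X+Y\to X+Y$ with $\sup\{\|Th\|_X:\|h\|_X\le1\}<\infty$, $\sup\{\|Th\|_Y:\|h\|_Y\le1\}<\infty$ and $Tg=f$. Let $J=\{n\in\mathbb Z:n<0\}$ if $\Omega=[0,1]$ and $J=\mathbb Z$ if $\Omega=[0,\infty)$. For an r.i. space $X$ let $E_X$ be the sequence space on $J$ with norm $\|x\|_{E_X}=\left\|\sum_{k\in J}x(k)\chi_{[2^k,2^{k+1})}\right\|_X$. For sets $A,B\subset J$ write $A<B$ if $a<b$ for all $a\in A$, $b\in B$. For an interval $I$ of $\mathbb Z$, a family $(x_n,y_n)_{n\in I}$ of pairs of finitely supported sequences on $J$ is *interlaced* if $\operatorname{supp}x_n<\operatorname{supp}y_n$ for all $n\in I$ and $\operatorname{supp}x_m\cup\operatorname{supp}y_m<\operatorname{supp}x_n\cup\operatorname{supp}y_n$ for all $m<n$ in $I$. Then $X$ is *stretchable* if there is a constant $C$ such that $$\Big\|\sum_{n\in I}\alpha_ny_n\Big\|_{E_X}\le C\Big\|\sum_{n\in I}\alpha_nx_n\Big\|_{E_X}$$ for every interlaced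 family with $\|y_n\|_{E_X}\le\|x_n\|_{E_X}=1$ $(n\in I)$ and all finitely nonzero scalars $(\alpha_n)_{n\in I}$. It is *compressible* if there is a constant $C'$ such that $$\Big\|\sum_{n\in I}\alpha_nx_n\Big\|_{E_X}\le C'\Big\|\sum_{n\in I}\alpha_ny_n\Big\|_{E_X}$$ for every interlaced family with $\|x_n\|_{E_X}\le\|y_n\|_{E_X}=1$ $(n\in I)$ and all finitely nonzero scalars $(\alpha_n)_{n\in I}$. It is *elastic* if it is both stretchable and compressible. **Statement.** Let $X$ be an r.i. space on $[0,1]$ or $[0,\infty)$ that is $r$-concave for some $1\le r<\infty$. Then both $(L_1,X)$ and $(L_\infty,X)$ are Calderón couples if and only if $X$ is elastic. -/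

import Mathlib

open MeasureTheory Set Filter Topology
open scoped ENNReal NNReal

noncomputable section

/-- A Köthe function space over `μ`: a Banach space `X` of classes of real measurable functions
modulo `μ`-a.e. equality.  It is given by its norm, extended by the value `∞` off `X`; so `X` is
the set where `eNorm` is finite (see `KotheSpace.carrier`). -/
structure KotheSpace {Ω : Type*} [MeasurableSpace Ω] (μ : Measure Ω) where
  /-- the norm, with value `∞` outside the space -/
  eNorm : (Ω →ₘ[μ] ℝ) → ℝ≥0∞
  eq_zero_of_eNorm : ∀ f, eNorm f = 0 → f = 0
  eNorm_smul : ∀ (c : ℝ) f, eNorm (c • f) = ‖c‖ₑ * eNorm f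
  eNorm_add_le : ∀ f g, eNorm (f + g) ≤ eNorm f + eNorm g
  /-- the space is complete -/
  complete : ∀ u : ℕ → Ω →ₘ[μ] ℝ, (∀ n, eNorm (u n) < ∞) →
    (∀ ε : ℝ≥0∞, 0 < ε → ∃ n₀, ∀ m ≥ n₀, ∀ n ≥ n₀, eNorm (u m - u n) < ε) →
    ∃ f, eNorm f < ∞ ∧ Tendsto (fun n => eNorm (u n - f)) atTop (𝓝 0)
  /-- the space contains the characteristic functions of sets of finite measure -/
  indicator_mem : ∀ (B : Set Ω) (hB : MeasurableSet B), μ B < ∞ →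
    eNorm (AEEqFun.mk (B.indicator fun _ => (1 : ℝ))
      ((measurable_const.indicator hB).aestronglyMeasurable)) < ∞
  /-- the norm is monotone in the modulus -/
  mono : ∀ f g : Ω →ₘ[μ] ℝ, (∀ᵐ x ∂μ, |f x| ≤ |g x|) → eNorm f ≤ eNorm g
  /-- the Fatou property: the closed unit ball is closed for convergence in measure on sets of
  finite measure (sequences suffice: that topology is metrizable when `μ` is σ-finite) -/
  fatou : ∀ (u : ℕ → Ω →ₘ[μ] ℝ) (f : Ω →ₘ[μ] ℝ), (∀ n, eNorm (u n) ≤ 1) →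
    (∀ B, MeasurableSet B → μ B < ∞ →
      TendstoInMeasure (μ.restrict B) (fun n => ⇑(u n)) atTop f) → eNorm f ≤ 1

namespace KotheSpace

variable {Ω : Type*} [MeasurableSpace Ω] {μ : Measure Ω}

/-- The space itself, as a linear subspace of the space of all (classes of) functions. -/
def carrier (X : KotheSpace μ) : Submodule ℝ (Ω →ₘ[μ] ℝ) where
  carrier := {f | X.eNorm f < ∞}
  add_mem' {f g} hf hg := (X.eNorm_add_le f g).trans_lt (ENNReal.add_lt_top.2 ⟨hf, hg⟩)
  zero_mem' := by
    have h := X.eNorm_smul 0 0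
    simp only [zero_smul, enorm_zero, zero_mul] at h
    simp [h]
  smul_mem' c f hf := by
    simp only [mem_ofPred_eq] at hf ⊢
    rw [X.eNorm_smul]
    exact ENNReal.mul_lt_top enorm_lt_top hf

/-- The Peetre `K`-functional of the pair `(X, Y)`; decompositions with `x ∉ X` or `y ∉ Y`
contribute the value `∞` to the infimum. -/
def kFunctional (X Y : KotheSpace μ) (t : ℝ≥0) (f : Ω →ₘ[μ] ℝ) : ℝ≥0∞ :=
  ⨅ (x : Ω →ₘ[μ] ℝ) (y : Ω →ₘ[μ] ℝ) (_ : x + y = f), X.eNorm x + t * Y.eNorm y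

/-- The sum `X + Y`. -/
abbrev sum (X Y : KotheSpace μ) : Submodule ℝ (Ω →ₘ[μ] ℝ) := X.carrier ⊔ Y.carrier

/-- `opNorm X T = sup {‖T f‖_X : ‖f‖_X ≤ 1}` for an operator `T` on a space `V` that contains `X`.
It is `∞` if `T` does not map `X` into `X`. -/
def opNorm (X : KotheSpace μ) {V : Submodule ℝ (Ω →ₘ[μ] ℝ)} (T : V →ₗ[ℝ] V) : ℝ≥0∞ :=
  ⨆ (f : V) (_ : X.eNorm f ≤ 1), X.eNorm (T f)

/-- `(X, Y)` is a Calderón couple: whenever `f, g ∈ X + Y` satisfy `K(t, f) ≤ K(t, g)` for all `t`,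
there is an operator `T` on `X + Y` that is bounded on `X` and on `Y`, with `T g = f`. -/
def IsCalderonCouple (X Y : KotheSpace μ) : Prop :=
  ∀ f g : sum X Y, (∀ t : ℝ≥0, 0 < t → kFunctional X Y t f ≤ kFunctional X Y t g) →
    ∃ T : sum X Y →ₗ[ℝ] sum X Y, opNorm X T < ∞ ∧ opNorm Y T < ∞ ∧ T g = f

/-- `X` is `r`-concave. -/
def IsConcave (X : KotheSpace μ) (r : ℝ) : Prop :=
  ∃ M : ℝ≥0, ∀ (n : ℕ) (f : Fin n → Ω →ₘ[μ] ℝ), (∀ k, f k ∈ X.carrier) →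
    ∀ g : Ω →ₘ[μ] ℝ, (∀ᵐ x ∂μ, g x = (∑ k, |f k x| ^ r) ^ (1 / r)) →
      (∑ k, X.eNorm (f k) ^ r) ^ (1 / r) ≤ M * X.eNorm g

/-- The Lebesgue space `L_p(μ)`, `1 ≤ p ≤ ∞`, as a Köthe function space. -/
def lebesgue (μ : Measure Ω) [SigmaFinite μ] (p : ℝ≥0∞) (hp : 1 ≤ p) : KotheSpace μ where
  eNorm f := eLpNorm f p μ
  eq_zero_of_eNorm f hf := by
    rw [eLpNorm_eq_zero_iff f.aestronglyMeasurable (by positivity)] at hf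
    exact AEEqFun.ext (hf.trans AEEqFun.coeFn_zero.symm)
  eNorm_smul c f := by
    rw [eLpNorm_congr_ae (AEEqFun.coeFn_smul c f), eLpNorm_const_smul]
  eNorm_add_le f g := by
    rw [eLpNorm_congr_ae (AEEqFun.coeFn_add f g)]
    exact eLpNorm_add_le f.aestronglyMeasurable g.aestronglyMeasurable hp
  complete u hu hc := by
    have : Fact (1 ≤ p) := ⟨hp⟩
    let U : ℕ → Lp ℝ p μ := fun n => ⟨u n, Lp.mem_Lp_iff_eLpNorm_lt_top.2 (hu n)⟩
    have key : ∀ (m : ℕ) (F : Lp ℝ p μ),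
        eLpNorm (u m - (F : Ω →ₘ[μ] ℝ) : Ω →ₘ[μ] ℝ) p μ = edist (U m) F := fun m F => by
      rw [Lp.edist_def]
      exact eLpNorm_congr_ae (AEEqFun.coeFn_sub _ _)
    have hU : CauchySeq U := by
      rw [EMetric.cauchySeq_iff]
      intro ε hε
      obtain ⟨n₀, h⟩ := hc ε hε
      exact ⟨n₀, fun m hm n hn => (key m (U n)) ▸ h m hm n hn⟩
    obtain ⟨F, hF⟩ := cauchySeq_tendsto_of_complete hU
    refine ⟨F, Lp.eLpNorm_lt_top F, ?_⟩
    simp only [key]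
    exact tendsto_iff_edist_tendsto_0.1 hF
  indicator_mem B hB hμ := by
    rw [eLpNorm_congr_ae (AEEqFun.coeFn_mk _ _)]
    exact (memLp_indicator_const p hB (1 : ℝ) (Or.inr hμ.ne)).2
  mono f g h := eLpNorm_mono_ae (by simpa [Real.norm_eq_abs] using h)
  fatou u f hu hlim := by
    have h1 : ∀ n, eLpNorm f p (μ.restrict (spanningSets μ n)) ≤ 1 := fun n => by
      obtain ⟨ns, -, hns⟩ := (hlim _ (measurableSet_spanningSets μ n)
        (measure_spanningSets_lt_top μ n)).exists_seq_tendsto_ae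
      refine (Lp.eLpNorm_lim_le_liminf_eLpNorm
        (fun k => (u (ns k)).aestronglyMeasurable.restrict) f hns).trans ?_
      refine liminf_le_of_le (by isBoundedDefault) fun b hb => ?_
      obtain ⟨k, hk⟩ := hb.exists
      exact hk.trans ((eLpNorm_mono_measure _ Measure.restrict_le_self).trans (hu _))
    refine (Lp.eLpNorm_lim_le_liminf_eLpNorm
      (f := fun n => (spanningSets μ n).indicator f)
      (fun n => f.aestronglyMeasurable.indicator (measurableSet_spanningSets μ n)) f
      (Eventually.of_forall fun x => ?_)).trans ?_
    · refine tendsto_const_nhds.congr' ?_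
      filter_upwards [eventually_ge_atTop (spanningSetsIndex μ x)] with n hn
      rw [indicator_of_mem]
      exact monotone_spanningSets μ hn (mem_spanningSetsIndex μ x)
    · refine liminf_le_of_le (by isBoundedDefault) fun b hb => ?_
      obtain ⟨k, hk⟩ := hb.exists
      refine hk.trans ?_
      rw [eLpNorm_indicator_eq_eLpNorm_restrict (measurableSet_spanningSets μ k)]
      exact h1 k

end KotheSpace

/-- The two underlying intervals `[0,1]` and `[0,∞)`. -/
inductive RIDomain
  | unitInterval
  | halfLine

namespace RIDomain

/-- The interval, as a subset of `ℝ`. -/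
def set : RIDomain → Set ℝ
  | unitInterval => Icc 0 1
  | halfLine => Ici 0

/-- Lebesgue measure on the interval. -/
abbrev measure (D : RIDomain) : Measure ℝ := volume.restrict D.set

/-- The set `J` of the `n` for which `[2^n, 2^(n+1))` is used: the negative integers for `[0,1]`,
all integers for `[0,∞)`. -/
def index : RIDomain → Set ℤ
  | unitInterval => Iio 0
  | halfLine => univ

end RIDomain

/-- The decreasing rearrangement `f^*(t) = inf {s ≥ 0 : μ(|f| > s) ≤ t}`. -/
def decRearrangement {Ω : Type*} [MeasurableSpace Ω] {μ : Measure Ω} (f : Ω →ₘ[μ] ℝ) (t : ℝ) :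
    ℝ≥0∞ :=
  sInf {s : ℝ≥0∞ | μ {x | s < ‖f x‖ₑ} ≤ ENNReal.ofReal t}

/-- The step function `∑_{k ∈ J} x(k) χ_{[2^k, 2^(k+1))}`. -/
def stepFun {J : Set ℤ} (x : J → ℝ) (t : ℝ) : ℝ :=
  ∑' k : J, (Ico ((2 : ℝ) ^ (k : ℤ)) ((2 : ℝ) ^ ((k : ℤ) + 1))).indicator (fun _ => x k) t

theorem measurable_stepFun {J : Set ℤ} (x : J → ℝ) : Measurable (stepFun x) := by
  refine measurable_of_tendsto_metrizable' (atTop : Filter (Finset J))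
    (f := fun (s : Finset J) (t : ℝ) => ∑ k ∈ s,
      (Ico ((2 : ℝ) ^ (k : ℤ)) ((2 : ℝ) ^ ((k : ℤ) + 1))).indicator (fun _ => x k) t)
    (fun s => Finset.measurable_sum _ fun k _ => measurable_const.indicator measurableSet_Ico)
    (tendsto_pi_nhds.2 fun t => ?_)
  have hs : Summable fun k : J =>
      (Ico ((2 : ℝ) ^ (k : ℤ)) ((2 : ℝ) ^ ((k : ℤ) + 1))).indicator (fun _ => x k) t := by
    refine summable_of_hasFiniteSupport (Set.Subsingleton.finite fun a ha b hb => ?_)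
    have ha' := mem_of_indicator_ne_zero ha
    have hb' := mem_of_indicator_ne_zero hb
    have h1 := (zpow_lt_zpow_iff_right₀ (one_lt_two (α := ℝ))).1 (ha'.1.trans_lt hb'.2)
    have h2 := (zpow_lt_zpow_iff_right₀ (one_lt_two (α := ℝ))).1 (hb'.1.trans_lt ha'.2)
    exact Subtype.ext (by omega)
  exact hs.hasSum

namespace KotheSpace

variable {D : RIDomain}

/-- `X` is rearrangement invariant: `‖f‖_X = ‖f^*‖_X` for all `f`. -/
def IsRearrangementInvariant (X : KotheSpace D.measure) : Prop :=
  ∀ f g : ℝ →ₘ[D.measure] ℝ, (∀ᵐ t ∂D.measure, ‖g t‖ₑ = decRearrangement f t) →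
    X.eNorm f = X.eNorm g

/-- The (extended) norm of the sequence space `E_X` on `J`:
`‖x‖_{E_X} = ‖∑_{k ∈ J} x(k) χ_{[2^k, 2^(k+1))}‖_X`. -/
def seqNorm (X : KotheSpace D.measure) (x : D.index → ℝ) : ℝ≥0∞ :=
  X.eNorm (AEEqFun.mk (stepFun x) (measurable_stepFun x).aestronglyMeasurable)

end KotheSpace

section Shift

variable {J : Set ℤ}

/-- `A < B`: every element of `A` is smaller than every element of `B`. -/
def SetLT (A B : Set J) : Prop := ∀ a ∈ A, ∀ b ∈ B, a < b

/-- The pair `(x_n, y_n)_{n ∈ I}` is interlaced: finite supports, and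
`supp x_n < supp y_n < supp x_{n+1} < supp y_{n+1} < ⋯`.  The order is demanded of all pairs and
not only of neighbours, so that it also holds across a vanishing term. -/
structure IsInterlaced (I : Set ℤ) (x y : ℤ → J → ℝ) : Prop where
  finite_left : ∀ n ∈ I, (Function.support (x n)).Finite
  finite_right : ∀ n ∈ I, (Function.support (y n)).Finite
  lt : ∀ n ∈ I, SetLT (Function.support (x n)) (Function.support (y n))
  lt_next : ∀ m ∈ I, ∀ n ∈ I, m < n →
    SetLT (Function.support (x m) ∪ Function.support (y m))
      (Function.support (x n) ∪ Function.support (y n))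

/-- The right-shift property of the sequence space on `J` with norm `N`. -/
def RightShiftProperty (N : (J → ℝ) → ℝ≥0∞) : Prop :=
  ∃ C : ℝ≥0, ∀ (I : Set ℤ) (x y : ℤ → J → ℝ), I.OrdConnected → IsInterlaced I x y →
    (∀ n ∈ I, N (y n) ≤ 1 ∧ N (x n) = 1) →
    ∀ (s : Finset ℤ) (α : ℤ → ℝ), ↑s ⊆ I →
      N (∑ n ∈ s, α n • y n) ≤ C * N (∑ n ∈ s, α n • x n)

/-- The left-shift property of the sequence space on `J` with norm `N`. -/
def LeftShiftProperty (N : (J → ℝ) → ℝ≥0∞) : Prop :=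
  ∃ C : ℝ≥0, ∀ (I : Set ℤ) (x y : ℤ → J → ℝ), I.OrdConnected → IsInterlaced I x y →
    (∀ n ∈ I, N (x n) ≤ 1 ∧ N (y n) = 1) →
    ∀ (s : Finset ℤ) (α : ℤ → ℝ), ↑s ⊆ I →
      N (∑ n ∈ s, α n • x n) ≤ C * N (∑ n ∈ s, α n • y n)

end Shift

namespace KotheSpace

variable {D : RIDomain}

/-- `X` is stretchable: `E_X` has the right-shift property. -/
def IsStretchable (X : KotheSpace D.measure) : Prop := RightShiftProperty X.seqNorm

/-- `X` is compressible: `E_X` has the left-shift property. -/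
def IsCompressible (X : KotheSpace D.measure) : Prop := LeftShiftProperty X.seqNorm

/-- `X` is elastic: stretchable and compressible. -/
def IsElastic (X : KotheSpace D.measure) : Prop := X.IsStretchable ∧ X.IsCompressible

end KotheSpace

end

/-! Everything is moved to dyadic sequences. Averaging over the dyadic intervals is a contraction
for every r.i. norm (`DistMono.dyadicNorm_average_le`), so a Calderón couple of function spaces
induces one of sequence spaces (`IsCalderonCouple.seqCalderon`). Conversely, a function and the
sequence of values of its rearrangement at the points 2^(k-1) are mapped to each other by operators
that are bounded for all r.i. norms (`Levelled.exists_expansion`, `exists_compression`), so that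
only decreasing sequences g have to be treated (`IsCalderonCouple.of_antitone`).

Let N be the norm of E_X, M the dyadic L_1 or L_∞ norm, and φ(2^k) the norm of the characteristic
function of the k-th dyadic interval. The weight t_k = 2·2^k/φ(2^k) for L_1, and t_k = 1/φ(2^k) with
the index set reversed for L_∞, ties the two norms together (`Compat`). In consequence K(t_n, f) is
equivalent to M(f on (-∞,n]) + t_n N(f on [n,∞)) (`kSeq_le`, `Compat.le_kSeq`). Reversal of the
index set turns the right-shift property into the left-shift property, so a single theory serves
both couples.

Elasticity gives operators. Where the right tails of g govern its K-functional, the coordinates at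
which f is not small against g are grouped by the size of the tail of g. Each group is fed, through
a norming functional, by a finite piece of g just to its right. The left-shift properties of N and M
make this operator bounded on both spaces (`LeftShift.block_le`, `exists_operator`). Left tails are
handled by reversal (`exists_operator_of_kSeq_le`). The necessary decay of tails comes from
r-concavity (`IsConcave.orderCont`). L_∞ has no such decay, but for decreasing g the tail on the N
side governs everywhere.

The Calderón property gives shifts. M has the shift property trivially; it has to be transferred to
N (`LeftShift.of_seqCalderon`). If families of widely separated pairs (x_n, y_n) violated the shift
inequality arbitrarily badly, infinitely many of them could be glued with rapidly varying weights
into f = Σ c_n x_n (suitably scaled down) and g = Σ c_n y_n with K(·,f) ≤ K(·,g). A single bounded T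
with Tg = f then maps every y_n almost to a multiple of x_n (`exists_diagonal`). Averaging over
signs removes the off-diagonal part (`block_diagonal_le`), and near-maximality of the x_n absorbs
the error (`SepBlock.false_of_blocks`). Hence separated families obey a shift inequality
(`exists_sepFam_bound`). Arbitrary interlaced families reduce to separated ones: long pairs by
taking every other member (`RangedFam.long_le`), short pairs by clustering them into ranges where N
and M are proportional up to constants (`RangedFam.short_le`). -/

/-! ### Lattice norms on sequences. -/

/-- A lattice norm with the Fatou property on the real families indexed by `ι`, extended by `∞`. -/
structure SeqNorm (ι : Type*) where
  /-- the norm, with value `∞` outside the space -/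
  toFun : (ι → ℝ) → ℝ≥0∞
  smul' : ∀ (c : ℝ) x, toFun (c • x) = ‖c‖ₑ * toFun x
  add_le' : ∀ x y, toFun (x + y) ≤ toFun x + toFun y
  mono' : ∀ x y, (∀ i, |x i| ≤ |y i|) → toFun x ≤ toFun y
  fatou' : ∀ x c, (∀ A : Finset ι, toFun ((A : Set ι).indicator x) ≤ c) → toFun x ≤ c
  single_ne_zero' : ∀ i, toFun (({i} : Set ι).indicator 1) ≠ 0
  single_ne_top' : ∀ i, toFun (({i} : Set ι).indicator 1) ≠ ∞

namespace SeqNorm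

variable {ι : Type*}

instance : CoeFun (SeqNorm ι) fun _ => (ι → ℝ) → ℝ≥0∞ := ⟨toFun⟩

section Basic

variable (N : SeqNorm ι)

theorem map_smul (c : ℝ) (x : ι → ℝ) : N (c • x) = ‖c‖ₑ * N x := N.smul' c x

theorem add_le (x y : ι → ℝ) : N (x + y) ≤ N x + N y := N.add_le' x y

theorem mono {x y : ι → ℝ} (h : ∀ i, |x i| ≤ |y i|) : N x ≤ N y := N.mono' x y h

theorem fatou {x : ι → ℝ} {c : ℝ≥0∞} (h : ∀ A : Finset ι, N ((A : Set ι).indicator x) ≤ c) :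
    N x ≤ c := N.fatou' x c h

@[simp] theorem map_zero : N 0 = 0 := by
  have := N.map_smul 0 0
  simpa using this

theorem map_nnreal_smul (c : ℝ≥0) (x : ι → ℝ) : N ((c : ℝ) • x) = c * N x := by
  rw [N.map_smul, Real.enorm_eq_ofReal c.coe_nonneg, ENNReal.ofReal, Real.toNNReal_coe]

@[simp] theorem indicator_empty (x : ι → ℝ) : N ((∅ : Set ι).indicator x) = 0 := by
  rw [Set.indicator_empty']
  exact N.map_zero

theorem indicator_real_smul (S : Set ι) (c : ℝ) (x : ι → ℝ) :
    S.indicator (c • x) = c • S.indicator x := Set.indicator_const_smul S c x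

theorem indicator_le_add {S T U : Set ι} (h : S ⊆ T ∪ U) (x : ι → ℝ) :
    N (S.indicator x) ≤ N (T.indicator x) + N (U.indicator x) := by
  have h1 : N (S.indicator x) ≤ N ((fun i => |T.indicator x i|) + fun i => |U.indicator x i|) :=
    N.mono fun i => by
      refine le_trans ?_ (le_abs_self _)
      by_cases hS : i ∈ S
      · rcases h hS with h | h
        · simp [hS, h]
        · simp [hS, h]
      · rw [Set.indicator_of_notMem hS, abs_zero]
        simp only [Pi.add_apply]
        positivity
  refine h1.trans ((N.add_le _ _).trans (add_le_add (N.mono fun i => ?_) (N.mono fun i => ?_))) <;>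
    simp

theorem map_neg (x : ι → ℝ) : N (-x) = N x := by
  have := N.map_smul (-1) x
  simpa using this

theorem sub_le (x y : ι → ℝ) : N (x - y) ≤ N x + N y := by
  rw [sub_eq_add_neg, ← N.map_neg y]
  exact N.add_le _ _

theorem abs_indicator_le (S : Set ι) (x : ι → ℝ) (i : ι) : |S.indicator x i| ≤ |x i| := by
  by_cases h : i ∈ S <;> simp [h]

theorem indicator_le (S : Set ι) (x : ι → ℝ) : N (S.indicator x) ≤ N x :=
  N.mono fun i => abs_indicator_le S x i

theorem indicator_mono {S T : Set ι} (h : S ⊆ T) (x : ι → ℝ) :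
    N (S.indicator x) ≤ N (T.indicator x) := N.mono fun i => by
  by_cases hS : i ∈ S
  · simp [hS, h hS]
  · simp [hS]

theorem indicator_singleton (x : ι → ℝ) (i : ι) :
    N (({i} : Set ι).indicator x) = ‖x i‖ₑ * N (({i} : Set ι).indicator 1) := by
  rw [← N.map_smul]
  congr 1
  ext j
  by_cases h : j = i
  · subst h; simp
  · simp [h]

theorem indicator_singleton_ne_top (x : ι → ℝ) (i : ι) : N (({i} : Set ι).indicator x) ≠ ∞ := by
  rw [indicator_singleton]
  exact ENNReal.mul_ne_top enorm_ne_top (N.single_ne_top' i)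

theorem eq_zero {x : ι → ℝ} (h : N x = 0) : x = 0 := by
  ext i
  have h1 : N (({i} : Set ι).indicator x) = 0 := le_antisymm ((N.indicator_le _ x).trans h.le) zero_le
  rw [indicator_singleton, mul_eq_zero] at h1
  simpa using h1.resolve_right (N.single_ne_zero' i)

theorem sum_le {κ : Type*} (s : Finset κ) (x : κ → ι → ℝ) : N (∑ k ∈ s, x k) ≤ ∑ k ∈ s, N (x k) := by
  classical
  induction s using Finset.induction_on with
  | empty => simp
  | insert a s ha ih =>
    rw [Finset.sum_insert ha, Finset.sum_insert ha]
    exact (N.add_le _ _).trans (by gcongr)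

theorem finite_ne_top {S : Set ι} (hS : S.Finite) (x : ι → ℝ) : N (S.indicator x) ≠ ∞ := by
  classical
  have h : N (S.indicator x) ≤ ∑ k ∈ hS.toFinset, N (({k} : Set ι).indicator x) := by
    refine le_trans (le_of_eq ?_) (N.sum_le _ _)
    congr 1
    ext i
    simp only [Finset.sum_apply, Set.indicator_apply, mem_singleton_iff]
    simp
  exact ne_top_of_le_ne_top (ENNReal.sum_ne_top.2 fun k _ => N.indicator_singleton_ne_top x k) h

/-- Countable subadditivity over a cover. -/
theorem le_tsum_of_cover {κ : Type*} (v : ι → ℝ) (Z : κ → Set ι) (d : κ → ℝ≥0∞)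
    (hc : ∀ i, v i ≠ 0 → ∃ k, i ∈ Z k) (hd : ∀ k, N ((Z k).indicator v) ≤ d k) :
    N v ≤ ∑' k, d k := by
  classical
  refine N.fatou fun A => ?_
  by_cases hκ : Nonempty κ
  swap
  · have : v = 0 := by
      ext i
      by_contra h
      obtain ⟨k, -⟩ := hc i h
      exact hκ ⟨k⟩
    simp [this]
  obtain ⟨k₀⟩ := hκ
  have hch : ∀ i, ∃ k, v i ≠ 0 → i ∈ Z k := fun i => by
    by_cases h : v i = 0
    · exact ⟨k₀, fun h' => absurd h h'⟩
    · obtain ⟨k, hk⟩ := hc i h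
      exact ⟨k, fun _ => hk⟩
  choose κ' hκ' using hch
  have h1 : N ((A : Set ι).indicator v) ≤ N (∑ k ∈ A.image κ', (Z k).indicator fun i => |v i|) := by
    refine N.mono fun i => ?_
    rw [Finset.sum_apply]
    by_cases hi : i ∈ A
    swap
    · rw [show (A : Set ι).indicator v i = 0 by simp [hi], abs_zero]
      exact abs_nonneg _
    by_cases hv : v i = 0
    · rw [show (A : Set ι).indicator v i = 0 by simp [hv], abs_zero]
      exact abs_nonneg _
    rw [Set.indicator_of_mem (by exact_mod_cast hi)]
    refine le_trans ?_ (le_abs_self _)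
    refine le_trans (le_of_eq ?_) (Finset.single_le_sum
      (f := fun k => (Z k).indicator (fun i => |v i|) i) (fun k _ => ?_)
      (Finset.mem_image_of_mem κ' hi))
    · simp [Set.indicator_of_mem (hκ' i hv)]
    · exact Set.indicator_nonneg (fun _ _ => abs_nonneg _) _
  refine h1.trans ((N.sum_le _ _).trans ?_)
  refine le_trans (Finset.sum_le_sum fun k _ => ?_) (ENNReal.sum_le_tsum (A.image κ'))
  refine le_trans (N.mono fun i => ?_) (hd k)
  by_cases h : i ∈ Z k <;> simp [h]

/-- A functional that norms `g` on a finite set. -/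
theorem exists_functional {S : Set ι} (hS : S.Finite) (g : ι → ℝ) :
    ∃ ψ : (ι → ℝ) →ₗ[ℝ] ℝ, ψ g = (N (S.indicator g)).toReal ∧
      ∀ u, |ψ u| ≤ (N (S.indicator u)).toReal := by
  have hfin : ∀ u, N (S.indicator u) ≠ ∞ := fun u => N.finite_ne_top hS u
  -- Finiteness of S makes this a real-valued seminorm on all sequences, so Hahn–Banach extends the
  -- functional from the line through g.
  let p : (ι → ℝ) → ℝ := fun u => (N (S.indicator u)).toReal
  have hsm : ∀ (c : ℝ) x, p (c • x) = |c| * p x := fun c x => by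
    simp only [p]
    rw [indicator_real_smul, N.map_smul, ENNReal.toReal_mul]
    simp
  have hadd : ∀ x y, p (x + y) ≤ p x + p y := fun x y => by
    simp only [p]
    rw [Set.indicator_add', ← ENNReal.toReal_add (hfin x) (hfin y)]
    exact ENNReal.toReal_mono (ENNReal.add_ne_top.2 ⟨hfin x, hfin y⟩) (N.add_le _ _)
  by_cases hg : g = 0
  · exact ⟨0, by simp [hg], fun u => by simp⟩
  obtain ⟨ψ, hψ, hle⟩ := exists_extension_of_le_sublinear
    (LinearPMap.mkSpanSingleton (σ := RingHom.id ℝ) g (p g) hg) p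
    (fun c hc x => by rw [hsm, abs_of_pos hc]) hadd (by
      rintro ⟨x, hx⟩
      obtain ⟨c, rfl⟩ := Submodule.mem_span_singleton.1 hx
      rw [LinearPMap.mkSpanSingleton'_apply]
      simp only [RingHom.id_apply, smul_eq_mul, hsm]
      exact mul_le_mul_of_nonneg_right (le_abs_self c) ENNReal.toReal_nonneg)
  refine ⟨ψ, ?_, fun u => abs_le.2 ⟨?_, hle u⟩⟩
  · have := hψ ⟨g, Submodule.mem_span_singleton_self g⟩
    rw [LinearPMap.mkSpanSingleton_apply] at this
    exact this
  · have h1 := hle (-u)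
    have h2 : p (-u) = p u := by
      have := hsm (-1) u
      simpa using this
    rw [h2, _root_.map_neg] at h1
    linarith

/-- The norm on the reversed index set. -/
def dual : SeqNorm ιᵒᵈ where
  toFun x := N (x ∘ OrderDual.toDual)
  smul' _ _ := N.smul' _ _
  add_le' _ _ := N.add_le' _ _
  mono' _ _ h := N.mono' _ _ h
  fatou' _ _ h := N.fatou' _ _ h
  single_ne_zero' i := N.single_ne_zero' i
  single_ne_top' i := N.single_ne_top' i

end Basic

theorem abs_sum_le_of_disjoint (s : Finset ℤ) (S : ℤ → Set ι) (u : ι → ℝ)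
    (hd : ∀ m ∈ s, ∀ n ∈ s, m < n → Disjoint (S m) (S n)) (i : ι) :
    |(∑ n ∈ s, (S n).indicator u) i| ≤ |u i| := by
  rw [Finset.sum_apply]
  by_cases h : ∃ n ∈ s, i ∈ S n
  · obtain ⟨n, hn, hi⟩ := h
    rw [Finset.sum_eq_single_of_mem n hn]
    · exact abs_indicator_le _ _ _
    · intro m hm hmn
      refine Set.indicator_of_notMem (fun him => ?_) _
      rcases lt_or_gt_of_ne hmn with h1 | h1
      · exact Set.disjoint_left.1 (hd m hm n hn h1) him hi
      · exact Set.disjoint_left.1 (hd n hn m hm h1) hi him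
  · push Not at h
    rw [Finset.sum_eq_zero fun n hn => Set.indicator_of_notMem (h n hn) _]
    simp

/-! ### The left-shift property and blockwise domination. -/

section LeftShift

variable [LT ι]

/-- The left-shift property with constant `K`, for finite families that are not normalised. -/
def LeftShift (N : SeqNorm ι) (K : ℝ≥0) : Prop :=
  ∀ (s : Finset ℤ) (x y : ℤ → ι → ℝ), (∀ n ∈ s, N (x n) ≤ N (y n)) →
    (∀ n ∈ s, (Function.support (x n)).Finite ∧ (Function.support (y n)).Finite) →
    (∀ n ∈ s, ∀ i j, x n i ≠ 0 → y n j ≠ 0 → i < j) →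
    (∀ m ∈ s, ∀ n ∈ s, m < n → ∀ i j, (x m i ≠ 0 ∨ y m i ≠ 0) → (x n j ≠ 0 ∨ y n j ≠ 0) → i < j) →
    N (∑ n ∈ s, x n) ≤ K * N (∑ n ∈ s, y n)

end LeftShift

section Operator

variable [LinearOrder ι]

/-- Blockwise domination of `v` by `u`, each block of `u` lying just to the right of the block of
`v`, gives domination of the norms. -/
theorem LeftShift.block_le {N : SeqNorm ι} {K : ℝ≥0} (hN : N.LeftShift K) (F S : ℤ → Set ι)
    (hS : ∀ k, (S k).Finite) (hFS : ∀ k, ∀ i ∈ F k, ∀ j ∈ S k, i < j)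
    (hnext : ∀ k l, k + 2 ≤ l → ∀ i ∈ F k ∪ S k, ∀ j ∈ F l ∪ S l, i < j)
    (u v : ι → ℝ) (hv : ∀ i, v i ≠ 0 → ∃ k, i ∈ F k)
    (hle : ∀ k, N ((F k).indicator v) ≤ N ((S k).indicator u)) : N v ≤ 2 * K * N u := by
  classical
  refine N.fatou fun A => ?_
  have hch : ∀ i, ∃ k, v i ≠ 0 → i ∈ F k := fun i => by
    by_cases h : v i = 0
    · exact ⟨0, fun h' => absurd h h'⟩
    · obtain ⟨k, hk⟩ := hv i h
      exact ⟨k, fun _ => hk⟩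
  choose κ hκ using hch
  -- The sets F k may be infinite, while the shift property concerns finite supports; the cut with
  -- A, allowed by Fatou, repairs this.
  set x : ℤ → ι → ℝ := fun k => ((A : Set ι) ∩ F k).indicator fun i => |v i| with hx
  set y : ℤ → ι → ℝ := fun k => (S k).indicator u with hy
  have hxF : ∀ k i, x k i ≠ 0 → i ∈ F k := fun k i h => by
    by_contra h'
    exact h (by simp [hx, h'])
  have hyS : ∀ k i, y k i ≠ 0 → i ∈ S k := fun k i h => by
    by_contra h'
    exact h (by simp [hy, h'])
  have key : ∀ s : Finset ℤ, (∀ m ∈ s, ∀ n ∈ s, m < n → m + 2 ≤ n) →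
      N (∑ n ∈ s, x n) ≤ K * N u := fun s hs => by
    refine (hN s x y (fun n _ => ?_) (fun n _ => ⟨?_, ?_⟩) (fun n _ i j hi hj => ?_)
      (fun m hm n hn hmn i j hi hj => ?_)).trans ?_
    · refine le_trans (N.mono fun i => ?_) (hle n)
      by_cases h1 : i ∈ F n <;> by_cases h2 : i ∈ A <;> simp [hx, h1, h2]
    · exact A.finite_toSet.subset fun i hi => by
        by_contra h
        exact hi (by simp only [hx]; exact Set.indicator_of_notMem (fun h' => h h'.1) _)
    · exact (hS n).subset fun i hi => hyS n i hi
    · exact hFS n i (hxF n i hi) j (hyS n j hj)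
    · exact hnext m n (hs m hm n hn hmn) i (hi.imp (hxF m i) (hyS m i)) j
        (hj.imp (hxF n j) (hyS n j))
    · gcongr
      refine N.mono (abs_sum_le_of_disjoint s S u fun m hm n hn hmn => ?_)
      refine Set.disjoint_left.2 fun i h1 h2 => ?_
      exact lt_irrefl i (hnext m n (hs m hm n hn hmn) i (Or.inr h1) i (Or.inr h2))
  set s := A.image κ
  have h1 : N ((A : Set ι).indicator v) ≤ N (∑ n ∈ s, x n) := by
    refine N.mono fun i => ?_
    rw [Finset.sum_apply]
    by_cases hi : i ∈ A
    swap
    · rw [show (A : Set ι).indicator v i = 0 by simp [hi], abs_zero]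
      exact abs_nonneg _
    by_cases hv0 : v i = 0
    · rw [show (A : Set ι).indicator v i = 0 by simp [hv0], abs_zero]
      exact abs_nonneg _
    rw [Set.indicator_of_mem (by exact_mod_cast hi)]
    refine le_trans ?_ (le_abs_self _)
    refine le_trans (le_of_eq ?_) (Finset.single_le_sum
      (f := fun k => x k i) (fun k _ => ?_) (Finset.mem_image_of_mem κ hi))
    · simp [hx, hi, hκ i hv0]
    · exact Set.indicator_nonneg (fun _ _ => abs_nonneg _) _
  -- Blocks are only known to be ordered when their indices differ by at least two. Even and odd
  -- indices are treated separately, which is the factor 2.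
  have h2 : ∑ n ∈ s, x n = ∑ n ∈ s.filter (fun n => Even n), x n +
      ∑ n ∈ s.filter (fun n => ¬ Even n), x n := (Finset.sum_filter_add_sum_filter_not _ _ _).symm
  rw [h2] at h1
  refine h1.trans ((N.add_le _ _).trans ?_)
  rw [mul_assoc, two_mul]
  refine add_le_add (key _ fun m hm n hn hmn => ?_) (key _ fun m hm n hn hmn => ?_)
  · obtain ⟨a, ha⟩ := (Finset.mem_filter.1 hm).2
    obtain ⟨b, hb⟩ := (Finset.mem_filter.1 hn).2
    omega
  · obtain ⟨a, ha⟩ := Int.not_even_iff_odd.1 (Finset.mem_filter.1 hm).2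
    obtain ⟨b, hb⟩ := Int.not_even_iff_odd.1 (Finset.mem_filter.1 hn).2
    omega

end Operator

/-! ### Compatible weights and the basic operator. -/

/-- `N` and `M` are compatible with the weight `t`: on vectors supported where `t ≤ τ` the norm `M`
is at most `τ N`, and on those supported where `t ≥ τ` it is at least a multiple of `τ N`. -/
structure Compat (N M : SeqNorm ι) (t : ι → ℝ≥0) (c : ℝ≥0) : Prop where
  pos : ∀ i, 0 < t i
  low : ∀ (τ : ℝ≥0) (u : ι → ℝ), (∀ i, u i ≠ 0 → t i ≤ τ) → M u ≤ τ * N u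
  high : ∀ (τ : ℝ≥0) (u : ι → ℝ), (∀ i, u i ≠ 0 → τ ≤ t i) → τ * N u ≤ c * M u

end SeqNorm

namespace SeqNorm

variable {ι : Type*}

/-- By Fatou it is enough to bound the norm over finite subsets of R, and such a subset lies in the
tail that starts at its least element. No least element of R itself is needed. -/
theorem le_of_finset_subset [LinearOrder ι] (N : SeqNorm ι) (R : Set ι) (f : ι → ℝ) {c : ℝ≥0∞}
    (h : ∀ j ∈ R, N ((Ici j).indicator f) ≤ c) : N (R.indicator f) ≤ c := by
  classical
  refine N.fatou fun A => ?_
  rw [Set.indicator_indicator]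
  by_cases hne : (A.filter (· ∈ R)).Nonempty
  · set j := (A.filter (· ∈ R)).min' hne
    have hj := (A.filter (· ∈ R)).min'_mem hne
    refine (N.indicator_mono (fun i hi => ?_) f).trans (h j (Finset.mem_filter.1 hj).2)
    exact Finset.min'_le _ _ (Finset.mem_filter.2 ⟨by exact_mod_cast hi.1, hi.2⟩)
  · have : (A : Set ι) ∩ R = ∅ := by
      refine Set.eq_empty_iff_forall_notMem.2 fun i hi => hne ⟨i, ?_⟩
      exact Finset.mem_filter.2 ⟨by exact_mod_cast hi.1, hi.2⟩
    rw [this, N.indicator_empty]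
    exact zero_le

/-- A diagonal operator with bounded entries. -/
theorem exists_multiplier (f g : ι → ℝ) (D : Set ι) (C : ℝ≥0) (h : ∀ i ∈ D, |f i| ≤ C * |g i|) :
    ∃ T : (ι → ℝ) →ₗ[ℝ] (ι → ℝ), (∀ (N : SeqNorm ι) u, N (T u) ≤ C * N u) ∧
      T g = D.indicator f := by
  classical
  refine ⟨{ toFun := fun u i => if i ∈ D then f i / g i * u i else 0
            map_add' := fun u v => by ext i; by_cases hi : i ∈ D <;> simp [hi, mul_add]
            map_smul' := fun c u => by
              ext i; by_cases hi : i ∈ D <;> simp [hi, mul_left_comm] }, fun N u => ?_, ?_⟩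
  · rw [← N.map_nnreal_smul]
    refine N.mono fun i => ?_
    simp only [LinearMap.coe_mk, AddHom.coe_mk, Pi.smul_apply, smul_eq_mul, abs_mul, NNReal.abs_eq]
    by_cases hi : i ∈ D
    · simp only [hi, if_true, abs_mul, abs_div]
      gcongr
      by_cases hg : g i = 0
      · simp [hg]
      · exact (div_le_iff₀ (abs_pos.2 hg)).2 (h i hi)
    · simp only [hi, if_false, abs_zero]
      positivity
  · ext i
    simp only [LinearMap.coe_mk, AddHom.coe_mk]
    by_cases hi : i ∈ D
    · simp only [hi, if_true, Set.indicator_of_mem]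
      by_cases hg : g i = 0
      · have := h i hi
        rw [hg, abs_zero, mul_zero] at this
        simp [hg, abs_nonpos_iff.1 this]
      · field_simp
    · simp [hi]

variable [LinearOrder ι] [LocallyFiniteOrder ι]

/-- If the tails of `g` dominate those of `f` at the points of `D`, then an operator that is
bounded for both norms maps `g` to the restriction of `f` to `D`. -/
theorem exists_operator {N M : SeqNorm ι} {t : ι → ℝ≥0} {c K K' : ℝ≥0} (hc : Compat N M t c)
    (ht : Monotone t) (hN : N.LeftShift K) (hM : M.LeftShift K') (f g : ι → ℝ) (D : Set ι)
    {C : ℝ≥0} (hC : 0 < C)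
    (hQ : ∀ n ∈ D, N ((Ici n).indicator f) ≤ C * N ((Ici n).indicator g))
    (hP : ∀ n ∈ D, M ((Iic n).indicator f) ≤ C * (t n * N ((Ici n).indicator g)))
    (hfin : ∀ n ∈ D, N ((Ici n).indicator g) ≠ ∞)
    (htail : ∀ ε : ℝ≥0∞, 0 < ε → BddAbove {n | ε < N ((Ici n).indicator g)}) :
    ∃ (T : (ι → ℝ) →ₗ[ℝ] (ι → ℝ)) (C' : ℝ≥0), (∀ u, N (T u) ≤ C' * N u) ∧
      (∀ u, M (T u) ≤ C' * M u) ∧ T g = D.indicator f := by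
  classical
  set Q : ι → ℝ≥0∞ := fun n => N ((Ici n).indicator g) with hQdef
  have hQanti : Antitone Q := fun m n hmn => N.indicator_mono (Ici_subset_Ici.2 hmn) g
  -- On the rest of D a diagonal operator suffices. On D₁ the coordinate of g is too small to
  -- produce that of f, and f has to be fed from the later part of g.
  set D₁ : Set ι := {n | n ∈ D ∧ 4 * C * |g n| < |f n|} with hD₁
  obtain ⟨T₀, hT₀, hT₀g⟩ := exists_multiplier f g (D \ D₁) (4 * C) fun i hi => by
    have h2 : ¬ (4 * C * |g i| < |f i|) := fun h => hi.2 ⟨hi.1, h⟩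
    push_cast
    exact not_lt.1 h2
  have hC0 : (C : ℝ≥0∞) ≠ 0 := by exact_mod_cast hC.ne'
  -- C·4·N(g e_n) ≤ N(f e_n) is at most the tail norm of f, hence at most C·Q(n). So the coordinate
  -- n carries at most a quarter of the tail of g, and at least three quarters remain strictly to
  -- its right.
  have hsingle : ∀ n ∈ D₁, 4 * N (({n} : Set ι).indicator g) ≤ Q n := fun n hn => by
    have h1 : (C : ℝ≥0∞) * (4 * N (({n} : Set ι).indicator g)) ≤ C * Q n := by
      refine le_trans ?_ (hQ n hn.1)
      refine le_trans ?_ (N.indicator_mono (singleton_subset_iff.2 self_mem_Ici) f)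
      rw [N.indicator_singleton f, N.indicator_singleton g, ← mul_assoc, ← mul_assoc]
      gcongr
      have h3 := hn.2.le
      rw [Real.enorm_eq_ofReal_abs, Real.enorm_eq_ofReal_abs]
      have h4 : (C : ℝ≥0∞) * 4 = ENNReal.ofReal (4 * C) := by
        rw [ENNReal.ofReal_mul (by norm_num), mul_comm]
        simp
      rw [h4, ← ENNReal.ofReal_mul (by positivity)]
      exact ENNReal.ofReal_le_ofReal h3
    exact (ENNReal.mul_le_mul_iff_right hC0 ENNReal.coe_ne_top).1 h1
  have hQ0 : ∀ n ∈ D₁, Q n ≠ 0 := fun n hn h0 => by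
    have h1 := hQ n hn.1
    have h2 : N ((Ici n).indicator f) = 0 := by
      refine le_antisymm (h1.trans ?_) zero_le
      change (C : ℝ≥0∞) * Q n ≤ 0
      simp [h0]
    have h3 := congrFun (N.eq_zero h2) n
    simp only [mem_Ici, le_refl, Set.indicator_of_mem, Pi.zero_apply] at h3
    have h4 := hn.2
    rw [h3, abs_zero] at h4
    exact absurd h4 (not_lt.2 (by positivity))
  have hIoi : ∀ n ∈ D₁, 3 * Q n ≤ 4 * N ((Ioi n).indicator g) := fun n hn => by
    have h1 : Q n ≤ N (({n} : Set ι).indicator g) + N ((Ioi n).indicator g) := by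
      refine N.indicator_le_add (fun i hi => ?_) g
      rcases eq_or_lt_of_le (mem_Ici.1 hi) with h | h
      · exact Or.inl h.symm
      · exact Or.inr h
    have h2 : Q n + 3 * Q n ≤ Q n + 4 * N ((Ioi n).indicator g) := by
      calc Q n + 3 * Q n = 4 * Q n := by ring
        _ ≤ 4 * (N (({n} : Set ι).indicator g) + N ((Ioi n).indicator g)) := by gcongr
        _ = 4 * N (({n} : Set ι).indicator g) + 4 * N ((Ioi n).indicator g) := mul_add _ _ _
        _ ≤ _ := by gcongr; exact hsingle n hn
    exact (ENNReal.add_le_add_iff_left (hfin n hn.1)).1 h2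
  have h40 : (4 : ℝ≥0∞) ≠ 0 := by norm_num
  have h4t : (4 : ℝ≥0∞) ≠ ∞ := by norm_num
  -- Points of D₁ are sorted by the size of the tail of g, on the scale of powers of 4.
  have hlevel : ∀ n, ∃ k : ℤ, n ∈ D₁ → Q n ∈ Ioc ((4 : ℝ≥0∞) ^ (-k)) (4 ^ (-k + 1)) := fun n => by
    by_cases hn : n ∈ D₁
    · obtain ⟨k, hk⟩ := ENNReal.exists_mem_Ioc_zpow (hQ0 n hn) (hfin n hn.1)
        (y := 4) (by norm_num) h4t
      exact ⟨-k, fun _ => by simpa using hk⟩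
    · exact ⟨0, fun h => absurd h hn⟩
  choose lev hlev using hlevel
  set F : ℤ → Set ι := fun k => {n | n ∈ D₁ ∧ lev n = k} with hF
  have hFQ : ∀ k, ∀ n ∈ F k, Q n ∈ Ioc ((4 : ℝ≥0∞) ^ (-k)) (4 ^ (-k + 1)) := fun k n hn => by
    have := hlev n hn.1
    rwa [hn.2] at this
  -- S k is the supplier of F k: everything to the right of F k where the tail of g has not yet
  -- dropped to 4^(-k-1). The decay of the tails makes it finite.
  set S : ℤ → Set ι := fun k => {m | (F k).Nonempty ∧ (∀ n ∈ F k, n < m) ∧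
    (4 : ℝ≥0∞) ^ (-k - 1) < Q m} with hS
  have hpos : ∀ k : ℤ, (0 : ℝ≥0∞) < 4 ^ k := fun k => ENNReal.zpow_pos h40 h4t k
  have hnt : ∀ k : ℤ, (4 : ℝ≥0∞) ^ k ≠ ∞ := fun k => ENNReal.zpow_ne_top h40 h4t k
  have hsucc : ∀ k : ℤ, (4 : ℝ≥0∞) ^ (k + 1) = 4 * 4 ^ k := fun k => by
    rw [ENNReal.zpow_add h40 h4t, zpow_one, mul_comm]
  have hmono : ∀ {k l : ℤ}, k ≤ l → (4 : ℝ≥0∞) ^ k ≤ 4 ^ l := fun h =>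
    ENNReal.zpow_le_of_le (by norm_num) h
  have hSfin : ∀ k, (S k).Finite := fun k => by
    by_cases hne : (F k).Nonempty
    · obtain ⟨n, hn⟩ := hne
      obtain ⟨b, hb⟩ := htail _ (hpos (-k - 1))
      exact (Set.finite_Ioc n b).subset fun m hm => ⟨hm.2.1 n hn, hb hm.2.2⟩
    · exact Set.finite_empty.subset fun m hm => (hne hm.1).elim
  have hFS : ∀ k, ∀ i ∈ F k, ∀ j ∈ S k, i < j := fun k i hi j hj => hj.2.1 i hi
  -- On F k ∪ S k the tail exceeds 4^(-k-1), on F l ∪ S l it is at most 4^(-l+1) ≤ 4^(-k-1). Tails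
  -- decrease, so the first union lies entirely to the left.
  have hnext : ∀ k l, k + 2 ≤ l → ∀ i ∈ F k ∪ S k, ∀ j ∈ F l ∪ S l, i < j := by
    intro k l hkl i hi j hj
    have h1 : (4 : ℝ≥0∞) ^ (-k - 1) < Q i := by
      rcases hi with hi | hi
      · exact (hmono (by omega)).trans_lt (hFQ k i hi).1
      · exact hi.2.2
    have h2 : Q j ≤ 4 ^ (-l + 1) := by
      rcases hj with hj | hj
      · exact (hFQ l j hj).2
      · obtain ⟨n, hn⟩ := hj.1
        exact (hQanti (hj.2.1 n hn).le).trans (hFQ l n hn).2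
    by_contra hij
    exact absurd (hQanti (not_lt.1 hij)) (not_le.2 ((h2.trans (hmono (by omega))).trans_lt h1))
  have hmax : ∀ k, (F k).Nonempty → ∃ m ∈ F k, ∀ n ∈ F k, n ≤ m := fun k hne => by
    obtain ⟨n, hn⟩ := hne
    obtain ⟨b, hb⟩ := htail _ (hpos (-k))
    have hfinite : (F k ∩ Ici n).Finite :=
      (Set.finite_Icc n b).subset fun m hm => ⟨hm.2, hb (hFQ k m hm.1).1⟩
    obtain ⟨m, hm, hmm⟩ := Set.exists_max_image _ id hfinite ⟨n, hn, le_refl n⟩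
    refine ⟨m, hm.1, fun i hi => ?_⟩
    rcases le_total i n with h | h
    · exact h.trans hm.2
    · exact hmm i ⟨hi, h⟩
  -- Let m be the last point of F k. The tail beyond m has norm at least (3/4)·4^(-k), and the part
  -- of it outside S k has norm at most (1/4)·4^(-k); S k keeps half of 4^(-k).
  have hSg : ∀ k, (F k).Nonempty → (4 : ℝ≥0∞) ^ (-k) ≤ 2 * N ((S k).indicator g) := by
    intro k hne
    obtain ⟨m, hm, hmm⟩ := hmax k hne
    set R : Set ι := {j | m < j ∧ Q j ≤ 4 ^ (-k - 1)} with hR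
    have h1 : N ((Ioi m).indicator g) ≤ N ((S k).indicator g) + N (R.indicator g) := by
      refine N.indicator_le_add (fun j hj => ?_) g
      by_cases h : Q j ≤ 4 ^ (-k - 1)
      · exact Or.inr ⟨hj, h⟩
      · exact Or.inl ⟨hne, fun n hn => (hmm n hn).trans_lt hj, not_le.1 h⟩
    have h2 : N (R.indicator g) ≤ 4 ^ (-k - 1) := N.le_of_finset_subset R g fun j hj => hj.2
    have h3 : 4 * (4 : ℝ≥0∞) ^ (-k - 1) = 4 ^ (-k) := by
      rw [← hsucc]
      congr 1
      ring
    have h4 : 3 * (4 : ℝ≥0∞) ^ (-k) ≤ 4 * N ((S k).indicator g) + 4 ^ (-k) := by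
      calc 3 * (4 : ℝ≥0∞) ^ (-k) ≤ 3 * Q m := by gcongr; exact (hFQ k m hm).1.le
        _ ≤ 4 * N ((Ioi m).indicator g) := hIoi m hm.1
        _ ≤ 4 * (N ((S k).indicator g) + 4 ^ (-k - 1)) := by gcongr; exact h1.trans (by gcongr)
        _ = _ := by rw [mul_add, h3]
    have h5 : 2 * (4 : ℝ≥0∞) ^ (-k) + 4 ^ (-k) ≤ 2 * (2 * N ((S k).indicator g)) + 4 ^ (-k) := by
      calc 2 * (4 : ℝ≥0∞) ^ (-k) + 4 ^ (-k) = 3 * 4 ^ (-k) := by ring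
        _ ≤ _ := h4
        _ = _ := by ring
    have h6 := (ENNReal.add_le_add_iff_right (hnt (-k))).1 h5
    exact (ENNReal.mul_le_mul_iff_right (by norm_num) (by norm_num)).1 h6
  have hSpos : ∀ k, (F k).Nonempty → N ((S k).indicator g) ≠ 0 := fun k hne h0 => by
    have := hSg k hne
    rw [h0, mul_zero] at this
    exact absurd this (not_le.2 (hpos _))
  have hStop : ∀ k u, N ((S k).indicator u) ≠ ∞ := fun k u => N.finite_ne_top (hSfin k) u
  have hFf : ∀ k, (F k).Nonempty → N ((F k).indicator f) ≤ 8 * C * N ((S k).indicator g) := by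
    intro k hne
    refine N.le_of_finset_subset _ f fun n hn => ?_
    calc N ((Ici n).indicator f) ≤ C * Q n := hQ n hn.1.1
      _ ≤ C * 4 ^ (-k + 1) := by gcongr; exact (hFQ k n hn).2
      _ = C * (4 * 4 ^ (-k)) := by rw [hsucc]
      _ ≤ C * (4 * (2 * N ((S k).indicator g))) := by gcongr; exact hSg k hne
      _ = _ := by ring
  choose ψ hψg hψ using fun k => N.exists_functional (hSfin k) g
  -- On F k the value is f times ψ_k(u)/ψ_k(g), where ψ_k norms g on S k. Thus g is mapped to f on
  -- D₁, and only the part of u on S k enters the coefficient.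
  let T₁ : (ι → ℝ) →ₗ[ℝ] (ι → ℝ) :=
    { toFun := fun u i => if i ∈ D₁ then ψ (lev i) u / ψ (lev i) g * f i else 0
      map_add' := fun u v => by ext i; by_cases hi : i ∈ D₁ <;> simp [hi, add_div, add_mul]
      map_smul' := fun a u => by
        ext i; by_cases hi : i ∈ D₁ <;> simp [hi, mul_div_assoc, mul_assoc] }
  have hT₁ : ∀ u k, (F k).indicator (T₁ u) = (ψ k u / ψ k g) • (F k).indicator f := fun u k => by
    ext i
    by_cases hi : i ∈ F k
    · have h1 := hi.1
      have h2 := hi.2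
      simp [T₁, hi, h1, h2]
    · simp [hi]
  have hcoef : ∀ u k, (F k).Nonempty →
      ‖ψ k u / ψ k g‖ₑ ≤ N ((S k).indicator u) / N ((S k).indicator g) := fun u k hne => by
    have h1 : (N ((S k).indicator g)).toReal ≠ 0 :=
      (ENNReal.toReal_pos (hSpos k hne) (hStop k g)).ne'
    rw [Real.enorm_eq_ofReal_abs, abs_div, hψg, abs_of_nonneg ENNReal.toReal_nonneg,
      ENNReal.ofReal_div_of_pos (ENNReal.toReal_pos (hSpos k hne) (hStop k g)),
      ENNReal.ofReal_toReal (hStop k g)]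
    gcongr
    exact ENNReal.ofReal_le_of_le_toReal (hψ k u)
  -- The coefficient is at most N(u on S k)/N(g on S k); multiplied out, a bound for L on the block
  -- becomes the hypothesis of `LeftShift.block_le` for B • u.
  have hblock : ∀ (L : SeqNorm ι) (B : ℝ≥0) (u : ι → ℝ), (∀ k, (F k).Nonempty →
      L ((F k).indicator f) * N ((S k).indicator u) ≤
        B * L ((S k).indicator u) * N ((S k).indicator g)) →
      ∀ k, L ((F k).indicator (T₁ u)) ≤ L ((S k).indicator ((B : ℝ) • u)) := by
    intro L B u h k
    by_cases hne : (F k).Nonempty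
    · rw [hT₁, L.map_smul, indicator_real_smul, L.map_nnreal_smul]
      refine (mul_le_mul_left (hcoef u k hne) _).trans ?_
      rw [ENNReal.div_eq_inv_mul, mul_assoc, mul_comm (N _) (L _)]
      refine (mul_le_mul_right (h k hne) _).trans (le_of_eq ?_)
      rw [mul_comm _ (N ((S k).indicator g)), ← mul_assoc,
        ENNReal.inv_mul_cancel (hSpos k hne) (hStop k g), one_mul]
    · have : F k = ∅ := Set.not_nonempty_iff_eq_empty.1 hne
      rw [this, L.indicator_empty]
      exact zero_le
  have hcover : ∀ u i, T₁ u i ≠ 0 → ∃ k, i ∈ F k := fun u i h => by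
    by_cases hi : i ∈ D₁
    · exact ⟨lev i, hi, rfl⟩
    · exact absurd (by simp [T₁, hi]) h
  have hN₁ : ∀ u, N (T₁ u) ≤ 2 * K * (8 * C : ℝ≥0) * N u := fun u => by
    have := hN.block_le F S hSfin hFS hnext (((8 * C : ℝ≥0) : ℝ) • u) (T₁ u) (hcover u)
      (hblock N (8 * C) u fun k hne => by
        push_cast
        calc N ((F k).indicator f) * N ((S k).indicator u)
            ≤ 8 * C * N ((S k).indicator g) * N ((S k).indicator u) := by
              gcongr; exact hFf k hne
          _ = _ := by ring)
    rwa [map_nnreal_smul, ← mul_assoc] at this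
  have hM₁ : ∀ u, M (T₁ u) ≤ 2 * K' * (8 * C * c : ℝ≥0) * M u := fun u => by
    have := hM.block_le F S hSfin hFS hnext (((8 * C * c : ℝ≥0) : ℝ) • u) (T₁ u) (hcover u)
      (hblock M (8 * C * c) u fun k hne => by
        obtain ⟨m, hm, hmm⟩ := hmax k hne
        have h1 : M ((F k).indicator f) ≤ 8 * C * (t m * N ((S k).indicator g)) := by
          calc M ((F k).indicator f) ≤ M ((Iic m).indicator f) := M.indicator_mono hmm f
            _ ≤ C * (t m * Q m) := hP m hm.1.1
            _ ≤ C * (t m * 4 ^ (-k + 1)) := by gcongr; exact (hFQ k m hm).2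
            _ = C * (t m * (4 * 4 ^ (-k))) := by rw [hsucc]
            _ ≤ C * (t m * (4 * (2 * N ((S k).indicator g)))) := by gcongr; exact hSg k hne
            _ = _ := by ring
        -- S k lies to the right of m, so the weight there is at least t m. This turns the N-norm of
        -- u in the coefficient into its M-norm.
        have h2 : t m * N ((S k).indicator u) ≤ c * M ((S k).indicator u) :=
          hc.high (t m) _ fun i hi => ht ((hmm m hm).trans (hFS k m hm i (by
            by_contra h
            exact hi (Set.indicator_of_notMem h _))).le)
        push_cast
        calc M ((F k).indicator f) * N ((S k).indicator u)
            ≤ 8 * C * (t m * N ((S k).indicator g)) * N ((S k).indicator u) := by gcongr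
          _ = 8 * C * (t m * N ((S k).indicator u)) * N ((S k).indicator g) := by ring
          _ ≤ 8 * C * (c * M ((S k).indicator u)) * N ((S k).indicator g) := by gcongr
          _ = _ := by ring)
    rwa [map_nnreal_smul, ← mul_assoc] at this
  refine ⟨T₀ + T₁, 4 * C + 2 * K * (8 * C) + 2 * K' * (8 * C * c), fun u => ?_, fun u => ?_, ?_⟩
  · refine (N.add_le _ _).trans ((add_le_add (hT₀ N u) (hN₁ u)).trans ?_)
    rw [← add_mul]
    gcongr
    push_cast
    exact le_self_add
  · refine (M.add_le _ _).trans ((add_le_add (hT₀ M u) (hM₁ u)).trans ?_)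
    rw [← add_mul]
    gcongr
    push_cast
    rw [add_assoc]
    gcongr
    exact le_add_self
  · ext i
    rw [LinearMap.add_apply, Pi.add_apply, hT₀g]
    by_cases hi : i ∈ D₁
    · have h1 : ψ (lev i) g ≠ 0 := by
        rw [hψg]
        exact (ENNReal.toReal_pos (hSpos _ ⟨i, hi, rfl⟩) (hStop _ g)).ne'
      have h2 : i ∉ D \ D₁ := fun h => h.2 hi
      simp [T₁, hi, h2, hi.1, h1]
    · by_cases hD : i ∈ D
      · have h2 : i ∈ D \ D₁ := ⟨hD, hi⟩
        simp [T₁, hi, h2, hD]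
      · have h2 : i ∉ D \ D₁ := fun h => hD h.1
        simp [T₁, hi, h2, hD]

end SeqNorm

/-! ### The K-functional and operators for couples with both shift properties. -/

namespace SeqNorm

variable {ι : Type*}

/-- The `K`-functional of the couple `(M, N)`. -/
noncomputable def kSeq (M N : SeqNorm ι) (τ : ℝ≥0) (f : ι → ℝ) : ℝ≥0∞ :=
  ⨅ (x : ι → ℝ) (y : ι → ℝ) (_ : x + y = f), M x + τ * N y

/-- Putting c/τ in place of τ interchanges the two inequalities. The constant c is moved into the
reversed weight c/t, so that the first inequality has constant 1 again. -/
theorem Compat.dual {N M : SeqNorm ι} {t : ι → ℝ≥0} {c : ℝ≥0} (h : Compat N M t c) (hc : 0 < c) :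
    Compat M.dual N.dual (fun i : ιᵒᵈ => c / t (OrderDual.ofDual i)) c where
  pos i := div_pos hc (h.pos _)
  low τ u hu := by
    change N (u ∘ OrderDual.toDual) ≤ τ * M (u ∘ OrderDual.toDual)
    by_cases h0 : u ∘ OrderDual.toDual = 0
    · simp [h0]
    obtain ⟨i, hi⟩ := Function.ne_iff.1 h0
    have hτ : 0 < τ := (div_pos hc (h.pos i)).trans_le (hu i hi)
    have h1 := h.high (c / τ) (u ∘ OrderDual.toDual) fun j hj => by
      have := hu j hj
      change c / t j ≤ τ at this
      rw [div_le_iff₀ (h.pos j)] at this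
      rwa [div_le_iff₀ hτ, mul_comm]
    have h2 : (c : ℝ≥0∞) * N (u ∘ OrderDual.toDual) ≤ c * (τ * M (u ∘ OrderDual.toDual)) := by
      have : (c : ℝ≥0∞) = τ * (c / τ : ℝ≥0) := by
        rw [← ENNReal.coe_mul, mul_div_cancel₀ _ hτ.ne']
      calc (c : ℝ≥0∞) * N (u ∘ OrderDual.toDual)
          = τ * ((c / τ : ℝ≥0) * N (u ∘ OrderDual.toDual)) := by rw [← mul_assoc, ← this]
        _ ≤ τ * (c * M (u ∘ OrderDual.toDual)) := by gcongr
        _ = _ := by ring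
    exact (ENNReal.mul_le_mul_iff_right (by exact_mod_cast hc.ne') ENNReal.coe_ne_top).1 h2
  high τ u hu := by
    change (τ : ℝ≥0∞) * M (u ∘ OrderDual.toDual) ≤ c * N (u ∘ OrderDual.toDual)
    rcases eq_or_lt_of_le (zero_le (a := τ)) with hτ | hτ
    · simp [← hτ]
    have h1 := h.low (c / τ) (u ∘ OrderDual.toDual) fun j hj => by
      have := hu j hj
      change τ ≤ c / t j at this
      rw [le_div_iff₀ (h.pos j)] at this
      rwa [le_div_iff₀ hτ, mul_comm]
    calc (τ : ℝ≥0∞) * M (u ∘ OrderDual.toDual)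
        ≤ τ * ((c / τ : ℝ≥0) * N (u ∘ OrderDual.toDual)) := by gcongr
      _ = _ := by rw [← mul_assoc, ← ENNReal.coe_mul, mul_div_cancel₀ _ hτ.ne']

variable [LinearOrder ι]

/-- The cut of g at n is a competitor. Keeping n in both pieces costs nothing and makes the bound
symmetric under reversal of the order. -/
theorem kSeq_le (M N : SeqNorm ι) (τ : ℝ≥0) (g : ι → ℝ) (n : ι) :
    kSeq M N τ g ≤ M ((Iic n).indicator g) + τ * N ((Ici n).indicator g) := by
  refine (iInf₂_le ((Iic n).indicator g) ((Ioi n).indicator g)).trans ((iInf_le _ ?_).trans ?_)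
  · ext i
    rcases le_or_gt i n with h | h
    · simp [h, h.not_gt]
    · simp [h, h.not_ge]
  · gcongr
    exact N.indicator_mono Ioi_subset_Ici_self g

/-- For any splitting f = x + y, the part of y up to n has M-norm at most t n · N(y), and the part
of x from n on satisfies t n · N ≤ c M(x). So no splitting beats the cut at n by more than a
constant. -/
theorem Compat.le_kSeq {N M : SeqNorm ι} {t : ι → ℝ≥0} {c : ℝ≥0} (h : Compat N M t c)
    (ht : Monotone t) (f : ι → ℝ) (n : ι) :
    M ((Iic n).indicator f) + t n * N ((Ici n).indicator f) ≤ (2 + c) * kSeq M N (t n) f := by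
  rw [kSeq]
  simp only [ENNReal.mul_iInf_of_ne (a := (2 + c : ℝ≥0∞)) (by simp)
    (ENNReal.add_ne_top.2 ⟨by norm_num, ENNReal.coe_ne_top⟩)]
  refine le_iInf fun x => le_iInf fun y => le_iInf fun hxy => ?_
  have hM : M ((Iic n).indicator f) ≤ M x + t n * N y := by
    rw [← hxy, Set.indicator_add']
    refine (M.add_le _ _).trans (add_le_add (M.indicator_le _ _) ?_)
    refine (h.low (t n) _ fun i hi => ht ?_).trans (by gcongr; exact N.indicator_le _ _)
    by_contra hin
    exact hi (Set.indicator_of_notMem (s := Iic n) hin _)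
  have hN : t n * N ((Ici n).indicator f) ≤ c * M x + t n * N y := by
    rw [← hxy, Set.indicator_add']
    refine (mul_le_mul_right (N.add_le _ _) _).trans ?_
    rw [mul_add]
    refine add_le_add ?_ (by gcongr; exact N.indicator_le _ _)
    refine (h.high (t n) _ fun i hi => ht ?_).trans (by gcongr; exact M.indicator_le _ _)
    by_contra hin
    exact hi (Set.indicator_of_notMem hin _)
  calc _ ≤ (M x + t n * N y) + (c * M x + t n * N y) := add_le_add hM hN
    _ = (1 + c) * M x + 2 * (t n * N y) := by ring
    _ ≤ (2 + c) * M x + (2 + c) * (t n * N y) := by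
      gcongr
      · norm_num
      · exact le_self_add
    _ = _ := (mul_add _ _ _).symm

theorem Compat.tail_le {N M : SeqNorm ι} {t : ι → ℝ≥0} {c C : ℝ≥0} (h : Compat N M t c)
    (ht : Monotone t) {f g : ι → ℝ} (hK : ∀ n, kSeq M N (t n) f ≤ C * kSeq M N (t n) g) (n : ι) :
    M ((Iic n).indicator f) + t n * N ((Ici n).indicator f) ≤
      ((2 + c) * C : ℝ≥0) * (M ((Iic n).indicator g) + t n * N ((Ici n).indicator g)) := by
  refine (h.le_kSeq ht f n).trans ?_
  push_cast
  rw [mul_assoc]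
  gcongr
  exact (hK n).trans (by gcongr; exact kSeq_le M N _ g n)

variable [LocallyFiniteOrder ι]

/-- An operator on a couple of sequence spaces both of which have the left-shift property, for an
element `g` whose `K`-functional is governed by its right tails. -/
theorem exists_operator_of_tail {N M : SeqNorm ι} {t : ι → ℝ≥0} {c K K' C : ℝ≥0}
    (hc : Compat N M t c) (ht : Monotone t) (hN : N.LeftShift K) (hM : M.LeftShift K')
    (f g : ι → ℝ) (D : Set ι) (hK : ∀ n, kSeq M N (t n) f ≤ C * kSeq M N (t n) g)
    (hfin : ∀ n ∈ D, N ((Ici n).indicator g) ≠ ∞)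
    (htail : ∀ ε : ℝ≥0∞, 0 < ε → BddAbove {n | ε < N ((Ici n).indicator g)})
    (hD : ∀ n ∈ D, M ((Iic n).indicator g) ≤ t n * N ((Ici n).indicator g)) :
    ∃ (T : (ι → ℝ) →ₗ[ℝ] (ι → ℝ)) (C' : ℝ≥0), (∀ u, N (T u) ≤ C' * N u) ∧
      (∀ u, M (T u) ≤ C' * M u) ∧ T g = D.indicator f := by
  have key : ∀ n ∈ D, M ((Iic n).indicator f) + t n * N ((Ici n).indicator f) ≤
      ((2 + c) * C * 2 + 1 : ℝ≥0) * (t n * N ((Ici n).indicator g)) := fun n hn => by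
    refine (hc.tail_le ht hK n).trans ?_
    calc (((2 + c) * C : ℝ≥0) : ℝ≥0∞) * (M ((Iic n).indicator g) + t n * N ((Ici n).indicator g))
        ≤ ((2 + c) * C : ℝ≥0) * (t n * N ((Ici n).indicator g) + t n * N ((Ici n).indicator g)) := by
          gcongr
          exact hD n hn
      _ = ((2 + c) * C * 2 : ℝ≥0) * (t n * N ((Ici n).indicator g)) := by push_cast; ring
      _ ≤ _ := by
          gcongr
          exact le_self_add
  refine exists_operator hc ht hN hM f g D (C := (2 + c) * C * 2 + 1) (by positivity)
    (fun n hn => ?_) (fun n hn => le_self_add.trans (key n hn)) hfin htail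
  have h1 := le_add_self.trans (key n hn)
  rw [mul_left_comm] at h1
  exact (ENNReal.mul_le_mul_iff_right (by exact_mod_cast (hc.pos n).ne') ENNReal.coe_ne_top).1 h1

/-- An operator on a couple of sequence spaces with both shift properties. -/
theorem exists_operator_of_kSeq_le {N M : SeqNorm ι} {t : ι → ℝ≥0} {c C K₁ K₂ K₃ K₄ : ℝ≥0}
    (hc : Compat N M t c) (hc0 : 0 < c) (ht : Monotone t) (hN : N.LeftShift K₁)
    (hM : M.LeftShift K₂) (hN' : N.dual.LeftShift K₃) (hM' : M.dual.LeftShift K₄) (f g : ι → ℝ)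
    (hK : ∀ n, kSeq M N (t n) f ≤ C * kSeq M N (t n) g)
    (hNfin : ∀ n, N ((Ici n).indicator g) ≠ ∞) (hMfin : ∀ n, M ((Iic n).indicator g) ≠ ∞)
    (hNtail : ∀ ε : ℝ≥0∞, 0 < ε → BddAbove {n | ε < N ((Ici n).indicator g)})
    (hMtail : ∀ ε : ℝ≥0∞, 0 < ε → BddBelow {n | ε < M ((Iic n).indicator g)}) :
    ∃ (T : (ι → ℝ) →ₗ[ℝ] (ι → ℝ)) (C' : ℝ≥0), (∀ u, N (T u) ≤ C' * N u) ∧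
      (∀ u, M (T u) ≤ C' * M u) ∧ T g = f := by
  -- On D the right tails of g govern its K-functional, off D the left tails do. The two halves of f
  -- are produced by two operators, the second one in the reversed order with N and M exchanged.
  set D : Set ι := {n | M ((Iic n).indicator g) ≤ t n * N ((Ici n).indicator g)} with hDdef
  obtain ⟨T, C₁, hTN, hTM, hTg⟩ := exists_operator_of_tail hc ht hN hM f g D hK
    (fun n _ => hNfin n) hNtail fun n hn => hn
  have key : ∀ n ∈ Dᶜ, M ((Iic n).indicator f) + t n * N ((Ici n).indicator f) ≤
      ((2 + c) * C * 2 + 1 : ℝ≥0) * M ((Iic n).indicator g) := fun n hn => by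
    refine (hc.tail_le ht hK n).trans ?_
    calc (((2 + c) * C : ℝ≥0) : ℝ≥0∞) * (M ((Iic n).indicator g) + t n * N ((Ici n).indicator g))
        ≤ ((2 + c) * C : ℝ≥0) * (M ((Iic n).indicator g) + M ((Iic n).indicator g)) := by
          gcongr
          have h1 : ¬ M ((Iic n).indicator g) ≤ t n * N ((Ici n).indicator g) := hn
          exact (not_le.1 h1).le
      _ = ((2 + c) * C * 2 : ℝ≥0) * M ((Iic n).indicator g) := by push_cast; ring
      _ ≤ _ := by
          gcongr
          exact le_self_add
  set B₀ : ℝ≥0 := (2 + c) * C * 2 + 1 with hB₀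
  -- Reversal replaces t by c/t, so the constant must absorb B₀ both directly and after
  -- multiplication by c.
  obtain ⟨B, hB0, hB1, hB2⟩ : ∃ B : ℝ≥0, 0 < B ∧ B₀ ≤ B ∧ B₀ ≤ B * c := by
    have hB₀' : 0 < B₀ := by positivity
    refine ⟨B₀ * (1 + c⁻¹), by positivity, le_mul_of_one_le_right' le_self_add, ?_⟩
    clear_value B₀
    rw [mul_assoc, add_mul, inv_mul_cancel₀ hc0.ne']
    exact le_mul_of_one_le_right' le_add_self
  obtain ⟨T', C₂, hTM', hTN', hTg'⟩ := exists_operator (ι := ιᵒᵈ) (hc.dual hc0)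
    (fun i j hij => div_le_div_of_nonneg_left zero_le (hc.pos _) (ht hij)) hM' hN'
    (f ∘ OrderDual.ofDual) (g ∘ OrderDual.ofDual) (OrderDual.ofDual ⁻¹' Dᶜ)
    (C := B) hB0
    (fun n hn => (le_self_add.trans (key n hn)).trans (by gcongr; exact le_rfl))
    (fun n hn => by
      change N ((Ici (OrderDual.ofDual n)).indicator f) ≤ B * ((c / t (OrderDual.ofDual n) : ℝ≥0) *
        M ((Iic (OrderDual.ofDual n)).indicator g))
      have h1 := le_add_self.trans (key n hn)
      have h2 : (t (OrderDual.ofDual n) : ℝ≥0∞) * N ((Ici (OrderDual.ofDual n)).indicator f) ≤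
          t (OrderDual.ofDual n) * (B * ((c / t (OrderDual.ofDual n) : ℝ≥0) *
            M ((Iic (OrderDual.ofDual n)).indicator g))) := by
        refine h1.trans ?_
        have h3 : (t (OrderDual.ofDual n) : ℝ≥0∞) * (B * ((c / t (OrderDual.ofDual n) : ℝ≥0) *
            M ((Iic (OrderDual.ofDual n)).indicator g))) = (B * c : ℝ≥0) *
            M ((Iic (OrderDual.ofDual n)).indicator g) := by
          rw [mul_left_comm, ← mul_assoc (t (OrderDual.ofDual n) : ℝ≥0∞), ← ENNReal.coe_mul,
            mul_div_cancel₀ _ (hc.pos _).ne', ← mul_assoc, ENNReal.coe_mul]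
        rw [h3]
        gcongr
        exact le_rfl
      exact (ENNReal.mul_le_mul_iff_right (by exact_mod_cast (hc.pos _).ne')
        ENNReal.coe_ne_top).1 h2)
    (fun n _ => hMfin n) (fun ε hε => hMtail ε hε)
  refine ⟨T + (show (ι → ℝ) →ₗ[ℝ] (ι → ℝ) from T'), C₁ + C₂, fun u => ?_, fun u => ?_, ?_⟩
  · refine (N.add_le _ _).trans ((add_le_add (hTN u) (hTN' u)).trans (le_of_eq ?_))
    push_cast
    exact (add_mul _ _ _).symm
  · refine (M.add_le _ _).trans ((add_le_add (hTM u) (hTM' u)).trans (le_of_eq ?_))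
    push_cast
    exact (add_mul _ _ _).symm
  · have h1 : T g + (show (ι → ℝ) →ₗ[ℝ] (ι → ℝ) from T') g = D.indicator f + Dᶜ.indicator f :=
      congrArg₂ (· + ·) hTg hTg'
    exact h1.trans (Set.indicator_self_add_compl D f)

end SeqNorm

/-! ### The Calderón property of sequence couples and averaging over signs. -/

namespace SeqNorm

variable {ι : Type*}

/-- The sum of the two sequence spaces. -/
def sumSpace (M N : SeqNorm ι) : Submodule ℝ (ι → ℝ) where
  carrier := {u | ∃ x y, M x ≠ ∞ ∧ N y ≠ ∞ ∧ x + y = u}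
  add_mem' := by
    rintro _ _ ⟨x, y, hx, hy, rfl⟩ ⟨x', y', hx', hy', rfl⟩
    exact ⟨x + x', y + y', ne_top_of_le_ne_top (ENNReal.add_ne_top.2 ⟨hx, hx'⟩) (M.add_le _ _),
      ne_top_of_le_ne_top (ENNReal.add_ne_top.2 ⟨hy, hy'⟩) (N.add_le _ _), by abel⟩
  zero_mem' := ⟨0, 0, by simp, by simp, by simp⟩
  smul_mem' := by
    rintro c _ ⟨x, y, hx, hy, rfl⟩
    exact ⟨c • x, c • y, by rw [M.map_smul]; exact ENNReal.mul_ne_top enorm_ne_top hx,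
      by rw [N.map_smul]; exact ENNReal.mul_ne_top enorm_ne_top hy, (smul_add c x y).symm⟩

theorem mem_sumSpace_left {M N : SeqNorm ι} {x : ι → ℝ} (h : M x ≠ ∞) : x ∈ sumSpace M N :=
  ⟨x, 0, h, by simp, by simp⟩

theorem mem_sumSpace_right {M N : SeqNorm ι} {x : ι → ℝ} (h : N x ≠ ∞) : x ∈ sumSpace M N :=
  ⟨0, x, by simp, h, by simp⟩

/-- The Calderón property of a couple of sequence spaces. -/
def SeqCalderon (M N : SeqNorm ι) : Prop :=
  ∀ f g : sumSpace M N, (∀ τ : ℝ≥0, 0 < τ → kSeq M N τ f ≤ kSeq M N τ g) →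
    ∃ (T : sumSpace M N →ₗ[ℝ] (ι → ℝ)) (Θ : ℝ≥0), (∀ u, M (T u) ≤ Θ * M u) ∧
      (∀ u, N (T u) ≤ Θ * N u) ∧ T g = f

/-- Subsets A of s stand for choices of signs. Toggling the membership of m is an involution that
flips the sign of the summand: distinct Rademacher functions are orthogonal. -/
theorem sum_signs_eq_zero {κ : Type*} [DecidableEq κ] (s : Finset κ) {m n : κ} (hm : m ∈ s)
    (hmn : m ≠ n) :
    ∑ A ∈ s.powerset, (if m ∈ A then (1 : ℝ) else -1) * (if n ∈ A then 1 else -1) = 0 := by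
  refine Finset.sum_involution (fun A _ => if m ∈ A then A.erase m else insert m A) ?_ ?_ ?_ ?_
  · intro A _
    by_cases h : m ∈ A <;> by_cases h' : n ∈ A <;> simp [h, h', hmn.symm]
  · intro A _ _ h
    by_cases hA : m ∈ A
    · simp only [hA, if_true] at h
      exact (Finset.notMem_erase m A) (by rw [h]; exact hA)
    · simp only [hA, if_false] at h
      exact hA (h ▸ Finset.mem_insert_self m A)
  · intro A hA
    have := Finset.mem_powerset.1 hA
    by_cases h : m ∈ A
    · simp only [h, if_true]
      exact Finset.mem_powerset.2 ((Finset.erase_subset _ _).trans this)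
    · simp only [h, if_false]
      exact Finset.mem_powerset.2 (Finset.insert_subset hm this)
  · intro A _
    by_cases h : m ∈ A <;> simp [h]

/-- Averaging over signs: the block diagonal of a bounded operator is bounded. -/
theorem block_diagonal_le {κ : Type*} {N : SeqNorm ι} {V : Submodule ℝ (ι → ℝ)}
    (T : V →ₗ[ℝ] (ι → ℝ)) {Θ : ℝ≥0} (hT : ∀ u, N (T u) ≤ Θ * N u) (s : Finset κ) (Z W : κ → Set ι)
    (hZ : ∀ m ∈ s, ∀ n ∈ s, m ≠ n → Disjoint (Z m) (Z n)) (hW : ∀ n ∈ s, W n ⊆ Z n)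
    (y : κ → V) (hy : ∀ n ∈ s, ∀ i, (y n : ι → ℝ) i ≠ 0 → i ∈ Z n) :
    N (∑ n ∈ s, (W n).indicator (T (y n))) ≤ Θ * N (∑ n ∈ s, (y n : ι → ℝ)) := by
  classical
  set σ : Finset κ → κ → ℝ := fun A n => if n ∈ A then 1 else -1 with hσ
  have hσabs : ∀ A n, |σ A n| = 1 := fun A n => by
    by_cases h : n ∈ A <;> simp [hσ, h]
  -- The signs are applied before T and again, blockwise, after it. Neither changes the modulus of a
  -- sum of disjointly supported blocks, so each v A obeys the bound.
  set v : Finset κ → ι → ℝ := fun A =>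
    ∑ n ∈ s, σ A n • (W n).indicator (T (∑ m ∈ s, σ A m • y m)) with hv
  have hsum_le : ∀ (U : κ → Set ι) (_ : ∀ n ∈ s, U n ⊆ Z n) (q : κ → ι → ℝ) (i : ι) (B : ℝ), 0 ≤ B →
      (∀ n ∈ s, i ∈ U n → |q n i| ≤ B) → (∀ n ∈ s, i ∉ U n → q n i = 0) →
      |(∑ n ∈ s, q n) i| ≤ B := by
    intro U hU q i B hB h1 h2
    rw [Finset.sum_apply]
    by_cases hi : ∃ n ∈ s, i ∈ U n
    · obtain ⟨n, hn, hin⟩ := hi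
      rw [Finset.sum_eq_single_of_mem n hn]
      · exact h1 n hn hin
      · intro m hm hmn
        exact h2 m hm fun him => Set.disjoint_left.1 (hZ m hm n hn hmn) (hU m hm him) (hU n hn hin)
    · push Not at hi
      rw [Finset.sum_eq_zero fun n hn => h2 n hn (hi n hn)]
      simpa using hB
  have hvle : ∀ A, N (v A) ≤ Θ * N (∑ n ∈ s, (y n : ι → ℝ)) := fun A => by
    have h1 : N (v A) ≤ N (T (∑ m ∈ s, σ A m • y m)) := by
      refine N.mono fun i => hsum_le W hW _ i _ (abs_nonneg _) (fun n _ hin => ?_) fun n _ hin => ?_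
      · simp [hin, abs_mul, hσabs]
      · simp [hin]
    refine h1.trans ((hT _).trans ?_)
    gcongr
    refine N.mono fun i => ?_
    rw [Submodule.coe_sum]
    refine hsum_le Z (fun _ _ => Subset.rfl) _ i _ (abs_nonneg _) (fun n hn hin => ?_)
      fun n hn hin => ?_
    · simp only [Submodule.coe_smul, Pi.smul_apply, smul_eq_mul, abs_mul, hσabs, one_mul]
      rw [Finset.sum_apply, Finset.sum_eq_single_of_mem n hn]
      intro m hm hmn
      by_contra h
      exact Set.disjoint_left.1 (hZ m hm n hn hmn) (hy m hm i h) hin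
    · have : (y n : ι → ℝ) i = 0 := by
        by_contra h
        exact hin (hy n hn i h)
      simp [this]
  -- In the mean over all signs the terms that send block m to block n ≠ m cancel, and the diagonal
  -- ones occur with coefficient 1.
  have havg : ∑ A ∈ s.powerset, v A =
      (2 ^ s.card : ℝ) • ∑ n ∈ s, (W n).indicator (T (y n)) := by
    have h1 : ∀ A, v A = ∑ n ∈ s, ∑ m ∈ s, (σ A n * σ A m) • (W n).indicator (T (y m)) := by
      intro A
      simp only [hv]
      refine Finset.sum_congr rfl fun n _ => ?_
      rw [_root_.map_sum]
      have : (W n).indicator (∑ m ∈ s, T (σ A m • y m)) =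
          ∑ m ∈ s, σ A m • (W n).indicator (T (y m)) := by
        ext i
        by_cases hi : i ∈ W n <;> simp [hi]
      rw [this, Finset.smul_sum]
      refine Finset.sum_congr rfl fun m _ => ?_
      rw [smul_smul]
    simp only [h1]
    rw [Finset.sum_comm, Finset.smul_sum]
    refine Finset.sum_congr rfl fun n hn => ?_
    rw [Finset.sum_comm, Finset.sum_eq_single_of_mem n hn]
    · rw [← Finset.sum_smul]
      congr 1
      have : ∀ A ∈ s.powerset, σ A n * σ A n = 1 := fun A _ => by
        by_cases h : n ∈ A <;> simp [hσ, h]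
      rw [Finset.sum_congr rfl this]
      simp [Finset.card_powerset]
    · intro m hm hmn
      rw [← Finset.sum_smul, sum_signs_eq_zero s hn hmn.symm, zero_smul]
  have h2 : (2 ^ s.card : ℝ≥0) * N (∑ n ∈ s, (W n).indicator (T (y n))) ≤
      (2 ^ s.card : ℝ≥0) * (Θ * N (∑ n ∈ s, (y n : ι → ℝ))) := by
    have : ((2 ^ s.card : ℝ≥0) : ℝ) = 2 ^ s.card := by push_cast; rfl
    rw [← N.map_nnreal_smul, this, ← havg]
    refine (N.sum_le _ _).trans ((Finset.sum_le_sum fun A _ => hvle A).trans (le_of_eq ?_))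
    simp [Finset.card_powerset]
  refine (ENNReal.mul_le_mul_iff_right ?_ ENNReal.coe_ne_top).1 h2
  exact_mod_cast (by positivity : (0 : ℝ≥0) < 2 ^ s.card).ne'

end SeqNorm

/-! ### Gluing separated pairs into one pair with comparable K-functionals. -/

namespace SeqNorm

variable {ι κ : Type*}

theorem tsum_ite_le_of_finset {p : κ → Prop} [DecidablePred p] {d : κ → ℝ≥0∞} {B : ℝ≥0∞}
    (h : ∀ s : Finset κ, (∀ k ∈ s, p k) → ∑ k ∈ s, d k ≤ B) :
    ∑' k, (if p k then d k else 0) ≤ B := by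
  rw [ENNReal.tsum_eq_iSup_sum]
  refine iSup_le fun s => ?_
  rw [← Finset.sum_filter]
  exact h _ fun k hk => (Finset.mem_filter.1 hk).2

open Classical in
/-- Gluing of separated pairs `(x k, y k)` with weights `c k`: the Calderón property yields one
bounded operator that maps each `y k` almost to a multiple of `x k` on the region of `k`. -/
theorem exists_diagonal [Nonempty κ] {N M : SeqNorm ι} {t : ι → ℝ≥0} {c₀ : ℝ≥0}
    (hc : Compat N M t c₀) (hcal : SeqCalderon M N) (x y : κ → ι → ℝ) (a w b c δ L : κ → ℝ≥0)
    (ha : ∀ k, 0 < a k) (haw : ∀ k, a k ≤ w k) (hwb : ∀ k, w k ≤ b k)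
    (hab : ∀ k l, k ≠ l → b k < a l ∨ b l < a k) (hcpos : ∀ k, 0 < c k) (hL : ∀ k, 1 ≤ L k)
    (hδ : ∀ k, δ k ≤ 1) (hx : ∀ k i, x k i ≠ 0 → a k ≤ t i ∧ t i ≤ b k ∧ t i ≤ L k * w k)
    (hy : ∀ k i, y k i ≠ 0 → w k ≤ t i ∧ t i ≤ b k) (hNx : ∀ k, N (x k) ≤ 1)
    (hNy : ∀ k, N (y k) = 1)
    (h₁ : ∀ k, ∑' l, (if b k < a l then (c l : ℝ≥0∞) else 0) ≤ δ k * c k)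
    (h₂ : ∀ k, ∑' l, (if b l < a k then (c l * b l : ℝ≥0∞) else 0) ≤ δ k * (c k * a k)) :
    ∃ (T : sumSpace M N →ₗ[ℝ] (ι → ℝ)) (Θ : ℝ≥0), (∀ u, N (T u) ≤ Θ * N u) ∧
      ∀ k, ∃ hk : y k ∈ sumSpace M N,
        N ({i | a k ≤ t i ∧ t i ≤ b k}.indicator (T ⟨y k, hk⟩) -
          ((4 * (c₀ + 1) * L k)⁻¹ : ℝ) • x k) ≤ Θ * (1 + c₀) * δ k := by
  set Z : κ → Set ι := fun k => {i | a k ≤ t i ∧ t i ≤ b k} with hZ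
  have hZuniq : ∀ {k l i}, i ∈ Z k → i ∈ Z l → k = l := fun {k l i} hk hl => by
    by_contra hne
    rcases hab k l hne with h | h
    · exact absurd (hk.2.trans_lt (h.trans_le hl.1)) (lt_irrefl _)
    · exact absurd (hl.2.trans_lt (h.trans_le hk.1)) (lt_irrefl _)
  let glue : (κ → ι → ℝ) → ι → ℝ := fun z i => if h : ∃ k, i ∈ Z k then z h.choose i else 0
  have hglue : ∀ (z : κ → ι → ℝ) k i, i ∈ Z k → glue z i = z k i := fun z k i hi => by
    have h : ∃ k, i ∈ Z k := ⟨k, hi⟩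
    simp only [glue, h, dif_pos]
    rw [hZuniq h.choose_spec hi]
  have hglue0 : ∀ (z : κ → ι → ℝ) i, glue z i ≠ 0 → ∃ k, i ∈ Z k := fun z i h => by
    by_contra h'
    exact h (by simp only [glue, h', dif_neg, not_false_iff])
  have hglueZ : ∀ (z : κ → ι → ℝ) k, (∀ i, z k i ≠ 0 → i ∈ Z k) → (Z k).indicator (glue z) = z k :=
    fun z k hz => by
      ext i
      by_cases hi : i ∈ Z k
      · rw [Set.indicator_of_mem hi, hglue z k i hi]
      · rw [Set.indicator_of_notMem hi]
        by_contra h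
        exact hi (hz i (Ne.symm h))
  -- norms of the pieces cut out by a condition on the block
  have hpiece : ∀ (P : SeqNorm ι) (z : κ → ι → ℝ) (q : κ → Prop) (d : κ → ℝ≥0∞),
      (∀ k i, z k i ≠ 0 → i ∈ Z k) → (∀ k, q k → P (z k) ≤ d k) →
      P ({i | ∃ l, q l ∧ i ∈ Z l}.indicator (glue z)) ≤ ∑' l, (if q l then d l else 0) := by
    intro P z q d hz hd
    refine P.le_tsum_of_cover _ Z _ (fun i hi => ?_) fun l => ?_
    · have : i ∈ {i | ∃ l, q l ∧ i ∈ Z l} := by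
        by_contra h
        exact hi (Set.indicator_of_notMem h _)
      obtain ⟨l, -, hl⟩ := this
      exact ⟨l, hl⟩
    · rw [Set.indicator_indicator]
      by_cases hq : q l
      · rw [if_pos hq]
        refine (P.indicator_mono inter_subset_left _).trans ?_
        rw [hglueZ z l (hz l)]
        exact hd l hq
      · rw [if_neg hq]
        have : Z l ∩ {i | ∃ l, q l ∧ i ∈ Z l} = ∅ := by
          refine Set.eq_empty_iff_forall_notMem.2 fun i hi => ?_
          obtain ⟨l', hq', hl'⟩ := hi.2
          exact hq (hZuniq hi.1 hl' ▸ hq')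
        rw [this, P.indicator_empty]
  have hZpos : ∀ k l, b k < a l → ¬ b l < a k := fun k l h h' =>
    absurd ((h.trans_le ((haw l).trans (hwb l))).trans (h'.trans_le ((haw k).trans (hwb k))))
      (lt_irrefl _)
  -- decomposition around the block `k`
  have hsplit : ∀ (z : κ → ι → ℝ) k, (∀ l i, z l i ≠ 0 → i ∈ Z l) →
      glue z = {i | ∃ l, b l < a k ∧ i ∈ Z l}.indicator (glue z) + z k +
        {i | ∃ l, b k < a l ∧ i ∈ Z l}.indicator (glue z) := by
    intro z k hz
    ext i
    rw [← hglueZ z k (hz k)]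
    simp only [Pi.add_apply]
    by_cases hi : glue z i = 0
    · have : ∀ S : Set ι, S.indicator (glue z) i = 0 := fun S => by
        by_cases h : i ∈ S <;> simp [h, hi]
      rw [hi, this, this, this]
      simp
    obtain ⟨l, hl⟩ := hglue0 z i hi
    by_cases hlk : l = k
    · subst hlk
      have hn1 : i ∉ {i | ∃ l', b l' < a l ∧ i ∈ Z l'} := by
        rintro ⟨l', h1, h2⟩
        rw [hZuniq h2 hl] at h1
        exact absurd h1 (not_lt.2 ((haw l).trans (hwb l)))
      have hn2 : i ∉ {i | ∃ l', b l < a l' ∧ i ∈ Z l'} := by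
        rintro ⟨l', h1, h2⟩
        rw [hZuniq h2 hl] at h1
        exact absurd h1 (not_lt.2 ((haw l).trans (hwb l)))
      rw [Set.indicator_of_notMem hn1, Set.indicator_of_notMem hn2, Set.indicator_of_mem hl]
      simp
    · have hk : i ∉ Z k := fun h => hlk (hZuniq hl h)
      rw [Set.indicator_of_notMem hk]
      rcases hab l k hlk with h | h
      · have hn2 : i ∉ {i | ∃ l', b k < a l' ∧ i ∈ Z l'} := by
          rintro ⟨l', h1, h2⟩
          rw [hZuniq h2 hl] at h1
          exact hZpos l k h h1
        have hm : i ∈ {i | ∃ l', b l' < a k ∧ i ∈ Z l'} := ⟨l, h, hl⟩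
        rw [Set.indicator_of_mem hm, Set.indicator_of_notMem hn2]
        simp
      · have hn2 : i ∉ {i | ∃ l', b l' < a k ∧ i ∈ Z l'} := by
          rintro ⟨l', h1, h2⟩
          rw [hZuniq h2 hl] at h1
          exact hZpos k l h h1
        have hm : i ∈ {i | ∃ l', b k < a l' ∧ i ∈ Z l'} := ⟨l, h, hl⟩
        rw [Set.indicator_of_mem hm, Set.indicator_of_notMem hn2]
        simp
  have hpost : ∀ (z : κ → ι → ℝ) k, (∀ l i, z l i ≠ 0 → i ∈ Z l) → (∀ l, N (z l) ≤ c l) →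
      N ({i | ∃ l, b k < a l ∧ i ∈ Z l}.indicator (glue z)) ≤ δ k * c k := fun z k hz hN =>
    (hpiece N z _ _ hz fun l _ => hN l).trans (h₁ k)
  have hMle : ∀ (z : κ → ι → ℝ), (∀ l i, z l i ≠ 0 → i ∈ Z l) → (∀ l, N (z l) ≤ c l) →
      ∀ l, M (z l) ≤ c l * b l := fun z hz hN l => by
    refine (hc.low (b l) (z l) fun i hi => (hz l i hi).2).trans ?_
    rw [mul_comm]
    gcongr
    exact hN l
  have hpre : ∀ (z : κ → ι → ℝ) k, (∀ l i, z l i ≠ 0 → i ∈ Z l) → (∀ l, N (z l) ≤ c l) →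
      M ({i | ∃ l, b l < a k ∧ i ∈ Z l}.indicator (glue z)) ≤ δ k * (c k * a k) :=
    fun z k hz hN => (hpiece M z _ _ hz fun l _ => hMle z hz hN l).trans (h₂ k)
  have hpre' : ∀ (z : κ → ι → ℝ) k, (∀ l i, z l i ≠ 0 → i ∈ Z l) → (∀ l, N (z l) ≤ c l) →
      M ({i | ∃ l, b l < a k ∧ i ∈ Z l}.indicator (glue z)) ≠ ∞ := fun z k hz hN =>
    ne_top_of_le_ne_top (by finiteness) (hpre z k hz hN)
  have hpost' : ∀ (z : κ → ι → ℝ) k, (∀ l i, z l i ≠ 0 → i ∈ Z l) → (∀ l, N (z l) ≤ c l) →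
      N ({i | ∃ l, b k < a l ∧ i ∈ Z l}.indicator (glue z)) ≠ ∞ := fun z k hz hN =>
    ne_top_of_le_ne_top (by finiteness) (hpost z k hz hN)
  obtain ⟨k₀⟩ := ‹Nonempty κ›
  have hmem : ∀ (z : κ → ι → ℝ), (∀ l i, z l i ≠ 0 → i ∈ Z l) → (∀ l, N (z l) ≤ c l) →
      glue z ∈ sumSpace M N := fun z hz hN => by
    rw [hsplit z k₀ hz]
    refine add_mem (add_mem (mem_sumSpace_left (hpre' z k₀ hz hN)) (mem_sumSpace_right ?_))
      (mem_sumSpace_right (hpost' z k₀ hz hN))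
    exact ne_top_of_le_ne_top ENNReal.coe_ne_top (hN k₀)
  -- the two elements
  set C : ℝ≥0 := 4 * (c₀ + 1) with hC
  have hC0 : 0 < C := by positivity
  have hLpos : ∀ k, 0 < L k := fun k => one_pos.trans_le (hL k)
  -- The vector x k may reach up to weight L k · w k, which makes its M-norm larger by the factor L
  -- k than the comparison allows; division by L k compensates for it.
  set zx : κ → ι → ℝ := fun k => ((c k / (C * L k) : ℝ≥0) : ℝ) • x k with hzx
  set zy : κ → ι → ℝ := fun k => (c k : ℝ) • y k with hzy
  have hzxZ : ∀ l i, zx l i ≠ 0 → i ∈ Z l := fun l i h => by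
    have := hx l i (right_ne_zero_of_mul h)
    exact ⟨this.1, this.2.1⟩
  have hzyZ : ∀ l i, zy l i ≠ 0 → i ∈ Z l := fun l i h => by
    have := hy l i (right_ne_zero_of_mul h)
    exact ⟨(haw l).trans this.1, this.2⟩
  have hzyN : ∀ l, N (zy l) = c l := fun l => by
    simp only [hzy]
    rw [N.map_nnreal_smul, hNy, mul_one]
  have hzxN' : ∀ l, N (zx l) ≤ (c l / (C * L l) : ℝ≥0) := fun l => by
    simp only [hzx]
    rw [N.map_nnreal_smul]
    exact mul_le_of_le_one_right' (hNx l)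
  have hCL : ∀ l, 1 ≤ C * L l := fun l =>
    one_le_mul (by rw [hC, mul_add]; exact (by norm_num : (1 : ℝ≥0) ≤ 4 * 1).trans le_add_self)
      (hL l)
  have hzxN : ∀ l, N (zx l) ≤ c l := fun l => (hzxN' l).trans (by
    exact_mod_cast div_le_self zero_le (hCL l))
  have hfM := hmem zx hzxZ hzxN
  have hgM := hmem zy hzyZ fun l => (hzyN l).le
  -- comparison of the `K`-functionals
  have hlow : ∀ (τ : ℝ≥0) k, (min (w k) τ * c k : ℝ≥0) ≤ ((c₀ + 1 : ℝ≥0) : ℝ≥0∞) *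
      kSeq M N τ (glue zy) := by
    intro τ k
    rw [kSeq]
    simp only [ENNReal.mul_iInf_of_ne (a := ((c₀ + 1 : ℝ≥0) : ℝ≥0∞))
      (by exact_mod_cast (by positivity : (0 : ℝ≥0) < c₀ + 1).ne') ENNReal.coe_ne_top]
    refine le_iInf fun u => le_iInf fun v => le_iInf fun huv => ?_
    -- Where w k ≤ t ≤ b k the glued vector is c_k y_k. Any splitting of it restricts to a splitting
    -- of this one piece, so a single block already bounds the K-functional from below.
    set W : Set ι := {i | w k ≤ t i ∧ t i ≤ b k}
    have hW : zy k = W.indicator u + W.indicator v := by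
      rw [← Set.indicator_add', huv]
      ext i
      by_cases hi : i ∈ W
      · rw [Set.indicator_of_mem hi, hglue zy k i ⟨(haw k).trans hi.1, hi.2⟩]
      · rw [Set.indicator_of_notMem hi]
        by_contra h
        exact hi (hy k i (right_ne_zero_of_mul h))
    have h3 : (c k : ℝ≥0∞) ≤ N (W.indicator u) + N v := by
      rw [← hzyN k, hW]
      exact (N.add_le _ _).trans (by gcongr; exact N.indicator_le _ _)
    have h4 : (min (w k) τ : ℝ≥0) * N (W.indicator u) ≤ c₀ * M u := by
      refine (hc.high _ _ fun i hi => ?_).trans (by gcongr; exact M.indicator_le _ _)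
      have : i ∈ W := by
        by_contra h
        exact hi (Set.indicator_of_notMem h _)
      exact (min_le_left _ _).trans this.1
    calc ((min (w k) τ * c k : ℝ≥0) : ℝ≥0∞) = (min (w k) τ : ℝ≥0) * (c k : ℝ≥0∞) := by push_cast; rfl
      _ ≤ (min (w k) τ : ℝ≥0) * (N (W.indicator u) + N v) := by gcongr
      _ = (min (w k) τ : ℝ≥0) * N (W.indicator u) + (min (w k) τ : ℝ≥0) * N v := mul_add _ _ _
      _ ≤ c₀ * M u + τ * N v :=
        add_le_add h4 (mul_le_mul_left (ENNReal.coe_le_coe.2 (min_le_right _ _)) _)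
      _ ≤ (c₀ + 1 : ℝ≥0) * M u + (c₀ + 1 : ℝ≥0) * (τ * N v) :=
        add_le_add (mul_le_mul_left (ENNReal.coe_le_coe.2 le_self_add) _)
          (le_mul_of_one_le_left' (ENNReal.one_le_coe_iff.2 le_add_self))
      _ = _ := (mul_add _ _ _).symm
  have hK : ∀ τ : ℝ≥0, 0 < τ → kSeq M N τ (glue zx) ≤ kSeq M N τ (glue zy) := by
    intro τ hτ
    set K := kSeq M N τ (glue zy) with hKdef
    -- Whole blocks are assigned to one side: those with w l < τ to the M part, the others to the N
    -- part.
    have hup : kSeq M N τ (glue zx) ≤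
        ∑' l, (if w l < τ then ((w l * c l / C : ℝ≥0) : ℝ≥0∞) else 0) +
          τ * ∑' l, (if τ ≤ w l then ((c l / C : ℝ≥0) : ℝ≥0∞) else 0) := by
      refine (iInf₂_le ({i | ∃ l, w l < τ ∧ i ∈ Z l}.indicator (glue zx))
        ({i | ∃ l, τ ≤ w l ∧ i ∈ Z l}.indicator (glue zx))).trans ((iInf_le _ ?_).trans ?_)
      · ext i
        simp only [Pi.add_apply]
        by_cases hi : glue zx i = 0
        · have : ∀ S : Set ι, S.indicator (glue zx) i = 0 := fun S => by
            by_cases h : i ∈ S <;> simp [h, hi]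
          rw [hi, this, this]
          simp
        obtain ⟨l, hl⟩ := hglue0 zx i hi
        rcases lt_or_ge (w l) τ with h | h
        · have hm : i ∈ {i | ∃ l, w l < τ ∧ i ∈ Z l} := ⟨l, h, hl⟩
          have hn : i ∉ {i | ∃ l, τ ≤ w l ∧ i ∈ Z l} := by
            rintro ⟨l', h', hl'⟩
            rw [hZuniq hl' hl] at h'
            exact absurd h' (not_le.2 h)
          rw [Set.indicator_of_mem hm, Set.indicator_of_notMem hn, add_zero]
        · have hm : i ∈ {i | ∃ l, τ ≤ w l ∧ i ∈ Z l} := ⟨l, h, hl⟩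
          have hn : i ∉ {i | ∃ l, w l < τ ∧ i ∈ Z l} := by
            rintro ⟨l', h', hl'⟩
            rw [hZuniq hl' hl] at h'
            exact absurd h (not_le.2 h')
          rw [Set.indicator_of_mem hm, Set.indicator_of_notMem hn, zero_add]
      · gcongr
        · refine hpiece M zx _ _ hzxZ fun l _ => ?_
          refine (hc.low (L l * w l) _ fun i hi => (hx l i (right_ne_zero_of_mul hi)).2.2).trans ?_
          refine (mul_le_mul_right (hzxN' l) _).trans ?_
          rw [← ENNReal.coe_mul]
          refine ENNReal.coe_le_coe.2 (le_of_eq ?_)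
          have := (hLpos l).ne'
          field_simp
        · refine hpiece N zx _ _ hzxZ fun l _ => (hzxN' l).trans ?_
          refine ENNReal.coe_le_coe.2 ?_
          exact div_le_div_of_nonneg_left zero_le hC0 (le_mul_of_one_le_right' (hL l))
    have hA : ∑' l, (if w l < τ then ((w l * c l / C : ℝ≥0) : ℝ≥0∞) else 0) ≤ 2⁻¹ * K := by
      refine tsum_ite_le_of_finset fun s hs => ?_
      rcases s.eq_empty_or_nonempty with rfl | hne
      · simp
      -- By `h₂` the rightmost block outweighs all earlier ones together in the M sum, so twice that
      -- block bounds the sum. The lower bound for it and the choice of C give half of K.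
      obtain ⟨k, hk, hmax⟩ := s.exists_max_image a hne
      have h3 : ∑ l ∈ s, (w l * c l : ℝ≥0∞) ≤ 2 * (w k * c k) := by
        rw [← Finset.add_sum_erase s _ hk, two_mul]
        gcongr
        have h5 : ∑ l ∈ s.erase k, (w l * c l : ℝ≥0∞) ≤
            ∑' l, (if b l < a k then (c l * b l : ℝ≥0∞) else 0) := by
          refine le_trans (Finset.sum_le_sum fun l hl => ?_) (ENNReal.sum_le_tsum (s.erase k))
          have h6 : b l < a k := by
            rcases hab l k (Finset.ne_of_mem_erase hl) with h | h
            · exact h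
            · exact absurd ((((haw k).trans (hwb k)).trans_lt h).trans_le
                (hmax l (Finset.mem_of_mem_erase hl))) (lt_irrefl _)
          rw [if_pos h6, mul_comm]
          gcongr
          exact hwb l
        refine h5.trans ((h₂ k).trans ?_)
        calc (δ k : ℝ≥0∞) * (c k * a k) ≤ 1 * (c k * w k) := by
              gcongr
              · exact_mod_cast hδ k
              · exact haw k
          _ = _ := by rw [one_mul, mul_comm]
      have h4 := hlow τ k
      rw [min_eq_left (hs k hk).le] at h4
      have h7 : ∑ l ∈ s, ((w l * c l / C : ℝ≥0) : ℝ≥0∞) = (C⁻¹ : ℝ≥0) * ∑ l ∈ s, (w l * c l : ℝ≥0∞) := by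
        rw [Finset.mul_sum]
        refine Finset.sum_congr rfl fun l _ => ?_
        rw [div_eq_inv_mul]
        push_cast
        rfl
      rw [h7]
      calc ((C⁻¹ : ℝ≥0) : ℝ≥0∞) * ∑ l ∈ s, (w l * c l : ℝ≥0∞)
          ≤ (C⁻¹ : ℝ≥0) * (2 * ((c₀ + 1 : ℝ≥0) * K)) := by
            refine mul_le_mul_right (h3.trans (mul_le_mul_right ?_ _)) _
            exact_mod_cast h4
        _ = ((C⁻¹ * (2 * (c₀ + 1)) : ℝ≥0) : ℝ≥0∞) * K := by push_cast; ring
        _ = ((2⁻¹ : ℝ≥0) : ℝ≥0∞) * K := by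
          congr 2
          rw [hC]
          field_simp
          norm_num
        _ = _ := by rw [ENNReal.coe_inv (by norm_num)]; rfl
    have hB : τ * ∑' l, (if τ ≤ w l then ((c l / C : ℝ≥0) : ℝ≥0∞) else 0) ≤ 2⁻¹ * K := by
      rw [← ENNReal.tsum_mul_left]
      simp only [mul_ite, mul_zero]
      refine tsum_ite_le_of_finset fun s hs => ?_
      rcases s.eq_empty_or_nonempty with rfl | hne
      · simp
      -- In the N sum it is the leftmost block that outweighs all later ones, by `h₁`.
      obtain ⟨k, hk, hmin⟩ := s.exists_min_image a hne
      have h3 : ∑ l ∈ s, (c l : ℝ≥0∞) ≤ 2 * c k := by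
        rw [← Finset.add_sum_erase s _ hk, two_mul]
        gcongr
        have h5 : ∑ l ∈ s.erase k, (c l : ℝ≥0∞) ≤
            ∑' l, (if b k < a l then (c l : ℝ≥0∞) else 0) := by
          refine le_trans (Finset.sum_le_sum fun l hl => ?_) (ENNReal.sum_le_tsum (s.erase k))
          have h6 : b k < a l := by
            rcases hab l k (Finset.ne_of_mem_erase hl) with h | h
            · exact absurd ((((haw l).trans (hwb l)).trans_lt h).trans_le
                (hmin l (Finset.mem_of_mem_erase hl))) (lt_irrefl _)
            · exact h
          rw [if_pos h6]
        refine h5.trans ((h₁ k).trans ?_)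
        exact mul_le_of_le_one_left' (by exact_mod_cast hδ k)
      have h4 := hlow τ k
      rw [min_eq_right (hs k hk)] at h4
      have h7 : ∑ l ∈ s, (τ : ℝ≥0∞) * ((c l / C : ℝ≥0) : ℝ≥0∞) =
          (C⁻¹ : ℝ≥0) * (τ * ∑ l ∈ s, (c l : ℝ≥0∞)) := by
        rw [Finset.mul_sum, Finset.mul_sum]
        refine Finset.sum_congr rfl fun l _ => ?_
        rw [div_eq_inv_mul]
        push_cast
        ring
      rw [h7]
      calc ((C⁻¹ : ℝ≥0) : ℝ≥0∞) * (τ * ∑ l ∈ s, (c l : ℝ≥0∞))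
          ≤ (C⁻¹ : ℝ≥0) * (2 * ((c₀ + 1 : ℝ≥0) * K)) := by
            refine mul_le_mul_right ?_ _
            calc (τ : ℝ≥0∞) * ∑ l ∈ s, (c l : ℝ≥0∞) ≤ τ * (2 * c k) := mul_le_mul_right h3 _
              _ = 2 * ((τ * c k : ℝ≥0) : ℝ≥0∞) := by push_cast; ring
              _ ≤ _ := mul_le_mul_right h4 _
        _ = ((C⁻¹ * (2 * (c₀ + 1)) : ℝ≥0) : ℝ≥0∞) * K := by push_cast; ring
        _ = ((2⁻¹ : ℝ≥0) : ℝ≥0∞) * K := by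
          congr 2
          rw [hC]
          field_simp
          norm_num
        _ = _ := by rw [ENNReal.coe_inv (by norm_num)]; rfl
    refine hup.trans ((add_le_add hA hB).trans (le_of_eq ?_))
    rw [← add_mul, ENNReal.inv_two_add_inv_two, one_mul]
  obtain ⟨T, Θ, hTM, hTN, hTg⟩ := hcal ⟨_, hfM⟩ ⟨_, hgM⟩ hK
  refine ⟨T, Θ, hTN, fun k => ?_⟩
  have hyk : y k ∈ sumSpace M N := mem_sumSpace_right (by rw [hNy]; exact ENNReal.one_ne_top)
  refine ⟨hyk, ?_⟩
  set gpre : sumSpace M N := ⟨_, mem_sumSpace_left (hpre' zy k hzyZ fun l => (hzyN l).le)⟩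
  set gpost : sumSpace M N := ⟨_, mem_sumSpace_right (hpost' zy k hzyZ fun l => (hzyN l).le)⟩
  have hsum : (⟨_, hgM⟩ : sumSpace M N) = gpre + (c k : ℝ) • ⟨y k, hyk⟩ + gpost :=
    Subtype.ext (hsplit zy k hzyZ)
  have hTsum : glue zx = T gpre + (c k : ℝ) • T ⟨y k, hyk⟩ + T gpost := by
    rw [hsum, _root_.map_add, _root_.map_add, _root_.map_smul] at hTg
    exact hTg.symm
  -- On Z k the vector f is its k-th piece, so the deviation of T (y k) from the multiple of x k
  -- comes only from the images of the parts of g before and after block k.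
  have hE : (c k : ℝ) • ((Z k).indicator (T ⟨y k, hyk⟩) -
      ((4 * (c₀ + 1) * L k)⁻¹ : ℝ) • x k) =
      -(Z k).indicator (T gpre) - (Z k).indicator (T gpost) := by
    have h3 : zx k = (Z k).indicator (T gpre) + (c k : ℝ) • (Z k).indicator (T ⟨y k, hyk⟩) +
        (Z k).indicator (T gpost) := by
      rw [← hglueZ zx k (hzxZ k), hTsum, Set.indicator_add', Set.indicator_add',
        indicator_real_smul]
    have h4 : zx k = (c k : ℝ) • ((4 * (c₀ + 1) * L k)⁻¹ : ℝ) • x k := by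
      simp only [hzx, hC, smul_smul]
      congr 1
    rw [smul_sub, ← h4, h3]
    abel
  have hfinal : (a k * c k : ℝ≥0) * N ((Z k).indicator (T ⟨y k, hyk⟩) -
      ((4 * (c₀ + 1) * L k)⁻¹ : ℝ) • x k) ≤ (a k * c k : ℝ≥0) * (Θ * (1 + c₀) * δ k) := by
    -- The part before the block is small in M only. On Z k the weight is at least a k, and
    -- compatibility converts the bound into one for N.
    have h3 : (a k : ℝ≥0∞) * N ((Z k).indicator (T gpre)) ≤ c₀ * (Θ * (δ k * (c k * a k))) := by
      refine (hc.high (a k) _ fun i hi => ?_).trans ?_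
      · have : i ∈ Z k := by
          by_contra h
          exact hi (Set.indicator_of_notMem h _)
        exact this.1
      · gcongr
        refine (M.indicator_le _ _).trans ((hTM _).trans ?_)
        gcongr
        exact hpre zy k hzyZ fun l => (hzyN l).le
    have h4 : N ((Z k).indicator (T gpost)) ≤ Θ * (δ k * c k) := by
      refine (N.indicator_le _ _).trans ((hTN _).trans ?_)
      gcongr
      exact hpost zy k hzyZ fun l => (hzyN l).le
    rw [ENNReal.coe_mul, mul_assoc, ← N.map_nnreal_smul (c k), hE]
    have h5 := N.sub_le (-(Z k).indicator (T gpre)) ((Z k).indicator (T gpost))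
    rw [N.map_neg] at h5
    calc _ ≤ (a k : ℝ≥0∞) * (N ((Z k).indicator (T gpre)) + N ((Z k).indicator (T gpost))) := by
          gcongr
      _ = a k * N ((Z k).indicator (T gpre)) + a k * N ((Z k).indicator (T gpost)) := mul_add _ _ _
      _ ≤ c₀ * (Θ * (δ k * (c k * a k))) + a k * (Θ * (δ k * c k)) := by gcongr
      _ = _ := by ring
  refine (ENNReal.mul_le_mul_iff_right ?_ ENNReal.coe_ne_top).1 hfinal
  exact_mod_cast (mul_pos (ha k) (hcpos k)).ne'

end SeqNorm

/-! ### Recursive choice and widely separated families. -/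

/-- Recursive choice of a sequence in which each term is small compared with the earlier ones and
large compared with their accumulated output. -/
theorem exists_block_sequence {β : Type*} (good : ℕ → β → Prop) (outO outN thrO thrN : β → ℝ≥0∞)
    (hO : ∀ j b, good j b → outO b ≠ ∞) (ht : ∀ j b, good j b → 0 < thrO b)
    (supply : ∀ (j : ℕ) (Γ ρ : ℝ≥0∞), Γ ≠ ∞ → 0 < ρ → ∃ b, good j b ∧ outN b ≤ ρ ∧ Γ ≤ thrN b) :
    ∃ u : ℕ → β, (∀ j, good j (u j)) ∧ (∀ j, ∑ i ∈ Finset.range j, outO (u i) ≤ thrN (u j)) ∧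
      ∀ j, ∑' i, (if j < i then outN (u i) else 0) ≤ thrO (u j) := by
  classical
  choose nxt hgood hN hΓ using supply
  -- The state consists of the accumulated output of the earlier terms and of an allowance for the
  -- later ones. The allowance is capped by the threshold of the newest term and halved, so that
  -- everything still to come fits below that threshold.
  let step : ℕ → {p : ℝ≥0∞ × ℝ≥0∞ // p.1 ≠ ∞ ∧ 0 < p.2} → {p : ℝ≥0∞ × ℝ≥0∞ // p.1 ≠ ∞ ∧ 0 < p.2} :=
    fun j p => ⟨(p.1.1 + outO (nxt j p.1.1 p.1.2 p.2.1 p.2.2),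
      min p.1.2 (thrO (nxt j p.1.1 p.1.2 p.2.1 p.2.2)) / 2),
      ENNReal.add_ne_top.2 ⟨p.2.1, hO j _ (hgood _ _ _ _ _)⟩,
      ENNReal.half_pos (lt_min p.2.2 (ht j _ (hgood _ _ _ _ _))).ne'⟩
  let st : ℕ → {p : ℝ≥0∞ × ℝ≥0∞ // p.1 ≠ ∞ ∧ 0 < p.2} := fun j =>
    Nat.rec ⟨(0, 1), by simp, by simp⟩ (fun j p => step j p) j
  let u : ℕ → β := fun j => nxt j (st j).1.1 (st j).1.2 (st j).2.1 (st j).2.2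
  have hst1 : ∀ j, (st (j + 1)).1.1 = (st j).1.1 + outO (u j) := fun j => rfl
  have hst2 : ∀ j, (st (j + 1)).1.2 = min (st j).1.2 (thrO (u j)) / 2 := fun j => rfl
  refine ⟨u, fun j => hgood _ _ _ _ _, fun j => ?_, fun j => ?_⟩
  · refine le_trans (le_of_eq ?_) (hΓ j (st j).1.1 (st j).1.2 (st j).2.1 (st j).2.2)
    induction j with
    | zero => rfl
    | succ j ih => rw [Finset.sum_range_succ, ih, hst1]
  · have h2 : ∀ x : ℝ≥0∞, 2 * (x / 2) = x := fun x =>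
      ENNReal.mul_div_cancel (by norm_num) (by norm_num)
    have hρ : ∀ n, 2 * (st (n + 1)).1.2 ≤ (st n).1.2 := fun n => by
      rw [hst2, h2]
      exact min_le_left _ _
    -- Telescoping invariant: term n uses at most its allowance, and twice the next allowance is at
    -- most the present one. Since 2·allowance(j+1) is at most the threshold of term j, this yields
    -- the tail bound.
    have hle : ∀ n, j + 1 ≤ n → ∑ i ∈ Finset.range n, (if j < i then outN (u i) else 0) +
        2 * (st n).1.2 ≤ 2 * (st (j + 1)).1.2 := by
      intro n hn
      induction n, hn using Nat.le_induction with
      | base =>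
        rw [Finset.sum_eq_zero, zero_add]
        intro i hi
        rw [if_neg]
        have := Finset.mem_range.1 hi
        omega
      | succ n hn ih =>
        rw [Finset.sum_range_succ, if_pos (by omega)]
        refine le_trans ?_ ih
        rw [add_assoc]
        gcongr
        rw [two_mul (st n).1.2]
        exact add_le_add (hN _ _ _ _ _) (hρ n)
    rw [ENNReal.tsum_eq_iSup_nat]
    refine iSup_le fun n => ?_
    have h3 : ∑ i ∈ Finset.range n, (if j < i then outN (u i) else 0) ≤
        ∑ i ∈ Finset.range (max n (j + 1)), (if j < i then outN (u i) else 0) :=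
      Finset.sum_le_sum_of_subset (Finset.range_subset_range.2 (le_max_left _ _))
    refine h3.trans ((le_self_add.trans (hle _ (le_max_right _ _))).trans ?_)
    rw [hst2, h2]
    exact min_le_right _ _

theorem NNReal.sum_pow_le_two {q : ℝ≥0} (hq : q ≤ 1 / 2) (n : ℕ) : ∑ i ∈ Finset.range n, q ^ i ≤ 2 := by
  have h1 : ∑ i ∈ Finset.range n, q ^ i ≤ ∑ i ∈ Finset.range n, (1 / 2 : ℝ≥0) ^ i :=
    Finset.sum_le_sum fun i _ => pow_le_pow_left₀ zero_le hq i
  refine h1.trans ?_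
  have := sum_geometric_two_le n
  rw [← NNReal.coe_le_coe]
  push_cast
  exact this

namespace SeqNorm

variable {ι κ : Type*}

/-- A finite family of pairs `(x n, y n)` located in widely separated ranges of the weight `t`. -/
structure SepFam [LT κ] (N : SeqNorm ι) (t : ι → ℝ≥0) (B : ℝ≥0) (s : Finset κ)
    (x y : κ → ι → ℝ) (a w b : κ → ℝ≥0) : Prop where
  pos : ∀ n ∈ s, 0 < a n
  aw : ∀ n ∈ s, a n ≤ w n
  wb : ∀ n ∈ s, w n ≤ b n
  sep : ∀ m ∈ s, ∀ n ∈ s, m < n → B ^ 4 * b m ≤ a n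
  x_supp : ∀ n ∈ s, ∀ i, x n i ≠ 0 → a n ≤ t i ∧ t i ≤ b n ∧ t i ≤ B * w n
  y_supp : ∀ n ∈ s, ∀ i, y n i ≠ 0 → w n ≤ t i ∧ t i ≤ b n
  le : ∀ n ∈ s, N (x n) ≤ N (y n)
  ne_top : ∀ n ∈ s, N (y n) ≠ ∞
  ne_zero : ∀ n ∈ s, N (y n) ≠ 0

namespace SepFam

variable {N : SeqNorm ι} {t : ι → ℝ≥0} {B : ℝ≥0}

theorem subset [LT κ] {s s' : Finset κ} {x y : κ → ι → ℝ} {a w b : κ → ℝ≥0}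
    (h : SepFam N t B s x y a w b) (hs : s' ⊆ s) : SepFam N t B s' x y a w b where
  pos n hn := h.pos n (hs hn)
  aw n hn := h.aw n (hs hn)
  wb n hn := h.wb n (hs hn)
  sep m hm n hn := h.sep m (hs hm) n (hs hn)
  x_supp n hn := h.x_supp n (hs hn)
  y_supp n hn := h.y_supp n (hs hn)
  le n hn := h.le n (hs hn)
  ne_top n hn := h.ne_top n (hs hn)
  ne_zero n hn := h.ne_zero n (hs hn)

theorem reindex [LinearOrder κ] [Nonempty κ] {s : Finset κ} {x y : κ → ι → ℝ} {a w b : κ → ℝ≥0}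
    (h : SepFam N t B s x y a w b) :
    ∃ (m : ℕ) (e : ℕ → κ), SepFam N t B (Finset.range m) (x ∘ e) (y ∘ e) (a ∘ e) (w ∘ e) (b ∘ e) ∧
      (∀ n < m, e n ∈ s) ∧ (∀ z : κ → ι → ℝ, ∑ n ∈ Finset.range m, z (e n) = ∑ n ∈ s, z n) := by
  classical
  obtain ⟨k₀⟩ := ‹Nonempty κ›
  set e : ℕ → κ := fun n => if hn : n < s.card then s.orderEmbOfFin rfl ⟨n, hn⟩ else k₀ with he
  have hmem : ∀ n < s.card, e n ∈ s := fun n hn => by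
    simp only [he, hn, dif_pos]
    exact Finset.orderEmbOfFin_mem _ _ _
  have hr : ∀ n ∈ Finset.range s.card, e n ∈ s := fun n hn => hmem n (Finset.mem_range.1 hn)
  have hlt : ∀ m ∈ Finset.range s.card, ∀ n ∈ Finset.range s.card, m < n → e m < e n := by
    intro m hm n hn hmn
    simp only [he, Finset.mem_range.1 hm, Finset.mem_range.1 hn, dif_pos]
    exact (s.orderEmbOfFin rfl).strictMono hmn
  refine ⟨s.card, e, ?_, hmem, fun z => ?_⟩
  · exact ⟨fun n hn => h.pos _ (hr n hn), fun n hn => h.aw _ (hr n hn), fun n hn => h.wb _ (hr n hn),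
      fun m hm n hn hmn => h.sep _ (hr m hm) _ (hr n hn) (hlt m hm n hn hmn),
      fun n hn => h.x_supp _ (hr n hn), fun n hn => h.y_supp _ (hr n hn),
      fun n hn => h.le _ (hr n hn), fun n hn => h.ne_top _ (hr n hn),
      fun n hn => h.ne_zero _ (hr n hn)⟩
  · refine Finset.sum_bij (fun n _ => e n) hr ?_ ?_ fun _ _ => rfl
    · intro m hm n hn hmn
      by_contra hne
      rcases lt_or_gt_of_ne hne with h1 | h1
      · exact absurd hmn (hlt m hm n hn h1).ne
      · exact absurd hmn (hlt n hn m hm h1).ne'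
    · intro k hk
      have : k ∈ Set.range (s.orderEmbOfFin rfl) := by
        rw [Finset.range_orderEmbOfFin]
        exact hk
      obtain ⟨⟨n, hn⟩, rfl⟩ := this
      exact ⟨n, Finset.mem_range.2 hn, by simp [he, hn]⟩

end SepFam

end SeqNorm

namespace SeqNorm

variable {ι κ : Type*}

namespace SepFam

variable {N : SeqNorm ι} {t : ι → ℝ≥0} {B : ℝ≥0} {x y : ℕ → ι → ℝ} {a w b : ℕ → ℝ≥0}

theorem ab [LT κ] {s : Finset κ} {x y : κ → ι → ℝ} {a w b : κ → ℝ≥0}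
    (h : SepFam N t B s x y a w b) {n : κ} (hn : n ∈ s) : a n ≤ b n := (h.aw n hn).trans (h.wb n hn)

theorem lt_of_lt [LT κ] {s : Finset κ} {x y : κ → ι → ℝ} {a w b : κ → ℝ≥0}
    (h : SepFam N t B s x y a w b) (hB : 2 ≤ B) {m n : κ} (hm : m ∈ s) (hn : n ∈ s) (hmn : m < n) :
    2 * b m ≤ a n := by
  refine le_trans ?_ (h.sep m hm n hn hmn)
  gcongr
  calc (2 : ℝ≥0) ≤ 2 ^ 4 := by norm_num
    _ ≤ B ^ 4 := by gcongr

theorem sum_le [LinearOrder κ] {s s' : Finset κ} {x y : κ → ι → ℝ} {a w b : κ → ℝ≥0}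
    (h : SepFam N t B s x y a w b) (hB : 2 ≤ B) (hs : s' ⊆ s) :
    N (∑ n ∈ s', y n) ≤ N (∑ n ∈ s, y n) := by
  refine N.mono fun i => ?_
  rw [Finset.sum_apply, Finset.sum_apply]
  by_cases h0 : ∃ n ∈ s', y n i ≠ 0
  · obtain ⟨n, hn, hi⟩ := h0
    have huniq : ∀ m ∈ s, m ≠ n → y m i = 0 := by
      intro m hm hmn
      by_contra him
      have h1 := h.y_supp m hm i him
      have h2 := h.y_supp n (hs hn) i hi
      have hpos : 0 < t i := (h.pos n (hs hn)).trans_le ((h.aw n (hs hn)).trans h2.1)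
      rcases lt_or_gt_of_ne hmn with h3 | h3
      · have h4 := h.lt_of_lt hB hm (hs hn) h3
        have h5 : 2 * t i ≤ t i :=
          (mul_le_mul_right h1.2 2).trans (h4.trans ((h.aw n (hs hn)).trans h2.1))
        exact absurd h5 (not_le.2 (by rw [two_mul]; exact lt_add_of_pos_left _ hpos))
      · have h4 := h.lt_of_lt hB (hs hn) hm h3
        have h5 : 2 * t i ≤ t i :=
          (mul_le_mul_right h2.2 2).trans (h4.trans ((h.aw m hm).trans h1.1))
        exact absurd h5 (not_le.2 (by rw [two_mul]; exact lt_add_of_pos_left _ hpos))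
    rw [Finset.sum_eq_single_of_mem n hn fun m hm hmn => huniq m (hs hm) hmn,
      Finset.sum_eq_single_of_mem n (hs hn) huniq]
  · push Not at h0
    rw [Finset.sum_eq_zero h0, abs_zero]
    exact abs_nonneg _

theorem pow_le {m : ℕ} (h : SepFam N t B (Finset.range m) x y a w b) {l n : ℕ} (hln : l < n)
    (hn : n < m) : (B ^ 4) ^ (n - l) * b l ≤ a n := by
  induction n, hln using Nat.le_induction with
  | base => simpa using h.sep l (Finset.mem_range.2 (by omega)) (l + 1) (Finset.mem_range.2 hn) (by omega)
  | succ n hln ih =>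
    have h1 := ih (by omega)
    have h2 := h.sep n (Finset.mem_range.2 (by omega)) (n + 1) (Finset.mem_range.2 hn) (by omega)
    have h3 : n + 1 - l = (n - l) + 1 := by omega
    rw [h3, pow_succ, mul_comm (_ ^ _) (B ^ 4), mul_assoc]
    refine le_trans ?_ h2
    gcongr
    exact h1.trans (h.ab (Finset.mem_range.2 (by omega)))

/-- Geometric weights: the later terms are small. -/
theorem sum_later_le {q γ : ℝ≥0} (hq : q ≤ 1 / 2) (m n : ℕ) :
    ∑ l ∈ (Finset.range m).filter (n < ·), γ * q ^ l ≤ 2 * q * (γ * q ^ n) := by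
  have h1 : (Finset.range m).filter (n < ·) = Finset.Ico (n + 1) m := by
    ext l
    simp only [Finset.mem_filter, Finset.mem_range, Finset.mem_Ico]
    omega
  rw [h1, Finset.sum_Ico_eq_sum_range]
  calc ∑ j ∈ Finset.range (m - (n + 1)), γ * q ^ (n + 1 + j)
      = γ * q ^ (n + 1) * ∑ j ∈ Finset.range (m - (n + 1)), q ^ j := by
        rw [Finset.mul_sum]
        refine Finset.sum_congr rfl fun j _ => ?_
        rw [pow_add, mul_assoc]
    _ ≤ γ * q ^ (n + 1) * 2 := by gcongr; exact NNReal.sum_pow_le_two hq _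
    _ = _ := by ring

/-- Geometric weights: the earlier terms, multiplied with the weight `t`, are small. -/
theorem sum_earlier_le {m : ℕ} (h : SepFam N t B (Finset.range m) x y a w b) (hB : 2 ≤ B)
    (γ : ℝ≥0) {n : ℕ} (hn : n < m) :
    ∑ l ∈ Finset.range n, γ * ((B ^ 2)⁻¹) ^ l * b l ≤
      2 * (B ^ 2)⁻¹ * (γ * ((B ^ 2)⁻¹) ^ n * a n) := by
  set q : ℝ≥0 := (B ^ 2)⁻¹ with hq
  have hB0 : 0 < B := lt_of_lt_of_le (by norm_num) hB
  have hq2 : q ≤ 1 / 2 := by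
    rw [hq, one_div]
    refine inv_anti₀ (by norm_num) ?_
    calc (2 : ℝ≥0) ≤ 2 ^ 2 := by norm_num
      _ ≤ B ^ 2 := by gcongr
  -- This explains the ratio q = B^(-2). The weights fall by B^2 per step while the positions rise
  -- by B^4, so the weights decrease in N and increase in M, geometrically with the same ratio.
  have h1 : ∀ l ∈ Finset.range n, γ * q ^ l * b l ≤ γ * q ^ n * a n * q ^ (n - l) := by
    intro l hl
    have hl' := Finset.mem_range.1 hl
    have h2 := h.pow_le hl' hn
    have h3 : b l ≤ q ^ (n - l) * q ^ (n - l) * a n := by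
      have : q ^ (n - l) * q ^ (n - l) * (B ^ 4) ^ (n - l) = 1 := by
        rw [← mul_pow, ← mul_pow, hq]
        have : (B ^ 2)⁻¹ * (B ^ 2)⁻¹ * B ^ 4 = 1 := by field_simp
        rw [this, one_pow]
      calc b l = q ^ (n - l) * q ^ (n - l) * ((B ^ 4) ^ (n - l) * b l) := by
            rw [← mul_assoc, this, one_mul]
        _ ≤ _ := by gcongr
    calc γ * q ^ l * b l ≤ γ * q ^ l * (q ^ (n - l) * q ^ (n - l) * a n) := by gcongr
      _ = γ * (q ^ l * q ^ (n - l)) * a n * q ^ (n - l) := by ring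
      _ = _ := by rw [← pow_add, Nat.add_sub_cancel' hl'.le]
  refine (Finset.sum_le_sum h1).trans ?_
  rw [← Finset.mul_sum]
  have h4 : ∑ l ∈ Finset.range n, q ^ (n - l) ≤ 2 * q := by
    have : ∑ l ∈ Finset.range n, q ^ (n - l) = ∑ l ∈ Finset.range n, q ^ (l + 1) := by
      rw [← Finset.sum_range_reflect]
      refine Finset.sum_congr rfl fun l hl => ?_
      congr 1
      have := Finset.mem_range.1 hl
      omega
    rw [this]
    calc ∑ l ∈ Finset.range n, q ^ (l + 1) = (∑ l ∈ Finset.range n, q ^ l) * q := by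
          rw [Finset.sum_mul]
          rfl
      _ ≤ 2 * q := by gcongr; exact NNReal.sum_pow_le_two hq2 n
  calc γ * q ^ n * a n * ∑ l ∈ Finset.range n, q ^ (n - l) ≤ γ * q ^ n * a n * (2 * q) := by gcongr
    _ = _ := by ring

end SepFam

/-! ### Bad separated families contradict the Calderón property. -/

/-- A finite separated family together with a scale. -/
structure SepBlock (ι : Type*) where
  /-- the number of pairs -/
  m : ℕ
  /-- the left members -/
  x : ℕ → ι → ℝ
  /-- the right members -/
  y : ℕ → ι → ℝ
  /-- the lower ends -/
  a : ℕ → ℝ≥0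
  /-- the division points -/
  w : ℕ → ℝ≥0
  /-- the upper ends -/
  b : ℕ → ℝ≥0
  /-- the separation parameter -/
  B : ℝ≥0
  /-- the scale -/
  γ : ℝ≥0

namespace SepBlock

/-- The ratio of consecutive weights. -/
noncomputable def q (u : SepBlock ι) : ℝ≥0 := (u.B ^ 2)⁻¹

/-- The weights. -/
noncomputable def c (u : SepBlock ι) (n : ℕ) : ℝ≥0 := u.γ * u.q ^ n

/-- The total weight. -/
noncomputable def wt (u : SepBlock ι) : ℝ≥0∞ := ∑ n ∈ Finset.range u.m, (u.c n : ℝ≥0∞)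

/-- The total weight in the other norm, plus the upper ends. -/
noncomputable def wt' (u : SepBlock ι) : ℝ≥0∞ :=
  ∑ n ∈ Finset.range u.m, ((u.c n * u.b n + u.b n : ℝ≥0) : ℝ≥0∞)

/-- The weight that may be added behind the block. -/
noncomputable def thr (u : SepBlock ι) : ℝ≥0∞ :=
  ⨅ n ∈ Finset.range u.m, ((2 * u.q * u.c n : ℝ≥0) : ℝ≥0∞)

/-- The weight, in the other norm, that may be added before the block. -/
noncomputable def thr' (u : SepBlock ι) : ℝ≥0∞ :=
  ⨅ n ∈ Finset.range u.m, ((min (2 * u.q * (u.c n * u.a n)) (u.a n / 2) : ℝ≥0) : ℝ≥0∞)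

/-- The family is separated with parameter at least `j + 4`, it is far from satisfying the shift
inequality, and its left members are nearly maximal. -/
structure Good (N : SeqNorm ι) (t : ι → ℝ≥0) (j : ℕ) (u : SepBlock ι) : Prop where
  fam : SepFam N t u.B (Finset.range u.m) u.x u.y u.a u.w u.b
  hB : (j : ℝ≥0) + 4 ≤ u.B
  hγ : 0 < u.γ
  hm : 0 < u.m
  viol : (j * u.B : ℝ≥0) * N (∑ n ∈ Finset.range u.m, u.y n) < N (∑ n ∈ Finset.range u.m, u.x n)
  max : ∀ x' : ℕ → ι → ℝ, (∀ n < u.m, (∀ i, x' n i ≠ 0 → u.x n i ≠ 0) ∧ N (x' n) ≤ N (u.y n)) →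
    N (∑ n ∈ Finset.range u.m, x' n) ≤ 2 * N (∑ n ∈ Finset.range u.m, u.x n)

namespace Good

variable {N : SeqNorm ι} {t : ι → ℝ≥0} {j : ℕ} {u : SepBlock ι}

theorem two_le (h : Good N t j u) : 2 ≤ u.B :=
  le_trans (by norm_num) (le_add_self.trans h.hB)

theorem B_pos (h : Good N t j u) : 0 < u.B := lt_of_lt_of_le (by norm_num) h.two_le

theorem q_pos (h : Good N t j u) : 0 < u.q := inv_pos.2 (pow_pos h.B_pos 2)

theorem q_le (h : Good N t j u) : u.q ≤ 1 / 4 := by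
  rw [q, one_div]
  refine inv_anti₀ (by norm_num) ?_
  calc (4 : ℝ≥0) = 2 ^ 2 := by norm_num
    _ ≤ u.B ^ 2 := by gcongr; exact h.two_le

theorem c_pos (h : Good N t j u) (n : ℕ) : 0 < u.c n := mul_pos h.hγ (pow_pos h.q_pos n)

theorem wt_ne_top : u.wt ≠ ∞ := ENNReal.sum_ne_top.2 fun _ _ => ENNReal.coe_ne_top

theorem wt'_ne_top : u.wt' ≠ ∞ := ENNReal.sum_ne_top.2 fun _ _ => ENNReal.coe_ne_top

theorem thr_pos (h : Good N t j u) : 0 < u.thr := by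
  have hne : (Finset.range u.m).Nonempty := Finset.nonempty_range_iff.2 h.hm.ne'
  rw [thr, ← Finset.inf_eq_iInf, Finset.lt_inf_iff (by simp)]
  intro n _
  exact_mod_cast mul_pos (mul_pos two_pos h.q_pos) (h.c_pos n)

theorem thr'_pos (h : Good N t j u) : 0 < u.thr' := by
  rw [thr', ← Finset.inf_eq_iInf, Finset.lt_inf_iff (by simp)]
  intro n hn
  have ha := h.fam.pos n hn
  have : 0 < min (2 * u.q * (u.c n * u.a n)) (u.a n / 2) :=
    lt_min (mul_pos (mul_pos two_pos h.q_pos) (mul_pos (h.c_pos n) ha)) (half_pos ha)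
  exact_mod_cast this

end Good

end SepBlock

end SeqNorm

namespace SeqNorm

variable {ι : Type*}

namespace SepBlock

open Classical in
/-- In a couple with the Calderón property the separated families cannot be arbitrarily bad. -/
theorem false_of_blocks {N M : SeqNorm ι} {t : ι → ℝ≥0} {c₀ : ℝ≥0} (hc : Compat N M t c₀)
    (hcal : SeqCalderon M N) (u : ℕ → SepBlock ι) (hu : ∀ j, Good N t j (u j)) (r : ℕ → ℕ → Prop)
    (htri : ∀ i j, i ≠ j → r i j ∨ r j i)
    (H₁ : ∀ j, ∑' i, (if r j i then (u i).wt else 0) ≤ (u j).thr)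
    (H₂ : ∀ j, ∑' i, (if r i j then (u i).wt' else 0) ≤ (u j).thr') : False := by
  have hfam := fun j => (hu j).fam
  have hthr : ∀ j, ∀ n < (u j).m, (u j).thr ≤ (2 * (u j).q * (u j).c n : ℝ≥0) := fun j n hn =>
    iInf₂_le n (Finset.mem_range.2 hn)
  have hthr' : ∀ j, ∀ n < (u j).m, (u j).thr' ≤
      (min (2 * (u j).q * ((u j).c n * (u j).a n)) ((u j).a n / 2) : ℝ≥0) := fun j n hn =>
    iInf₂_le n (Finset.mem_range.2 hn)
  -- The totals `wt'` contain the upper ends b and the thresholds `thr'` contain a/2; so the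
  -- smallness condition `H₂` also orders the blocks in space.
  have hblk : ∀ i j, r i j → ∀ n < (u i).m, ∀ n' < (u j).m, (u i).b n < (u j).a n' := by
    intro i j hij n hn n' hn'
    have h1 : (((u i).b n : ℝ≥0) : ℝ≥0∞) ≤ (u i).wt' := by
      refine le_trans ?_ (Finset.single_le_sum
        (f := fun n => (((u i).c n * (u i).b n + (u i).b n : ℝ≥0) : ℝ≥0∞))
        (fun _ _ => zero_le) (Finset.mem_range.2 hn))
      exact ENNReal.coe_le_coe.2 le_add_self
    have h2 : (u i).wt' ≤ (u j).thr' := by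
      refine le_trans ?_ (H₂ j)
      refine le_trans (le_of_eq ?_) (ENNReal.le_tsum i)
      rw [if_pos hij]
    have h3 : (u i).b n ≤ (u j).a n' / 2 :=
      (ENNReal.coe_le_coe.1 (h1.trans (h2.trans (hthr' j n' hn')))).trans (min_le_right _ _)
    exact h3.trans_lt (half_lt_self ((hfam j).pos n' (Finset.mem_range.2 hn')))
  let κ := Σ j : ℕ, Fin (u j).m
  have : Nonempty κ := ⟨⟨0, ⟨0, (hu 0).hm⟩⟩⟩
  let a : κ → ℝ≥0 := fun k => (u k.1).a k.2
  let b : κ → ℝ≥0 := fun k => (u k.1).b k.2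
  let w : κ → ℝ≥0 := fun k => (u k.1).w k.2
  let c : κ → ℝ≥0 := fun k => (u k.1).c k.2
  have hmem : ∀ k : κ, (k.2 : ℕ) ∈ Finset.range (u k.1).m := fun k => Finset.mem_range.2 k.2.2
  -- Both members are divided by the norm of y, as the gluing requires N(y) = 1.
  let x : κ → ι → ℝ := fun k => (N ((u k.1).y k.2)).toReal⁻¹ • (u k.1).x k.2
  let y : κ → ι → ℝ := fun k => (N ((u k.1).y k.2)).toReal⁻¹ • (u k.1).y k.2
  have hνpos : ∀ k : κ, 0 < (N ((u k.1).y k.2)).toReal := fun k =>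
    ENNReal.toReal_pos ((hfam k.1).ne_zero _ (hmem k)) ((hfam k.1).ne_top _ (hmem k))
  have hν : ∀ k : κ, ‖(N ((u k.1).y k.2)).toReal⁻¹‖ₑ = (N ((u k.1).y k.2))⁻¹ := fun k => by
    rw [Real.enorm_eq_ofReal (inv_nonneg.2 ENNReal.toReal_nonneg), ENNReal.ofReal_inv_of_pos (hνpos k),
      ENNReal.ofReal_toReal ((hfam k.1).ne_top _ (hmem k))]
  have hsame : ∀ j, ∀ n < (u j).m, ∀ n' < (u j).m, n < n' → (u j).b n < (u j).a n' := by
    intro j n hn n' hn' h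
    have h1 := (hfam j).lt_of_lt (hu j).two_le (Finset.mem_range.2 hn) (Finset.mem_range.2 hn') h
    refine lt_of_lt_of_le ?_ h1
    rw [two_mul]
    exact lt_add_of_pos_left _ (((hfam j).pos n (Finset.mem_range.2 hn)).trans_le
      ((hfam j).ab (Finset.mem_range.2 hn)))
  have hab : ∀ k l : κ, k ≠ l → b k < a l ∨ b l < a k := by
    rintro ⟨i, n⟩ ⟨j, n'⟩ hne
    by_cases hij : i = j
    · subst hij
      have hnn : (n : ℕ) ≠ n' := fun h => hne (by rw [Fin.ext h])
      rcases lt_or_gt_of_ne hnn with h | h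
      · exact Or.inl (hsame i n n.2 n' n'.2 h)
      · exact Or.inr (hsame i n' n'.2 n n.2 h)
    · rcases htri i j hij with h | h
      · exact Or.inl (hblk i j h n n.2 n' n'.2)
      · exact Or.inr (hblk j i h n' n'.2 n n.2)
  have hle : ∀ j, ∀ n < (u j).m, (u j).a n ≤ (u j).b n := fun j n hn =>
    (hfam j).ab (Finset.mem_range.2 hn)
  have hq2 : ∀ j, (u j).q ≤ 1 / 2 := fun j => (hu j).q_le.trans (by
    rw [← NNReal.coe_le_coe]; norm_num)
  -- Two contributions of size 2q·c each: the later members of the same family, a geometric sum, and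
  -- the families behind it, bounded by the threshold. Together they give δ = 4q.
  have h₁ : ∀ k, ∑' l, (if b k < a l then (c l : ℝ≥0∞) else 0) ≤ (4 * (u k.1).q : ℝ≥0) * c k := by
    rintro ⟨j, n⟩
    refine (le_of_eq (ENNReal.tsum_sigma fun i n' =>
      if b ⟨j, n⟩ < a ⟨i, n'⟩ then (c ⟨i, n'⟩ : ℝ≥0∞) else 0)).trans ?_
    have hb : ∀ i, ∑' n' : Fin (u i).m, (if b ⟨j, n⟩ < a ⟨i, n'⟩ then (c ⟨i, n'⟩ : ℝ≥0∞) else 0) ≤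
        (if i = j then ((2 * (u j).q * (u j).c n : ℝ≥0) : ℝ≥0∞) else 0) +
          (if r j i then (u i).wt else 0) := by
      intro i
      rw [tsum_fintype]
      by_cases hij : i = j
      · subst hij
        rw [if_pos rfl]
        refine le_trans ?_ le_self_add
        refine le_trans ?_ (ENNReal.coe_le_coe.2 (SepFam.sum_later_le (γ := (u i).γ) (hq2 i) (u i).m n))
        push_cast
        rw [Finset.sum_filter, Finset.sum_range]
        refine Finset.sum_le_sum fun n' _ => ?_
        by_cases h : b ⟨i, n⟩ < a ⟨i, n'⟩
        · have hlt : (n : ℕ) < n' := by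
            by_contra hle'
            rcases eq_or_lt_of_le (not_lt.1 hle') with h' | h'
            · have : n' = n := Fin.ext h'
              rw [this] at h
              exact absurd h (not_lt.2 (hle i n n.2))
            · exact absurd (h.trans_le ((hle i n' n'.2).trans ((hsame i n' n'.2 n n.2 h').le.trans
                (hle i n n.2)))) (lt_irrefl _)
          rw [if_pos h, if_pos hlt]
          simp [c, SepBlock.c]
        · rw [if_neg h]
          exact zero_le
      · rw [if_neg hij, zero_add]
        by_cases hr : r j i
        · rw [if_pos hr, wt, Finset.sum_range]
          refine Finset.sum_le_sum fun n' _ => ?_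
          split_ifs
          · exact le_rfl
          · exact zero_le
        · rw [if_neg hr]
          refine le_of_eq (Finset.sum_eq_zero fun n' _ => if_neg fun h => ?_)
          have h' := hblk i j ((htri i j hij).resolve_right hr) n' n'.2 n n.2
          exact absurd (h.trans_le ((hle i n' n'.2).trans (h'.le.trans (hle j n n.2)))) (lt_irrefl _)
    refine (ENNReal.tsum_le_tsum hb).trans ?_
    rw [ENNReal.tsum_add, tsum_ite_eq]
    refine (add_le_add_right ((H₁ j).trans (hthr j n n.2)) _).trans (le_of_eq ?_)
    simp only [c]
    push_cast
    ring
  have h₂ : ∀ k, ∑' l, (if b l < a k then (c l * b l : ℝ≥0∞) else 0) ≤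
      (4 * (u k.1).q : ℝ≥0) * (c k * a k) := by
    rintro ⟨j, n⟩
    refine (le_of_eq (ENNReal.tsum_sigma fun i n' =>
      if b ⟨i, n'⟩ < a ⟨j, n⟩ then (c ⟨i, n'⟩ * b ⟨i, n'⟩ : ℝ≥0∞) else 0)).trans ?_
    have hb : ∀ i, ∑' n' : Fin (u i).m,
        (if b ⟨i, n'⟩ < a ⟨j, n⟩ then (c ⟨i, n'⟩ * b ⟨i, n'⟩ : ℝ≥0∞) else 0) ≤
        (if i = j then ((2 * (u j).q * ((u j).c n * (u j).a n) : ℝ≥0) : ℝ≥0∞) else 0) +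
          (if r i j then (u i).wt' else 0) := by
      intro i
      rw [tsum_fintype]
      by_cases hij : i = j
      · subst hij
        rw [if_pos rfl]
        refine le_trans ?_ le_self_add
        refine le_trans ?_ (ENNReal.coe_le_coe.2 ((hfam i).sum_earlier_le (hu i).two_le (u i).γ n.2))
        have h3 : ∑ l ∈ Finset.range n, (u i).γ * ((u i).B ^ 2)⁻¹ ^ l * (u i).b l =
            ∑ l ∈ Finset.range (u i).m, if l < n then (u i).γ * ((u i).B ^ 2)⁻¹ ^ l * (u i).b l else 0 := by
          rw [← Finset.sum_filter]
          congr 1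
          ext l
          simp only [Finset.mem_filter, Finset.mem_range]
          have := n.2
          omega
        rw [h3, Finset.sum_range]
        push_cast
        refine Finset.sum_le_sum fun n' _ => ?_
        by_cases h : b ⟨i, n'⟩ < a ⟨i, n⟩
        · have hlt : (n' : ℕ) < n := by
            by_contra hle'
            rcases eq_or_lt_of_le (not_lt.1 hle') with h' | h'
            · have : n = n' := Fin.ext h'
              rw [this] at h
              exact absurd h (not_lt.2 (hle i n' n'.2))
            · exact absurd (h.trans_le ((hle i n n.2).trans ((hsame i n n.2 n' n'.2 h').le.trans
                (hle i n' n'.2)))) (lt_irrefl _)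
          rw [if_pos h, if_pos hlt]
          simp only [c, b, SepBlock.c, SepBlock.q]
          push_cast
          exact le_rfl
        · rw [if_neg h]
          exact zero_le
      · rw [if_neg hij, zero_add]
        by_cases hr : r i j
        · rw [if_pos hr, wt', Finset.sum_range]
          refine Finset.sum_le_sum fun n' _ => ?_
          split_ifs
          · simp only [c, b]
            push_cast
            exact le_self_add
          · exact zero_le
        · rw [if_neg hr]
          refine le_of_eq (Finset.sum_eq_zero fun n' _ => if_neg fun h => ?_)
          have h' := hblk j i ((htri i j hij).resolve_left hr) n n.2 n' n'.2
          exact absurd (h.trans_le ((hle j n n.2).trans (h'.le.trans (hle i n' n'.2)))) (lt_irrefl _)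
    refine (ENNReal.tsum_le_tsum hb).trans ?_
    rw [ENNReal.tsum_add, tsum_ite_eq]
    refine (add_le_add_right ((H₂ j).trans ((hthr' j n n.2).trans
      (ENNReal.coe_le_coe.2 (min_le_left _ _)))) _).trans (le_of_eq ?_)
    simp only [c, a]
    push_cast
    ring
  obtain ⟨T, Θ₀, hT, hdiag⟩ := exists_diagonal hc hcal x y a w b c (fun k => 4 * (u k.1).q)
    (fun k => (u k.1).B) (fun k => (hfam k.1).pos _ (hmem k)) (fun k => (hfam k.1).aw _ (hmem k))
    (fun k => (hfam k.1).wb _ (hmem k)) hab (fun k => (hu k.1).c_pos _)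
    (fun k => le_trans (by norm_num) (hu k.1).two_le)
    (fun k => (mul_le_mul_right (hu k.1).q_le 4).trans (by norm_num))
    (fun k i hi => (hfam k.1).x_supp _ (hmem k) i (right_ne_zero_of_mul hi))
    (fun k i hi => (hfam k.1).y_supp _ (hmem k) i (right_ne_zero_of_mul hi))
    (fun k => by
      simp only [x]
      rw [N.map_smul, hν, ← ENNReal.div_eq_inv_mul]
      exact ENNReal.div_le_of_le_mul (by rw [one_mul]; exact (hfam k.1).le _ (hmem k)))
    (fun k => by
      simp only [y]
      rw [N.map_smul, hν, ENNReal.inv_mul_cancel ((hfam k.1).ne_zero _ (hmem k))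
        ((hfam k.1).ne_top _ (hmem k))]) h₁ h₂
  -- conclusion, for a single far block
  set Θ : ℝ≥0 := Θ₀ + 1 with hΘ
  set C : ℝ≥0 := 4 * (c₀ + 1) with hC
  have hC0 : 0 < C := by positivity
  -- The first summand will contradict the violation of the shift inequality; the second makes B
  -- large enough for the error to be absorbed.
  obtain ⟨j, hj⟩ := exists_nat_ge (2 * C * Θ + 16 * Θ * (1 + c₀) * C)
  set v := u j with hv
  have hvG : Good N t j v := hu j
  set η : ℝ≥0 := Θ * (1 + c₀) * (4 * v.q) with hη
  have hη0 : 0 < η := by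
    have := hvG.q_pos
    positivity
  set s := Finset.range v.m with hs
  have hkey : ∀ n, ∃ Y : sumSpace M N, n < v.m → ((Y : ι → ℝ) = v.y n ∧
      ∃ Dn : ι → ℝ, (∀ i, Dn i ≠ 0 → v.x n i ≠ 0) ∧ N Dn ≤ η * N (v.y n) ∧
        (Function.support (v.x n)).indicator (T Y) = Dn + ((C * v.B : ℝ≥0)⁻¹ : ℝ) • v.x n) := by
    intro n
    by_cases hn : n < v.m
    swap
    · exact ⟨0, fun h => absurd h hn⟩
    obtain ⟨hk, hd⟩ := hdiag ⟨j, ⟨n, hn⟩⟩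
    set ν := (N (v.y n)).toReal with hνdef
    have hν0 : 0 < ν := hνpos ⟨j, ⟨n, hn⟩⟩
    have hνN : ENNReal.ofReal ν = N (v.y n) :=
      ENNReal.ofReal_toReal ((hfam j).ne_top _ (Finset.mem_range.2 hn))
    refine ⟨ν • ⟨_, hk⟩, fun _ => ⟨?_, ?_⟩⟩
    · change ν • (ν⁻¹ • v.y n) = v.y n
      rw [smul_smul, mul_inv_cancel₀ hν0.ne', one_smul]
    set E := {i | a ⟨j, ⟨n, hn⟩⟩ ≤ t i ∧ t i ≤ b ⟨j, ⟨n, hn⟩⟩}.indicator (T ⟨_, hk⟩) -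
      ((4 * (c₀ + 1) * v.B)⁻¹ : ℝ) • x ⟨j, ⟨n, hn⟩⟩ with hE
    refine ⟨ν • (Function.support (v.x n)).indicator E, fun i hi => ?_, ?_, ?_⟩
    · by_contra h
      exact hi (by simp [h])
    · rw [N.map_smul, Real.enorm_eq_ofReal hν0.le, hνN, mul_comm]
      refine mul_le_mul_left ((N.indicator_le _ _).trans (hd.trans ?_)) _
      rw [hη]
      push_cast
      refine mul_le_mul_left (mul_le_mul_left ?_ _) _
      rw [hΘ]
      push_cast
      exact le_self_add
    · rw [_root_.map_smul]
      ext i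
      by_cases hi : v.x n i = 0
      · simp [hi]
      · have h3 := (hfam j).x_supp n (Finset.mem_range.2 hn) i hi
        have h4 : i ∈ {i | a ⟨j, ⟨n, hn⟩⟩ ≤ t i ∧ t i ≤ b ⟨j, ⟨n, hn⟩⟩} := ⟨h3.1, h3.2.1⟩
        have h5 : i ∈ Function.support (v.x n) := hi
        have h6 : x ⟨j, ⟨n, hn⟩⟩ i = ν⁻¹ * v.x n i := rfl
        simp only [Pi.add_apply, Pi.smul_apply, smul_eq_mul, Set.indicator_of_mem h5, hE, Pi.sub_apply,
          Set.indicator_of_mem h4, h6, hC]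
        push_cast
        field_simp
        ring
  choose Y hY using hkey
  have hY1 : ∀ n < v.m, (Y n : ι → ℝ) = v.y n := fun n hn => (hY n hn).1
  have hD : ∀ n, ∃ Dn : ι → ℝ, n < v.m → (∀ i, Dn i ≠ 0 → v.x n i ≠ 0) ∧ N Dn ≤ η * N (v.y n) ∧
      (Function.support (v.x n)).indicator (T (Y n)) = Dn + ((C * v.B : ℝ≥0)⁻¹ : ℝ) • v.x n := fun n => by
    by_cases hn : n < v.m
    · obtain ⟨Dn, hDn⟩ := (hY n hn).2
      exact ⟨Dn, fun _ => hDn⟩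
    · exact ⟨0, fun h => absurd h hn⟩
  choose Dn hDn using hD
  -- The errors are small one by one, but their sum is not controlled by any shift inequality yet.
  -- After division by η they are competitors in the near-maximality of the x n, and this bounds the
  -- sum by a multiple of N(Σ x n).
  have hDsum : N (∑ n ∈ s, Dn n) ≤ η * (2 * N (∑ n ∈ s, v.x n)) := by
    have h3 := hvG.max (fun n => (η⁻¹ : ℝ) • Dn n) fun n hn => by
      refine ⟨fun i hi => (hDn n hn).1 i (right_ne_zero_of_mul hi), ?_⟩
      rw [show ((η : ℝ)⁻¹) = ((η⁻¹ : ℝ≥0) : ℝ) by push_cast; rfl, N.map_nnreal_smul]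
      refine (mul_le_mul_right (hDn n hn).2.1 _).trans (le_of_eq ?_)
      rw [← mul_assoc, ← ENNReal.coe_mul, inv_mul_cancel₀ hη0.ne', ENNReal.coe_one, one_mul]
    rw [← Finset.smul_sum, show ((η : ℝ)⁻¹) = ((η⁻¹ : ℝ≥0) : ℝ) by push_cast; rfl,
      N.map_nnreal_smul] at h3
    calc N (∑ n ∈ s, Dn n) = η * ((η⁻¹ : ℝ≥0) * N (∑ n ∈ s, Dn n)) := by
          rw [← mul_assoc, ← ENNReal.coe_mul, mul_inv_cancel₀ hη0.ne', ENNReal.coe_one, one_mul]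
      _ ≤ _ := mul_le_mul_right h3 _
  have hTsum : N (∑ n ∈ s, (Function.support (v.x n)).indicator (T (Y n))) ≤
      Θ * N (∑ n ∈ s, v.y n) := by
    have h3 := block_diagonal_le T hT s (fun n => {i | v.a n ≤ t i ∧ t i ≤ v.b n})
      (fun n => Function.support (v.x n)) (fun m hm n hn hmn => ?_) (fun n hn i hi => ?_) Y
      (fun n hn i hi => ?_)
    · rw [Finset.sum_congr rfl fun n hn => hY1 n (Finset.mem_range.1 hn)] at h3
      refine h3.trans (mul_le_mul_left (ENNReal.coe_le_coe.2 ?_) _)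
      exact le_self_add
    · refine Set.disjoint_left.2 fun i h4 h5 => ?_
      rcases lt_or_gt_of_ne hmn with h | h
      · exact absurd (h4.2.trans_lt ((hsame j m (Finset.mem_range.1 hm) n (Finset.mem_range.1 hn)
          h).trans_le h5.1)) (lt_irrefl _)
      · exact absurd (h5.2.trans_lt ((hsame j n (Finset.mem_range.1 hn) m (Finset.mem_range.1 hm)
          h).trans_le h4.1)) (lt_irrefl _)
    · have := (hfam j).x_supp n hn i hi
      exact ⟨this.1, this.2.1⟩
    · rw [hY1 n (Finset.mem_range.1 hn)] at hi
      have := (hfam j).y_supp n hn i hi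
      exact ⟨((hfam j).aw n hn).trans this.1, this.2⟩
  have hxtop : N (∑ n ∈ s, v.x n) ≠ ∞ := by
    refine ne_top_of_le_ne_top ?_ (N.sum_le _ _)
    exact ENNReal.sum_ne_top.2 fun n hn => ne_top_of_le_ne_top ((hfam j).ne_top n hn) ((hfam j).le n hn)
  have hCB0 : C * v.B ≠ 0 := (mul_pos hC0 hvG.B_pos).ne'
  have hmain : N (∑ n ∈ s, v.x n) ≤ (C * v.B : ℝ≥0) * (Θ * N (∑ n ∈ s, v.y n) +
      η * (2 * N (∑ n ∈ s, v.x n))) := by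
    have h3 : ((C * v.B : ℝ≥0)⁻¹ : ℝ) • ∑ n ∈ s, v.x n =
        ∑ n ∈ s, (Function.support (v.x n)).indicator (T (Y n)) - ∑ n ∈ s, Dn n := by
      rw [Finset.smul_sum, ← Finset.sum_sub_distrib]
      refine Finset.sum_congr rfl fun n hn => ?_
      rw [(hDn n (Finset.mem_range.1 hn)).2.2, add_sub_cancel_left]
    have h4 : ((C * v.B)⁻¹ : ℝ≥0) * N (∑ n ∈ s, v.x n) ≤ Θ * N (∑ n ∈ s, v.y n) +
        η * (2 * N (∑ n ∈ s, v.x n)) := by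
      rw [← N.map_nnreal_smul, NNReal.coe_inv, h3]
      exact (N.sub_le _ _).trans (add_le_add hTsum hDsum)
    calc N (∑ n ∈ s, v.x n) = (C * v.B : ℝ≥0) * (((C * v.B)⁻¹ : ℝ≥0) * N (∑ n ∈ s, v.x n)) := by
          rw [← mul_assoc, ← ENNReal.coe_mul, mul_inv_cancel₀ hCB0, ENNReal.coe_one, one_mul]
      _ ≤ _ := mul_le_mul_right h4 _
  -- The error η is of order B^(-2), while recovering x n from x n/(C B) costs only the factor C B.
  -- The product is of order 1/B.
  have hsmall : C * v.B * η * 2 ≤ 1 / 2 := by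
    have hB0 := hvG.B_pos
    have h3 : 16 * Θ * (1 + c₀) * C ≤ v.B :=
      (le_add_self.trans hj).trans (le_self_add.trans hvG.hB)
    rw [hη, q]
    have h4 : C * v.B * (Θ * (1 + c₀) * (4 * (v.B ^ 2)⁻¹)) * 2 =
        (16 * Θ * (1 + c₀) * C) / (2 * v.B) := by
      field_simp
      ring
    rw [h4, div_le_div_iff₀ (by positivity) two_pos]
    calc 16 * Θ * (1 + c₀) * C * 2 ≤ v.B * 2 := by gcongr
      _ = _ := by ring
  have hviol := hvG.viol
  have h5 : N (∑ n ∈ s, v.x n) ≤ (C * v.B * Θ : ℝ≥0) * N (∑ n ∈ s, v.y n) +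
      (1 / 2 : ℝ≥0) * N (∑ n ∈ s, v.x n) := by
    refine hmain.trans ?_
    calc ((C * v.B : ℝ≥0) : ℝ≥0∞) * (Θ * N (∑ n ∈ s, v.y n) + η * (2 * N (∑ n ∈ s, v.x n)))
        = (C * v.B * Θ : ℝ≥0) * N (∑ n ∈ s, v.y n) +
          ((C * v.B * η * 2 : ℝ≥0) : ℝ≥0∞) * N (∑ n ∈ s, v.x n) := by push_cast; ring
      _ ≤ _ := add_le_add le_rfl (mul_le_mul_left (ENNReal.coe_le_coe.2 hsmall) _)
  have h6 : (1 / 2 : ℝ≥0) * N (∑ n ∈ s, v.x n) ≤ (C * v.B * Θ : ℝ≥0) * N (∑ n ∈ s, v.y n) := by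
    have h7 : N (∑ n ∈ s, v.x n) = (1 / 2 : ℝ≥0) * N (∑ n ∈ s, v.x n) +
        (1 / 2 : ℝ≥0) * N (∑ n ∈ s, v.x n) := by
      rw [← add_mul, ← ENNReal.coe_add, add_halves, ENNReal.coe_one, one_mul]
    have h8 : (1 / 2 : ℝ≥0) * N (∑ n ∈ s, v.x n) + (1 / 2 : ℝ≥0) * N (∑ n ∈ s, v.x n) ≤
        (C * v.B * Θ : ℝ≥0) * N (∑ n ∈ s, v.y n) + (1 / 2 : ℝ≥0) * N (∑ n ∈ s, v.x n) := by
      rw [← h7]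
      exact h5
    exact (ENNReal.add_le_add_iff_right (ENNReal.mul_ne_top ENNReal.coe_ne_top hxtop)).1 h8
  refine absurd hviol (not_lt.2 ?_)
  calc N (∑ n ∈ s, v.x n) = (2 : ℝ≥0) * ((1 / 2 : ℝ≥0) * N (∑ n ∈ s, v.x n)) := by
        rw [← mul_assoc, ← ENNReal.coe_mul, mul_one_div_cancel two_ne_zero, ENNReal.coe_one, one_mul]
    _ ≤ (2 : ℝ≥0) * ((C * v.B * Θ : ℝ≥0) * N (∑ n ∈ s, v.y n)) := mul_le_mul_right h6 _
    _ = ((2 * C * Θ) * v.B : ℝ≥0) * N (∑ n ∈ s, v.y n) := by push_cast; ring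
    _ ≤ _ := mul_le_mul_left (ENNReal.coe_le_coe.2 (mul_le_mul_left (le_self_add.trans hj) _)) _

end SepBlock

end SeqNorm

/-! ### The shift inequality for widely separated families. -/

namespace SeqNorm

variable {ι : Type*}

/-- There are separated families far to the right that violate every shift inequality. -/
def RightBad (N : SeqNorm ι) (t : ι → ℝ≥0) (B : ℝ≥0) : Prop :=
  ∀ K β : ℝ≥0, ∃ (m : ℕ) (x y : ℕ → ι → ℝ) (a w b : ℕ → ℝ≥0),
    SepFam N t B (Finset.range m) x y a w b ∧
      K * N (∑ n ∈ Finset.range m, y n) < N (∑ n ∈ Finset.range m, x n) ∧ ∀ n < m, β ≤ a n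

/-- There are separated families far to the left that violate every shift inequality. -/
def LeftBad (N : SeqNorm ι) (t : ι → ℝ≥0) (B : ℝ≥0) : Prop :=
  ∀ K α : ℝ≥0, 0 < α → ∃ (m : ℕ) (x y : ℕ → ι → ℝ) (a w b : ℕ → ℝ≥0),
    SepFam N t B (Finset.range m) x y a w b ∧
      K * N (∑ n ∈ Finset.range m, y n) < N (∑ n ∈ Finset.range m, x n) ∧ ∀ n < m, b n ≤ α

/-- The number of pairs of a separated family in a bounded range is bounded. -/
theorem SepFam.two_pow_card_le {N : SeqNorm ι} {t : ι → ℝ≥0} {B α : ℝ≥0} (hB : 2 ≤ B)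
    (s : Finset ℤ) {x y : ℤ → ι → ℝ} {a w b : ℤ → ℝ≥0} (h : SepFam N t B s x y a w b)
    (hα : ∀ n ∈ s, α ≤ b n) : ∀ c, α ≤ c → (∀ n ∈ s, 2 * b n ≤ c) → 2 ^ s.card * α ≤ c := by
  induction s using Finset.induction_on_max with
  | empty => intro c hc _; simpa using hc
  | insert k s hk ih =>
    intro c _ hs
    have hks : k ∉ s := fun h => lt_irrefl _ (hk k h)
    have h1 := ih (h.subset (Finset.subset_insert _ _))
      (fun n hn => hα n (Finset.mem_insert_of_mem hn)) (b k) (hα k (Finset.mem_insert_self _ _))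
      fun n hn => (h.lt_of_lt hB (Finset.mem_insert_of_mem hn) (Finset.mem_insert_self _ _)
        (hk n hn)).trans (h.ab (Finset.mem_insert_self _ _))
    -- The upper end at least doubles from each member to the next.
    rw [Finset.card_insert_of_notMem hks, pow_succ', mul_assoc]
    exact (mul_le_mul_right h1 2).trans (hs k (Finset.mem_insert_self _ _))

/-- If families far to the right have shift constant K₁ and those far to the left K₂, then a family
of any position has constant K₁ + K₂ + p. The members in between lie in a bounded range, so there
are at most p of them, and each has norm at most that of Σ y. -/
theorem bad_of_unbounded {N : SeqNorm ι} {t : ι → ℝ≥0} {B : ℝ≥0} (hB : 2 ≤ B)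
    (h : ∀ K : ℝ≥0, ∃ (s : Finset ℤ) (x y : ℤ → ι → ℝ) (a w b : ℤ → ℝ≥0),
      SepFam N t B s x y a w b ∧ K * N (∑ n ∈ s, y n) < N (∑ n ∈ s, x n)) :
    RightBad N t B ∨ LeftBad N t B := by
  classical
  by_contra hcon
  rw [not_or] at hcon
  obtain ⟨hR, hL⟩ := hcon
  unfold RightBad at hR
  unfold LeftBad at hL
  push Not at hR hL
  obtain ⟨K₁, β, hR⟩ := hR
  obtain ⟨K₂, α, hα, hL⟩ := hL
  obtain ⟨p, hp⟩ := exists_nat_gt (max α β / α)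
  have hp' : max α β < 2 ^ p * α := by
    rw [div_lt_iff₀ hα] at hp
    refine hp.trans ?_
    exact mul_lt_mul_of_pos_right (by exact_mod_cast p.lt_two_pow_self) hα
  obtain ⟨s, x, y, a, w, b, hf, hv⟩ := h (K₁ + K₂ + p)
  have h1 : ∀ s' ⊆ s, (∀ n ∈ s', β ≤ a n) → N (∑ n ∈ s', x n) ≤ K₁ * N (∑ n ∈ s, y n) := by
    intro s' hs' ha
    obtain ⟨m, e, hfe, he, hsum⟩ := (hf.subset hs').reindex
    have h2 : N (∑ n ∈ Finset.range m, (x ∘ e) n) ≤ K₁ * N (∑ n ∈ Finset.range m, (y ∘ e) n) := by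
      by_contra hlt
      obtain ⟨n, hn, h3⟩ := hR m _ _ _ _ _ hfe (not_le.1 hlt)
      exact absurd (ha _ (he n hn)) (not_le.2 h3)
    simp only [Function.comp_apply, hsum] at h2
    exact h2.trans (mul_le_mul_right (hf.sum_le hB hs') _)
  have h2 : ∀ s' ⊆ s, (∀ n ∈ s', b n ≤ α) → N (∑ n ∈ s', x n) ≤ K₂ * N (∑ n ∈ s, y n) := by
    intro s' hs' ha
    obtain ⟨m, e, hfe, he, hsum⟩ := (hf.subset hs').reindex
    have h2 : N (∑ n ∈ Finset.range m, (x ∘ e) n) ≤ K₂ * N (∑ n ∈ Finset.range m, (y ∘ e) n) := by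
      by_contra hlt
      obtain ⟨n, hn, h3⟩ := hL m _ _ _ _ _ hfe (not_le.1 hlt)
      exact absurd (ha _ (he n hn)) (not_le.2 h3)
    simp only [Function.comp_apply, hsum] at h2
    exact h2.trans (mul_le_mul_right (hf.sum_le hB hs') _)
  have h3 : ∀ s' ⊆ s, (∀ n ∈ s', α ≤ b n) → (∀ n ∈ s', a n ≤ β) →
      N (∑ n ∈ s', x n) ≤ p * N (∑ n ∈ s, y n) := by
    intro s' hs' hb ha
    have hcard : s'.card ≤ p := by
      rcases s'.eq_empty_or_nonempty with rfl | hne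
      · simp
      have hmax := s'.max'_mem hne
      set k := s'.max' hne
      have h4 := SepFam.two_pow_card_le hB (s'.erase k)
        (hf.subset ((Finset.erase_subset _ _).trans hs'))
        (fun n hn => hb n (Finset.mem_of_mem_erase hn)) (max α β) (le_max_left _ _)
        (fun n hn => (hf.lt_of_lt hB (hs' (Finset.mem_of_mem_erase hn)) (hs' hmax)
          (lt_of_le_of_ne (s'.le_max' _ (Finset.mem_of_mem_erase hn))
            (Finset.ne_of_mem_erase hn))).trans ((ha k hmax).trans (le_max_right _ _)))
      have h5 : (2 : ℝ≥0) ^ (s'.erase k).card < 2 ^ p :=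
        lt_of_mul_lt_mul_right (h4.trans_lt hp') zero_le
      rw [pow_lt_pow_iff_right₀ one_lt_two, Finset.card_erase_of_mem hmax] at h5
      omega
    refine (N.sum_le _ _).trans ?_
    calc ∑ n ∈ s', N (x n) ≤ ∑ n ∈ s', N (∑ n ∈ s, y n) := by
          refine Finset.sum_le_sum fun n hn => (hf.le n (hs' hn)).trans ?_
          have := hf.sum_le hB (s' := {n}) (Finset.singleton_subset_iff.2 (hs' hn))
          rwa [Finset.sum_singleton] at this
      _ = s'.card * N (∑ n ∈ s, y n) := by rw [Finset.sum_const, nsmul_eq_mul]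
      _ ≤ _ := mul_le_mul_left (by exact_mod_cast hcard) _
  refine absurd hv (not_lt.2 ?_)
  rw [← Finset.sum_filter_add_sum_filter_not s (fun n => b n ≤ α),
    ← Finset.sum_filter_add_sum_filter_not (s.filter fun n => ¬ b n ≤ α) (fun n => β ≤ a n)]
  refine (N.add_le _ _).trans ((add_le_add_right (N.add_le _ _) _).trans ?_)
  refine (add_le_add (h2 _ (Finset.filter_subset _ _) fun n hn => (Finset.mem_filter.1 hn).2)
    (add_le_add (h1 _ ((Finset.filter_subset _ _).trans (Finset.filter_subset _ _))
      fun n hn => (Finset.mem_filter.1 hn).2)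
    (h3 _ ((Finset.filter_subset _ _).trans (Finset.filter_subset _ _)) (fun n hn => ?_)
      fun n hn => (not_le.1 (Finset.mem_filter.1 hn).2).le))).trans (le_of_eq ?_)
  · exact (not_le.1 (Finset.mem_filter.1 (Finset.mem_filter.1 hn).1).2).le
  · rw [← Finset.sum_filter_add_sum_filter_not s (fun n => b n ≤ α)]
    push_cast
    ring

/-- The left members of a violating family may be chosen nearly maximal. -/
theorem SepFam.exists_near_max {N : SeqNorm ι} {t : ι → ℝ≥0} {B K : ℝ≥0} {m : ℕ}
    {x y : ℕ → ι → ℝ} {a w b : ℕ → ℝ≥0} (h : SepFam N t B (Finset.range m) x y a w b)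
    (hv : (2 * K : ℝ≥0) * N (∑ n ∈ Finset.range m, y n) < N (∑ n ∈ Finset.range m, x n)) :
    ∃ x', SepFam N t B (Finset.range m) x' y a w b ∧
      K * N (∑ n ∈ Finset.range m, y n) < N (∑ n ∈ Finset.range m, x' n) ∧
      ∀ z : ℕ → ι → ℝ, (∀ n < m, (∀ i, z n i ≠ 0 → x' n i ≠ 0) ∧ N (z n) ≤ N (y n)) →
        N (∑ n ∈ Finset.range m, z n) ≤ 2 * N (∑ n ∈ Finset.range m, x' n) := by
  set P : (ℕ → ι → ℝ) → Prop := fun z => ∀ n < m, (∀ i, z n i ≠ 0 → x n i ≠ 0) ∧ N (z n) ≤ N (y n)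
  have hxP : P x := fun n hn => ⟨fun _ h => h, h.le n (Finset.mem_range.2 hn)⟩
  -- The supremum over all admissible left members is finite and positive, so some choice exceeds
  -- half of it. The supports stay inside those of the given x; the halving is why 2K is assumed.
  set S := ⨆ (z) (_ : P z), N (∑ n ∈ Finset.range m, z n) with hS
  have hle : ∀ z, P z → N (∑ n ∈ Finset.range m, z n) ≤ S := fun z hz =>
    le_iSup₂ (f := fun z (_ : P z) => N (∑ n ∈ Finset.range m, z n)) z hz
  have hStop : S ≠ ∞ := by
    refine ne_top_of_le_ne_top (b := ∑ n ∈ Finset.range m, N (y n))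
      (ENNReal.sum_ne_top.2 fun n hn => h.ne_top n hn) ?_
    refine iSup₂_le fun z hz => (N.sum_le _ _).trans (Finset.sum_le_sum fun n hn => ?_)
    exact (hz n (Finset.mem_range.1 hn)).2
  have hS0 : S ≠ 0 := ((zero_le.trans_lt hv).trans_le (hle x hxP)).ne'
  obtain ⟨x', hx'P, hx'⟩ : ∃ x', P x' ∧ S / 2 < N (∑ n ∈ Finset.range m, x' n) := by
    have := ENNReal.half_lt_self hS0 hStop
    rw [hS, lt_iSup_iff] at this
    obtain ⟨x', h'⟩ := this
    rw [lt_iSup_iff] at h'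
    obtain ⟨hP, h'⟩ := h'
    exact ⟨x', hP, h'⟩
  refine ⟨x', ⟨h.pos, h.aw, h.wb, h.sep, fun n hn i hi => h.x_supp n hn i
    ((hx'P n (Finset.mem_range.1 hn)).1 i hi), h.y_supp, fun n hn =>
    (hx'P n (Finset.mem_range.1 hn)).2, h.ne_top, h.ne_zero⟩, ?_, fun z hz => ?_⟩
  · refine lt_of_le_of_lt ?_ hx'
    rw [ENNReal.le_div_iff_mul_le (by simp) (by simp)]
    refine le_trans (le_of_eq ?_) (hv.le.trans (hle x hxP))
    push_cast
    ring
  · have h1 := hle z fun n hn => ⟨fun i hi => (hx'P n hn).1 i ((hz n hn).1 i hi), (hz n hn).2⟩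
    refine h1.trans ?_
    rw [mul_comm, ← ENNReal.div_le_iff_le_mul (by simp) (by simp)]
    exact hx'.le

/-- The scale γ = ρ/2 bounds the total weight by ρ. The position far to the right then makes the
products c·a exceed any prescribed amount. -/
theorem RightBad.supply {N : SeqNorm ι} {t : ι → ℝ≥0} {B : ℝ≥0} (h : RightBad N t B) {j : ℕ}
    (hB : (j : ℝ≥0) + 4 ≤ B) (Γ ρ : ℝ≥0) (hρ : 0 < ρ) :
    ∃ u : SepBlock ι, SepBlock.Good N t j u ∧ u.wt ≤ ρ ∧ Γ ≤ u.thr' := by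
  have hB2 : 2 ≤ B := le_trans (by norm_num) (le_add_self.trans hB)
  have hB0 : 0 < B := lt_of_lt_of_le (by norm_num) hB2
  set q : ℝ≥0 := (B ^ 2)⁻¹ with hq
  have hq0 : 0 < q := by positivity
  set γ : ℝ≥0 := ρ / 2 with hγ
  have hγ0 : 0 < γ := by positivity
  -- Chosen so that 2qγβ ≥ Γ and β/2 ≥ Γ, the two entries of `thr'`.
  set β : ℝ≥0 := Γ * (1 / (2 * q * γ) + 2) with hβ
  obtain ⟨m, x, y, a, w, b, hf, hv, ha⟩ := h (2 * (j * B)) β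
  obtain ⟨x', hf', hv', hmax⟩ := hf.exists_near_max hv
  have hm : 0 < m := by
    rcases Nat.eq_zero_or_pos m with rfl | hm
    · simp at hv'
    · exact hm
  have hgood : SepBlock.Good N t j ⟨m, x', y, a, w, b, B, γ⟩ := ⟨hf', hB, hγ0, hm, hv', hmax⟩
  refine ⟨_, hgood, ?_, ?_⟩
  · simp only [SepBlock.wt, SepBlock.c, SepBlock.q]
    rw [← ENNReal.ofNNReal_finsetSum, ← Finset.mul_sum]
    refine ENNReal.coe_le_coe.2 ?_
    have hq2 := hgood.q_le
    refine (mul_le_mul_right (NNReal.sum_pow_le_two (hq2.trans ?_) m) _).trans (le_of_eq ?_)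
    · rw [← NNReal.coe_le_coe]; norm_num
    · rw [hγ]; field_simp
  · refine le_iInf₂ fun n hn => ?_
    have hn' := Finset.mem_range.1 hn
    simp only [SepBlock.c, SepBlock.q]
    rw [← hq]
    refine ENNReal.coe_le_coe.2 (le_min ?_ ?_)
    · have h1 : β ≤ q ^ n * a n := by
        rcases Nat.eq_zero_or_pos n with rfl | hn0
        · simpa using ha 0 hn'
        · have h2 := hf.pow_le hn0 hn'
          have h3 : q ^ n * (B ^ 4) ^ n = (B ^ 2) ^ n := by
            rw [← mul_pow, hq]
            congr 1
            field_simp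
          calc β ≤ b 0 := (ha 0 hm).trans (hf.ab (Finset.mem_range.2 hm))
            _ ≤ (B ^ 2) ^ n * b 0 := le_mul_of_one_le_left' (one_le_pow₀ (one_le_pow₀
                (le_trans (by norm_num) hB2)))
            _ = q ^ n * ((B ^ 4) ^ (n - 0) * b 0) := by rw [← h3, Nat.sub_zero, mul_assoc]
            _ ≤ q ^ n * a n := mul_le_mul_right h2 _
      calc Γ = 2 * q * γ * (Γ * (1 / (2 * q * γ))) := by field_simp
        _ ≤ 2 * q * γ * (Γ * (1 / (2 * q * γ) + 2)) :=
          mul_le_mul_right (mul_le_mul_right le_self_add _) _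
        _ ≤ 2 * q * γ * (q ^ n * a n) := mul_le_mul_right h1 _
        _ = _ := by ring
    · rw [le_div_iff₀ two_pos]
      refine le_trans ?_ (ha n hn')
      exact mul_le_mul_right le_add_self _

/-- The mirror case: the weights are made large, so that much may follow the block, and the products
c·b are small because all positions lie below a tiny α. -/
theorem LeftBad.supply {N : SeqNorm ι} {t : ι → ℝ≥0} {B : ℝ≥0} (h : LeftBad N t B) {j : ℕ}
    (hB : (j : ℝ≥0) + 4 ≤ B) (Γ ρ : ℝ≥0) (hρ : 0 < ρ) :
    ∃ u : SepBlock ι, SepBlock.Good N t j u ∧ u.wt' ≤ ρ ∧ Γ ≤ u.thr := by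
  have hB2 : 2 ≤ B := le_trans (by norm_num) (le_add_self.trans hB)
  have hB0 : 0 < B := lt_of_lt_of_le (by norm_num) hB2
  set q : ℝ≥0 := (B ^ 2)⁻¹ with hq
  have hq0 : 0 < q := by positivity
  set γ₀ : ℝ≥0 := Γ / (2 * q) + 1 with hγ₀
  have hγ0 : 0 < γ₀ := by positivity
  set α : ℝ≥0 := ρ / (2 * γ₀ / q + 2) with hα
  have hα0 : 0 < α := by positivity
  obtain ⟨m, x, y, a, w, b, hf, hv, hb⟩ := h (2 * (j * B)) α hα0
  obtain ⟨x', hf', hv', hmax⟩ := hf.exists_near_max hv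
  have hm : 0 < m := by
    rcases Nat.eq_zero_or_pos m with rfl | hm
    · simp at hv'
    · exact hm
  -- The length m of the family is known only now. This scale keeps even its last weight at least
  -- γ₀; the smallness of α does not depend on m, since c·b is a geometric sum dominated by the last
  -- member.
  set γ : ℝ≥0 := γ₀ * (q ^ m)⁻¹ with hγ
  have hgood : SepBlock.Good N t j ⟨m, x', y, a, w, b, B, γ⟩ :=
    ⟨hf', hB, mul_pos hγ0 (inv_pos.2 (pow_pos hq0 m)), hm, hv', hmax⟩
  have hq4 : q ≤ 1 / 4 := hgood.q_le
  have hq2 : q ≤ 1 / 2 := hq4.trans (by rw [← NNReal.coe_le_coe]; norm_num)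
  have hq1 : q ≤ 1 := hq4.trans (by rw [← NNReal.coe_le_coe]; norm_num)
  refine ⟨_, hgood, ?_, ?_⟩
  · simp only [SepBlock.wt', SepBlock.c, SepBlock.q]
    rw [← hq, ← ENNReal.ofNNReal_finsetSum]
    refine ENNReal.coe_le_coe.2 ?_
    have h1 : ∀ n ∈ Finset.range m, γ * q ^ n * b n + b n ≤ (γ₀ / q + 1) * α * q ^ (m - 1 - n) := by
      intro n hn
      have hn' := Finset.mem_range.1 hn
      obtain ⟨k, hk⟩ : ∃ k, m = n + k + 1 := ⟨m - 1 - n, by omega⟩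
      have hk' : m - 1 - n = k := by omega
      have h2 : b n ≤ q ^ k * q ^ k * α := by
        rcases Nat.eq_zero_or_pos k with rfl | hk0
        · simpa using hb n hn'
        · have h3 := hf.pow_le (l := n) (n := n + k) (by omega) (by omega)
          rw [Nat.add_sub_cancel_left] at h3
          have h4 : q ^ k * q ^ k * (B ^ 4) ^ k = 1 := by
            rw [← mul_pow, ← mul_pow, hq]
            have : (B ^ 2)⁻¹ * (B ^ 2)⁻¹ * B ^ 4 = 1 := by field_simp
            rw [this, one_pow]
          calc b n = q ^ k * q ^ k * ((B ^ 4) ^ k * b n) := by rw [← mul_assoc, h4, one_mul]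
            _ ≤ q ^ k * q ^ k * α := mul_le_mul_right (h3.trans
                ((hf.ab (Finset.mem_range.2 (by omega))).trans (hb _ (by omega)))) _
      rw [hk']
      have h5 : γ * q ^ n = γ₀ / (q ^ k * q) := by
        rw [hγ, hk, pow_succ, pow_add]
        field_simp
      have h6 : γ * q ^ n * b n ≤ γ₀ / q * α * q ^ k := by
        rw [h5]
        refine (mul_le_mul_right h2 _).trans (le_of_eq ?_)
        field_simp
      have h7 : b n ≤ 1 * α * q ^ k := by
        refine h2.trans ?_
        calc q ^ k * q ^ k * α ≤ 1 * q ^ k * α :=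
              mul_le_mul_left (mul_le_mul_left (pow_le_one₀ zero_le hq1) _) _
          _ = _ := by ring
      calc _ ≤ γ₀ / q * α * q ^ k + 1 * α * q ^ k := add_le_add h6 h7
        _ = _ := by ring
    refine (Finset.sum_le_sum h1).trans ?_
    rw [← Finset.mul_sum, Finset.sum_range_reflect (fun n => q ^ n)]
    refine (mul_le_mul_right (NNReal.sum_pow_le_two hq2 m) _).trans (le_of_eq ?_)
    rw [hα]
    have : (2 * γ₀ / q + 2) ≠ 0 := by positivity
    field_simp
  · refine le_iInf₂ fun n hn => ?_
    have hn' := Finset.mem_range.1 hn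
    simp only [SepBlock.c, SepBlock.q]
    rw [← hq]
    refine ENNReal.coe_le_coe.2 ?_
    have h1 : γ₀ ≤ γ * q ^ n := by
      obtain ⟨k, hk⟩ : ∃ k, m = n + k := ⟨m - n, (Nat.add_sub_cancel' (le_of_lt hn')).symm⟩
      have h2 : γ * q ^ n = γ₀ / q ^ k := by
        rw [hγ, hk, pow_add]
        field_simp
      rw [h2, le_div_iff₀ (pow_pos hq0 k)]
      exact mul_le_of_le_one_right' (pow_le_one₀ zero_le hq1)
    calc Γ = 2 * q * (Γ / (2 * q)) := by field_simp
      _ ≤ 2 * q * γ₀ := mul_le_mul_right le_self_add _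
      _ ≤ _ := mul_le_mul_right h1 _

/-- In a couple with the Calderón property, widely separated families satisfy the shift
inequality. -/
theorem exists_sepFam_bound {N M : SeqNorm ι} {t : ι → ℝ≥0} {c₀ : ℝ≥0} (hc : Compat N M t c₀)
    (hcal : SeqCalderon M N) : ∃ B₀ : ℝ≥0, ∀ B ≥ B₀, ∃ K : ℝ≥0, ∀ (s : Finset ℤ)
      (x y : ℤ → ι → ℝ) (a w b : ℤ → ℝ≥0), SepFam N t B s x y a w b →
      N (∑ n ∈ s, x n) ≤ K * N (∑ n ∈ s, y n) := by
  classical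
  by_contra hcon
  push Not at hcon
  have hbad : ∀ B₀ : ℝ≥0, ∃ B ≥ B₀, RightBad N t B ∨ LeftBad N t B := fun B₀ => by
    obtain ⟨B, hB, h⟩ := hcon (max B₀ 2)
    exact ⟨B, (le_max_left _ _).trans hB, bad_of_unbounded ((le_max_right _ _).trans hB) h⟩
  -- One of the two alternatives occurs for arbitrarily large B, so all blocks can be chosen on the
  -- same side.
  have hdich : (∀ B₀ : ℝ≥0, ∃ B ≥ B₀, RightBad N t B) ∨ ∀ B₀ : ℝ≥0, ∃ B ≥ B₀, LeftBad N t B := by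
    by_contra h
    push Not at h
    obtain ⟨⟨B₁, h1⟩, B₂, h2⟩ := h
    obtain ⟨B, hB, h⟩ := hbad (max B₁ B₂)
    rcases h with h | h
    · exact h1 B ((le_max_left _ _).trans hB) h
    · exact h2 B ((le_max_right _ _).trans hB) h
  have hρ : ∀ ρ : ℝ≥0∞, 0 < ρ → ∃ ρ' : ℝ≥0, 0 < ρ' ∧ (ρ' : ℝ≥0∞) ≤ ρ := fun ρ h0 => by
    obtain ⟨ρ', h1, h2⟩ := ENNReal.lt_iff_exists_nnreal_btwn.1 h0
    exact ⟨ρ', by exact_mod_cast h1, h2.le⟩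
  have hsum : ∀ (f : ℕ → ℝ≥0∞) (j : ℕ), ∑' i, (if i < j then f i else 0) =
      ∑ i ∈ Finset.range j, f i := fun f j => by
    rw [tsum_eq_sum (s := Finset.range j) fun i hi => if_neg fun h => hi (Finset.mem_range.2 h)]
    exact Finset.sum_congr rfl fun i hi => if_pos (Finset.mem_range.1 hi)
  rcases hdich with hR | hL
  · obtain ⟨u, hu, h1, h2⟩ := exists_block_sequence (fun j u => SepBlock.Good N t j u)
      (fun u => u.wt') (fun u => u.wt) (fun u => u.thr) (fun u => u.thr')
      (fun _ _ _ => SepBlock.Good.wt'_ne_top) (fun _ _ h => h.thr_pos) (fun j Γ ρ hΓ h0 => by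
        obtain ⟨ρ', hρ0, hle⟩ := hρ ρ h0
        obtain ⟨B, hB, h⟩ := hR (j + 4)
        obtain ⟨u, hu, h1, h2⟩ := h.supply hB Γ.toNNReal ρ' hρ0
        rw [ENNReal.coe_toNNReal hΓ] at h2
        exact ⟨u, hu, h1.trans hle, h2⟩)
    refine SepBlock.false_of_blocks hc hcal u hu (fun i j => i < j)
      (fun i j h => lt_or_gt_of_ne h) (fun j => ?_) (fun j => ?_)
    · convert h2 j
    · convert h1 j using 1
      rw [← hsum]
      congr 1
      ext i
      congr
  -- Blocks chosen later now lie further to the left; the two weights, the two thresholds and the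
  -- order relation exchange their roles.
  · obtain ⟨u, hu, h1, h2⟩ := exists_block_sequence (fun j u => SepBlock.Good N t j u)
      (fun u => u.wt) (fun u => u.wt') (fun u => u.thr') (fun u => u.thr)
      (fun _ _ _ => SepBlock.Good.wt_ne_top) (fun _ _ h => h.thr'_pos) (fun j Γ ρ hΓ h0 => by
        obtain ⟨ρ', hρ0, hle⟩ := hρ ρ h0
        obtain ⟨B, hB, h⟩ := hL (j + 4)
        obtain ⟨u, hu, h1, h2⟩ := h.supply hB Γ.toNNReal ρ' hρ0
        rw [ENNReal.coe_toNNReal hΓ] at h2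
        exact ⟨u, hu, h1.trans hle, h2⟩)
    refine SepBlock.false_of_blocks hc hcal u hu (fun i j => j < i)
      (fun i j h => (lt_or_gt_of_ne h).symm) (fun j => ?_) (fun j => ?_)
    · convert h1 j using 1
      rw [← hsum]
      congr 1
      ext i
      congr
    · convert h2 j

end SeqNorm

/-! ### From separated families to all interlaced families. -/

namespace SeqNorm

variable {ι : Type*}

theorem sum_filter_le {N : SeqNorm ι} (s s' : Finset ℤ) (hs : s' ⊆ s) (y : ℤ → ι → ℝ)
    (h : ∀ m ∈ s, ∀ n ∈ s, m ≠ n → ∀ i, y m i ≠ 0 → y n i = 0) :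
    N (∑ n ∈ s', y n) ≤ N (∑ n ∈ s, y n) := by
  refine N.mono fun i => ?_
  rw [Finset.sum_apply, Finset.sum_apply]
  by_cases h0 : ∃ n ∈ s', y n i ≠ 0
  · obtain ⟨n, hn, hi⟩ := h0
    rw [Finset.sum_eq_single_of_mem n hn fun m hm hmn => h n (hs hn) m (hs hm) hmn.symm i hi,
      Finset.sum_eq_single_of_mem n (hs hn) fun m hm hmn => h n (hs hn) m hm hmn.symm i hi]
  · push Not at h0
    rw [Finset.sum_eq_zero h0, abs_zero]
    exact abs_nonneg _

theorem sum_le_sum_classes {N : SeqNorm ι} {κ : Type*} [DecidableEq κ] (s : Finset ℤ)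
    (R : Finset κ) (cls : ℤ → κ) (h : ∀ n ∈ s, cls n ∈ R) (x : ℤ → ι → ℝ) {c : ℝ≥0∞}
    (hc : ∀ r ∈ R, N (∑ n ∈ s with cls n = r, x n) ≤ c) : N (∑ n ∈ s, x n) ≤ R.card * c := by
  rw [← Finset.sum_fiberwise_of_maps_to h]
  refine (N.sum_le _ _).trans ((Finset.sum_le_sum hc).trans ?_)
  rw [Finset.sum_const, nsmul_eq_mul]

/-- A finite interlaced family together with the ranges of the weight. -/
structure RangedFam (N : SeqNorm ι) (t : ι → ℝ≥0) (s : Finset ℤ) (x y : ℤ → ι → ℝ)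
    (a w b : ℤ → ℝ≥0) : Prop where
  pos : ∀ n ∈ s, 0 < a n
  aw : ∀ n ∈ s, a n ≤ w n
  wb : ∀ n ∈ s, w n ≤ b n
  next : ∀ m ∈ s, ∀ n ∈ s, m < n → b m ≤ a n
  x_supp : ∀ n ∈ s, ∀ i, x n i ≠ 0 → a n ≤ t i ∧ t i ≤ w n
  y_supp : ∀ n ∈ s, ∀ i, y n i ≠ 0 → w n ≤ t i ∧ t i ≤ b n
  disj : ∀ m ∈ s, ∀ n ∈ s, m ≠ n → ∀ i, y m i ≠ 0 → y n i = 0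
  le : ∀ n ∈ s, N (x n) ≤ N (y n)
  ne_top : ∀ n ∈ s, N (y n) ≠ ∞
  ne_zero : ∀ n ∈ s, N (y n) ≠ 0

namespace RangedFam

variable {N M : SeqNorm ι} {t : ι → ℝ≥0} {s : Finset ℤ} {x y : ℤ → ι → ℝ} {a w b : ℤ → ℝ≥0}

theorem subset {s' : Finset ℤ} (h : RangedFam N t s x y a w b) (hs : s' ⊆ s) :
    RangedFam N t s' x y a w b where
  pos n hn := h.pos n (hs hn)
  aw n hn := h.aw n (hs hn)
  wb n hn := h.wb n (hs hn)
  next m hm n hn := h.next m (hs hm) n (hs hn)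
  x_supp n hn := h.x_supp n (hs hn)
  y_supp n hn := h.y_supp n (hs hn)
  disj m hm n hn := h.disj m (hs hm) n (hs hn)
  le n hn := h.le n (hs hn)
  ne_top n hn := h.ne_top n (hs hn)
  ne_zero n hn := h.ne_zero n (hs hn)

/-- Between two members with ranks of equal parity lies a third one, whose own length supplies the
ratio B^4. Hence each of the two parity classes is a separated family. -/
theorem long_le (h : RangedFam N t s x y a w b) {B K : ℝ≥0} (hB : 1 ≤ B)
    (hK : ∀ (s : Finset ℤ) (x y : ℤ → ι → ℝ) (a w b : ℤ → ℝ≥0), SepFam N t B s x y a w b →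
      N (∑ n ∈ s, x n) ≤ K * N (∑ n ∈ s, y n))
    (hl : ∀ n ∈ s, B ^ 4 * a n ≤ b n) : N (∑ n ∈ s, x n) ≤ 2 * K * N (∑ n ∈ s, y n) := by
  classical
  set rk : ℤ → ℕ := fun n => (s.filter (· < n)).card with hrk
  have hbetween : ∀ m ∈ s, ∀ p ∈ s, m < p → rk m % 2 = rk p % 2 → ∃ n ∈ s, m < n ∧ n < p := by
    intro m hm p _ hmp hpar
    by_contra hno
    push Not at hno
    have h1 : s.filter (· < p) = insert m (s.filter (· < m)) := by
      ext l
      simp only [Finset.mem_filter, Finset.mem_insert]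
      constructor
      · rintro ⟨hl, hlp⟩
        rcases lt_trichotomy l m with h2 | h2 | h2
        · exact Or.inr ⟨hl, h2⟩
        · exact Or.inl h2
        · exact absurd hlp (not_lt.2 (hno l hl h2))
      · rintro (rfl | ⟨h2, h3⟩)
        · exact ⟨hm, hmp⟩
        · exact ⟨h2, h3.trans hmp⟩
    have h2 : rk p = rk m + 1 := by
      simp only [hrk]
      rw [h1, Finset.card_insert_of_notMem (by simp)]
    omega
  have h1 := sum_le_sum_classes (N := N) s (Finset.range 2) (fun n => rk n % 2)
    (fun n _ => Finset.mem_range.2 (Nat.mod_lt _ two_pos)) x (c := K * N (∑ n ∈ s, y n)) fun r _ => by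
      have hsub : (s.filter fun n => rk n % 2 = r) ⊆ s := Finset.filter_subset _ _
      have h' := h.subset hsub
      refine (hK _ x y a w b ⟨h'.pos, h'.aw, h'.wb, fun m hm p hp hmp => ?_, fun n hn i hi => ?_,
        h'.y_supp, h'.le, h'.ne_top, h'.ne_zero⟩).trans
        (mul_le_mul_right (sum_filter_le _ _ hsub y h.disj) _)
      · have hm' := Finset.mem_filter.1 hm
        have hp' := Finset.mem_filter.1 hp
        obtain ⟨n, hn, h2, h3⟩ := hbetween m hm'.1 p hp'.1 hmp (hm'.2.trans hp'.2.symm)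
        exact (mul_le_mul_right (h.next m hm'.1 n hn h2) _).trans ((hl n hn).trans
          (h.next n hn p hp'.1 h3))
      · have h2 := h'.x_supp n hn i hi
        exact ⟨h2.1, h2.2.trans (h'.wb n hn), h2.2.trans (le_mul_of_one_le_left' hB)⟩
  refine h1.trans (le_of_eq ?_)
  rw [Finset.card_range]
  push_cast
  ring

/-- For supports in τ ≤ t ≤ βτ compatibility makes M and τN equivalent. The shift inequality of M
therefore transfers to N: one factor βc arises termwise, another one for the sums. -/
theorem cluster_le (h : RangedFam N t s x y a w b) {c κ β : ℝ≥0} (hc : Compat N M t c)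
    (hM : ∀ s' ⊆ s, ∀ z : ℝ≥0, (∀ n ∈ s', M (x n) ≤ z * M (y n)) →
      M (∑ n ∈ s', x n) ≤ κ * z * M (∑ n ∈ s', y n)) {τ : ℝ≥0} (hτ : 0 < τ)
    (ha : ∀ n ∈ s, τ ≤ a n ∧ b n ≤ β * τ) :
    N (∑ n ∈ s, x n) ≤ (β ^ 2 * c ^ 2 * κ : ℝ≥0) * N (∑ n ∈ s, y n) := by
  have hx : ∀ n ∈ s, ∀ i, x n i ≠ 0 → τ ≤ t i ∧ t i ≤ β * τ := fun n hn i hi =>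
    ⟨(ha n hn).1.trans (h.x_supp n hn i hi).1,
      (h.x_supp n hn i hi).2.trans ((h.wb n hn).trans (ha n hn).2)⟩
  have hy : ∀ n ∈ s, ∀ i, y n i ≠ 0 → τ ≤ t i ∧ t i ≤ β * τ := fun n hn i hi =>
    ⟨((ha n hn).1.trans (h.aw n hn)).trans (h.y_supp n hn i hi).1,
      (h.y_supp n hn i hi).2.trans (ha n hn).2⟩
  have hsum : ∀ z : ℤ → ι → ℝ, (∀ n ∈ s, ∀ i, z n i ≠ 0 → τ ≤ t i ∧ t i ≤ β * τ) →
      ∀ i, (∑ n ∈ s, z n) i ≠ 0 → τ ≤ t i ∧ t i ≤ β * τ := fun z hz i hi => by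
    rw [Finset.sum_apply] at hi
    obtain ⟨n, hn, hi⟩ := Finset.exists_ne_zero_of_sum_ne_zero hi
    exact hz n hn i hi
  have h1 := hM s subset_rfl (β * c) fun n hn => by
    calc M (x n) ≤ (β * τ : ℝ≥0) * N (x n) := hc.low _ _ fun i hi => (hx n hn i hi).2
      _ ≤ (β * τ : ℝ≥0) * N (y n) := mul_le_mul_right (h.le n hn) _
      _ = β * (τ * N (y n)) := by push_cast; ring
      _ ≤ β * (c * M (y n)) := mul_le_mul_right (hc.high _ _ fun i hi => (hy n hn i hi).1) _
      _ = _ := by push_cast; ring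
  have h2 : τ * N (∑ n ∈ s, x n) ≤ τ * ((β ^ 2 * c ^ 2 * κ : ℝ≥0) * N (∑ n ∈ s, y n)) := by
    calc τ * N (∑ n ∈ s, x n) ≤ c * M (∑ n ∈ s, x n) :=
          hc.high _ _ fun i hi => (hsum x hx i hi).1
      _ ≤ c * (κ * (β * c : ℝ≥0) * M (∑ n ∈ s, y n)) := mul_le_mul_right h1 _
      _ ≤ c * (κ * (β * c : ℝ≥0) * ((β * τ : ℝ≥0) * N (∑ n ∈ s, y n))) := by
        refine mul_le_mul_right (mul_le_mul_right ?_ _) _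
        exact hc.low _ _ fun i hi => (hsum y hy i hi).2
      _ = _ := by push_cast; ring
  exact (ENNReal.mul_le_mul_iff_right (by exact_mod_cast hτ.ne') ENNReal.coe_ne_top).1 h2

/-- Short pairs that start in the same range B^l ≤ t < B^(l+1) form a cluster, which `cluster_le`
controls. The cluster sums are in turn a separated family, to which the shift inequality with
parameter B^5 applies. -/
theorem short_le (h : RangedFam N t s x y a w b) {c κ B K : ℝ≥0} (hB : 2 ≤ B)
    (hc : Compat N M t c)
    (hK : ∀ (s : Finset ℤ) (x y : ℤ → ι → ℝ) (a w b : ℤ → ℝ≥0), SepFam N t (B ^ 5) s x y a w b →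
      N (∑ n ∈ s, x n) ≤ K * N (∑ n ∈ s, y n))
    (hM : ∀ s' ⊆ s, ∀ z : ℝ≥0, (∀ n ∈ s', M (x n) ≤ z * M (y n)) →
      M (∑ n ∈ s', x n) ≤ κ * z * M (∑ n ∈ s', y n))
    (hsh : ∀ n ∈ s, b n ≤ B ^ 4 * a n) :
    N (∑ n ∈ s, x n) ≤ (25 * ((B ^ 10 * c ^ 2 * κ + 1) * K) : ℝ≥0) * N (∑ n ∈ s, y n) := by
  classical
  have hB1 : 1 < B := lt_of_lt_of_le (by norm_num) hB
  have hB0 : 0 < B := one_pos.trans hB1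
  have hch : ∀ n, ∃ p : ℤ, n ∈ s → B ^ p ≤ a n ∧ a n < B ^ (p + 1) := fun n => by
    by_cases hn : n ∈ s
    · obtain ⟨p, hp⟩ := NNReal.exists_mem_Ico_zpow (h.pos n hn).ne' hB1
      exact ⟨p, fun _ => ⟨hp.1, hp.2⟩⟩
    · exact ⟨0, fun h => absurd h hn⟩
  choose p hp using hch
  have hpb : ∀ n ∈ s, b n ≤ B ^ 5 * B ^ p n := fun n hn => by
    refine (hsh n hn).trans ((mul_le_mul_right (hp n hn).2.le _).trans (le_of_eq ?_))
    rw [zpow_add_one₀ hB0.ne']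
    ring
  set κ' : ℝ≥0 := B ^ 10 * c ^ 2 * κ + 1 with hκ'
  have hκ0 : 0 < κ' := by positivity
  -- A cluster reaches from B^l to B^(l+5), and separation with parameter B^5 needs the further
  -- ratio B^20. Clusters in one residue class modulo 25 are far enough apart.
  have h1 := sum_le_sum_classes (N := N) s (Finset.Ico (0 : ℤ) 25) (fun n => p n % 25)
    (fun n _ => Finset.mem_Ico.2 ⟨Int.emod_nonneg _ (by norm_num), Int.emod_lt_of_pos _ (by norm_num)⟩)
    x (c := (κ' * K : ℝ≥0) * N (∑ n ∈ s, y n)) fun r _ => by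
      set sr := s.filter fun n => p n % 25 = r with hsr
      have hsub : sr ⊆ s := Finset.filter_subset _ _
      refine le_trans ?_ (mul_le_mul_right (sum_filter_le _ _ hsub y h.disj) _)
      set X : ℤ → ι → ℝ := fun l => ∑ n ∈ sr with p n = l, x n with hX
      set Y : ℤ → ι → ℝ := fun l => ∑ n ∈ sr with p n = l, y n with hY
      have hsum : ∀ z : ℤ → ι → ℝ, ∑ l ∈ sr.image p, (∑ n ∈ sr with p n = l, z n) = ∑ n ∈ sr, z n :=
        fun z => Finset.sum_fiberwise_of_maps_to (fun n hn => Finset.mem_image_of_mem p hn) z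
      have hrange : ∀ z : ℤ → ι → ℝ, (∀ n ∈ s, ∀ i, z n i ≠ 0 → a n ≤ t i ∧ t i ≤ b n) →
          ∀ l i, (∑ n ∈ sr with p n = l, z n) i ≠ 0 → B ^ l ≤ t i ∧ t i ≤ B ^ 5 * B ^ l := by
        intro z hz l i hi
        rw [Finset.sum_apply] at hi
        obtain ⟨n, hn, hni⟩ := Finset.exists_ne_zero_of_sum_ne_zero hi
        obtain ⟨hns, rfl⟩ := Finset.mem_filter.1 hn
        have h2 := hz n (hsub hns) i hni
        exact ⟨(hp n (hsub hns)).1.trans h2.1, h2.2.trans (hpb n (hsub hns))⟩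
      have hXr := hrange x fun n hn i hi => ⟨(h.x_supp n hn i hi).1,
        (h.x_supp n hn i hi).2.trans (h.wb n hn)⟩
      have hYr := hrange y fun n hn i hi => ⟨(h.aw n hn).trans (h.y_supp n hn i hi).1,
        (h.y_supp n hn i hi).2⟩
      have hsubl : ∀ l, (sr.filter fun n => p n = l) ⊆ s := fun l =>
        (Finset.filter_subset _ _).trans hsub
      have hXY : ∀ l, N (X l) ≤ κ' * N (Y l) := fun l => by
        refine ((h.subset (hsubl l)).cluster_le hc (β := B ^ 5) (κ := κ)
          (fun s' hs' => hM s' (hs'.trans (hsubl l))) (τ := B ^ l) (zpow_pos hB0 l)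
          fun n hn => ?_).trans (mul_le_mul_left (ENNReal.coe_le_coe.2 ?_) _)
        · obtain ⟨hns, rfl⟩ := Finset.mem_filter.1 hn
          exact ⟨(hp n (hsub hns)).1, hpb n (hsub hns)⟩
        · rw [hκ', ← pow_mul]
          exact le_self_add
      -- In a cluster sum X l does not lie to the left of Y l. This is where separated families must
      -- allow x beyond w: the division point is put at the lower end B^l, and x stays below B^5·w.
      have h2 := hK (sr.image p) (fun l => ((κ'⁻¹ : ℝ≥0) : ℝ) • X l) Y (fun l => B ^ l) (fun l => B ^ l)
        (fun l => B ^ 5 * B ^ l) ⟨fun l _ => zpow_pos hB0 l, fun l _ => le_rfl,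
          fun l _ => le_mul_of_one_le_left' (one_le_pow₀ hB1.le), fun l hl l' hl' hll => ?_,
          fun l _ i hi => ?_, fun l _ i hi => hYr l i hi, fun l _ => ?_, fun l _ => ?_, fun l hl => ?_⟩
      · rw [← Finset.smul_sum, N.map_nnreal_smul, hsum x, hsum y] at h2
        calc N (∑ n ∈ sr, x n) = κ' * ((κ'⁻¹ : ℝ≥0) * N (∑ n ∈ sr, x n)) := by
              rw [← mul_assoc, ← ENNReal.coe_mul, mul_inv_cancel₀ hκ0.ne', ENNReal.coe_one, one_mul]
          _ ≤ κ' * (K * N (∑ n ∈ sr, y n)) := mul_le_mul_right h2 _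
          _ = _ := by push_cast; ring
      · obtain ⟨n, hn, rfl⟩ := Finset.mem_image.1 hl
        obtain ⟨n', hn', rfl⟩ := Finset.mem_image.1 hl'
        have h3 := (Finset.mem_filter.1 hn).2
        have h4 := (Finset.mem_filter.1 hn').2
        have h5 : p n + 25 ≤ p n' := by omega
        calc (B ^ 5) ^ 4 * (B ^ 5 * B ^ p n) = B ^ (p n + 25) := by
              rw [zpow_add₀ hB0.ne']
              norm_cast
              ring
          _ ≤ B ^ p n' := zpow_le_zpow_right₀ hB1.le h5
      · have h3 := hXr l i (right_ne_zero_of_mul hi)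
        exact ⟨h3.1, h3.2, h3.2⟩
      · rw [N.map_nnreal_smul]
        refine (mul_le_mul_right (hXY l) _).trans (le_of_eq ?_)
        rw [← mul_assoc, ← ENNReal.coe_mul, inv_mul_cancel₀ hκ0.ne', ENNReal.coe_one, one_mul]
      · exact ne_top_of_le_ne_top (ENNReal.sum_ne_top.2 fun n hn => h.ne_top n (hsubl l hn))
          (N.sum_le _ _)
      · obtain ⟨n, hn, rfl⟩ := Finset.mem_image.1 hl
        intro h0
        have h3 := sum_filter_le (N := N) (sr.filter fun n' => p n' = p n) {n}
          (Finset.singleton_subset_iff.2 (Finset.mem_filter.2 ⟨hn, rfl⟩)) y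
          fun m hm n' hn' => h.disj m (hsubl _ hm) n' (hsubl _ hn')
        rw [Finset.sum_singleton] at h3
        exact h.ne_zero n (hsub hn) (le_antisymm (h3.trans h0.le) zero_le)
  refine h1.trans (le_of_eq ?_)
  rw [Int.card_Ico]
  push_cast
  ring

end RangedFam

/-- If a couple of compatible sequence spaces has the Calderón property, the left-shift property of
the first member passes to the second. -/
theorem LeftShift.of_seqCalderon [LinearOrder ι] {N M : SeqNorm ι} {t : ι → ℝ≥0} {c K' : ℝ≥0}
    (hc : Compat N M t c) (ht : Monotone t) (hcal : SeqCalderon M N) (hM : M.LeftShift K') :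
    ∃ K, N.LeftShift K := by
  classical
  obtain ⟨B₀, hB₀⟩ := exists_sepFam_bound hc hcal
  set B := max B₀ 2 with hB
  have hB2 : 2 ≤ B := le_max_right _ _
  have hB1 : 1 ≤ B := le_trans (by norm_num) hB2
  obtain ⟨K₁, hK₁⟩ := hB₀ B (le_max_left _ _)
  obtain ⟨K₂, hK₂⟩ := hB₀ (B ^ 5) ((le_max_left _ _).trans (le_self_pow₀ hB1 (by norm_num)))
  -- The first summand comes from long pairs, where b ≥ B^4 a; the second from short ones.
  refine ⟨2 * K₁ + 25 * ((B ^ 10 * c ^ 2 * K' + 1) * K₂), fun s x y hle hfin hlt hnext => ?_⟩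
  set s' := s.filter fun n => x n ≠ 0 ∧ y n ≠ 0 with hs'
  have hsub : s' ⊆ s := Finset.filter_subset _ _
  have hdisj : ∀ m ∈ s, ∀ n ∈ s, m ≠ n → ∀ i, y m i ≠ 0 → y n i = 0 := by
    intro m hm n hn hmn i hi
    by_contra h
    rcases lt_or_gt_of_ne hmn with h1 | h1
    · exact lt_irrefl i (hnext m hm n hn h1 i i (Or.inr hi) (Or.inr h))
    · exact lt_irrefl i (hnext n hn m hm h1 i i (Or.inr h) (Or.inr hi))
  have hxs : ∑ n ∈ s, x n = ∑ n ∈ s', x n := by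
    refine (Finset.sum_subset hsub fun n hn hn' => ?_).symm
    by_contra hx
    refine hn' (Finset.mem_filter.2 ⟨hn, hx, fun hy => hx ?_⟩)
    have := hle n hn
    rw [hy, N.map_zero] at this
    exact N.eq_zero (le_antisymm this zero_le)
  rw [hxs]
  refine le_trans ?_ (mul_le_mul_right (sum_filter_le s s' hsub y hdisj) _)
  -- a is the least weight on the support of x, w and b are the least and greatest weights on the
  -- support of y. Monotonicity of t turns the interlacing of supports into an ordering of these
  -- numbers.
  have hch : ∀ n, ∃ a w b : ℝ≥0, n ∈ s' → (∀ i, x n i ≠ 0 → a ≤ t i ∧ t i ≤ w) ∧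
      (∀ i, y n i ≠ 0 → w ≤ t i ∧ t i ≤ b) ∧ (∃ i, x n i ≠ 0 ∧ t i = a) ∧
        ∃ i, y n i ≠ 0 ∧ t i = b := fun n => by
    by_cases hn : n ∈ s'
    swap
    · exact ⟨0, 0, 0, fun h => absurd h hn⟩
    obtain ⟨hns, hx, hy⟩ := Finset.mem_filter.1 hn
    obtain ⟨i, hi, hi'⟩ := Set.exists_min_image _ t (hfin n hns).1 (Function.support_nonempty_iff.2 hx)
    obtain ⟨j, hj, hj'⟩ := Set.exists_min_image _ t (hfin n hns).2 (Function.support_nonempty_iff.2 hy)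
    obtain ⟨k, hk, hk'⟩ := Set.exists_max_image _ t (hfin n hns).2 (Function.support_nonempty_iff.2 hy)
    exact ⟨t i, t j, t k, fun _ => ⟨fun l hl => ⟨hi' l hl, ht (hlt n hns l j hl hj).le⟩,
      fun l hl => ⟨hj' l hl, hk' l hl⟩, ⟨i, hi, rfl⟩, ⟨k, hk, rfl⟩⟩⟩
  choose a w b hab using hch
  have hfam : RangedFam N t s' x y a w b := by
    refine ⟨fun n hn => ?_, fun n hn => ?_, fun n hn => ?_, fun m hm n hn hmn => ?_,
      fun n hn => (hab n hn).1, fun n hn => (hab n hn).2.1,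
      fun m hm n hn => hdisj m (hsub hm) n (hsub hn), fun n hn => hle n (hsub hn), fun n hn => ?_,
      fun n hn h0 => (Finset.mem_filter.1 hn).2.2 (N.eq_zero h0)⟩
    · obtain ⟨i, _, h⟩ := (hab n hn).2.2.1
      rw [← h]
      exact hc.pos i
    · obtain ⟨i, h1, _⟩ := (hab n hn).2.2.1
      exact ((hab n hn).1 i h1).1.trans ((hab n hn).1 i h1).2
    · obtain ⟨i, h1, _⟩ := (hab n hn).2.2.2
      exact ((hab n hn).2.1 i h1).1.trans ((hab n hn).2.1 i h1).2
    · obtain ⟨i, h1, h2⟩ := (hab m hm).2.2.2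
      obtain ⟨j, h3, h4⟩ := (hab n hn).2.2.1
      rw [← h2, ← h4]
      exact ht (hnext m (hsub hm) n (hsub hn) hmn i j (Or.inr h1) (Or.inl h3)).le
    · have := N.finite_ne_top (hfin n (hsub hn)).2 (y n)
      rwa [Set.indicator_support] at this
  have hMs : ∀ s₁ ⊆ s', ∀ z : ℝ≥0, (∀ n ∈ s₁, M (x n) ≤ z * M (y n)) →
      M (∑ n ∈ s₁, x n) ≤ K' * z * M (∑ n ∈ s₁, y n) := by
    intro s₁ hs₁ z hz
    have hs := hs₁.trans hsub
    have hy : ∀ n i, ((z : ℝ) • y n) i ≠ 0 → y n i ≠ 0 := fun n i h => right_ne_zero_of_mul h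
    have h1 := hM s₁ x (fun n => (z : ℝ) • y n) (fun n hn => by rw [M.map_nnreal_smul]; exact hz n hn)
      (fun n hn => ⟨(hfin n (hs hn)).1, (hfin n (hs hn)).2.subset fun i hi => hy n i hi⟩)
      (fun n hn i j hi hj => hlt n (hs hn) i j hi (hy n j hj))
      (fun m hm n hn hmn i j hi hj => hnext m (hs hm) n (hs hn) hmn i j (hi.imp_right (hy m i))
        (hj.imp_right (hy n j)))
    rw [← Finset.smul_sum, M.map_nnreal_smul, ← mul_assoc] at h1
    exact h1
  rw [← Finset.sum_filter_add_sum_filter_not s' (fun n => B ^ 4 * a n ≤ b n)]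
  have hsub1 : (s'.filter fun n => B ^ 4 * a n ≤ b n) ⊆ s' := Finset.filter_subset _ _
  have hsub2 : (s'.filter fun n => ¬ B ^ 4 * a n ≤ b n) ⊆ s' := Finset.filter_subset _ _
  refine (N.add_le _ _).trans ?_
  rw [ENNReal.coe_add, add_mul]
  refine add_le_add ?_ ?_
  · refine ((hfam.subset hsub1).long_le hB1 hK₁ fun n hn => (Finset.mem_filter.1 hn).2).trans ?_
    push_cast
    exact mul_le_mul_right (sum_filter_le _ _ hsub1 y hfam.disj) _
  · refine ((hfam.subset hsub2).short_le hB2 hc hK₂ (fun s₁ hs₁ => hMs s₁ (hs₁.trans hsub2))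
      fun n hn => (not_le.1 (Finset.mem_filter.1 hn).2).le).trans ?_
    exact mul_le_mul_right (sum_filter_le _ _ hsub2 y hfam.disj) _

end SeqNorm

/-! ### Norms of functions and monotonicity in the distribution function. -/

namespace KotheSpace

section Norm

variable {Ω : Type*} [MeasurableSpace Ω] {μ : Measure Ω}

open Classical in
/-- The norm of a function, with value `∞` if the function is not measurable. -/
noncomputable def nrm (X : KotheSpace μ) (f : Ω → ℝ) : ℝ≥0∞ :=
  if h : AEStronglyMeasurable f μ then X.eNorm (AEEqFun.mk f h) else ∞

variable (X : KotheSpace μ)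

theorem nrm_eq {f : Ω → ℝ} (h : AEStronglyMeasurable f μ) : X.nrm f = X.eNorm (AEEqFun.mk f h) :=
  dif_pos h

theorem nrm_coe (f : Ω →ₘ[μ] ℝ) : X.nrm f = X.eNorm f := by
  rw [nrm_eq X f.aestronglyMeasurable, AEEqFun.mk_coeFn]

theorem nrm_of_not {f : Ω → ℝ} (h : ¬ AEStronglyMeasurable f μ) : X.nrm f = ∞ := dif_neg h

theorem aestronglyMeasurable_of_nrm {f : Ω → ℝ} (h : X.nrm f ≠ ∞) : AEStronglyMeasurable f μ := by
  by_contra h'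
  exact h (X.nrm_of_not h')

theorem nrm_mono {f g : Ω → ℝ} (hf : AEStronglyMeasurable f μ) (h : ∀ᵐ x ∂μ, |f x| ≤ |g x|) :
    X.nrm f ≤ X.nrm g := by
  by_cases hg : AEStronglyMeasurable g μ
  · rw [X.nrm_eq hf, X.nrm_eq hg]
    refine X.mono _ _ ?_
    filter_upwards [AEEqFun.coeFn_mk f hf, AEEqFun.coeFn_mk g hg, h] with x h1 h2 h3
    rwa [h1, h2]
  · rw [X.nrm_of_not hg]
    exact le_top

theorem nrm_add_le (f g : Ω → ℝ) : X.nrm (f + g) ≤ X.nrm f + X.nrm g := by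
  by_cases hf : AEStronglyMeasurable f μ
  swap
  · rw [X.nrm_of_not hf, top_add]
    exact le_top
  by_cases hg : AEStronglyMeasurable g μ
  swap
  · rw [X.nrm_of_not hg, add_top]
    exact le_top
  rw [X.nrm_eq hf, X.nrm_eq hg, X.nrm_eq (hf.add hg), ← AEEqFun.mk_add_mk]
  exact X.eNorm_add_le _ _

theorem nrm_smul {f : Ω → ℝ} (hf : AEStronglyMeasurable f μ) (c : ℝ) :
    X.nrm (c • f) = ‖c‖ₑ * X.nrm f := by
  rw [X.nrm_eq hf, X.nrm_eq (hf.const_smul c), ← X.eNorm_smul, AEEqFun.smul_mk]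

theorem eNorm_zero : X.eNorm 0 = 0 := by
  have := X.eNorm_smul 0 0
  simpa using this

theorem nrm_zero : X.nrm (0 : Ω → ℝ) = 0 := by
  have h : AEStronglyMeasurable (0 : Ω → ℝ) μ := aestronglyMeasurable_const
  rw [X.nrm_eq h]
  exact X.eNorm_zero

theorem nrm_sum_le {κ : Type*} (s : Finset κ) (f : κ → Ω → ℝ) :
    X.nrm (∑ k ∈ s, f k) ≤ ∑ k ∈ s, X.nrm (f k) := by
  classical
  induction s using Finset.induction_on with
  | empty => simp [X.nrm_zero]
  | insert a s ha ih =>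
    rw [Finset.sum_insert ha, Finset.sum_insert ha]
    exact (X.nrm_add_le _ _).trans (by gcongr)

theorem nrm_eq_zero {f : Ω → ℝ} (h : X.nrm f = 0) : f =ᵐ[μ] 0 := by
  have hf : AEStronglyMeasurable f μ := X.aestronglyMeasurable_of_nrm (by rw [h]; exact ENNReal.zero_ne_top)
  rw [X.nrm_eq hf] at h
  have := X.eq_zero_of_eNorm _ h
  exact AEEqFun.mk_eq_mk.1 this

/-- The Fatou property for almost everywhere convergence. -/
theorem nrm_fatou {u : ℕ → Ω → ℝ} {f : Ω → ℝ} {c : ℝ≥0∞}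
    (hu : ∀ n, AEStronglyMeasurable (u n) μ)
    (hlim : ∀ᵐ x ∂μ, Tendsto (fun n => u n x) atTop (𝓝 (f x))) (hc : ∀ n, X.nrm (u n) ≤ c) :
    X.nrm f ≤ c := by
  have hf : AEStronglyMeasurable f μ := aestronglyMeasurable_of_tendsto_ae atTop hu hlim
  have key : ∀ (u : ℕ → Ω → ℝ) (f : Ω → ℝ), (∀ n, AEStronglyMeasurable (u n) μ) →
      AEStronglyMeasurable f μ → (∀ᵐ x ∂μ, Tendsto (fun n => u n x) atTop (𝓝 (f x))) →
      (∀ n, X.nrm (u n) ≤ 1) → X.nrm f ≤ 1 := by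
    intro u f hu hf hlim hc
    rw [X.nrm_eq hf]
    refine X.fatou (fun n => AEEqFun.mk (u n) (hu n)) _ (fun n => ?_) fun B _ hBμ => ?_
    · rw [← X.nrm_eq]
      exact hc n
    · have : IsFiniteMeasure (μ.restrict B) := ⟨by simpa using hBμ⟩
      refine tendstoInMeasure_of_tendsto_ae
        (fun n => (AEEqFun.aestronglyMeasurable _).mono_measure Measure.restrict_le_self) ?_
      refine ae_restrict_of_ae ?_
      filter_upwards [hlim, ae_all_iff.2 fun n => AEEqFun.coeFn_mk (u n) (hu n),
        AEEqFun.coeFn_mk f hf] with x h1 h2 h3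
      simp only [h2, h3]
      exact h1
  -- The Fatou property concerns the unit ball. Rescaling uses c + ε because c may vanish.
  refine ENNReal.le_of_forall_pos_le_add fun ε hε hctop => ?_
  lift c to ℝ≥0 using hctop.ne
  have hd : 0 < c + ε := by positivity
  set d : ℝ≥0 := c + ε
  have hsm : ∀ g : Ω → ℝ, AEStronglyMeasurable g μ → X.nrm ((d⁻¹ : ℝ) • g) = (d : ℝ≥0∞)⁻¹ * X.nrm g :=
    fun g hg => by
      rw [X.nrm_smul hg, Real.enorm_eq_ofReal (by positivity), ENNReal.ofReal_inv_of_pos (by positivity),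
        ENNReal.ofReal_coe_nnreal]
  have h1 := key (fun n => (d⁻¹ : ℝ) • u n) ((d⁻¹ : ℝ) • f) (fun n => (hu n).const_smul _)
    (hf.const_smul _) (by filter_upwards [hlim] with x hx using hx.const_mul _) fun n => by
      rw [hsm _ (hu n), ENNReal.inv_mul_le_iff (by exact_mod_cast hd.ne') ENNReal.coe_ne_top, mul_one]
      refine (hc n).trans ?_
      exact_mod_cast le_self_add
  rw [hsm _ hf, ENNReal.inv_mul_le_iff (by exact_mod_cast hd.ne') ENNReal.coe_ne_top, mul_one] at h1
  exact_mod_cast h1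

/-- Domination of the distribution functions gives domination of the norms. -/
def DistMono : Prop :=
  ∀ f g : Ω → ℝ, AEStronglyMeasurable f μ → AEStronglyMeasurable g μ →
    (∀ s : ℝ≥0∞, μ {x | s < ‖f x‖ₑ} ≤ μ {x | s < ‖g x‖ₑ}) → X.nrm f ≤ X.nrm g

theorem tendsto_truncate (a : ℝ) : Tendsto (fun n : ℕ => min |a| (n : ℝ)) atTop (𝓝 |a|) := by
  refine tendsto_const_nhds.congr' ?_
  filter_upwards [tendsto_natCast_atTop_atTop.eventually (eventually_ge_atTop |a|)] with n hn
  exact (min_eq_left hn).symm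

theorem nrm_abs {f : Ω → ℝ} (hf : AEStronglyMeasurable f μ) : X.nrm (fun x => |f x|) = X.nrm f :=
  le_antisymm (X.nrm_mono hf.norm (Eventually.of_forall fun x => by simp))
    (X.nrm_mono hf (Eventually.of_forall fun x => by simp))

theorem nrm_le_of_truncate {f : Ω → ℝ} (hf : AEStronglyMeasurable f μ) {c : ℝ≥0∞}
    (h : ∀ n : ℕ, X.nrm (fun x => min |f x| n) ≤ c) : X.nrm f ≤ c := by
  rw [← X.nrm_abs hf]
  exact X.nrm_fatou (fun n => hf.norm.inf aestronglyMeasurable_const)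
    (Eventually.of_forall fun x => tendsto_truncate (f x)) h

end Norm

theorem lebesgue_top_distMono {Ω : Type*} [MeasurableSpace Ω] (μ : Measure Ω) [SigmaFinite μ] :
    (lebesgue μ ∞ le_top).DistMono := by
  intro f g hf hg h
  rw [nrm_eq _ hf, nrm_eq _ hg]
  simp only [lebesgue]
  rw [eLpNorm_congr_ae (AEEqFun.coeFn_mk f hf), eLpNorm_congr_ae (AEEqFun.coeFn_mk g hg),
    eLpNorm_exponent_top, eLpNorm_exponent_top]
  refine essSup_le_of_ae_le _ ?_
  have h1 : μ {x | eLpNormEssSup g μ < ‖g x‖ₑ} = 0 := by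
    have := ae_le_eLpNormEssSup (f := g) (μ := μ)
    rw [ae_iff] at this
    simpa using this
  have h2 := le_antisymm ((h _).trans h1.le) zero_le
  change ∀ᵐ x ∂μ, ‖f x‖ₑ ≤ eLpNormEssSup g μ
  rw [ae_iff]
  simpa using h2

theorem lebesgue_one_distMono {Ω : Type*} [MeasurableSpace Ω] (μ : Measure Ω) [SigmaFinite μ] :
    (lebesgue μ 1 le_rfl).DistMono := by
  intro f g hf hg h
  rw [nrm_eq _ hf, nrm_eq _ hg]
  simp only [lebesgue]
  rw [eLpNorm_congr_ae (AEEqFun.coeFn_mk f hf), eLpNorm_congr_ae (AEEqFun.coeFn_mk g hg),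
    eLpNorm_one_eq_lintegral_enorm, eLpNorm_one_eq_lintegral_enorm]
  have key : ∀ f : Ω → ℝ, AEStronglyMeasurable f μ → ∫⁻ x, ‖f x‖ₑ ∂μ =
      ∫⁻ t in Ioi (0 : ℝ), μ {x | ENNReal.ofReal t < ‖f x‖ₑ} := fun f hf => by
    have h1 := lintegral_eq_lintegral_meas_lt μ (f := fun x => |f x|)
      (Eventually.of_forall fun x => abs_nonneg _) hf.norm.aemeasurable
    have h2 : ∀ x, ‖f x‖ₑ = ENNReal.ofReal |f x| := fun x => by
      rw [← Real.enorm_abs, Real.enorm_eq_ofReal (abs_nonneg _)]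
    simp only [h2]
    rw [h1]
    refine setLIntegral_congr_fun measurableSet_Ioi fun t ht => ?_
    congr 1
    ext x
    exact (ENNReal.ofReal_lt_ofReal_iff_of_nonneg (le_of_lt ht)).symm
  rw [key f hf, key g hg]
  exact lintegral_mono fun t => h _

theorem decRearrangement_antitone {Ω : Type*} [MeasurableSpace Ω] {μ : Measure Ω}
    (f : Ω →ₘ[μ] ℝ) : Antitone (decRearrangement f) := fun _ _ h =>
  sInf_le_sInf fun _ hs => le_trans hs (ENNReal.ofReal_le_ofReal h)

theorem decRearrangement_mono {Ω : Type*} [MeasurableSpace Ω] {μ : Measure Ω} {f g : Ω →ₘ[μ] ℝ}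
    (h : ∀ s : ℝ≥0∞, μ {x | s < ‖f x‖ₑ} ≤ μ {x | s < ‖g x‖ₑ}) (t : ℝ) :
    decRearrangement f t ≤ decRearrangement g t := sInf_le_sInf fun s hs => (h s).trans hs

/-- Domination of distribution functions gives pointwise domination of rearrangements, and the norm
is monotone. Truncation comes first: invariance speaks of rearrangements that are real functions,
whereas that of an unbounded f may be infinite on a set of positive measure. -/
theorem IsRearrangementInvariant.distMono {D : RIDomain} {X : KotheSpace D.measure}
    (hX : X.IsRearrangementInvariant) : X.DistMono := by
  have hnorm : ∀ (f : ℝ →ₘ[D.measure] ℝ) (n : ℕ), (∀ᵐ x ∂D.measure, |f x| ≤ n) →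
      ∃ F : ℝ → ℝ, AEStronglyMeasurable F D.measure ∧ (∀ t, ENNReal.ofReal (F t) = decRearrangement f t) ∧
        (∀ t, 0 ≤ F t) ∧ X.eNorm f = X.nrm F := by
    intro f n hn
    have hle : ∀ t, decRearrangement f t ≤ n := fun t => by
      refine sInf_le ?_
      change D.measure _ ≤ _
      have : D.measure {x | (n : ℝ≥0∞) < ‖f x‖ₑ} = 0 := by
        rw [measure_eq_zero_iff_ae_notMem]
        filter_upwards [hn] with x hx hx'
        refine absurd hx' (not_lt.2 ?_)
        rw [← Real.enorm_abs, Real.enorm_eq_ofReal (abs_nonneg _)]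
        exact (ENNReal.ofReal_le_ofReal hx).trans (by simp)
      rw [this]
      exact zero_le
    have hmeas : Measurable fun t => (decRearrangement f t).toReal :=
      (decRearrangement_antitone f).measurable.ennreal_toReal
    have htop : ∀ t, decRearrangement f t ≠ ∞ := fun t =>
      ne_top_of_le_ne_top (by simp) (hle t)
    refine ⟨_, hmeas.aestronglyMeasurable, fun t => ENNReal.ofReal_toReal (htop t),
      fun t => ENNReal.toReal_nonneg, ?_⟩
    rw [X.nrm_eq hmeas.aestronglyMeasurable]
    refine hX f _ ?_
    filter_upwards [AEEqFun.coeFn_mk _ hmeas.aestronglyMeasurable] with t ht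
    rw [ht, Real.enorm_eq_ofReal ENNReal.toReal_nonneg, ENNReal.ofReal_toReal (htop t)]
  have hmin : ∀ (a : ℝ) (n : ℕ) (s : ℝ≥0∞), s < ‖min |a| (n : ℝ)‖ₑ ↔ s < ‖a‖ₑ ∧ s < n := fun a n s => by
    rw [Real.enorm_eq_ofReal (le_min (abs_nonneg _) (Nat.cast_nonneg n)), ENNReal.ofReal_min,
      lt_min_iff, ← Real.enorm_eq_ofReal (abs_nonneg a), Real.enorm_abs, ENNReal.ofReal_natCast]
  intro f g hf hg h
  refine X.nrm_le_of_truncate hf fun n => ?_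
  have hf' : AEStronglyMeasurable (fun x => min |f x| (n : ℝ)) D.measure :=
    hf.norm.inf aestronglyMeasurable_const
  have hg' : AEStronglyMeasurable (fun x => min |g x| (n : ℝ)) D.measure :=
    hg.norm.inf aestronglyMeasurable_const
  have hbd : ∀ (φ : ℝ → ℝ) (hφ : AEStronglyMeasurable (fun x => min |φ x| (n : ℝ)) D.measure),
      ∀ᵐ x ∂D.measure, |AEEqFun.mk _ hφ x| ≤ n := fun φ hφ => by
    filter_upwards [AEEqFun.coeFn_mk _ hφ] with x hx
    rw [hx, abs_of_nonneg (le_min (abs_nonneg _) (Nat.cast_nonneg n))]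
    exact min_le_right _ _
  obtain ⟨F, hF, hF1, hF0, hF2⟩ := hnorm _ n (hbd f hf')
  obtain ⟨G, hG, hG1, hG0, hG2⟩ := hnorm _ n (hbd g hg')
  refine le_trans ?_ (X.nrm_mono (f := fun x => min |g x| (n : ℝ)) hg' (Eventually.of_forall fun x => ?_))
  · rw [X.nrm_eq hf', X.nrm_eq hg', hF2, hG2]
    refine X.nrm_mono hF (Eventually.of_forall fun t => ?_)
    rw [abs_of_nonneg (hF0 t), abs_of_nonneg (hG0 t)]
    refine (ENNReal.ofReal_le_ofReal_iff (hG0 t)).1 ?_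
    rw [hF1, hG1]
    refine decRearrangement_mono (fun s => ?_) t
    have hset : ∀ (φ : ℝ → ℝ) (hφ : AEStronglyMeasurable (fun x => min |φ x| (n : ℝ)) D.measure),
        D.measure {x | s < ‖AEEqFun.mk _ hφ x‖ₑ} = if s < n then D.measure {x | s < ‖φ x‖ₑ} else 0 := by
      intro φ hφ
      have h1 : D.measure {x | s < ‖AEEqFun.mk _ hφ x‖ₑ} =
          D.measure {x | s < ‖φ x‖ₑ ∧ s < n} := by
        refine measure_congr ?_
        filter_upwards [AEEqFun.coeFn_mk _ hφ] with x hx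
        change (s < ‖AEEqFun.mk _ hφ x‖ₑ) = (s < ‖φ x‖ₑ ∧ s < n)
        rw [hx, hmin]
      rw [h1]
      by_cases hs : s < n <;> simp [hs]
    rw [hset f hf', hset g hg']
    split_ifs
    · exact h s
    · exact le_rfl
  · rw [abs_of_nonneg (le_min (abs_nonneg _) (Nat.cast_nonneg n))]
    exact min_le_left _ _

end KotheSpace

/-! ### Averaging operators are contractions for r.i. norms. -/

section Glue

variable {ι Ω : Type*}

open Classical in
/-- The function that equals `g k` on `A k` and vanishes elsewhere. -/
noncomputable def glueFun (A : ι → Set Ω) (g : ι → Ω → ℝ) (x : Ω) : ℝ :=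
  if h : ∃ k, x ∈ A k then g h.choose x else 0

theorem glueFun_of_mem {A : ι → Set Ω} (hA : Pairwise (Function.onFun Disjoint A)) (g : ι → Ω → ℝ)
    {k : ι} {x : Ω} (hx : x ∈ A k) : glueFun A g x = g k x := by
  have h : ∃ k, x ∈ A k := ⟨k, hx⟩
  rw [glueFun, dif_pos h]
  have : h.choose = k := by
    by_contra hne
    exact Set.disjoint_left.1 (hA hne) h.choose_spec hx
  rw [this]

theorem glueFun_of_notMem {A : ι → Set Ω} (g : ι → Ω → ℝ) {x : Ω} (hx : ∀ k, x ∉ A k) :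
    glueFun A g x = 0 := by
  rw [glueFun, dif_neg]
  rintro ⟨k, hk⟩
  exact hx k hk

theorem measurable_glueFun [MeasurableSpace Ω] [Countable ι] {A : ι → Set Ω} (hA : Pairwise (Function.onFun Disjoint A))
    (hAm : ∀ k, MeasurableSet (A k)) {g : ι → Ω → ℝ} (hg : ∀ k, Measurable (g k)) :
    Measurable (glueFun A g) := by
  intro S hS
  have h : glueFun A g ⁻¹' S = (⋃ k, A k ∩ g k ⁻¹' S) ∪ ((⋃ k, A k)ᶜ ∩ {_x | (0 : ℝ) ∈ S}) := by
    ext x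
    simp only [Set.mem_preimage, Set.mem_union, Set.mem_iUnion, Set.mem_inter_iff, Set.mem_compl_iff]
    by_cases hx : ∃ k, x ∈ A k
    · obtain ⟨k, hk⟩ := hx
      rw [glueFun_of_mem hA g hk]
      constructor
      · exact fun h => Or.inl ⟨k, hk, h⟩
      · rintro (⟨l, hl, h⟩ | ⟨h, _⟩)
        · rwa [← glueFun_of_mem hA g hk, glueFun_of_mem hA g hl]
        · exact absurd ⟨k, hk⟩ h
    · push Not at hx
      rw [glueFun_of_notMem g hx]
      constructor
      · exact fun h => Or.inr ⟨by push Not; exact hx, h⟩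
      · rintro (⟨l, hl, _⟩ | ⟨_, h⟩)
        · exact absurd hl (hx l)
        · exact h
  rw [h]
  exact (MeasurableSet.iUnion fun k => (hAm k).inter (hg k hS)).union
    ((MeasurableSet.iUnion hAm).compl.inter (MeasurableSet.const _))

end Glue

/-- Lower quantiles of a bounded function on a set of finite measure. -/
theorem exists_quantiles {Ω : Type*} [MeasurableSpace Ω] (μ : Measure Ω) {B : Set Ω}
    (h0 : μ B ≠ 0) {v : Ω → ℝ} (hv : Measurable v)
    (hv0 : ∀ x, 0 ≤ v x) (b : ℝ≥0) (hvb : ∀ x, v x ≤ b) (n : ℕ) :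
    ∃ w : Fin (n + 1) → ℝ≥0,
      (∀ s : ℝ≥0, ((Finset.univ.filter fun i => s < w i).card : ℝ≥0∞) * μ B ≤
        (n + 1 : ℕ) * μ (B ∩ {x | (s : ℝ) < v x})) ∧
      ((n + 1 : ℕ) : ℝ≥0∞) * ∫⁻ x in B, ENNReal.ofReal (v x) ∂μ ≤ μ B * (∑ i, (w i : ℝ≥0∞) + b) := by
  classical
  set d : ℝ → ℝ≥0∞ := fun s => μ (B ∩ {x | s < v x}) with hd
  have hanti : Antitone d := fun s s' h => measure_mono fun x hx => ⟨hx.1, lt_of_le_of_lt h hx.2⟩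
  have hdB : ∀ s, d s ≤ μ B := fun s => measure_mono Set.inter_subset_left
  have hd0 : ∀ s, (b : ℝ) ≤ s → d s = 0 := fun s hs => by
    have : B ∩ {x | s < v x} = ∅ := by
      refine Set.eq_empty_iff_forall_notMem.2 fun x hx => ?_
      exact absurd (hx.2.trans_le ((hvb x).trans hs)) (lt_irrefl _)
    simp only [hd, this, measure_empty]
  -- The length of S i is the value of the rearrangement of v on B at (i+1)μ(B)/(n+1).
  set S : ℕ → Set ℝ := fun i => {s | 0 < s ∧ ((i + 1 : ℕ) : ℝ≥0∞) * μ B ≤ (n + 1 : ℕ) * d s} with hS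
  have hSm : ∀ i, MeasurableSet (S i) := fun i =>
    measurableSet_Ioi.inter (measurableSet_le measurable_const (hanti.measurable.const_mul _))
  have hSb : ∀ i, S i ⊆ Ioo 0 (b : ℝ) := fun i s hs => by
    refine ⟨hs.1, ?_⟩
    by_contra h
    have h1 := hs.2
    rw [hd0 s (not_lt.1 h), mul_zero] at h1
    exact (mul_ne_zero (by positivity) h0) (le_antisymm h1 zero_le)
  have hSfin : ∀ i, volume (S i) ≠ ∞ := fun i =>
    ne_top_of_le_ne_top (by simp) (measure_mono (hSb i))
  set w : Fin (n + 1) → ℝ≥0 := fun i => (volume (S i)).toNNReal with hw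
  have hwc : ∀ i, (w i : ℝ≥0∞) = volume (S i) := fun i => ENNReal.coe_toNNReal (hSfin i)
  refine ⟨w, fun s => ?_, ?_⟩
  · set F := Finset.univ.filter fun i => s < w i
    rcases F.eq_empty_or_nonempty with hF | hF
    · rw [hF]; simp
    have hmax := F.max'_mem hF
    set i := F.max' hF
    have hcard : F.card ≤ (i : ℕ) + 1 := by
      have : F ⊆ Finset.Iic i := fun j hj => Finset.mem_Iic.2 (F.le_max' j hj)
      refine (Finset.card_le_card this).trans ?_
      simp
    have hsi : s < w i := (Finset.mem_filter.1 hmax).2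
    obtain ⟨s', hs', hss'⟩ : ∃ s' ∈ S i, (s : ℝ) < s' := by
      by_contra h
      push Not at h
      have : volume (S i) ≤ s := by
        refine (measure_mono (t := Ioc 0 (s : ℝ)) fun x hx => ⟨hx.1, h x hx⟩).trans ?_
        simp
      rw [← hwc] at this
      exact absurd hsi (not_lt.2 (by exact_mod_cast this))
    calc (F.card : ℝ≥0∞) * μ B ≤ ((i + 1 : ℕ) : ℝ≥0∞) * μ B :=
          mul_le_mul_left (by exact_mod_cast hcard) _
      _ ≤ (n + 1 : ℕ) * d s' := hs'.2
      _ ≤ (n + 1 : ℕ) * d s := mul_le_mul_right (hanti hss'.le) _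
  · have hlayer := lintegral_eq_lintegral_meas_lt (μ.restrict B) (f := v)
      (Eventually.of_forall hv0) hv.aemeasurable
    -- At level s the number of i with s ∈ S i is (n+1)d(s)/μ(B) rounded down. The rounding error is
    -- at most one and is paid by the indicator of (0,b), which integrates to b.
    have hpt : ∀ s ∈ Ioi (0 : ℝ), ((n + 1 : ℕ) : ℝ≥0∞) * d s ≤
        μ B * (∑ i : Fin (n + 1), (S i).indicator 1 s + (Ioo 0 (b : ℝ)).indicator 1 s) := by
      intro s hs
      by_cases hsb : (b : ℝ) ≤ s
      · rw [hd0 s hsb, mul_zero]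
        exact zero_le
      rw [Set.indicator_of_mem (show s ∈ Ioo 0 (b : ℝ) from ⟨hs, not_le.1 hsb⟩), Pi.one_apply]
      set F := Finset.univ.filter fun i : Fin (n + 1) => s ∈ S i with hF
      have hsum : ∑ i : Fin (n + 1), (S i).indicator (1 : ℝ → ℝ≥0∞) s = F.card := by
        rw [Finset.card_filter]
        push_cast
        refine Finset.sum_congr rfl fun i _ => ?_
        by_cases h : s ∈ S i <;> simp [h]
      rw [hsum]
      by_cases hc : F.card < n + 1
      · have hnot : s ∉ S F.card := fun hmem => by
          have hsub : (Finset.Iic (⟨F.card, hc⟩ : Fin (n + 1))) ⊆ F := fun j hj => by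
            refine Finset.mem_filter.2 ⟨Finset.mem_univ _, hmem.1, le_trans ?_ hmem.2⟩
            have hj' : j ≤ (⟨F.card, hc⟩ : Fin (n + 1)) := Finset.mem_Iic.1 hj
            have : (j : ℕ) ≤ F.card := hj'
            exact mul_le_mul_left (by exact_mod_cast Nat.add_le_add_right this 1) _
          have := Finset.card_le_card hsub
          simp at this
        have h1 : ¬ ((F.card + 1 : ℕ) : ℝ≥0∞) * μ B ≤ (n + 1 : ℕ) * d s := fun h => hnot ⟨hs, h⟩
        refine (not_le.1 h1).le.trans (le_of_eq ?_)
        push_cast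
        ring
      · have : n + 1 ≤ F.card := not_lt.1 hc
        calc ((n + 1 : ℕ) : ℝ≥0∞) * d s ≤ (F.card : ℝ≥0∞) * μ B :=
              mul_le_mul' (by exact_mod_cast this) (hdB s)
          _ ≤ _ := by
            rw [mul_comm]
            exact mul_le_mul_right le_self_add _
    rw [hlayer]
    have hrs : ∀ s, (μ.restrict B) {a | s < v a} = d s := fun s => by
      rw [Measure.restrict_apply (measurableSet_lt measurable_const hv), Set.inter_comm]
    simp only [hrs]
    rw [← lintegral_const_mul _ hanti.measurable]
    refine (setLIntegral_mono_ae (Measurable.aemeasurable ?_) (Eventually.of_forall hpt)).trans ?_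
    · refine Measurable.const_mul (Measurable.add (Finset.measurable_sum _ fun i _ => ?_) ?_) _
      · exact measurable_one.indicator (hSm i)
      · exact measurable_one.indicator measurableSet_Ioo
    · have hm1 : Measurable fun x => ∑ i : Fin (n + 1), (S i).indicator (1 : ℝ → ℝ≥0∞) x :=
        Finset.measurable_sum _ fun i _ => measurable_one.indicator (hSm i)
      have hm2 : Measurable fun x => (Ioo 0 (b : ℝ)).indicator (1 : ℝ → ℝ≥0∞) x :=
        measurable_one.indicator measurableSet_Ioo
      have hm3 : Measurable fun x => ∑ i : Fin (n + 1), (S i).indicator (1 : ℝ → ℝ≥0∞) x +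
          (Ioo 0 (b : ℝ)).indicator (1 : ℝ → ℝ≥0∞) x := hm1.add hm2
      rw [lintegral_const_mul _ hm3, lintegral_add_right _ hm2,
        lintegral_finsetSum (f := fun (i : Fin (n + 1)) x => (S i).indicator (1 : ℝ → ℝ≥0∞) x) _
          fun i _ => measurable_one.indicator (hSm i)]
      refine mul_le_mul_right (add_le_add (Finset.sum_le_sum fun i _ => ?_) ?_) _
      · rw [hwc, lintegral_indicator_one (hSm _)]
        exact Measure.restrict_apply_le _ _
      · rw [lintegral_indicator_one measurableSet_Ioo]
        refine (Measure.restrict_apply_le _ _).trans ?_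
        simp

namespace KotheSpace

variable {D : RIDomain}

theorem measure_le_volume (D : RIDomain) (S : Set ℝ) : D.measure S ≤ volume S :=
  Measure.restrict_apply_le _ _

/-- The cell, among `n + 1` equal ones, of the interval `[c, c + l)` that contains `x`. -/
noncomputable def cell (n : ℕ) (c l : ℝ) (x : ℝ) : Fin (n + 1) :=
  Fin.ofNat (n + 1) ⌊(n + 1) * (x - c) / l⌋₊

theorem measurable_cell (n : ℕ) (c l : ℝ) : Measurable (cell n c l) := by
  have h : Measurable fun x : ℝ => ⌊((n : ℝ) + 1) * (x - c) / l⌋₊ :=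
    Nat.measurable_floor.comp (by fun_prop)
  exact (Measurable.of_discrete (f := Fin.ofNat (n + 1))).comp h

theorem measure_cell_le (n : ℕ) (c : ℝ) {l : ℝ} (hl : 0 < l) (i : Fin (n + 1)) :
    (n + 1 : ℕ) * D.measure {x | x ∈ Ico c (c + l) ∧ cell n c l x = i} ≤ ENNReal.ofReal l := by
  have hsub : {x | x ∈ Ico c (c + l) ∧ cell n c l x = i} ⊆
      Ico (c + i * l / (n + 1)) (c + (i + 1) * l / (n + 1)) := by
    rintro x ⟨hx, rfl⟩
    have h0 : 0 ≤ (n + 1) * (x - c) / l := by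
      have := sub_nonneg.2 hx.1
      positivity
    have h1 : (n + 1) * (x - c) / l < ((n + 1 : ℕ) : ℝ) := by
      rw [div_lt_iff₀ hl]
      push_cast
      have : x - c < l := by linarith [hx.2]
      nlinarith [hx.1]
    have h2 : ((cell n c l x : Fin (n + 1)) : ℕ) = ⌊(n + 1) * (x - c) / l⌋₊ := by
      simp only [cell, Fin.ofNat]
      exact Nat.mod_eq_of_lt ((Nat.floor_lt h0).2 h1)
    have h3 := Nat.floor_le h0
    have h4 := Nat.lt_floor_add_one ((n + 1) * (x - c) / l)
    rw [← h2] at h3 h4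
    rw [le_div_iff₀ hl] at h3
    rw [div_lt_iff₀ hl] at h4
    have hn : (0 : ℝ) < n + 1 := by positivity
    constructor
    · have : (cell n c l x : ℕ) * l / (n + 1) ≤ x - c := by
        rw [div_le_iff₀ hn]; linarith
      linarith
    · have : x - c < ((cell n c l x : ℕ) + 1) * l / (n + 1) := by
        rw [lt_div_iff₀ hn]; linarith
      linarith
  refine (mul_le_mul_right ((measure_le_volume D _).trans (measure_mono hsub)) _).trans ?_
  rw [Real.volume_Ico, ← ENNReal.ofReal_natCast, ← ENNReal.ofReal_mul (by positivity)]
  refine ENNReal.ofReal_le_ofReal (le_of_eq ?_)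
  push_cast
  field_simp
  ring

/-- Averages over disjoint sets, spread over disjoint intervals that are not longer, have a norm
not exceeding that of the function: the bounded case. -/
theorem DistMono.nrm_average_le_of_bounded {X : KotheSpace D.measure} (hX : X.DistMono) {ι : Type*}
    [Countable ι] {B : ι → Set ℝ} (hB : ∀ k, MeasurableSet (B k))
    (hBd : Pairwise (Function.onFun Disjoint B)) (hBtop : ∀ k, D.measure (B k) ≠ ∞) {c l : ι → ℝ}
    (hl : ∀ k, 0 < l k) (hlB : ∀ k, ENNReal.ofReal (l k) ≤ D.measure (B k))
    (hA : Pairwise (Function.onFun Disjoint fun k => Ico (c k) (c k + l k))) {v : ℝ → ℝ}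
    (hv : Measurable v) (hv0 : ∀ x, 0 ≤ v x) (b : ℝ≥0) (hvb : ∀ x, v x ≤ b) :
    X.nrm (glueFun (fun k => Ico (c k) (c k + l k)) fun k _ =>
      ((D.measure (B k))⁻¹ * ∫⁻ x in B k, ENNReal.ofReal (v x) ∂D.measure).toReal) ≤ X.nrm v := by
  classical
  set A : ι → Set ℝ := fun k => Ico (c k) (c k + l k) with hAdef
  have hAm : ∀ k, MeasurableSet (A k) := fun k => measurableSet_Ico
  have hB0 : ∀ k, D.measure (B k) ≠ 0 := fun k =>
    ((ENNReal.ofReal_pos.2 (hl k)).trans_le (hlB k)).ne'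
  set avg : ι → ℝ≥0∞ := fun k => (D.measure (B k))⁻¹ * ∫⁻ x in B k, ENNReal.ofReal (v x) ∂D.measure
    with havg
  choose w hw1 hw2 using fun k n => exists_quantiles D.measure (hB0 k) hv hv0 b hvb n
  -- On the n+1 equal cells of A k the quantiles of v on B k are placed, cyclically shifted by σ.
  -- Such a step function is dominated in distribution by v.
  set z : (n : ℕ) → Fin (n + 1) → ℝ → ℝ := fun n σ =>
    glueFun A fun k x => (w k n (cell n (c k) (l k) x + σ) : ℝ) with hz
  have hzm : ∀ n σ, Measurable (z n σ) := fun n σ => by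
    refine measurable_glueFun hA hAm fun k => ?_
    exact (Measurable.of_discrete (f := fun i : Fin (n + 1) => (w k n (i + σ) : ℝ))).comp
      (measurable_cell n (c k) (l k))
  have hzle : ∀ n σ, X.nrm (z n σ) ≤ X.nrm v := fun n σ => by
    refine hX _ _ (hzm n σ).aestronglyMeasurable hv.aestronglyMeasurable fun s => ?_
    rcases eq_or_ne s ∞ with rfl | hs
    · simp
    lift s to ℝ≥0 using hs
    have h1 : {x | (s : ℝ≥0∞) < ‖z n σ x‖ₑ} ⊆
        ⋃ k, {x | x ∈ A k ∧ s < w k n (cell n (c k) (l k) x + σ)} := by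
      intro x hx
      by_cases hxA : ∃ k, x ∈ A k
      · obtain ⟨k, hk⟩ := hxA
        refine Set.mem_iUnion.2 ⟨k, hk, ?_⟩
        have hx' : (s : ℝ≥0∞) < ‖z n σ x‖ₑ := hx
        simp only [hz] at hx'
        rw [glueFun_of_mem hA _ hk, Real.enorm_eq_ofReal (NNReal.coe_nonneg _),
          ENNReal.ofReal_coe_nnreal] at hx'
        exact_mod_cast hx'
      · push Not at hxA
        have hx' : (s : ℝ≥0∞) < ‖z n σ x‖ₑ := hx
        simp only [hz] at hx'
        rw [glueFun_of_notMem _ hxA] at hx'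
        simp at hx'
    have h2 : ∀ k, D.measure {x | x ∈ A k ∧ s < w k n (cell n (c k) (l k) x + σ)} ≤
        D.measure (B k ∩ {x | (s : ℝ) < v x}) := fun k => by
      set F := Finset.univ.filter fun i => s < w k n i with hF
      have h3 : {x | x ∈ A k ∧ s < w k n (cell n (c k) (l k) x + σ)} ⊆
          ⋃ i ∈ F, {x | x ∈ A k ∧ cell n (c k) (l k) x = i - σ} := by
        rintro x ⟨hx, hx'⟩
        refine Set.mem_iUnion₂.2 ⟨cell n (c k) (l k) x + σ, ?_, hx, by simp⟩
        exact Finset.mem_filter.2 ⟨Finset.mem_univ _, hx'⟩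
      have hn0 : ((n + 1 : ℕ) : ℝ≥0∞) ≠ 0 := by positivity
      refine (ENNReal.mul_le_mul_iff_right hn0 (ENNReal.natCast_ne_top _)).1 ?_
      calc ((n + 1 : ℕ) : ℝ≥0∞) * D.measure {x | x ∈ A k ∧ s < w k n (cell n (c k) (l k) x + σ)}
          ≤ (n + 1 : ℕ) * ∑ i ∈ F, D.measure {x | x ∈ A k ∧ cell n (c k) (l k) x = i - σ} :=
            mul_le_mul_right ((measure_mono h3).trans (measure_biUnion_finset_le _ _)) _
        _ ≤ ∑ i ∈ F, ENNReal.ofReal (l k) := by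
            rw [Finset.mul_sum]
            exact Finset.sum_le_sum fun i _ => measure_cell_le n (c k) (hl k) _
        _ = F.card * ENNReal.ofReal (l k) := by rw [Finset.sum_const, nsmul_eq_mul]
        _ ≤ F.card * D.measure (B k) := mul_le_mul_right (hlB k) _
        _ ≤ _ := hw1 k n s
    calc D.measure {x | (s : ℝ≥0∞) < ‖z n σ x‖ₑ}
        ≤ ∑' k, D.measure {x | x ∈ A k ∧ s < w k n (cell n (c k) (l k) x + σ)} :=
          (measure_mono h1).trans (measure_iUnion_le _)
      _ ≤ ∑' k, D.measure (B k ∩ {x | (s : ℝ) < v x}) := ENNReal.tsum_le_tsum h2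
      _ = D.measure (⋃ k, B k ∩ {x | (s : ℝ) < v x}) := by
          refine (measure_iUnion (fun i j hij => ?_) fun k =>
            (hB k).inter (measurableSet_lt measurable_const hv)).symm
          exact (hBd hij).mono Set.inter_subset_left Set.inter_subset_left
      _ ≤ _ := by
          refine measure_mono fun x hx => ?_
          obtain ⟨k, hk⟩ := Set.mem_iUnion.1 hx
          have h4 : (s : ℝ) < v x := hk.2
          change (s : ℝ≥0∞) < ‖v x‖ₑ
          rw [Real.enorm_eq_ofReal (hv0 x), ← ENNReal.ofReal_coe_nnreal]
          exact (ENNReal.ofReal_lt_ofReal_iff_of_nonneg s.coe_nonneg).2 h4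
  set W : ℕ → ι → ℝ := fun n k => ((n + 1 : ℕ) : ℝ)⁻¹ * ∑ i, (w k n i : ℝ) with hW
  set G : ℕ → ℝ → ℝ := fun n => ((n + 1 : ℕ) : ℝ)⁻¹ • ∑ σ, z n σ with hG
  have hsm : ∀ n, Measurable (∑ σ, z n σ) := fun n => by
    rw [Finset.sum_fn]
    exact Finset.measurable_sum _ fun σ _ => hzm n σ
  have hGle : ∀ n, X.nrm (G n) ≤ X.nrm v := fun n => by
    have hn0 : ((n + 1 : ℕ) : ℝ≥0∞) ≠ 0 := by positivity
    have hm : Measurable (∑ σ, z n σ) := hsm n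
    simp only [hG]
    rw [X.nrm_smul hm.aestronglyMeasurable, Real.enorm_eq_ofReal (by positivity),
      ENNReal.ofReal_inv_of_pos (by positivity), ENNReal.ofReal_natCast,
      ENNReal.inv_mul_le_iff hn0 (ENNReal.natCast_ne_top _)]
    refine (X.nrm_sum_le _ _).trans ((Finset.sum_le_sum fun σ _ => hzle n σ).trans (le_of_eq ?_))
    simp
  -- Over all cyclic shifts each cell receives every quantile once, so the mean is constant on A k.
  have hGA : ∀ n k x, x ∈ A k → G n x = W n k := fun n k x hx => by
    simp only [hG, hW, Pi.smul_apply, Finset.sum_apply, smul_eq_mul, hz]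
    congr 1
    rw [Finset.sum_congr rfl fun σ _ => glueFun_of_mem hA _ hx]
    exact Equiv.sum_comp (Equiv.addLeft (cell n (c k) (l k) x)) fun i => (w k n i : ℝ)
  have hGm : ∀ n, Measurable (G n) := fun n =>
    (hsm n).const_smul _
  have havgW : ∀ n k, (avg k).toReal ≤ W n k + b / (n + 1) := fun n k => by
    have h1 := hw2 k n
    have h2 : avg k ≤ ENNReal.ofReal (W n k + b / (n + 1)) := by
      have hn0 : ((n + 1 : ℕ) : ℝ≥0∞) ≠ 0 := by positivity
      simp only [havg]
      rw [ENNReal.inv_mul_le_iff (hB0 k) (hBtop k)]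
      refine (ENNReal.mul_le_mul_iff_right hn0 (ENNReal.natCast_ne_top _)).1 (h1.trans (le_of_eq ?_))
      rw [mul_left_comm]
      congr 1
      rw [← ENNReal.ofReal_natCast, ← ENNReal.ofReal_mul (by positivity)]
      have : ((n + 1 : ℕ) : ℝ) * (W n k + b / (n + 1)) = ((∑ i, w k n i + b : ℝ≥0) : ℝ) := by
        simp only [hW]
        push_cast
        field_simp
      rw [this, ENNReal.ofReal_coe_nnreal]
      push_cast
      rfl
    exact ENNReal.toReal_le_of_le_ofReal (by
      have : 0 ≤ W n k := mul_nonneg (by positivity) (Finset.sum_nonneg fun i _ => NNReal.coe_nonneg _)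
      positivity) h2
  set H := glueFun A fun k _ => (avg k).toReal with hH
  have hHm : Measurable H := measurable_glueFun hA hAm fun k => measurable_const
  -- The mean of the quantiles falls short of the average by at most b/(n+1); the deficit is
  -- subtracted and vanishes in the limit.
  refine X.nrm_fatou (u := fun n x => max (H x - b / ((n : ℝ) + 1)) 0 )
    (fun n => ((hHm.sub_const _).max measurable_const).aestronglyMeasurable)
    (Eventually.of_forall fun x => ?_) fun n => ?_
  · have hH0 : 0 ≤ H x := by
      simp only [hH, glueFun]
      split_ifs
      · exact ENNReal.toReal_nonneg
      · exact le_rfl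
    have h1 : Tendsto (fun n : ℕ => (b : ℝ) / ((n : ℝ) + 1)) atTop (𝓝 0) :=
      ((tendsto_const_div_atTop_nhds_zero_nat (b : ℝ)).comp (tendsto_add_atTop_nat 1)).congr
        fun n => by simp
    have h2 := (tendsto_const_nhds (x := H x)).sub h1
    have h3 := h2.max (tendsto_const_nhds (x := (0 : ℝ)))
    rwa [sub_zero, max_eq_left hH0] at h3
  · refine (X.nrm_mono ((hHm.sub_const _).max measurable_const).aestronglyMeasurable
      (Eventually.of_forall fun x => ?_)).trans (hGle n)
    rw [abs_of_nonneg (le_max_right _ _)]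
    refine max_le ?_ (abs_nonneg _)
    by_cases hxA : ∃ k, x ∈ A k
    · obtain ⟨k, hk⟩ := hxA
      simp only [hH]
      rw [glueFun_of_mem hA _ hk, hGA n k x hk]
      have := havgW n k
      exact le_trans (by linarith) (le_abs_self _)
    · push Not at hxA
      simp only [hH]
      rw [glueFun_of_notMem _ hxA]
      have : (0 : ℝ) ≤ b / ((n : ℝ) + 1) := by positivity
      exact le_trans (by linarith) (abs_nonneg _)

end KotheSpace

namespace KotheSpace

variable {D : RIDomain}

/-- Averages over disjoint sets, spread over disjoint intervals that are not longer, have a norm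
not exceeding that of the function. -/
theorem DistMono.nrm_le_of_average {X : KotheSpace D.measure} (hX : X.DistMono) {ι : Type*}
    [Countable ι] {B : ι → Set ℝ} (hB : ∀ k, MeasurableSet (B k))
    (hBd : Pairwise (Function.onFun Disjoint B)) (hBtop : ∀ k, D.measure (B k) ≠ ∞) {c l : ι → ℝ}
    (hl : ∀ k, 0 < l k) (hlB : ∀ k, ENNReal.ofReal (l k) ≤ D.measure (B k))
    (hA : Pairwise (Function.onFun Disjoint fun k => Ico (c k) (c k + l k))) {v F : ℝ → ℝ}
    (hv : Measurable v) (hF : Measurable F) (hF0 : ∀ x, (∀ k, x ∉ Ico (c k) (c k + l k)) → F x = 0)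
    (hFA : ∀ k, ∀ x ∈ Ico (c k) (c k + l k),
      ‖F x‖ₑ * D.measure (B k) ≤ ∫⁻ x in B k, ‖v x‖ₑ ∂D.measure) : X.nrm F ≤ X.nrm v := by
  set A : ι → Set ℝ := fun k => Ico (c k) (c k + l k) with hAdef
  have hB0 : ∀ k, D.measure (B k) ≠ 0 := fun k =>
    ((ENNReal.ofReal_pos.2 (hl k)).trans_le (hlB k)).ne'
  have habs : ∀ x, ‖v x‖ₑ = ENNReal.ofReal |v x| := fun x => by
    rw [← Real.enorm_abs, Real.enorm_eq_ofReal (abs_nonneg _)]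
  -- Averages of v truncated at height b. They increase to the true averages, possibly infinite, and
  -- the minimum with |F| then tends to |F|.
  set avg : ℕ → ι → ℝ≥0∞ := fun b k =>
    (D.measure (B k))⁻¹ * ∫⁻ x in B k, ENNReal.ofReal (min |v x| b) ∂D.measure with havg
  have havgtop : ∀ b k, avg b k ≠ ∞ := fun b k => by
    refine ENNReal.mul_ne_top (ENNReal.inv_ne_top.2 (hB0 k)) ?_
    refine ne_top_of_le_ne_top (b := ∫⁻ x in B k, (b : ℝ≥0∞) ∂D.measure) ?_
      (lintegral_mono fun x => ?_)
    · rw [setLIntegral_const]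
      exact ENNReal.mul_ne_top (by simp) (hBtop k)
    · exact (ENNReal.ofReal_le_ofReal (min_le_right _ _)).trans (by simp)
  set G : ℕ → ℝ → ℝ := fun b => glueFun A fun k _ => (avg b k).toReal with hG
  have hGm : ∀ b, Measurable (G b) := fun b =>
    measurable_glueFun hA (fun k => measurableSet_Ico) fun k => measurable_const
  have hvm : ∀ b : ℕ, Measurable fun x => min |v x| (b : ℝ) := fun b =>
    (measurable_norm.comp hv).min measurable_const
  have hGle : ∀ b, X.nrm (G b) ≤ X.nrm v := fun b => by
    have hmin0 : ∀ x, 0 ≤ min |v x| (b : ℝ) := fun x => le_min (abs_nonneg _) (Nat.cast_nonneg b)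
    refine (hX.nrm_average_le_of_bounded hB hBd hBtop hl hlB hA (hvm b) hmin0 (b : ℝ≥0)
      (fun x => min_le_right _ _)).trans (X.nrm_mono (hvm b).aestronglyMeasurable
        (Eventually.of_forall fun x => ?_))
    rw [abs_of_nonneg (hmin0 x)]
    exact min_le_left _ _
  refine (X.nrm_abs hF.aestronglyMeasurable).symm.le.trans ?_
  refine X.nrm_fatou (u := fun b x => min |F x| (G b x))
    (fun b => ((measurable_norm.comp hF).min (hGm b)).aestronglyMeasurable)
    (Eventually.of_forall fun x => ?_) fun b => ?_
  · by_cases hx : ∃ k, x ∈ A k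
    · obtain ⟨k, hk⟩ := hx
      have h1 : Tendsto (fun b => avg b k) atTop
          (𝓝 ((D.measure (B k))⁻¹ * ∫⁻ x in B k, ‖v x‖ₑ ∂D.measure)) := by
        refine ENNReal.Tendsto.const_mul ?_ (Or.inr (ENNReal.inv_ne_top.2 (hB0 k)))
        refine lintegral_tendsto_of_tendsto_of_monotone
          (fun b => (hvm b).ennreal_ofReal.aemeasurable) (Eventually.of_forall fun x => ?_)
          (Eventually.of_forall fun x => ?_)
        · intro b b' hbb
          exact ENNReal.ofReal_le_ofReal (min_le_min_left _ (by exact_mod_cast hbb))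
        · rw [habs]
          exact (ENNReal.continuous_ofReal.tendsto _).comp (tendsto_truncate (v x))
      have h2 : ‖F x‖ₑ ≤ (D.measure (B k))⁻¹ * ∫⁻ x in B k, ‖v x‖ₑ ∂D.measure := by
        rw [← ENNReal.div_eq_inv_mul, ENNReal.le_div_iff_mul_le (Or.inl (hB0 k)) (Or.inl (hBtop k))]
        exact hFA k x hk
      have h3 := (tendsto_const_nhds (x := ‖F x‖ₑ)).min h1
      rw [min_eq_left h2] at h3
      have h4 := (ENNReal.tendsto_toReal enorm_ne_top).comp h3
      rw [toReal_enorm, Real.norm_eq_abs] at h4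
      refine h4.congr fun b => ?_
      simp only [Function.comp_apply, hG]
      rw [glueFun_of_mem hA _ hk, ENNReal.toReal_min enorm_ne_top (havgtop b k), toReal_enorm,
        Real.norm_eq_abs]
    · push Not at hx
      have h1 : ∀ b, min |F x| (G b x) = |F x| := fun b => by
        simp only [hG]
        rw [hF0 x hx, glueFun_of_notMem _ hx]
        simp
      simp only [h1]
      exact tendsto_const_nhds
  · refine (X.nrm_mono ((measurable_norm.comp hF).min (hGm b)).aestronglyMeasurable
      (Eventually.of_forall fun x => ?_)).trans (hGle b)
    have hG0 : 0 ≤ G b x := by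
      simp only [hG, glueFun]
      split_ifs
      · exact ENNReal.toReal_nonneg
      · exact le_rfl
    refine (abs_of_nonneg (le_min (norm_nonneg _) hG0)).le.trans ?_
    exact (min_le_right _ _).trans (le_abs_self _)

theorem nrm_indicator_ne_top (X : KotheSpace D.measure) {B : Set ℝ} (hB : MeasurableSet B)
    (h : D.measure B ≠ ∞) : X.nrm (B.indicator fun _ => (1 : ℝ)) ≠ ∞ := by
  rw [X.nrm_eq ((measurable_const.indicator hB).aestronglyMeasurable)]
  exact (X.indicator_mem B hB h.lt_top).ne

theorem nrm_indicator_ne_zero (X : KotheSpace D.measure) {B : Set ℝ} (h : D.measure B ≠ 0) :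
    X.nrm (B.indicator fun _ => (1 : ℝ)) ≠ 0 := fun h0 => h (by
  have := X.nrm_eq_zero h0
  refine measure_mono_null (fun x hx => ?_) (ae_iff.1 this)
  simpa using hx)

theorem measure_Ico_zero {l : ℝ} (hl : l ≤ 1) : D.measure (Ico 0 l) = ENNReal.ofReal l := by
  have hsub : Ico 0 l ⊆ D.set := fun x hx => by
    cases D
    · exact ⟨hx.1, hx.2.le.trans hl⟩
    · exact hx.1
  rw [Measure.restrict_apply measurableSet_Ico, Set.inter_eq_left.2 hsub, Real.volume_Ico, sub_zero]

theorem exists_interval_le {δ : ℝ≥0∞} (hδ : δ ≠ 0) :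
    ∃ l : ℝ, 0 < l ∧ ENNReal.ofReal l ≤ δ ∧ D.measure (Ico 0 l) = ENNReal.ofReal l := by
  refine ⟨(min δ 1).toReal, ?_, ?_, measure_Ico_zero ?_⟩
  · exact ENNReal.toReal_pos (by simp [min_eq_iff, hδ]) (by simp)
  · rw [ENNReal.ofReal_toReal (by simp)]
    exact min_le_left _ _
  · exact ENNReal.toReal_le_of_le_ofReal (by simp) (by simp)

/-- A function of finite norm is integrable over sets of finite measure. -/
theorem DistMono.setLIntegral_ne_top {X : KotheSpace D.measure} (hX : X.DistMono) {B : Set ℝ}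
    (hB : MeasurableSet B) (htop : D.measure B ≠ ∞) {v : ℝ → ℝ} (hv : Measurable v)
    (h : X.nrm v ≠ ∞) : ∫⁻ x in B, ‖v x‖ₑ ∂D.measure ≠ ∞ := by
  intro hint
  have h0 : D.measure B ≠ 0 := fun h0 => by
    rw [setLIntegral_measure_zero _ _ h0] at hint
    exact ENNReal.zero_ne_top hint
  obtain ⟨l, hl, hlB, hlμ⟩ := exists_interval_le (D := D) h0
  set χ : ℝ → ℝ := (Ico 0 l).indicator fun _ => (1 : ℝ) with hχ
  have hχm : Measurable χ := measurable_const.indicator measurableSet_Ico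
  have hχ0 : X.nrm χ ≠ 0 := X.nrm_indicator_ne_zero (by
    rw [hlμ]
    exact (ENNReal.ofReal_pos.2 hl).ne')
  -- An infinite mean over B dominates every constant on a short interval, which would force the
  -- norm of v to be infinite.
  have hn : ∀ n : ℕ, (n : ℝ≥0∞) * X.nrm χ ≤ X.nrm v := fun n => by
    have h1 := hX.nrm_le_of_average (ι := Unit) (B := fun _ => B) (fun _ => hB)
      (fun i j hij => absurd (Subsingleton.elim i j) hij) (fun _ => htop) (c := fun _ => 0)
      (l := fun _ => l) (fun _ => hl) (fun _ => hlB)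
      (fun i j hij => absurd (Subsingleton.elim i j) hij) (F := (n : ℝ) • χ) hv (hχm.const_smul _)
      (fun x hx => by
        have := hx ()
        rw [zero_add] at this
        simp [hχ, this]) (fun _ x _ => by rw [hint]; exact le_top)
    rwa [X.nrm_smul hχm.aestronglyMeasurable, Real.enorm_natCast] at h1
  refine h (ENNReal.eq_top_of_forall_nnreal_le fun r => ?_)
  obtain ⟨n, hnr⟩ := exists_nat_gt ((r : ℝ≥0∞) / X.nrm χ).toNNReal
  refine le_trans ?_ (hn n)
  have h2 : (r : ℝ≥0∞) / X.nrm χ ≤ n := by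
    have h3 : (r : ℝ≥0∞) / X.nrm χ ≠ ∞ := ENNReal.div_ne_top ENNReal.coe_ne_top hχ0
    rw [← ENNReal.coe_toNNReal h3]
    exact_mod_cast hnr.le
  have hχt : X.nrm χ ≠ ∞ := X.nrm_indicator_ne_top measurableSet_Ico (by rw [hlμ]; simp)
  rwa [ENNReal.div_le_iff_le_mul (Or.inl hχ0) (Or.inl hχt)] at h2

/-- The distribution function of a function of finite norm tends to zero. -/
theorem DistMono.exists_level {X : KotheSpace D.measure} (hX : X.DistMono) {v : ℝ → ℝ}
    (h : X.nrm v ≠ ∞) {δ : ℝ≥0∞} (hδ : δ ≠ 0) :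
    ∃ s : ℝ≥0, D.measure {x | (s : ℝ≥0∞) < ‖v x‖ₑ} ≤ δ := by
  by_contra hcon
  push Not at hcon
  obtain ⟨l, hl, hlB, hlμ⟩ := exists_interval_le (D := D) hδ
  set χ : ℝ → ℝ := (Ico 0 l).indicator fun _ => (1 : ℝ) with hχ
  have hχm : Measurable χ := measurable_const.indicator measurableSet_Ico
  have hχ0 : X.nrm χ ≠ 0 := X.nrm_indicator_ne_zero (by
    rw [hlμ]
    exact (ENNReal.ofReal_pos.2 hl).ne')
  have hn : ∀ n : ℝ≥0, (n : ℝ≥0∞) * X.nrm χ ≤ X.nrm v := fun n => by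
    have h1 := hX ((n : ℝ) • χ) v (hχm.const_smul _).aestronglyMeasurable
      (X.aestronglyMeasurable_of_nrm h) fun s => by
        rcases le_or_gt (n : ℝ≥0∞) s with hs | hs
        · have : {x | s < ‖((n : ℝ) • χ) x‖ₑ} = ∅ := by
            refine Set.eq_empty_iff_forall_notMem.2 fun x hx => ?_
            have hx' : s < ‖(n : ℝ) * χ x‖ₑ := hx
            by_cases hxl : x ∈ Ico 0 l
            · rw [hχ, Set.indicator_of_mem hxl, mul_one, Real.enorm_eq_ofReal n.coe_nonneg,
                ENNReal.ofReal_coe_nnreal] at hx'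
              exact absurd hx' (not_lt.2 hs)
            · rw [hχ, Set.indicator_of_notMem hxl] at hx'
              simp at hx'
          rw [this, measure_empty]
          exact zero_le
        · have h2 : {x | s < ‖((n : ℝ) • χ) x‖ₑ} ⊆ Ico 0 l := fun x hx => by
            by_contra hxl
            have hx' : s < ‖(n : ℝ) * χ x‖ₑ := hx
            rw [hχ, Set.indicator_of_notMem hxl] at hx'
            simp at hx'
          refine (measure_mono h2).trans (hlμ.le.trans (hlB.trans ?_))
          refine (hcon n).le.trans (measure_mono fun x hx => ?_)
          exact lt_of_lt_of_le hs (le_of_lt hx)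
    rwa [X.nrm_smul hχm.aestronglyMeasurable, Real.enorm_eq_ofReal n.coe_nonneg,
      ENNReal.ofReal_coe_nnreal] at h1
  have hχt : X.nrm χ ≠ ∞ := X.nrm_indicator_ne_top measurableSet_Ico (by rw [hlμ]; simp)
  refine h (ENNReal.eq_top_of_forall_nnreal_le fun r => ?_)
  have h3 : (r : ℝ≥0∞) / X.nrm χ ≠ ∞ := ENNReal.div_ne_top ENNReal.coe_ne_top hχ0
  have h4 := hn ((r : ℝ≥0∞) / X.nrm χ).toNNReal
  rwa [ENNReal.coe_toNNReal h3, ENNReal.div_mul_cancel hχ0 hχt] at h4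

end KotheSpace

/-! ### Dyadic step functions and their norm. -/

section StepFun

variable {J : Set ℤ}

/-- The dyadic interval `[2^k, 2^(k+1))`. -/
def dyadic (k : ℤ) : Set ℝ := Ico ((2 : ℝ) ^ k) ((2 : ℝ) ^ k + (2 : ℝ) ^ k)

theorem dyadic_eq (k : ℤ) : dyadic k = Ico ((2 : ℝ) ^ k) ((2 : ℝ) ^ (k + 1)) := by
  rw [dyadic, zpow_add_one₀ two_ne_zero, mul_two]

theorem dyadic_lt {k l : ℤ} (h : k < l) {x y : ℝ} (hx : x ∈ dyadic k) (hy : y ∈ dyadic l) : x < y := by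
  rw [dyadic_eq] at hx
  exact hx.2.trans_le ((zpow_le_zpow_right₀ one_le_two (by omega)).trans hy.1)

theorem dyadic_disjoint {k l : ℤ} (h : k ≠ l) : Disjoint (dyadic k) (dyadic l) :=
  Set.disjoint_left.2 fun x hx hy => by
    rcases lt_or_gt_of_ne h with h | h
    · exact lt_irrefl x (dyadic_lt h hx hy)
    · exact lt_irrefl x (dyadic_lt h hy hx)

theorem pairwise_dyadic : Pairwise (Function.onFun Disjoint fun k : J => dyadic (k : ℤ)) :=
  fun _ _ h => dyadic_disjoint fun h' => h (Subtype.ext h')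

theorem stepFun_eq (x : J → ℝ) : stepFun x = glueFun (fun k : J => dyadic (k : ℤ)) fun k _ => x k := by
  ext t
  simp only [stepFun, ← dyadic_eq]
  by_cases h : ∃ k : J, t ∈ dyadic (k : ℤ)
  · obtain ⟨k, hk⟩ := h
    rw [glueFun_of_mem pairwise_dyadic _ hk, tsum_eq_single k, Set.indicator_of_mem hk]
    intro l hl
    refine Set.indicator_of_notMem (fun h => ?_) _
    exact Set.disjoint_left.1 (pairwise_dyadic hl) h hk
  · push Not at h
    rw [glueFun_of_notMem _ h]
    simp [h]

theorem stepFun_of_mem (x : J → ℝ) {k : J} {t : ℝ} (h : t ∈ dyadic (k : ℤ)) : stepFun x t = x k := by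
  rw [stepFun_eq, glueFun_of_mem pairwise_dyadic _ h]

theorem stepFun_of_notMem (x : J → ℝ) {t : ℝ} (h : ∀ k : J, t ∉ dyadic (k : ℤ)) : stepFun x t = 0 := by
  rw [stepFun_eq, glueFun_of_notMem _ h]

theorem stepFun_add (x y : J → ℝ) : stepFun (x + y) = stepFun x + stepFun y := by
  ext t
  by_cases h : ∃ k : J, t ∈ dyadic (k : ℤ)
  · obtain ⟨k, hk⟩ := h
    simp [stepFun_of_mem _ hk]
  · push Not at h
    simp [stepFun_of_notMem _ h]

theorem stepFun_smul (c : ℝ) (x : J → ℝ) : stepFun (c • x) = c • stepFun x := by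
  ext t
  by_cases h : ∃ k : J, t ∈ dyadic (k : ℤ)
  · obtain ⟨k, hk⟩ := h
    simp [stepFun_of_mem _ hk]
  · push Not at h
    simp [stepFun_of_notMem _ h]

theorem abs_stepFun_le {x y : J → ℝ} (h : ∀ k, |x k| ≤ |y k|) (t : ℝ) : |stepFun x t| ≤ |stepFun y t| := by
  by_cases h' : ∃ k : J, t ∈ dyadic (k : ℤ)
  · obtain ⟨k, hk⟩ := h'
    rw [stepFun_of_mem _ hk, stepFun_of_mem _ hk]
    exact h k
  · push Not at h'
    rw [stepFun_of_notMem _ h', stepFun_of_notMem _ h']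

end StepFun

theorem dyadic_subset {D : RIDomain} (k : D.index) : dyadic (k : ℤ) ⊆ D.set := by
  intro x hx
  obtain ⟨k, hk⟩ := k
  cases D
  · refine ⟨le_trans (by positivity) hx.1, ?_⟩
    rw [dyadic_eq] at hx
    have hk' : k < 0 := hk
    refine hx.2.le.trans (zpow_le_one_of_nonpos₀ one_le_two ?_)
    change k + 1 ≤ 0
    omega
  · exact le_trans (by positivity) hx.1

theorem measure_dyadic {D : RIDomain} (k : D.index) :
    D.measure (dyadic (k : ℤ)) = ENNReal.ofReal ((2 : ℝ) ^ (k : ℤ)) := by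
  rw [dyadic, Measure.restrict_apply measurableSet_Ico, ← dyadic,
    Set.inter_eq_left.2 (dyadic_subset k), dyadic, Real.volume_Ico, add_sub_cancel_left]

namespace KotheSpace

variable {D : RIDomain}

theorem seqNorm_eq (X : KotheSpace D.measure) (x : D.index → ℝ) : X.seqNorm x = X.nrm (stepFun x) :=
  (X.nrm_eq _).symm

theorem stepFun_single (k : D.index) :
    stepFun (({k} : Set D.index).indicator 1) = (dyadic (k : ℤ)).indicator fun _ => (1 : ℝ) := by
  ext t
  by_cases h' : ∃ k : D.index, t ∈ dyadic (k : ℤ)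
  · obtain ⟨l, hl⟩ := h'
    rw [stepFun_of_mem _ hl]
    by_cases hkl : l = k
    · subst hkl
      simp [hl]
    · have : t ∉ dyadic (k : ℤ) := fun h => Set.disjoint_left.1 (pairwise_dyadic hkl) hl h
      simp [hkl, this]
  · push Not at h'
    rw [stepFun_of_notMem _ h', Set.indicator_of_notMem (h' k)]

/-- The norm of the sequence space of dyadic step functions. -/
noncomputable def dyadicNorm (X : KotheSpace D.measure) : SeqNorm D.index where
  toFun := X.seqNorm
  smul' c x := by
    rw [seqNorm_eq, seqNorm_eq, stepFun_smul, X.nrm_smul (measurable_stepFun x).aestronglyMeasurable]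
  add_le' x y := by
    rw [seqNorm_eq, seqNorm_eq, seqNorm_eq, stepFun_add]
    exact X.nrm_add_le _ _
  mono' x y h := by
    rw [seqNorm_eq, seqNorm_eq]
    exact X.nrm_mono (measurable_stepFun x).aestronglyMeasurable
      (Eventually.of_forall (abs_stepFun_le h))
  fatou' x c h := by
    classical
    rw [seqNorm_eq]
    -- An increasing sequence of finite sets that exhausts the indices; the step functions of the
    -- cut sequences are eventually constant at every point.
    set A : ℕ → Finset D.index := fun n => (Finset.Icc (-(n : ℤ)) n).subtype (· ∈ D.index) with hA
    refine X.nrm_fatou (u := fun n => stepFun ((A n : Set D.index).indicator x))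
      (fun n => (measurable_stepFun _).aestronglyMeasurable) (Eventually.of_forall fun t => ?_)
      fun n => ?_
    · refine tendsto_const_nhds.congr' ?_
      by_cases h' : ∃ k : D.index, t ∈ dyadic (k : ℤ)
      · obtain ⟨k, hk⟩ := h'
        filter_upwards [eventually_ge_atTop (k : ℤ).natAbs] with n hn
        rw [stepFun_of_mem _ hk, stepFun_of_mem _ hk, Set.indicator_of_mem]
        simp only [hA, Finset.mem_coe, Finset.mem_subtype, Finset.mem_Icc]
        omega
      · push Not at h'
        exact Eventually.of_forall fun n => by
          change _ = stepFun _ t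
          rw [stepFun_of_notMem _ h', stepFun_of_notMem _ h']
    · rw [← seqNorm_eq]
      exact h (A n)
  single_ne_zero' k := by
    rw [seqNorm_eq, stepFun_single]
    refine X.nrm_indicator_ne_zero ?_
    rw [measure_dyadic]
    exact (ENNReal.ofReal_pos.2 (by positivity)).ne'
  single_ne_top' k := by
    rw [seqNorm_eq, stepFun_single]
    refine X.nrm_indicator_ne_top measurableSet_Ico ?_
    rw [measure_dyadic]
    exact ENNReal.ofReal_ne_top

theorem dyadicNorm_apply (X : KotheSpace D.measure) (x : D.index → ℝ) :
    X.dyadicNorm x = X.nrm (stepFun x) := X.seqNorm_eq x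

end KotheSpace

/-! ### The Calderón property passes to dyadic sequences. -/

namespace KotheSpace

/-- The summand 1 covers elements of V outside X: without it the right side would be 0·∞ = 0 when
the operator norm vanishes. -/
theorem eNorm_map_le {Ω : Type*} [MeasurableSpace Ω] {μ : Measure Ω} (X : KotheSpace μ)
    {V : Submodule ℝ (Ω →ₘ[μ] ℝ)} (T : V →ₗ[ℝ] V) (u : V) :
    X.eNorm (T u) ≤ (X.opNorm T + 1) * X.eNorm u := by
  rcases eq_or_ne (X.eNorm u) ∞ with h | h
  · rw [h, ENNReal.mul_top (by simp)]
    exact le_top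
  rcases eq_or_ne (X.eNorm u) 0 with h0 | h0
  · have : u = 0 := Subtype.ext (X.eq_zero_of_eNorm _ h0)
    rw [this, _root_.map_zero]
    change X.eNorm 0 ≤ _
    rw [X.eNorm_zero]
    exact zero_le
  have hpos : 0 < (X.eNorm u).toReal := ENNReal.toReal_pos h0 h
  have hen : ‖(X.eNorm u).toReal⁻¹‖ₑ = (X.eNorm u)⁻¹ := by
    rw [Real.enorm_eq_ofReal (inv_nonneg.2 hpos.le), ENNReal.ofReal_inv_of_pos hpos,
      ENNReal.ofReal_toReal h]
  have h1 : X.eNorm (T ((X.eNorm u).toReal⁻¹ • u)) ≤ X.opNorm T := by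
    refine le_iSup₂ (f := fun (f : V) (_ : X.eNorm f ≤ 1) => X.eNorm (T f)) _ ?_
    change X.eNorm ((X.eNorm u).toReal⁻¹ • (u : Ω →ₘ[μ] ℝ)) ≤ 1
    rw [X.eNorm_smul, hen, ENNReal.inv_mul_cancel h0 h]
  rw [_root_.map_smul] at h1
  change X.eNorm ((X.eNorm u).toReal⁻¹ • (T u : Ω →ₘ[μ] ℝ)) ≤ _ at h1
  rw [X.eNorm_smul, hen, ENNReal.inv_mul_le_iff h0 h, mul_comm] at h1
  exact h1.trans (mul_le_mul_left le_self_add _)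

theorem opNorm_le {Ω : Type*} [MeasurableSpace Ω] {μ : Measure Ω} (X : KotheSpace μ)
    {V : Submodule ℝ (Ω →ₘ[μ] ℝ)} (T : V →ₗ[ℝ] V) {C : ℝ≥0∞}
    (h : ∀ u : V, X.eNorm (T u) ≤ C * X.eNorm u) : X.opNorm T ≤ C :=
  iSup₂_le fun u hu => (h u).trans (mul_le_of_le_one_right' hu)

variable {D : RIDomain}

/-- The step function of a sequence, as a class of functions. -/
noncomputable def stepClass (D : RIDomain) : (D.index → ℝ) →ₗ[ℝ] (ℝ →ₘ[D.measure] ℝ) where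
  toFun x := AEEqFun.mk (stepFun x) (measurable_stepFun x).aestronglyMeasurable
  map_add' x y := by
    rw [AEEqFun.mk_add_mk]
    exact AEEqFun.mk_eq_mk.2 (by rw [stepFun_add])
  map_smul' c x := by
    rw [RingHom.id_apply, AEEqFun.smul_mk]
    exact AEEqFun.mk_eq_mk.2 (by rw [stepFun_smul])

theorem eNorm_stepClass (X : KotheSpace D.measure) (x : D.index → ℝ) :
    X.eNorm (stepClass D x) = X.dyadicNorm x := rfl

/-- The averages of a function over the dyadic intervals. -/
noncomputable def dyadicAverage (D : RIDomain) (u : ℝ →ₘ[D.measure] ℝ) (k : D.index) : ℝ :=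
  ((2 : ℝ) ^ (k : ℤ))⁻¹ * ∫ x in dyadic (k : ℤ), u x ∂D.measure

theorem dyadicAverage_stepClass (x : D.index → ℝ) : dyadicAverage D (stepClass D x) = x := by
  ext k
  have h1 : ∫ t in dyadic (k : ℤ), stepClass D x t ∂D.measure =
      ∫ _t in dyadic (k : ℤ), x k ∂D.measure := by
    refine setIntegral_congr_ae measurableSet_Ico ?_
    filter_upwards [AEEqFun.coeFn_mk (stepFun x) (measurable_stepFun x).aestronglyMeasurable] with t ht
      htk
    exact ht.trans (stepFun_of_mem x htk)
  have h2 : D.measure.real (dyadic (k : ℤ)) = (2 : ℝ) ^ (k : ℤ) := by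
    rw [measureReal_def, measure_dyadic, ENNReal.toReal_ofReal (by positivity)]
  rw [dyadicAverage, h1, setIntegral_const, h2, smul_eq_mul, ← mul_assoc,
    inv_mul_cancel₀ (by positivity), one_mul]

theorem DistMono.dyadicNorm_average_le {X : KotheSpace D.measure} (hX : X.DistMono)
    (u : ℝ →ₘ[D.measure] ℝ) : X.dyadicNorm (dyadicAverage D u) ≤ X.eNorm u := by
  rw [dyadicNorm_apply, ← X.nrm_coe]
  refine hX.nrm_le_of_average (ι := D.index) (B := fun k => dyadic (k : ℤ)) (fun k => measurableSet_Ico)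
    pairwise_dyadic (fun k => by rw [measure_dyadic]; exact ENNReal.ofReal_ne_top)
    (c := fun k => (2 : ℝ) ^ (k : ℤ)) (l := fun k => (2 : ℝ) ^ (k : ℤ)) (fun k => by positivity)
    (fun k => (measure_dyadic k).ge) pairwise_dyadic u.measurable (measurable_stepFun _)
    (fun x hx => stepFun_of_notMem _ hx) fun k x hx => ?_
  rw [stepFun_of_mem _ (show x ∈ dyadic (k : ℤ) from hx), measure_dyadic, dyadicAverage, enorm_mul,
    Real.enorm_eq_ofReal (by positivity), ENNReal.ofReal_inv_of_pos (by positivity), mul_comm,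
    ← mul_assoc, ENNReal.mul_inv_cancel (ENNReal.ofReal_pos.2 (by positivity)).ne'
    ENNReal.ofReal_ne_top, one_mul]
  exact enorm_integral_le_lintegral_enorm _

theorem DistMono.integrableOn {X : KotheSpace D.measure} (hX : X.DistMono) {B : Set ℝ}
    (hB : MeasurableSet B) (htop : D.measure B ≠ ∞) {u : ℝ →ₘ[D.measure] ℝ} (h : X.eNorm u ≠ ∞) :
    IntegrableOn u B D.measure := by
  refine ⟨u.aestronglyMeasurable.restrict, ?_⟩
  rw [← X.nrm_coe] at h
  exact (hX.setLIntegral_ne_top hB htop u.measurable h).lt_top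

theorem integrableOn_of_mem_sum {X Y : KotheSpace D.measure} (hY : Y.DistMono) (hX : X.DistMono)
    {B : Set ℝ} (hB : MeasurableSet B) (htop : D.measure B ≠ ∞) {u : ℝ →ₘ[D.measure] ℝ}
    (h : u ∈ sum Y X) : IntegrableOn u B D.measure := by
  obtain ⟨y, hy, x, hx, rfl⟩ := Submodule.mem_sup.1 h
  have h1 := (hY.integrableOn hB htop (LT.lt.ne hy)).add (hX.integrableOn hB htop (LT.lt.ne hx))
  have h2 : ((y + x : ℝ →ₘ[D.measure] ℝ) : ℝ → ℝ) =ᵐ[D.measure.restrict B] ⇑y + ⇑x :=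
    ae_restrict_of_ae (AEEqFun.coeFn_add y x)
  exact h1.congr h2.symm

theorem mem_sum_left {X Y : KotheSpace D.measure} {u : ℝ →ₘ[D.measure] ℝ} (h : Y.eNorm u ≠ ∞) :
    u ∈ sum Y X := Submodule.mem_sup_left (lt_top_iff_ne_top.2 h)

theorem mem_sum_right {X Y : KotheSpace D.measure} {u : ℝ →ₘ[D.measure] ℝ} (h : X.eNorm u ≠ ∞) :
    u ∈ sum Y X := Submodule.mem_sup_right (lt_top_iff_ne_top.2 h)

theorem dyadicAverage_add {X Y : KotheSpace D.measure} (hY : Y.DistMono) (hX : X.DistMono)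
    {u v : ℝ →ₘ[D.measure] ℝ} (hu : u ∈ sum Y X) (hv : v ∈ sum Y X) :
    dyadicAverage D (u + v) = dyadicAverage D u + dyadicAverage D v := by
  ext k
  have hk : D.measure (dyadic (k : ℤ)) ≠ ∞ := by rw [measure_dyadic]; exact ENNReal.ofReal_ne_top
  simp only [dyadicAverage, Pi.add_apply]
  rw [integral_congr_ae (ae_restrict_of_ae (AEEqFun.coeFn_add u v)), ← mul_add]
  congr 1
  exact integral_add (integrableOn_of_mem_sum hY hX measurableSet_Ico hk hu)
    (integrableOn_of_mem_sum hY hX measurableSet_Ico hk hv)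

/-- The averages as a linear map on the sum of two spaces. -/
noncomputable def dyadicAverageL {X Y : KotheSpace D.measure} (hY : Y.DistMono) (hX : X.DistMono) :
    sum Y X →ₗ[ℝ] (D.index → ℝ) where
  toFun u := dyadicAverage D u
  map_add' u v := dyadicAverage_add hY hX u.2 v.2
  map_smul' c u := by
    ext k
    simp only [dyadicAverage, Pi.smul_apply, RingHom.id_apply, smul_eq_mul]
    rw [SetLike.val_smul, integral_congr_ae (ae_restrict_of_ae (AEEqFun.coeFn_smul c u.1))]
    simp only [Pi.smul_apply, smul_eq_mul]
    rw [integral_const_mul]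
    ring

theorem stepClass_mem_sum {X Y : KotheSpace D.measure} {x : D.index → ℝ}
    (h : x ∈ SeqNorm.sumSpace Y.dyadicNorm X.dyadicNorm) : stepClass D x ∈ sum Y X := by
  obtain ⟨y, z, hy, hz, rfl⟩ := h
  rw [_root_.map_add]
  exact add_mem (mem_sum_left hy) (mem_sum_right hz)

/-- The Calderón property passes to the sequence spaces of dyadic step functions. -/
theorem IsCalderonCouple.seqCalderon {X Y : KotheSpace D.measure} (h : IsCalderonCouple Y X)
    (hY : Y.DistMono) (hX : X.DistMono) : SeqNorm.SeqCalderon Y.dyadicNorm X.dyadicNorm := by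
  intro f g hfg
  obtain ⟨T, hTY, hTX, hTg⟩ := h ⟨_, stepClass_mem_sum f.2⟩ ⟨_, stepClass_mem_sum g.2⟩ fun t ht => by
    have h1 : kFunctional Y X t (stepClass D f) ≤ SeqNorm.kSeq Y.dyadicNorm X.dyadicNorm t f := by
      refine le_iInf fun x => le_iInf fun y => le_iInf fun hxy => ?_
      refine (iInf₂_le (stepClass D x) (stepClass D y)).trans (iInf_le _ ?_)
      rw [← _root_.map_add, hxy]
    -- Averaging is a left inverse of the step function map and contracts both norms, so any
    -- splitting of the step function yields one of the sequence. Splittings of infinite cost are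
    -- set aside first, since averages are additive only for integrable functions.
    have h2 : SeqNorm.kSeq Y.dyadicNorm X.dyadicNorm t g ≤ kFunctional Y X t (stepClass D g) := by
      refine le_iInf fun x => le_iInf fun y => le_iInf fun hxy => ?_
      by_cases hx : Y.eNorm x = ∞
      · simp [hx]
      by_cases hy : X.eNorm y = ∞
      · rw [hy, ENNReal.mul_top (by exact_mod_cast ht.ne'), add_top]
        exact le_top
      refine (iInf₂_le (dyadicAverage D x) (dyadicAverage D y)).trans ((iInf_le _ ?_).trans ?_)
      · rw [← dyadicAverage_add hY hX (mem_sum_left hx) (mem_sum_right hy), hxy,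
          dyadicAverage_stepClass]
      · exact add_le_add (hY.dyadicNorm_average_le x)
          (mul_le_mul_right (hX.dyadicNorm_average_le y) _)
    exact h1.trans ((hfg t ht).trans h2)
  refine ⟨dyadicAverageL hY hX ∘ₗ T ∘ₗ (((stepClass D).comp (Submodule.subtype _)).codRestrict _
    fun u => stepClass_mem_sum u.2), (Y.opNorm T + 1 + (X.opNorm T + 1)).toNNReal, fun u => ?_,
    fun u => ?_, ?_⟩
  · rw [ENNReal.coe_toNNReal (by finiteness)]
    refine (hY.dyadicNorm_average_le _).trans ((Y.eNorm_map_le T _).trans ?_)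
    exact mul_le_mul_left le_self_add _
  · rw [ENNReal.coe_toNNReal (by finiteness)]
    refine (hX.dyadicNorm_average_le _).trans ((X.eNorm_map_le T _).trans ?_)
    exact mul_le_mul_left le_add_self _
  · have : dyadicAverage D (T ⟨_, stepClass_mem_sum g.2⟩) = f := by
      rw [hTg]
      exact dyadicAverage_stepClass _
    exact this

end KotheSpace

/-! ### The dyadic norms of L_1 and L_∞ and the two weights. -/

theorem measurableSet_dyadic (k : ℤ) : MeasurableSet (dyadic k) := measurableSet_Ico

theorem enorm_stepFun {J : Set ℤ} (x : J → ℝ) (t : ℝ) :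
    ‖stepFun x t‖ₑ = ∑' k : J, (dyadic (k : ℤ)).indicator (fun _ => ‖x k‖ₑ) t := by
  by_cases h : ∃ k : J, t ∈ dyadic (k : ℤ)
  · obtain ⟨k, hk⟩ := h
    rw [stepFun_of_mem _ hk, tsum_eq_single k, Set.indicator_of_mem hk]
    intro l hl
    refine Set.indicator_of_notMem (fun h => ?_) _
    exact Set.disjoint_left.1 (pairwise_dyadic hl) h hk
  · push Not at h
    rw [stepFun_of_notMem _ h]
    simp [h]

namespace KotheSpace

variable {D : RIDomain}

theorem dyadicNorm_one (x : D.index → ℝ) : (lebesgue D.measure 1 le_rfl).dyadicNorm x =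
    ∑' k : D.index, ENNReal.ofReal ((2 : ℝ) ^ (k : ℤ)) * ‖x k‖ₑ := by
  rw [dyadicNorm_apply, nrm_eq _ (measurable_stepFun x).aestronglyMeasurable]
  simp only [lebesgue]
  rw [eLpNorm_congr_ae (AEEqFun.coeFn_mk _ _), eLpNorm_one_eq_lintegral_enorm]
  simp only [enorm_stepFun]
  rw [lintegral_tsum fun k => (measurable_const.indicator (measurableSet_dyadic _)).aemeasurable]
  refine tsum_congr fun k => ?_
  rw [lintegral_indicator_const (measurableSet_dyadic _), measure_dyadic,
    mul_comm]

theorem dyadicNorm_one_eq_lintegral (x : D.index → ℝ) :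
    (lebesgue D.measure 1 le_rfl).dyadicNorm x = ∫⁻ t, ‖stepFun x t‖ₑ ∂D.measure := by
  rw [dyadicNorm_apply, nrm_eq _ (measurable_stepFun x).aestronglyMeasurable]
  simp only [lebesgue]
  rw [eLpNorm_congr_ae (AEEqFun.coeFn_mk _ _), eLpNorm_one_eq_lintegral_enorm]

theorem dyadicNorm_top_le_iff (x : D.index → ℝ) (c : ℝ≥0∞) :
    (lebesgue D.measure ∞ le_top).dyadicNorm x ≤ c ↔ ∀ k, ‖x k‖ₑ ≤ c := by
  constructor
  · intro h k
    refine le_trans ?_ (((lebesgue D.measure ∞ le_top).dyadicNorm.indicator_le {k} x).trans h)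
    rw [SeqNorm.indicator_singleton, dyadicNorm_apply, stepFun_single,
      nrm_eq _ (measurable_const.indicator (measurableSet_dyadic _)).aestronglyMeasurable]
    simp only [lebesgue]
    rw [eLpNorm_congr_ae (AEEqFun.coeFn_mk _ _), eLpNorm_indicator_const' (measurableSet_dyadic _)
      (by rw [measure_dyadic]; exact (ENNReal.ofReal_pos.2 (by positivity)).ne') (by simp)]
    simp
  · intro h
    rw [dyadicNorm_apply, nrm_eq _ (measurable_stepFun x).aestronglyMeasurable]
    simp only [lebesgue]
    rw [eLpNorm_congr_ae (AEEqFun.coeFn_mk _ _), eLpNorm_exponent_top]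
    refine essSup_le_of_ae_le _ (Eventually.of_forall fun t => ?_)
    change ‖stepFun x t‖ₑ ≤ c
    by_cases h' : ∃ k : D.index, t ∈ dyadic (k : ℤ)
    · obtain ⟨k, hk⟩ := h'
      rw [stepFun_of_mem _ hk]
      exact h k
    · push Not at h'
      rw [stepFun_of_notMem _ h']
      simp

end KotheSpace

namespace SeqNorm

variable {ι : Type*}

/-- A norm that compares families with disjoint supports termwise has the shift property. -/
theorem LeftShift.of_disjoint [LinearOrder ι] {M : SeqNorm ι}
    (h : ∀ (s : Finset ℤ) (x y : ℤ → ι → ℝ), (∀ n ∈ s, M (x n) ≤ M (y n)) →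
      (∀ m ∈ s, ∀ n ∈ s, m ≠ n → ∀ i, x m i ≠ 0 → x n i = 0) →
      (∀ m ∈ s, ∀ n ∈ s, m ≠ n → ∀ i, y m i ≠ 0 → y n i = 0) →
      M (∑ n ∈ s, x n) ≤ M (∑ n ∈ s, y n)) : M.LeftShift 1 := by
  intro s x y hle _ _ hnext
  rw [ENNReal.coe_one, one_mul]
  refine h s x y hle (fun m hm n hn hmn i hi => ?_) fun m hm n hn hmn i hi => ?_
  · by_contra h
    rcases lt_or_gt_of_ne hmn with h1 | h1
    · exact lt_irrefl i (hnext m hm n hn h1 i i (Or.inl hi) (Or.inl h))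
    · exact lt_irrefl i (hnext n hn m hm h1 i i (Or.inl h) (Or.inl hi))
  · by_contra h
    rcases lt_or_gt_of_ne hmn with h1 | h1
    · exact lt_irrefl i (hnext m hm n hn h1 i i (Or.inr hi) (Or.inr h))
    · exact lt_irrefl i (hnext n hn m hm h1 i i (Or.inr h) (Or.inr hi))

end SeqNorm

namespace KotheSpace

variable {D : RIDomain}

/-- The L_1 norm is additive on disjoint supports and subadditive in general, so only the y n have
to be disjoint. -/
theorem dyadicNorm_one_sum_le (s : Finset ℤ) (x y : ℤ → D.index → ℝ)
    (hle : ∀ n ∈ s, (lebesgue D.measure 1 le_rfl).dyadicNorm (x n) ≤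
      (lebesgue D.measure 1 le_rfl).dyadicNorm (y n))
    (hy : ∀ m ∈ s, ∀ n ∈ s, m ≠ n → ∀ i, y m i ≠ 0 → y n i = 0) :
    (lebesgue D.measure 1 le_rfl).dyadicNorm (∑ n ∈ s, x n) ≤
      (lebesgue D.measure 1 le_rfl).dyadicNorm (∑ n ∈ s, y n) := by
  refine (SeqNorm.sum_le _ _ _).trans ((Finset.sum_le_sum hle).trans (le_of_eq ?_))
  simp only [dyadicNorm_one]
  rw [← Summable.tsum_finsetSum fun _ _ => ENNReal.summable]
  refine tsum_congr fun k => ?_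
  rw [← Finset.mul_sum, Finset.sum_apply]
  congr 1
  by_cases h0 : ∃ n ∈ s, y n k ≠ 0
  · obtain ⟨n, hn, hk⟩ := h0
    have hz : ∀ m ∈ s, m ≠ n → y m k = 0 := fun m hm hmn => hy n hn m hm hmn.symm k hk
    rw [Finset.sum_eq_single_of_mem n hn hz,
      Finset.sum_eq_single_of_mem n hn fun m hm hmn => by rw [hz m hm hmn, enorm_zero]]
  · push Not at h0
    rw [Finset.sum_eq_zero h0, enorm_zero, Finset.sum_eq_zero fun n hn => by rw [h0 n hn, enorm_zero]]

theorem dyadicNorm_top_sum_le (s : Finset ℤ) (x y : ℤ → D.index → ℝ)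
    (hle : ∀ n ∈ s, (lebesgue D.measure ∞ le_top).dyadicNorm (x n) ≤
      (lebesgue D.measure ∞ le_top).dyadicNorm (y n))
    (hx : ∀ m ∈ s, ∀ n ∈ s, m ≠ n → ∀ i, x m i ≠ 0 → x n i = 0)
    (hy : ∀ m ∈ s, ∀ n ∈ s, m ≠ n → ∀ i, y m i ≠ 0 → y n i = 0) :
    (lebesgue D.measure ∞ le_top).dyadicNorm (∑ n ∈ s, x n) ≤
      (lebesgue D.measure ∞ le_top).dyadicNorm (∑ n ∈ s, y n) := by
  rw [dyadicNorm_top_le_iff]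
  intro k
  rw [Finset.sum_apply]
  by_cases h0 : ∃ n ∈ s, x n k ≠ 0
  · obtain ⟨n, hn, hk⟩ := h0
    rw [Finset.sum_eq_single_of_mem n hn fun m hm hmn => hx n hn m hm hmn.symm k hk]
    have h1 := SeqNorm.sum_filter_le (N := (lebesgue D.measure ∞ le_top).dyadicNorm) s {n}
      (Finset.singleton_subset_iff.2 hn) y hy
    rw [Finset.sum_singleton] at h1
    exact ((dyadicNorm_top_le_iff (x n) _).1 le_rfl k).trans ((hle n hn).trans h1)
  · push Not at h0
    rw [Finset.sum_eq_zero h0, enorm_zero]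
    exact zero_le

theorem leftShift_one : (lebesgue D.measure 1 le_rfl).dyadicNorm.LeftShift 1 :=
  SeqNorm.LeftShift.of_disjoint fun s x y hle _ hy => dyadicNorm_one_sum_le s x y hle hy

theorem leftShift_one_dual : (lebesgue D.measure 1 le_rfl).dyadicNorm.dual.LeftShift 1 :=
  SeqNorm.LeftShift.of_disjoint fun s x y hle _ hy => dyadicNorm_one_sum_le s x y hle hy

theorem leftShift_top_dual : (lebesgue D.measure ∞ le_top).dyadicNorm.dual.LeftShift 1 :=
  SeqNorm.LeftShift.of_disjoint fun s x y hle hx hy => dyadicNorm_top_sum_le s x y hle hx hy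

/-- The norm of the characteristic function of a dyadic interval. -/
noncomputable def fundam (X : KotheSpace D.measure) (k : D.index) : ℝ≥0 :=
  (X.dyadicNorm (({k} : Set D.index).indicator 1)).toNNReal

variable {X : KotheSpace D.measure}

theorem coe_fundam (k : D.index) :
    (X.fundam k : ℝ≥0∞) = X.dyadicNorm (({k} : Set D.index).indicator 1) :=
  ENNReal.coe_toNNReal (X.dyadicNorm.single_ne_top' k)

theorem coe_fundam_eq_nrm (k : D.index) :
    (X.fundam k : ℝ≥0∞) = X.nrm ((dyadic (k : ℤ)).indicator fun _ => (1 : ℝ)) := by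
  rw [coe_fundam, dyadicNorm_apply, stepFun_single]

theorem fundam_pos (k : D.index) : 0 < X.fundam k := by
  have h : (X.fundam k : ℝ≥0∞) ≠ 0 := by
    rw [coe_fundam]
    exact X.dyadicNorm.single_ne_zero' k
  exact pos_iff_ne_zero.2 (by exact_mod_cast h)

theorem DistMono.nrm_indicator_le (hX : X.DistMono) {A B : Set ℝ} (hA : MeasurableSet A)
    (hB : MeasurableSet B) (h : D.measure A ≤ D.measure B) :
    X.nrm (A.indicator fun _ => (1 : ℝ)) ≤ X.nrm (B.indicator fun _ => (1 : ℝ)) := by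
  refine hX _ _ (measurable_const.indicator hA).aestronglyMeasurable
    (measurable_const.indicator hB).aestronglyMeasurable fun s => ?_
  have key : ∀ S : Set ℝ, {x | s < ‖S.indicator (fun _ => (1 : ℝ)) x‖ₑ} = if s < 1 then S else ∅ := by
    intro S
    ext x
    by_cases hx : x ∈ S <;> by_cases hs : s < 1 <;> simp [hx, hs]
  rw [key, key]
  split_ifs
  · exact h
  · simp

theorem measure_Ico_dyadic (k : D.index) (l : ℤ) (hl : l ≤ k) {c : ℝ} (h0 : 0 ≤ c)
    (hc : c ≤ (2 : ℝ) ^ (k : ℤ)) :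
    D.measure (Ico c (c + (2 : ℝ) ^ l)) = ENNReal.ofReal ((2 : ℝ) ^ l) := by
  have hsub : Ico c (c + (2 : ℝ) ^ l) ⊆ D.set := by
    intro x hx
    obtain ⟨k, hk⟩ := k
    cases D
    · refine ⟨h0.trans hx.1, hx.2.le.trans ?_⟩
      have hk' : k < 0 := hk
      have h1 : (2 : ℝ) ^ l ≤ (2 : ℝ) ^ k := zpow_le_zpow_right₀ one_le_two hl
      have h2 : (2 : ℝ) ^ (k + 1) ≤ 1 := zpow_le_one_of_nonpos₀ one_le_two (by omega)
      rw [zpow_add_one₀ two_ne_zero] at h2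
      change c ≤ (2 : ℝ) ^ k at hc
      linarith
    · exact h0.trans hx.1
  rw [Measure.restrict_apply measurableSet_Ico, Set.inter_eq_left.2 hsub, Real.volume_Ico,
    add_sub_cancel_left]

theorem DistMono.fundam_mono (hX : X.DistMono) : Monotone X.fundam := by
  intro k l hkl
  rw [← ENNReal.coe_le_coe, coe_fundam_eq_nrm, coe_fundam_eq_nrm]
  refine hX.nrm_indicator_le measurableSet_Ico measurableSet_Ico ?_
  rw [measure_dyadic, measure_dyadic]
  exact ENNReal.ofReal_le_ofReal (zpow_le_zpow_right₀ one_le_two hkl)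

/-- Averaging over one set. -/
theorem DistMono.average_mul_fundam_le (hX : X.DistMono) {B : Set ℝ} (hB : MeasurableSet B)
    (htop : D.measure B ≠ ∞) (k : D.index) (hk : D.measure (dyadic (k : ℤ)) ≤ D.measure B)
    {v : ℝ → ℝ} (hv : Measurable v) (c : ℝ≥0)
    (hc : c * D.measure B ≤ ∫⁻ x in B, ‖v x‖ₑ ∂D.measure) : c * X.fundam k ≤ X.nrm v := by
  have hm : Measurable ((dyadic (k : ℤ)).indicator fun _ => (1 : ℝ)) :=
    measurable_const.indicator measurableSet_Ico
  have h1 := hX.nrm_le_of_average (ι := Unit) (B := fun _ => B) (fun _ => hB)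
    (fun i j hij => absurd (Subsingleton.elim i j) hij) (fun _ => htop)
    (c := fun _ => (2 : ℝ) ^ (k : ℤ)) (l := fun _ => (2 : ℝ) ^ (k : ℤ)) (fun _ => by positivity)
    (fun _ => (measure_dyadic k).ge.trans hk)
    (fun i j hij => absurd (Subsingleton.elim i j) hij)
    (F := (c : ℝ) • (dyadic (k : ℤ)).indicator fun _ => (1 : ℝ)) hv (hm.const_smul _)
    (fun x hx => by
      have h2 : x ∉ dyadic (k : ℤ) := hx ()
      simp [h2]) (fun _ x hx => by
        have h2 : x ∈ dyadic (k : ℤ) := hx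
        refine le_trans (le_of_eq ?_) hc
        simp [h2])
  rwa [X.nrm_smul hm.aestronglyMeasurable, ← coe_fundam_eq_nrm, Real.enorm_eq_ofReal c.coe_nonneg,
    ENNReal.ofReal_coe_nnreal] at h1

/-- The weight of the couple `(L_1, X)`. -/
noncomputable def weightOne (X : KotheSpace D.measure) (k : D.index) : ℝ≥0 :=
  2 * (2 : ℝ≥0) ^ (k : ℤ) / X.fundam k

theorem ofReal_two_zpow (k : ℤ) : ENNReal.ofReal ((2 : ℝ) ^ k) = ((2 : ℝ≥0) ^ k : ℝ≥0) := by
  rw [← ENNReal.ofReal_coe_nnreal]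
  push_cast
  rfl

/-- This is the quasi-concavity of the fundamental function: spreading the characteristic function
of a short interval over a longer one by averaging does not increase the norm, so φ(s)/s decreases.
-/
theorem DistMono.weightOne_mono (hX : X.DistMono) : Monotone X.weightOne := by
  intro k l hkl
  have hkl' : (k : ℤ) ≤ l := hkl
  have h1 : ((2 : ℝ≥0) ^ (k : ℤ) / (2 : ℝ≥0) ^ (l : ℤ) : ℝ≥0) * X.fundam l ≤ (X.fundam k : ℝ≥0∞) := by
    rw [coe_fundam_eq_nrm k]
    have hB := measure_Ico_dyadic l l le_rfl (c := (2 : ℝ) ^ (k : ℤ)) (by positivity)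
      (zpow_le_zpow_right₀ one_le_two hkl')
    refine hX.average_mul_fundam_le
      (B := Ico ((2 : ℝ) ^ (k : ℤ)) ((2 : ℝ) ^ (k : ℤ) + (2 : ℝ) ^ (l : ℤ))) measurableSet_Ico
      (by rw [hB]; exact ENNReal.ofReal_ne_top) l (by rw [hB, measure_dyadic])
      (measurable_const.indicator (measurableSet_dyadic k)) _ ?_
    have hsub : dyadic (k : ℤ) ⊆ Ico ((2 : ℝ) ^ (k : ℤ)) ((2 : ℝ) ^ (k : ℤ) + (2 : ℝ) ^ (l : ℤ)) :=
      Ico_subset_Ico_right (by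
        have := zpow_le_zpow_right₀ (one_le_two (α := ℝ)) hkl'
        linarith)
    have h2 : ∀ x, ‖(dyadic (k : ℤ)).indicator (fun _ => (1 : ℝ)) x‖ₑ =
        (dyadic (k : ℤ)).indicator (fun _ => (1 : ℝ≥0∞)) x := fun x => by
      by_cases hx : x ∈ dyadic (k : ℤ) <;> simp [hx]
    rw [lintegral_congr h2, lintegral_indicator_const (measurableSet_dyadic _), one_mul,
      Measure.restrict_apply (measurableSet_dyadic _),
      Set.inter_eq_left.2 hsub, measure_dyadic, hB, ofReal_two_zpow, ofReal_two_zpow,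
      ← ENNReal.coe_mul]
    refine ENNReal.coe_le_coe.2 (le_of_eq ?_)
    field_simp
  rw [weightOne, weightOne, div_le_div_iff₀ (fundam_pos k) (fundam_pos l)]
  have h3 : (2 : ℝ≥0) ^ (k : ℤ) / (2 : ℝ≥0) ^ (l : ℤ) * X.fundam l ≤ X.fundam k := by
    exact_mod_cast h1
  have h4 : (2 : ℝ≥0) ^ (k : ℤ) * X.fundam l = (2 : ℝ≥0) ^ (l : ℤ) *
      ((2 : ℝ≥0) ^ (k : ℤ) / (2 : ℝ≥0) ^ (l : ℤ) * X.fundam l) := by field_simp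
  rw [mul_assoc, mul_assoc, h4]
  exact mul_le_mul_right (mul_le_mul_right h3 _) _

/-- Finitely many nonzero terms lie below one of them. -/
theorem exists_last_index {ι : Type*} [LinearOrder ι] (A : Finset ι) (u : ι → ℝ) :
    (A : Set ι).indicator u = 0 ∨ ∃ n ∈ A, u n ≠ 0 ∧ ∀ k ∈ A, u k ≠ 0 → k ≤ n := by
  classical
  rcases (A.filter fun k => u k ≠ 0).eq_empty_or_nonempty with h | h
  · left
    ext k
    by_cases hk : k ∈ A
    · have : u k = 0 := by
        by_contra h'
        exact Finset.notMem_empty k (h ▸ Finset.mem_filter.2 ⟨hk, h'⟩)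
      simp [this]
    · simp [hk]
  · right
    have h1 := Finset.mem_filter.1 (Finset.max'_mem _ h)
    exact ⟨_, h1.1, h1.2, fun k hk hk' => Finset.le_max' _ _ (Finset.mem_filter.2 ⟨hk, hk'⟩)⟩

theorem stepFun_indicator_eq_zero (A : Finset D.index) {u : D.index → ℝ} {n : D.index}
    (hn : ∀ k ∈ A, u k ≠ 0 → k ≤ n) {t : ℝ} (ht : t ∉ Ico 0 (0 + (2 : ℝ) ^ ((n : ℤ) + 1))) :
    stepFun ((A : Set D.index).indicator u) t = 0 := by
  by_cases h' : ∃ k : D.index, t ∈ dyadic (k : ℤ)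
  · obtain ⟨k, hk⟩ := h'
    rw [stepFun_of_mem _ hk]
    by_contra h0
    have hkA : k ∈ A := by
      by_contra h1
      exact h0 (by simp [h1])
    rw [Set.indicator_of_mem (by exact_mod_cast hkA)] at h0
    have hkn : (k : ℤ) ≤ n := hn k hkA h0
    rw [dyadic_eq] at hk
    refine ht ⟨le_trans (by positivity) hk.1, ?_⟩
    rw [zero_add]
    exact hk.2.trans_le (zpow_le_zpow_right₀ one_le_two (by omega))
  · push Not at h'
    exact stepFun_of_notMem _ h'

theorem measure_Ico_next (n : D.index) :
    D.measure (Ico 0 (0 + (2 : ℝ) ^ ((n : ℤ) + 1))) = ENNReal.ofReal ((2 : ℝ) ^ ((n : ℤ) + 1)) := by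
  have hsub : Ico 0 (0 + (2 : ℝ) ^ ((n : ℤ) + 1)) ⊆ D.set := by
    intro x hx
    obtain ⟨n, hn⟩ := n
    cases D
    · refine ⟨hx.1, hx.2.le.trans ?_⟩
      have hn' : n < 0 := hn
      rw [zero_add]
      refine zpow_le_one_of_nonpos₀ one_le_two ?_
      change n + 1 ≤ 0
      omega
    · exact hx.1
  rw [Measure.restrict_apply measurableSet_Ico, Set.inter_eq_left.2 hsub, Real.volume_Ico,
    add_sub_cancel_left]

/-- A vector that ends at n dominates in norm the average of its L_1 mass; this is the first
inequality. The second is the triangle inequality N(u) ≤ Σ|u_k|φ(2^k), weighed termwise. -/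
theorem DistMono.compat_one (hX : X.DistMono) :
    SeqNorm.Compat X.dyadicNorm (lebesgue D.measure 1 le_rfl).dyadicNorm X.weightOne 2 where
  pos k := div_pos (by positivity) (fundam_pos k)
  low τ u hu := by
    refine SeqNorm.fatou _ fun A => ?_
    rcases exists_last_index A u with h | ⟨n, hnA, hn0, hn⟩
    · rw [h, SeqNorm.map_zero]
      exact zero_le
    set M := (lebesgue D.measure 1 le_rfl).dyadicNorm with hM
    set v := (A : Set D.index).indicator u with hv
    have hMtop : M v ≠ ∞ := M.finite_ne_top A.finite_toSet u
    set P : ℝ≥0 := (M v).toNNReal with hP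
    have hPM : (P : ℝ≥0∞) = M v := ENNReal.coe_toNNReal hMtop
    -- This interval carries the whole mass P, so P/2^(n+1) is a mean value over a set longer than
    -- the n-th dyadic interval. The factor 2 in `weightOne` offsets the length 2^(n+1).
    set B : Set ℝ := Ico 0 (0 + (2 : ℝ) ^ ((n : ℤ) + 1)) with hB
    have hμB : D.measure B = ((2 : ℝ≥0) ^ ((n : ℤ) + 1) : ℝ≥0) := by
      rw [hB, measure_Ico_next, ofReal_two_zpow]
    have h1 := hX.average_mul_fundam_le (B := B) measurableSet_Ico (by rw [hμB]; exact ENNReal.coe_ne_top) n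
      (by
        rw [hμB, measure_dyadic, ofReal_two_zpow]
        exact ENNReal.coe_le_coe.2 (zpow_le_zpow_right₀ one_le_two (by omega)))
      (measurable_stepFun v) (P / (2 : ℝ≥0) ^ ((n : ℤ) + 1)) (by
        rw [hμB, ← ENNReal.coe_mul, div_mul_cancel₀ _ (by positivity), hPM, hM,
          dyadicNorm_one_eq_lintegral, ← lintegral_indicator measurableSet_Ico]
        refine lintegral_mono fun t => ?_
        by_cases ht : t ∈ B
        · rw [Set.indicator_of_mem ht]
        · rw [stepFun_indicator_eq_zero A hn ht, enorm_zero]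
          exact zero_le)
    rw [← dyadicNorm_apply, ← ENNReal.coe_mul] at h1
    have h2 : X.dyadicNorm v ≤ X.dyadicNorm u := X.dyadicNorm.indicator_le _ _
    rw [← hPM]
    have h3 : P = X.weightOne n * (P / (2 : ℝ≥0) ^ ((n : ℤ) + 1) * X.fundam n) := by
      have := (fundam_pos (X := X) n).ne'
      rw [weightOne, zpow_add_one₀ two_ne_zero]
      field_simp
    calc (P : ℝ≥0∞) = X.weightOne n * ((P / (2 : ℝ≥0) ^ ((n : ℤ) + 1) * X.fundam n : ℝ≥0) : ℝ≥0∞) := by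
          rw [← ENNReal.coe_mul, ← h3]
      _ ≤ τ * X.dyadicNorm u := mul_le_mul' (ENNReal.coe_le_coe.2 (hu n hn0)) (h1.trans h2)
  high τ u hu := by
    have h1 := X.dyadicNorm.le_tsum_of_cover u (fun k : D.index => {k}) (fun k => ‖u k‖ₑ * X.fundam k)
      (fun k _ => ⟨k, rfl⟩) fun k => by rw [SeqNorm.indicator_singleton, coe_fundam]
    refine (mul_le_mul_right h1 _).trans ?_
    rw [dyadicNorm_one, ← ENNReal.tsum_mul_left, ← ENNReal.tsum_mul_left]
    refine ENNReal.tsum_le_tsum fun k => ?_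
    by_cases h0 : u k = 0
    · simp [h0]
    have h2 := hu k h0
    rw [weightOne, le_div_iff₀ (fundam_pos k)] at h2
    calc (τ : ℝ≥0∞) * (‖u k‖ₑ * X.fundam k) = ((τ * X.fundam k : ℝ≥0) : ℝ≥0∞) * ‖u k‖ₑ := by
          push_cast; ring
      _ ≤ ((2 * 2 ^ (k : ℤ) : ℝ≥0) : ℝ≥0∞) * ‖u k‖ₑ := mul_le_mul_left (ENNReal.coe_le_coe.2 h2) _
      _ = _ := by rw [ofReal_two_zpow, ENNReal.coe_mul, mul_assoc]

/-- The weight of the couple `(L_∞, X)`. -/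
noncomputable def weightTop (X : KotheSpace D.measure) (k : (D.index)ᵒᵈ) : ℝ≥0 :=
  (X.fundam (OrderDual.ofDual k))⁻¹

theorem DistMono.weightTop_mono (hX : X.DistMono) : Monotone X.weightTop := fun _ l hkl =>
  inv_anti₀ (fundam_pos (OrderDual.ofDual l)) (hX.fundam_mono hkl)

/-- In the reversed order the second inequality concerns vectors that end at a last index n. Such a
vector is at most its supremum on [0,2^(n+1)), whose characteristic function has norm at most
2φ(2^n); the first inequality looks at single coordinates. -/
theorem DistMono.compat_top (hX : X.DistMono) :
    SeqNorm.Compat X.dyadicNorm.dual (lebesgue D.measure ∞ le_top).dyadicNorm.dual X.weightTop 2 where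
  pos k := inv_pos.2 (fundam_pos _)
  low τ u hu := by
    change (lebesgue D.measure ∞ le_top).dyadicNorm (u ∘ OrderDual.toDual) ≤
      τ * X.dyadicNorm (u ∘ OrderDual.toDual)
    set u' : D.index → ℝ := u ∘ OrderDual.toDual with hu'
    rw [dyadicNorm_top_le_iff]
    intro k
    by_cases h0 : u' k = 0
    · rw [h0, enorm_zero]
      exact zero_le
    have h1 := X.dyadicNorm.indicator_le {k} u'
    rw [SeqNorm.indicator_singleton, ← coe_fundam] at h1
    have h2 : (X.fundam k)⁻¹ ≤ τ := hu k h0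
    calc ‖u' k‖ₑ = ((X.fundam k)⁻¹ : ℝ≥0) * (‖u' k‖ₑ * X.fundam k) := by
          rw [mul_left_comm, ← ENNReal.coe_mul, inv_mul_cancel₀ (fundam_pos k).ne', ENNReal.coe_one,
            mul_one]
      _ ≤ τ * X.dyadicNorm u' := mul_le_mul' (ENNReal.coe_le_coe.2 h2) h1
  high τ u hu := by
    change (τ : ℝ≥0∞) * X.dyadicNorm (u ∘ OrderDual.toDual) ≤
      (2 : ℝ≥0) * (lebesgue D.measure ∞ le_top).dyadicNorm (u ∘ OrderDual.toDual)
    set u' : D.index → ℝ := u ∘ OrderDual.toDual with hu'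
    set M := (lebesgue D.measure ∞ le_top).dyadicNorm with hM
    rcases eq_or_ne (M u') ∞ with htop | htop
    · rw [htop, ENNReal.mul_top (by simp)]
      exact le_top
    rcases eq_or_ne τ 0 with rfl | hτ
    · simp
    rw [mul_comm, ← ENNReal.le_div_iff_mul_le (Or.inl (by exact_mod_cast hτ)) (Or.inl ENNReal.coe_ne_top)]
    refine SeqNorm.fatou _ fun A => ?_
    rcases exists_last_index A u' with h | ⟨n, hnA, hn0, hn⟩
    · rw [h, SeqNorm.map_zero]
      exact zero_le
    rw [ENNReal.le_div_iff_mul_le (Or.inl (by exact_mod_cast hτ)) (Or.inl ENNReal.coe_ne_top)]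
    set P : ℝ≥0 := (M u').toNNReal with hP
    have hPM : (P : ℝ≥0∞) = M u' := ENNReal.coe_toNNReal htop
    set χ : Set ℝ → ℝ → ℝ := fun S => S.indicator fun _ => (1 : ℝ) with hχ
    have hχm : ∀ c d : ℝ, Measurable (χ (Ico c d)) := fun c d =>
      measurable_const.indicator measurableSet_Ico
    -- [0,2^(n+1)) is split into two intervals of length 2^n, each of norm at most φ(2^n).
    have h1 : X.dyadicNorm ((A : Set D.index).indicator u') ≤
        X.nrm ((P : ℝ) • (χ (Ico 0 (0 + (2 : ℝ) ^ (n : ℤ))) + χ (dyadic (n : ℤ)))) := by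
      rw [dyadicNorm_apply]
      refine X.nrm_mono (measurable_stepFun _).aestronglyMeasurable (Eventually.of_forall fun t => ?_)
      by_cases ht : t ∈ Ico 0 (0 + (2 : ℝ) ^ ((n : ℤ) + 1))
      swap
      · rw [stepFun_indicator_eq_zero A hn ht, abs_zero]
        exact abs_nonneg _
      have h2 : χ (Ico 0 (0 + (2 : ℝ) ^ (n : ℤ))) t + χ (dyadic (n : ℤ)) t = 1 := by
        rw [zero_add] at ht
        rcases lt_or_ge t ((2 : ℝ) ^ (n : ℤ)) with h | h
        · have h3 : t ∈ Ico 0 (0 + (2 : ℝ) ^ (n : ℤ)) := ⟨ht.1, by rwa [zero_add]⟩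
          have h4 : t ∉ dyadic (n : ℤ) := fun h' => absurd h'.1 (not_le.2 h)
          simp only [hχ]
          rw [Set.indicator_of_mem h3, Set.indicator_of_notMem h4, add_zero]
        · have h3 : t ∉ Ico 0 (0 + (2 : ℝ) ^ (n : ℤ)) := fun h' => by
            rw [zero_add] at h'
            exact absurd h'.2 (not_lt.2 h)
          have h4 : t ∈ dyadic (n : ℤ) := by
            rw [dyadic_eq]
            exact ⟨h, ht.2⟩
          simp only [hχ]
          rw [Set.indicator_of_notMem h3, Set.indicator_of_mem h4, zero_add]
      rw [Pi.smul_apply, Pi.add_apply, h2, smul_eq_mul, mul_one, abs_of_nonneg P.coe_nonneg]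
      by_cases h' : ∃ k : D.index, t ∈ dyadic (k : ℤ)
      · obtain ⟨k, hk⟩ := h'
        rw [stepFun_of_mem _ hk]
        refine (SeqNorm.abs_indicator_le _ _ _).trans ?_
        have h5 := (dyadicNorm_top_le_iff u' (P : ℝ≥0∞)).1 hPM.ge k
        rw [← Real.enorm_abs, Real.enorm_eq_ofReal (abs_nonneg _), ← ENNReal.ofReal_coe_nnreal] at h5
        exact (ENNReal.ofReal_le_ofReal_iff P.coe_nonneg).1 h5
      · push Not at h'
        rw [stepFun_of_notMem _ h', abs_zero]
        exact P.coe_nonneg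
    have h2 : X.nrm (χ (Ico 0 (0 + (2 : ℝ) ^ (n : ℤ)))) ≤ X.fundam n := by
      rw [coe_fundam_eq_nrm]
      refine hX.nrm_indicator_le measurableSet_Ico measurableSet_Ico ?_
      rw [measure_dyadic, measure_Ico_dyadic n n le_rfl le_rfl (by positivity)]
    have h3 : X.nrm (χ (dyadic (n : ℤ))) ≤ X.fundam n := (coe_fundam_eq_nrm n).ge
    have h4 : τ ≤ (X.fundam n)⁻¹ := hu n hn0
    have hχ2 : Measurable (χ (dyadic (n : ℤ))) := hχm _ _
    rw [X.nrm_smul ((hχm _ _).add hχ2).aestronglyMeasurable, Real.enorm_eq_ofReal P.coe_nonneg,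
      ENNReal.ofReal_coe_nnreal] at h1
    calc X.dyadicNorm ((A : Set D.index).indicator u') * τ
        ≤ P * (X.fundam n + X.fundam n) * ((X.fundam n)⁻¹ : ℝ≥0) :=
          mul_le_mul' (h1.trans (mul_le_mul_right ((X.nrm_add_le _ _).trans (add_le_add h2 h3)) _))
            (ENNReal.coe_le_coe.2 h4)
      _ = ((P * (X.fundam n + X.fundam n) * (X.fundam n)⁻¹ : ℝ≥0) : ℝ≥0∞) := by push_cast; rfl
      _ = ((2 * P : ℝ≥0) : ℝ≥0∞) := by
        congr 1
        have := (fundam_pos (X := X) n).ne'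
        field_simp
        ring
      _ = _ := by rw [ENNReal.coe_mul, hPM]

end KotheSpace

/-! ### Comparison with the normalised shift properties, and necessity of elasticity. -/

namespace SeqNorm

theorem SeqCalderon.dual {ι : Type*} {M N : SeqNorm ι} (h : SeqCalderon M N) :
    SeqCalderon M.dual N.dual := h

/-- A finite family of pairs can be reindexed by an initial interval and normalised. -/
theorem exists_normalised {ι : Type*} (N : SeqNorm ι) (s : Finset ℤ) (x y : ℤ → ι → ℝ)
    (hle : ∀ n ∈ s, N (x n) ≤ N (y n)) (hfin : ∀ n ∈ s, (Function.support (y n)).Finite) :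
    ∃ (m : ℕ) (e : ℤ → ℤ) (β : ℤ → ℝ), (∀ i ∈ Finset.Ico 0 (m : ℤ), e i ∈ s) ∧
      (∀ i ∈ Finset.Ico 0 (m : ℤ), ∀ j ∈ Finset.Ico 0 (m : ℤ), i < j → e i < e j) ∧
      (∀ i ∈ Finset.Ico 0 (m : ℤ), N ((β i)⁻¹ • x (e i)) ≤ 1 ∧ N ((β i)⁻¹ • y (e i)) = 1) ∧
      ∑ n ∈ s, x n = ∑ i ∈ Finset.Ico 0 (m : ℤ), β i • (β i)⁻¹ • x (e i) ∧
      ∑ n ∈ s, y n = ∑ i ∈ Finset.Ico 0 (m : ℤ), β i • (β i)⁻¹ • y (e i) := by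
  classical
  -- Where y vanishes so does x, because its norm is not larger. The remaining pairs can be divided
  -- by N(y).
  set s' := s.filter fun n => N (y n) ≠ 0 with hs'
  have hsub : s' ⊆ s := Finset.filter_subset _ _
  set e : ℤ → ℤ := fun i => if h : i.toNat < s'.card then s'.orderEmbOfFin rfl ⟨i.toNat, h⟩ else 0
    with he
  have hi : ∀ i ∈ Finset.Ico 0 (s'.card : ℤ), i.toNat < s'.card := fun i hi => by
    have := Finset.mem_Ico.1 hi
    omega
  have hes : ∀ i ∈ Finset.Ico 0 (s'.card : ℤ), e i ∈ s' := fun i h => by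
    simp only [he, hi i h, dif_pos]
    exact Finset.orderEmbOfFin_mem _ _ _
  have hmono : ∀ i ∈ Finset.Ico 0 (s'.card : ℤ), ∀ j ∈ Finset.Ico 0 (s'.card : ℤ), i < j →
      e i < e j := fun i h j h' hij => by
    simp only [he, hi i h, hi j h', dif_pos]
    refine (s'.orderEmbOfFin rfl).strictMono ?_
    change i.toNat < j.toNat
    have := Finset.mem_Ico.1 h
    omega
  have himage : (Finset.Ico 0 (s'.card : ℤ)).image e = s' := by
    refine Finset.eq_of_subset_of_card_le (Finset.image_subset_iff.2 hes) ?_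
    rw [Finset.card_image_of_injOn, Int.card_Ico]
    · omega
    · intro i h j h' hij
      by_contra hne
      rcases lt_or_gt_of_ne hne with h1 | h1
      · exact absurd hij (hmono i h j h' h1).ne
      · exact absurd hij (hmono j h' i h h1).ne'
  have hinj : Set.InjOn e (Finset.Ico 0 (s'.card : ℤ)) := by
    intro i h j h' hij
    by_contra hne
    rcases lt_or_gt_of_ne hne with h1 | h1
    · exact absurd hij (hmono i h j h' h1).ne
    · exact absurd hij (hmono j h' i h h1).ne'
  have hfinN : ∀ n ∈ s, N (y n) ≠ ∞ := fun n hn => by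
    have := N.finite_ne_top (hfin n hn) (y n)
    rwa [Set.indicator_support] at this
  have hβ : ∀ i ∈ Finset.Ico 0 (s'.card : ℤ), 0 < (N (y (e i))).toReal := fun i h =>
    ENNReal.toReal_pos (Finset.mem_filter.1 (hes i h)).2 (hfinN _ (hsub (hes i h)))
  have hen : ∀ i ∈ Finset.Ico 0 (s'.card : ℤ), ‖(N (y (e i))).toReal⁻¹‖ₑ = (N (y (e i)))⁻¹ :=
    fun i h => by
      rw [Real.enorm_eq_ofReal (inv_nonneg.2 ENNReal.toReal_nonneg), ENNReal.ofReal_inv_of_pos (hβ i h),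
        ENNReal.ofReal_toReal (hfinN _ (hsub (hes i h)))]
  have hsum : ∀ z : ℤ → ι → ℝ, (∀ n ∈ s, N (y n) = 0 → z n = 0) → ∑ n ∈ s, z n =
      ∑ i ∈ Finset.Ico 0 (s'.card : ℤ), (N (y (e i))).toReal • (N (y (e i))).toReal⁻¹ • z (e i) := by
    intro z hz
    have h1 : ∑ n ∈ s, z n = ∑ n ∈ s', z n := by
      refine (Finset.sum_subset hsub fun n hn hn' => ?_).symm
      refine hz n hn ?_
      by_contra h
      exact hn' (Finset.mem_filter.2 ⟨hn, h⟩)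
    rw [h1, ← himage, Finset.sum_image hinj]
    refine Finset.sum_congr (by rw [himage]) fun i h => ?_
    rw [himage] at h
    rw [smul_smul, mul_inv_cancel₀ (hβ i h).ne', one_smul]
  refine ⟨s'.card, e, fun i => (N (y (e i))).toReal, fun i h => hsub (hes i h), hmono, fun i h => ?_,
    hsum x fun n hn h => ?_, hsum y fun n _ h => N.eq_zero h⟩
  · have h0 : N (y (e i)) ≠ 0 := (Finset.mem_filter.1 (hes i h)).2
    have ht := hfinN _ (hsub (hes i h))
    constructor
    · rw [N.map_smul, hen i h, ENNReal.inv_mul_le_iff h0 ht, mul_one]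
      exact hle _ (hsub (hes i h))
    · rw [N.map_smul, hen i h, ENNReal.inv_mul_cancel h0 ht]
  · exact N.eq_zero (le_antisymm ((hle n hn).trans h.le) zero_le)

variable {J : Set ℤ}

theorem leftShiftProperty_iff (N : SeqNorm J) :
    LeftShiftProperty N.toFun ↔ ∃ K, N.LeftShift K := by
  constructor
  · rintro ⟨C, hC⟩
    refine ⟨C, fun s x y hle hfin hlt hnext => ?_⟩
    obtain ⟨m, e, β, hes, hmono, hN, hx, hy⟩ := exists_normalised N s x y hle fun n hn => (hfin n hn).2
    have hsx : ∀ (z : ℤ → J → ℝ) i j, ((β i)⁻¹ • z (e i)) j ≠ 0 → z (e i) j ≠ 0 := fun z i j h =>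
      right_ne_zero_of_mul h
    have := hC (Set.Ico 0 (m : ℤ)) (fun i => (β i)⁻¹ • x (e i)) (fun i => (β i)⁻¹ • y (e i))
      Set.ordConnected_Ico ⟨fun i hi => ?_, fun i hi => ?_, fun i hi => ?_, fun i hi j hj hij => ?_⟩
      (fun i hi => hN i (by simpa using hi)) (Finset.Ico 0 (m : ℤ)) β (by simp)
    · rw [← hx, ← hy] at this
      exact this
    · exact (hfin _ (hes i (by simpa using hi))).1.subset fun j hj => hsx x i j hj
    · exact (hfin _ (hes i (by simpa using hi))).2.subset fun j hj => hsx y i j hj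
    · exact fun a ha b hb => hlt _ (hes i (by simpa using hi)) a b (hsx x i a ha) (hsx y i b hb)
    · intro a ha b hb
      have hi' : i ∈ Finset.Ico 0 (m : ℤ) := by simpa using hi
      have hj' : j ∈ Finset.Ico 0 (m : ℤ) := by simpa using hj
      exact hnext _ (hes i hi') _ (hes j hj') (hmono i hi' j hj' hij) a b
        (ha.imp (hsx x i a) (hsx y i a)) (hb.imp (hsx x j b) (hsx y j b))
  · rintro ⟨K, hK⟩
    refine ⟨K, fun I x y _ hint hN s α hs => ?_⟩
    have hsm : ∀ (z : ℤ → J → ℝ) n j, (α n • z n) j ≠ 0 → z n j ≠ 0 := fun z n j h =>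
      right_ne_zero_of_mul h
    refine hK s (fun n => α n • x n) (fun n => α n • y n) (fun n hn => ?_) (fun n hn => ⟨?_, ?_⟩)
      (fun n hn i j hi hj => hint.lt n (hs hn) i (hsm x n i hi) j (hsm y n j hj))
      (fun m hm n hn hmn i j hi hj => hint.lt_next m (hs hm) n (hs hn) hmn i
        (hi.imp (hsm x m i) (hsm y m i)) j (hj.imp (hsm x n j) (hsm y n j)))
    · rw [N.map_smul, N.map_smul]
      exact mul_le_mul_right ((hN n (hs hn)).1.trans (hN n (hs hn)).2.ge) _
    · exact (hint.finite_left n (hs hn)).subset fun j hj => hsm x n j hj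
    · exact (hint.finite_right n (hs hn)).subset fun j hj => hsm y n j hj

/-- Reversing the index set reverses the sequence of pairs, so n is replaced by -n, and inside each
pair the two members change places. -/
theorem rightShiftProperty_iff (N : SeqNorm J) :
    RightShiftProperty N.toFun ↔ ∃ K, N.dual.LeftShift K := by
  constructor
  · rintro ⟨C, hC⟩
    refine ⟨C, fun s x y hle hfin hlt hnext => ?_⟩
    let x' : ℤ → J → ℝ := fun n => x (-n)
    let y' : ℤ → J → ℝ := fun n => y (-n)
    have hneg : ∀ n ∈ s.image (-·), -n ∈ s := fun n hn => by
      obtain ⟨k, hk, rfl⟩ := Finset.mem_image.1 hn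
      simpa using hk
    have hsum : ∀ z : ℤ → J → ℝ, ∑ n ∈ s, z n = ∑ n ∈ s.image (-·), z (-n) := fun z => by
      rw [Finset.sum_image fun a _ b _ h => neg_injective h]
      simp
    obtain ⟨m, e, β, hes, hmono, hN, hx, hy⟩ := exists_normalised N (s.image (-·)) x' y'
      (fun n hn => hle _ (hneg n hn)) fun n hn => (hfin _ (hneg n hn)).2
    have hsx : ∀ (z : ℤ → J → ℝ) i j, ((β i)⁻¹ • z (e i)) j ≠ 0 → z (e i) j ≠ 0 := fun z i j h =>
      right_ne_zero_of_mul h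
    have := hC (Set.Ico 0 (m : ℤ)) (fun i => (β i)⁻¹ • y' (e i)) (fun i => (β i)⁻¹ • x' (e i))
      Set.ordConnected_Ico ⟨fun i hi => ?_, fun i hi => ?_, fun i hi => ?_, fun i hi j hj hij => ?_⟩
      (fun i hi => hN i (by simpa using hi)) (Finset.Ico 0 (m : ℤ)) β (by simp)
    · change N (∑ n ∈ s, (x n : J → ℝ)) ≤ C * N (∑ n ∈ s, (y n : J → ℝ))
      rw [← hx, ← hy, ← hsum x, ← hsum y] at this
      exact this
    · exact (hfin _ (hneg _ (hes i (by simpa using hi)))).2.subset fun j hj => hsx y' i j hj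
    · exact (hfin _ (hneg _ (hes i (by simpa using hi)))).1.subset fun j hj => hsx x' i j hj
    · exact fun a ha b hb => hlt _ (hneg _ (hes i (by simpa using hi))) b a (hsx x' i b hb)
        (hsx y' i a ha)
    · intro a ha b hb
      have hi' : i ∈ Finset.Ico 0 (m : ℤ) := by simpa using hi
      have hj' : j ∈ Finset.Ico 0 (m : ℤ) := by simpa using hj
      exact hnext _ (hneg _ (hes j hj')) _ (hneg _ (hes i hi')) (neg_lt_neg (hmono i hi' j hj' hij)) b a
        (hb.symm.imp (hsx x' j b) (hsx y' j b)) (ha.symm.imp (hsx x' i a) (hsx y' i a))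
  · rintro ⟨K, hK⟩
    refine ⟨K, fun I x y _ hint hN s α hs => ?_⟩
    have hsm : ∀ (z : ℤ → J → ℝ) n j, (α n • z n) j ≠ 0 → z n j ≠ 0 := fun z n j h =>
      right_ne_zero_of_mul h
    have hneg : ∀ n ∈ s.image (-·), -n ∈ s := fun n hn => by
      obtain ⟨k, hk, rfl⟩ := Finset.mem_image.1 hn
      simpa using hk
    have hsum : ∀ z : ℤ → J → ℝ, ∑ n ∈ s, z n = ∑ n ∈ s.image (-·), z (-n) := fun z => by
      rw [Finset.sum_image fun a _ b _ h => neg_injective h]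
      simp
    have := hK (s.image (-·)) (fun n => α (-n) • y (-n)) (fun n => α (-n) • x (-n)) (fun n hn => ?_)
      (fun n hn => ⟨?_, ?_⟩)
      (fun n hn i j hi hj => hint.lt _ (hs (hneg n hn)) j (hsm x _ j hj) i (hsm y _ i hi))
      (fun m hm n hn hmn i j hi hj => hint.lt_next _ (hs (hneg n hn)) _ (hs (hneg m hm))
        (neg_lt_neg hmn) j (hj.symm.imp (hsm x _ j) (hsm y _ j)) i
        (hi.symm.imp (hsm x _ i) (hsm y _ i)))
    · change N (∑ n ∈ s.image (-·), (α (-n) • y (-n) : J → ℝ)) ≤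
        K * N (∑ n ∈ s.image (-·), (α (-n) • x (-n) : J → ℝ)) at this
      rw [← hsum fun n => α n • y n, ← hsum fun n => α n • x n] at this
      exact this
    · change N (α (-n) • y (-n)) ≤ N (α (-n) • x (-n))
      rw [N.map_smul, N.map_smul]
      exact mul_le_mul_right ((hN _ (hs (hneg n hn))).1.trans (hN _ (hs (hneg n hn))).2.ge) _
    · exact (hint.finite_right _ (hs (hneg n hn))).subset fun j hj => hsm y _ j hj
    · exact (hint.finite_left _ (hs (hneg n hn))).subset fun j hj => hsm x _ j hj

end SeqNorm

namespace KotheSpace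

variable {D : RIDomain} {X : KotheSpace D.measure}

/-- The L_1 norm has the left-shift property with constant 1, and the Calderón property hands it on
to E_X. -/
theorem DistMono.isCompressible (hX : X.DistMono)
    (h : IsCalderonCouple (lebesgue D.measure 1 le_rfl) X) : X.IsCompressible :=
  (SeqNorm.leftShiftProperty_iff X.dyadicNorm).2 (SeqNorm.LeftShift.of_seqCalderon hX.compat_one
    hX.weightOne_mono (h.seqCalderon (lebesgue_one_distMono _) hX) leftShift_one)

/-- The same transfer from L_∞ with the index set reversed, where left shifts of the reversed
sequence are right shifts. -/
theorem DistMono.isStretchable (hX : X.DistMono)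
    (h : IsCalderonCouple (lebesgue D.measure ∞ le_top) X) : X.IsStretchable :=
  (SeqNorm.rightShiftProperty_iff X.dyadicNorm).2 (SeqNorm.LeftShift.of_seqCalderon hX.compat_top
    hX.weightTop_mono (h.seqCalderon (lebesgue_top_distMono _) hX).dual leftShift_top_dual)

end KotheSpace

/-! ### Order continuity from concavity. -/

namespace SeqNorm

variable {ι : Type*}

/-- Every vector of finite norm has only boundedly many disjoint parts of norm at least `ε`. -/
def OrderCont (N : SeqNorm ι) : Prop :=
  ∀ u, N u ≠ ∞ → ∀ ε : ℝ≥0∞, 0 < ε → ∃ m : ℕ, ∀ S : ℕ → Set ι,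
    Pairwise (Function.onFun Disjoint S) → ∃ k < m, N ((S k).indicator u) ≤ ε

/-- If tails arbitrarily far out had norm above ε, Fatou would give finite pieces of them with norm
above ε. Chosen one after the other, each beyond the end of the previous one, they are infinitely
many disjoint parts. -/
theorem OrderCont.bddAbove [LinearOrder ι] [Nonempty ι] {N : SeqNorm ι} (hN : N.OrderCont) {u : ι → ℝ}
    (hu : N u ≠ ∞) {ε : ℝ≥0∞} (hε : 0 < ε) : BddAbove {n | ε < N ((Ici n).indicator u)} := by
  classical
  by_contra hcon
  rw [not_bddAbove_iff] at hcon
  have hF : ∀ a : ι, ∃ F : Finset ι, ∃ b : ι, (∀ i ∈ F, a < i ∧ i ≤ b) ∧ a ≤ b ∧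
      ε < N ((F : Set ι).indicator u) := fun a => by
    obtain ⟨n, hn, han⟩ := hcon a
    have h1 : ∃ A : Finset ι, ε < N ((A : Set ι).indicator ((Ici n).indicator u)) := by
      by_contra h
      push Not at h
      exact absurd (N.fatou h) (not_le.2 hn)
    obtain ⟨A, hA⟩ := h1
    set F := A.filter (n ≤ ·) with hFdef
    have h2 : (A : Set ι).indicator ((Ici n).indicator u) = (F : Set ι).indicator u := by
      rw [Set.indicator_indicator]
      congr 1
      ext i
      simp [hFdef]
    rw [h2] at hA
    rcases F.eq_empty_or_nonempty with h0 | h0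
    · rw [h0, Finset.coe_empty, Set.indicator_empty', N.map_zero] at hA
      exact absurd hA not_lt_zero
    refine ⟨F, F.max' h0, fun i hi => ⟨han.trans_le (Finset.mem_filter.1 hi).2, F.le_max' i hi⟩, ?_, hA⟩
    obtain ⟨i, hi⟩ := h0
    exact han.le.trans ((Finset.mem_filter.1 hi).2.trans (F.le_max' i hi))
  choose F b hF1 hF2 hF3 using hF
  obtain ⟨n₀⟩ := ‹Nonempty ι›
  set a : ℕ → ι := fun k => b^[k] n₀ with ha
  have ha1 : ∀ k, a (k + 1) = b (a k) := fun k => Function.iterate_succ_apply' b k n₀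
  have hmono : Monotone a := monotone_nat_of_le_succ fun k => by
    rw [ha1]
    exact hF2 _
  have hsub : ∀ k, (F (a k) : Set ι) ⊆ Ioc (a k) (a (Order.succ k)) := fun k x hx => by
    rw [Order.succ_eq_add_one, ha1]
    exact hF1 _ x hx
  obtain ⟨m, hm⟩ := hN u hu ε hε
  obtain ⟨k, -, hk⟩ := hm (fun k => (F (a k) : Set ι)) fun i j hij =>
    Disjoint.mono (hsub i) (hsub j) (hmono.pairwise_disjoint_on_Ioc_succ hij)
  exact absurd hk (not_le.2 (hF3 _))

theorem OrderCont.dual {N : SeqNorm ι} (hN : N.OrderCont) : N.dual.OrderCont :=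
  fun u hu ε hε => hN u hu ε hε

theorem OrderCont.bddBelow [LinearOrder ι] [Nonempty ι] {N : SeqNorm ι} (hN : N.OrderCont) {u : ι → ℝ}
    (hu : N u ≠ ∞) {ε : ℝ≥0∞} (hε : 0 < ε) : BddBelow {n | ε < N ((Iic n).indicator u)} := by
  obtain ⟨b, hb⟩ := hN.dual.bddAbove (u := u ∘ OrderDual.ofDual) hu hε
  exact ⟨OrderDual.ofDual b, fun n hn => hb (a := OrderDual.toDual n) hn⟩

end SeqNorm

namespace KotheSpace

variable {D : RIDomain} {X : KotheSpace D.measure}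

/-- The r-th power sum of disjoint parts of u is at most |u| pointwise. With m parts of norm above
ε, concavity gives m·ε^r ≤ (M·N(u))^r, which bounds m. -/
theorem IsConcave.orderCont {r : ℝ} (hr : 1 ≤ r) (h : X.IsConcave r) : X.dyadicNorm.OrderCont := by
  obtain ⟨M, hM⟩ := h
  intro u hu ε hε
  have hr0 : 0 < r := by linarith
  rcases eq_or_ne ε ∞ with rfl | hεt
  · exact ⟨1, fun S _ => ⟨0, one_pos, le_top⟩⟩
  have hfin : ((M * X.dyadicNorm u) / ε) ^ r ≠ ∞ :=
    ENNReal.rpow_ne_top_of_nonneg hr0.le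
      (ENNReal.div_ne_top (ENNReal.mul_ne_top ENNReal.coe_ne_top hu) hε.ne')
  obtain ⟨m, hm⟩ := ENNReal.exists_nat_gt hfin
  refine ⟨m, fun S hS => ?_⟩
  by_contra hcon
  push Not at hcon
  set w : D.index → ℝ := fun i => (∑ k : Fin m, |(S k).indicator u i| ^ r) ^ (1 / r) with hw
  have hwu : ∀ i, |w i| ≤ |u i| := fun i => by
    have h0 : 0 ≤ ∑ k : Fin m, |(S k).indicator u i| ^ r :=
      Finset.sum_nonneg fun k _ => Real.rpow_nonneg (abs_nonneg _) _
    rw [hw, abs_of_nonneg (Real.rpow_nonneg h0 _), one_div]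
    refine (Real.rpow_inv_le_iff_of_pos h0 (abs_nonneg _) hr0).2 ?_
    by_cases hi : ∃ k : Fin m, i ∈ S k
    · obtain ⟨k, hk⟩ := hi
      rw [Finset.sum_eq_single k, Set.indicator_of_mem hk]
      · intro l _ hl
        have : i ∉ S l := fun h => Set.disjoint_left.1 (hS fun h' => hl (Fin.ext h')) h hk
        rw [Set.indicator_of_notMem this, abs_zero, Real.zero_rpow hr0.ne']
      · simp
    · push Not at hi
      rw [Finset.sum_eq_zero fun k _ => by
        rw [Set.indicator_of_notMem (hi k), abs_zero, Real.zero_rpow hr0.ne']]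
      positivity
  have h1 := hM m (fun k => stepClass D ((S k).indicator u)) (fun k =>
    lt_top_iff_ne_top.2 (ne_top_of_le_ne_top hu (X.dyadicNorm.indicator_le (S k) u)))
    (stepClass D w) (by
      filter_upwards [AEEqFun.coeFn_mk (stepFun w) (measurable_stepFun w).aestronglyMeasurable,
        ae_all_iff.2 fun k : Fin m => AEEqFun.coeFn_mk (stepFun ((S k).indicator u))
          (measurable_stepFun ((S k).indicator u)).aestronglyMeasurable] with t h2 h3
      refine h2.trans ?_
      have h4 : ∀ k : Fin m, stepClass D ((S k).indicator u) t = stepFun ((S k).indicator u) t := h3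
      simp only [h4]
      by_cases h' : ∃ k : D.index, t ∈ dyadic (k : ℤ)
      · obtain ⟨k, hk⟩ := h'
        simp only [stepFun_of_mem _ hk, hw]
      · push Not at h'
        simp only [stepFun_of_notMem _ h', abs_zero, Real.zero_rpow hr0.ne', Finset.sum_const_zero]
        rw [Real.zero_rpow (one_div_pos.2 hr0).ne'])
  simp only [eNorm_stepClass] at h1
  have h2 : (m : ℝ≥0∞) * ε ^ r ≤ ∑ k : Fin m, X.dyadicNorm ((S k).indicator u) ^ r := by
    refine le_trans (le_of_eq ?_) (Finset.sum_le_sum fun k _ =>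
      ENNReal.rpow_le_rpow (hcon k k.2).le hr0.le)
    simp
  have h3 : (m : ℝ≥0∞) * ε ^ r ≤ (M * X.dyadicNorm u) ^ r := by
    refine h2.trans ?_
    rw [one_div] at h1
    exact (ENNReal.rpow_inv_le_iff hr0).1 (h1.trans (mul_le_mul_right (X.dyadicNorm.mono hwu) _))
  rw [ENNReal.div_rpow_of_nonneg _ _ hr0.le] at hm
  refine absurd h3 (not_le.2 ?_)
  have hε0 : ε ^ r ≠ 0 := (ENNReal.rpow_pos hε hεt).ne'
  have hεt' : ε ^ r ≠ ∞ := ENNReal.rpow_ne_top_of_nonneg hr0.le hεt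
  rwa [ENNReal.div_lt_iff (Or.inl hε0) (Or.inl hεt')] at hm

theorem orderCont_one : (lebesgue D.measure 1 le_rfl).dyadicNorm.OrderCont := by
  intro u hu ε hε
  obtain ⟨m, hm⟩ := ENNReal.exists_nat_gt (ENNReal.div_ne_top hu hε.ne')
  refine ⟨m, fun S hS => ?_⟩
  by_contra hcon
  push Not at hcon
  have h1 : (m : ℝ≥0∞) * ε ≤ ∑ k ∈ Finset.range m,
      (lebesgue D.measure 1 le_rfl).dyadicNorm ((S k).indicator u) := by
    refine le_trans (le_of_eq ?_) (Finset.sum_le_sum fun k hk => (hcon k (Finset.mem_range.1 hk)).le)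
    simp
  have h2 : ∑ k ∈ Finset.range m, (lebesgue D.measure 1 le_rfl).dyadicNorm ((S k).indicator u) ≤
      (lebesgue D.measure 1 le_rfl).dyadicNorm u := by
    simp only [dyadicNorm_one]
    rw [← Summable.tsum_finsetSum fun _ _ => ENNReal.summable]
    refine ENNReal.tsum_le_tsum fun i => ?_
    rw [← Finset.mul_sum]
    refine mul_le_mul_right ?_ _
    by_cases hi : ∃ k ∈ Finset.range m, i ∈ S k
    · obtain ⟨k, hkm, hk⟩ := hi
      rw [Finset.sum_eq_single_of_mem k hkm, Set.indicator_of_mem hk]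
      intro l _ hl
      have : i ∉ S l := fun h => Set.disjoint_left.1 (hS hl) h hk
      rw [Set.indicator_of_notMem this, enorm_zero]
    · push Not at hi
      rw [Finset.sum_eq_zero fun k hk => by rw [Set.indicator_of_notMem (hi k hk), enorm_zero]]
      exact zero_le
  have hεt : ε ≠ ∞ := fun h => by
    have h0 : m ≠ 0 := fun h0 => by simp [h0] at hm
    rw [h, ENNReal.mul_top (by exact_mod_cast h0)] at h1
    exact hu (top_le_iff.1 (h1.trans h2))
  rw [ENNReal.div_lt_iff (Or.inl hε.ne') (Or.inl hεt)] at hm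
  exact absurd (h1.trans h2) (not_le.2 hm)

end KotheSpace

/-! ### A function and the sampled values of its rearrangement. -/

namespace KotheSpace

variable {D : RIDomain}

/-- Lebesgue measure takes all intermediate values on the subsets of a set. -/
theorem exists_subset_measure_eq {S : Set ℝ} (hS : MeasurableSet S) {r : ℝ} (hr : 0 ≤ r)
    (h : ENNReal.ofReal r < D.measure S) :
    ∃ N ⊆ S, MeasurableSet N ∧ D.measure N = ENNReal.ofReal r := by
  -- The measure of S up to t is a 1-Lipschitz function of t; the intermediate value theorem
  -- applies.
  set F : ℝ → ℝ := fun t => D.measure.real (S ∩ Icc 0 t) with hF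
  have hfin : ∀ t, D.measure (S ∩ Icc 0 t) ≠ ∞ := fun t =>
    ne_top_of_le_ne_top (by rw [Real.volume_Icc]; exact ENNReal.ofReal_ne_top)
      ((measure_mono Set.inter_subset_right).trans (Measure.restrict_apply_le _ _) :
        D.measure (S ∩ Icc 0 t) ≤ volume (Icc 0 t))
  have hstep : ∀ s t, s ≤ t → F s ≤ F t ∧ F t ≤ F s + (t - s) := fun s t hst => by
    refine ⟨measureReal_mono (Set.inter_subset_inter_right _ (Icc_subset_Icc_right hst)) (hfin t), ?_⟩
    have h1 : D.measure (S ∩ Icc 0 t) ≤ D.measure (S ∩ Icc 0 s) + ENNReal.ofReal (t - s) := by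
      have h2 : S ∩ Icc 0 t ⊆ (S ∩ Icc 0 s) ∪ Ioc s t := fun x hx => by
        rcases le_or_gt x s with h | h
        · exact Or.inl ⟨hx.1, hx.2.1, h⟩
        · exact Or.inr ⟨h, hx.2.2⟩
      refine (measure_mono h2).trans ((measure_union_le _ _).trans (add_le_add le_rfl ?_))
      exact (Measure.restrict_apply_le _ _).trans Real.volume_Ioc.le
    have h3 := ENNReal.toReal_mono (ENNReal.add_ne_top.2 ⟨hfin s, ENNReal.ofReal_ne_top⟩) h1
    rwa [ENNReal.toReal_add (hfin s) ENNReal.ofReal_ne_top,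
      ENNReal.toReal_ofReal (sub_nonneg.2 hst)] at h3
  have hcont : Continuous F := by
    refine (LipschitzWith.of_dist_le_mul (K := 1) fun s t => ?_).continuous
    rw [NNReal.coe_one, one_mul, Real.dist_eq, Real.dist_eq]
    rcases le_total s t with hst | hst
    · have := hstep s t hst
      rw [abs_sub_comm s t, abs_sub_comm, abs_of_nonneg (sub_nonneg.2 hst), abs_of_nonneg] <;> linarith
    · have := hstep t s hst
      rw [abs_of_nonneg (sub_nonneg.2 hst), abs_of_nonneg] <;> linarith
  have hlim : Tendsto (fun n : ℕ => D.measure (S ∩ Icc 0 (n : ℝ))) atTop (𝓝 (D.measure S)) := by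
    have h1 : D.measure S = D.measure (⋃ n : ℕ, S ∩ Icc 0 (n : ℝ)) := by
      rw [← Set.inter_iUnion]
      have hD : MeasurableSet D.set := by cases D <;> [exact measurableSet_Icc; exact measurableSet_Ici]
      rw [Measure.restrict_apply' hD, Measure.restrict_apply' hD]
      congr 1
      ext x
      simp only [Set.mem_inter_iff, Set.mem_iUnion]
      constructor
      · rintro ⟨hx, hxD⟩
        refine ⟨⟨hx, ?_⟩, hxD⟩
        obtain ⟨n, hn⟩ := exists_nat_ge x
        refine ⟨n, ?_, hn⟩
        cases D
        · exact hxD.1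
        · exact hxD
      · rintro ⟨⟨hx, -⟩, hxD⟩
        exact ⟨hx, hxD⟩
    rw [h1]
    refine tendsto_measure_iUnion_atTop fun m n hmn => ?_
    exact Set.inter_subset_inter_right _ (Icc_subset_Icc_right (by exact_mod_cast hmn))
  obtain ⟨n, hn⟩ := (hlim.eventually (lt_mem_nhds h)).exists
  have h0 : F 0 = 0 := by
    have : D.measure (S ∩ Icc 0 0) = 0 := by
      refine measure_mono_null Set.inter_subset_right ?_
      rw [Icc_self]
      exact measure_singleton 0
    change (D.measure (S ∩ Icc 0 0)).toReal = 0
    rw [this, ENNReal.toReal_zero]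
  have h1 : r ∈ Icc (F 0) (F n) := by
    rw [h0]
    refine ⟨hr, ?_⟩
    exact (ENNReal.ofReal_le_iff_le_toReal (hfin n)).1 hn.le
  obtain ⟨t, -, ht⟩ := intermediate_value_Icc (Nat.cast_nonneg n) hcont.continuousOn h1
  refine ⟨S ∩ Icc 0 t, Set.inter_subset_left, hS.inter measurableSet_Icc, ?_⟩
  rw [← ht]
  exact (ENNReal.ofReal_toReal (hfin t)).symm

/-- Sequences spread over sets not larger than the dyadic intervals. -/
theorem DistMono.nrm_glue_le {X : KotheSpace D.measure} (hX : X.DistMono) {A : D.index → Set ℝ}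
    (hA : Pairwise (Function.onFun Disjoint A)) (hAm : ∀ k, MeasurableSet (A k))
    (hAμ : ∀ k, D.measure (A k) ≤ ENNReal.ofReal ((2 : ℝ) ^ (k : ℤ))) {ω : ℝ → ℝ}
    (hω : Measurable ω) (hω1 : ∀ t, |ω t| ≤ 1) (x : D.index → ℝ) :
    X.nrm (fun t => ω t * glueFun A (fun k _ => x k) t) ≤ X.dyadicNorm x := by
  have hgm : Measurable (glueFun A fun k _ => x k) := measurable_glueFun hA hAm fun _ => measurable_const
  rw [dyadicNorm_apply]
  refine hX _ _ (hω.mul hgm).aestronglyMeasurable (measurable_stepFun x).aestronglyMeasurable fun s => ?_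
  set P : Set D.index := {k | s < ‖x k‖ₑ} with hP
  have h1 : {t | s < ‖ω t * glueFun A (fun k _ => x k) t‖ₑ} ⊆ ⋃ k : P, A k := fun t ht => by
    have h2 : s < ‖glueFun A (fun k _ => x k) t‖ₑ := by
      refine lt_of_lt_of_le ht ?_
      rw [enorm_mul]
      refine mul_le_of_le_one_left' ?_
      rw [← Real.enorm_abs, Real.enorm_eq_ofReal (abs_nonneg _)]
      exact ENNReal.ofReal_le_one.2 (hω1 t)
    by_cases h3 : ∃ k, t ∈ A k
    · obtain ⟨k, hk⟩ := h3
      rw [glueFun_of_mem hA _ hk] at h2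
      exact Set.mem_iUnion.2 ⟨⟨k, h2⟩, hk⟩
    · push Not at h3
      rw [glueFun_of_notMem _ h3] at h2
      simp at h2
  have h2 : ⋃ k : P, dyadic ((k : D.index) : ℤ) ⊆ {t | s < ‖stepFun x t‖ₑ} := fun t ht => by
    obtain ⟨k, hk⟩ := Set.mem_iUnion.1 ht
    change s < ‖stepFun x t‖ₑ
    rw [stepFun_of_mem x hk]
    exact k.2
  refine (measure_mono h1).trans ((measure_iUnion_le _).trans (le_trans ?_ (measure_mono h2)))
  rw [measure_iUnion (fun k l hkl => dyadic_disjoint fun h => hkl (Subtype.ext (Subtype.ext h)))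
    fun k => measurableSet_dyadic _]
  refine ENNReal.tsum_le_tsum fun k => ?_
  rw [measure_dyadic]
  exact hAμ k

end KotheSpace

namespace KotheSpace

variable {D : RIDomain}

/-- A sequence of averages over sets that are disjoint up to neighbours and comparable with the
dyadic intervals. -/
theorem DistMono.dyadicNorm_le_of_average {X : KotheSpace D.measure} (hX : X.DistMono)
    {B : D.index → Set ℝ} (hB : ∀ k, MeasurableSet (B k))
    (hBd : ∀ k l : D.index, (k : ℤ) + 2 ≤ l → Disjoint (B k) (B l))
    (hBtop : ∀ k, D.measure (B k) ≠ ∞)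
    (hBμ : ∀ k : D.index, ENNReal.ofReal ((2 : ℝ) ^ ((k : ℤ) - 2)) ≤ D.measure (B k)) {v : ℝ → ℝ}
    (hv : Measurable v) (x : D.index → ℝ)
    (hx : ∀ k, ‖x k‖ₑ * D.measure (B k) ≤ ∫⁻ t in B k, ‖v t‖ₑ ∂D.measure) :
    X.dyadicNorm x ≤ 8 * X.nrm v := by
  have h4 : ∀ k : ℤ, (2 : ℝ) ^ k = 4 * (2 : ℝ) ^ (k - 2) := fun k => by
    rw [zpow_sub₀ two_ne_zero]
    norm_num
    ring
  have hpos : ∀ k : ℤ, (0 : ℝ) < (2 : ℝ) ^ k := fun k => by positivity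
  -- B k is only known to have measure 2^(k-2), so an average over it may be spread over a quarter
  -- of the k-th dyadic interval.
  set cell : Fin 4 → D.index → Set ℝ := fun j k =>
    Ico ((2 : ℝ) ^ (k : ℤ) + j * (2 : ℝ) ^ ((k : ℤ) - 2))
      ((2 : ℝ) ^ (k : ℤ) + j * (2 : ℝ) ^ ((k : ℤ) - 2) + (2 : ℝ) ^ ((k : ℤ) - 2)) with hcell
  have hsub : ∀ j k, cell j k ⊆ dyadic (k : ℤ) := fun j k => by
    have hj : ((j : ℕ) : ℝ) ≤ 3 := by exact_mod_cast (by omega : (j : ℕ) ≤ 3)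
    have := hpos ((k : ℤ) - 2)
    refine Ico_subset_Ico (by nlinarith [Nat.cast_nonneg (α := ℝ) (j : ℕ)]) ?_
    nlinarith [h4 k]
  have hcov : ∀ k, ∀ t ∈ dyadic ((k : D.index) : ℤ), ∃ j, t ∈ cell j k := fun k t ht => by
    have ht1 : (2 : ℝ) ^ (k : ℤ) ≤ t := ht.1
    have ht2 : t < (2 : ℝ) ^ (k : ℤ) + (2 : ℝ) ^ (k : ℤ) := ht.2
    have h := h4 k
    set d : ℝ := (2 : ℝ) ^ ((k : ℤ) - 2) with hd
    by_cases h1 : t < (2 : ℝ) ^ (k : ℤ) + d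
    · refine ⟨0, ?_, ?_⟩ <;> simp <;> linarith
    by_cases h2 : t < (2 : ℝ) ^ (k : ℤ) + 2 * d
    · refine ⟨1, ?_, ?_⟩ <;> simp <;> linarith
    by_cases h3 : t < (2 : ℝ) ^ (k : ℤ) + 3 * d
    · refine ⟨2, ?_, ?_⟩ <;> simp <;> linarith
    · refine ⟨3, ?_, ?_⟩ <;> simp <;> linarith
  -- The sets B k are disjoint within each parity class of k. Two classes and four quarters give
  -- eight functions, each dominated by v.
  set F : Fin 2 × Fin 4 → ℝ → ℝ := fun q =>
    glueFun (fun k : {k : D.index // (k : ℤ) % 2 = q.1} => cell q.2 k) fun k _ => x k with hF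
  have hdisj : ∀ q : Fin 2 × Fin 4, Pairwise (Function.onFun Disjoint
      fun k : {k : D.index // (k : ℤ) % 2 = q.1} => cell q.2 k) := fun q k l hkl =>
    (pairwise_dyadic fun h => hkl (Subtype.ext h)).mono (hsub _ _) (hsub _ _)
  have hFm : ∀ q, Measurable (F q) := fun q =>
    measurable_glueFun (hdisj q) (fun k => measurableSet_Ico) fun k => measurable_const
  have hFle : ∀ q, X.nrm (F q) ≤ X.nrm v := fun q => by
    refine hX.nrm_le_of_average (B := fun k : {k : D.index // (k : ℤ) % 2 = q.1} => B k)
      (fun k => hB k) (fun k l hkl => ?_) (fun k => hBtop k)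
      (c := fun k => (2 : ℝ) ^ (k : ℤ) + q.2 * (2 : ℝ) ^ ((k : ℤ) - 2))
      (l := fun k => (2 : ℝ) ^ ((k : ℤ) - 2)) (fun k => hpos _) (fun k => hBμ k) (hdisj q) hv
      (hFm q) (fun t ht => glueFun_of_notMem _ ht) fun k t ht => ?_
    · have h1 : ((k : D.index) : ℤ) ≠ (l : D.index) := fun h => hkl (Subtype.ext (Subtype.ext h))
      have h2 := k.2
      have h3 := l.2
      rcases lt_or_gt_of_ne h1 with h | h
      · exact hBd _ _ (by omega)
      · exact (hBd _ _ (by omega)).symm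
    · rw [hF]
      simp only
      rw [glueFun_of_mem (hdisj q) _ ht]
      exact hx k
  rw [dyadicNorm_apply]
  have h1 : X.nrm (stepFun x) ≤ X.nrm (∑ q, fun t => |F q t|) := by
    refine X.nrm_mono (measurable_stepFun x).aestronglyMeasurable (Eventually.of_forall fun t => ?_)
    by_cases h' : ∃ k : D.index, t ∈ dyadic (k : ℤ)
    · obtain ⟨k, hk⟩ := h'
      obtain ⟨j, hj⟩ := hcov k t hk
      rw [stepFun_of_mem x hk, Finset.sum_apply]
      refine le_trans ?_ (le_abs_self _)
      have hmod : ∃ p : Fin 2, (k : ℤ) % 2 = p := by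
        rcases Int.emod_two_eq_zero_or_one k with h | h
        · exact ⟨0, by simpa using h⟩
        · exact ⟨1, by simpa using h⟩
      obtain ⟨p, hp⟩ := hmod
      refine le_trans (le_of_eq ?_) (Finset.single_le_sum (f := fun q => |F q t|)
        (fun q _ => abs_nonneg _) (Finset.mem_univ (p, j)))
      rw [hF]
      simp only
      rw [glueFun_of_mem (hdisj (p, j)) _ (k := ⟨k, hp⟩) hj]
    · push Not at h'
      rw [stepFun_of_notMem x h', abs_zero]
      exact abs_nonneg _
  refine h1.trans ((X.nrm_sum_le _ _).trans ?_)
  refine (Finset.sum_le_sum (g := fun _ => X.nrm v) fun q _ => ?_).trans (le_of_eq ?_)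
  · rw [X.nrm_abs (hFm q).aestronglyMeasurable]
    exact hFle q
  · simp

end KotheSpace

namespace RIDomain

instance nonempty_index (D : RIDomain) : Nonempty D.index :=
  ⟨⟨-1, by cases D <;> simp [RIDomain.index]⟩⟩

theorem add_one_mem_index {D : RIDomain} {k l : ℤ} (hl : l ∈ D.index) (h : k < l) : k + 1 ∈ D.index := by
  cases D
  · have h1 : l < 0 := hl
    change k + 1 < 0
    omega
  · exact Set.mem_univ _

theorem ae_mem_dyadic (D : RIDomain) : ∀ᵐ t ∂D.measure, ∃ k : D.index, t ∈ dyadic (k : ℤ) := by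
  have hD : MeasurableSet D.set := by cases D <;> [exact measurableSet_Icc; exact measurableSet_Ici]
  have h0 : ∀ᵐ t ∂D.measure, t ≠ 0 := by
    rw [ae_iff]
    simp
  have h1 : ∀ᵐ t ∂D.measure, t ≠ 1 := by
    rw [ae_iff]
    simp
  filter_upwards [ae_restrict_mem hD, h0, h1] with t ht ht0 ht1
  have hpos : 0 < t := by
    cases D
    · exact lt_of_le_of_ne ht.1 ht0.symm
    · exact lt_of_le_of_ne ht ht0.symm
  obtain ⟨k, hk1, hk2⟩ := exists_mem_Ico_zpow hpos one_lt_two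
  have hk : t ∈ dyadic k := by
    rw [dyadic_eq]
    exact ⟨hk1, hk2⟩
  refine ⟨⟨k, ?_⟩, hk⟩
  cases D
  · have h2 : t < 1 := lt_of_le_of_ne ht.2 ht1
    change k < 0
    by_contra hcon
    have h3 : (1 : ℝ) ≤ 2 ^ k := one_le_zpow₀ one_le_two (not_lt.1 hcon)
    linarith
  · exact Set.mem_univ _

end RIDomain

namespace KotheSpace

variable {D : RIDomain}

/-- The values of the decreasing rearrangement at the points `2^(k-1)`. -/
noncomputable def rearr (h : ℝ →ₘ[D.measure] ℝ) (k : D.index) : ℝ≥0 :=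
  sInf {s : ℝ≥0 | D.measure {t | s < ‖h t‖₊} ≤ ENNReal.ofReal ((2 : ℝ) ^ ((k : ℤ) - 1))}

/-- The distribution function tends to zero at infinity. -/
def Levelled (h : ℝ →ₘ[D.measure] ℝ) : Prop :=
  ∀ δ : ℝ≥0∞, δ ≠ 0 → ∃ s : ℝ≥0, D.measure {t | s < ‖h t‖₊} ≤ δ

theorem levelled_of_mem_sum {X Y : KotheSpace D.measure} (hY : Y.DistMono) (hX : X.DistMono)
    {h : ℝ →ₘ[D.measure] ℝ} (hh : h ∈ sum Y X) : Levelled h := by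
  intro δ hδ
  obtain ⟨y, hy, x, hx, rfl⟩ := Submodule.mem_sup.1 hh
  have hδ2 : δ / 2 ≠ 0 := by simp [hδ]
  obtain ⟨s, hs⟩ := hY.exists_level (v := y) (by rw [nrm_coe]; exact LT.lt.ne hy) hδ2
  obtain ⟨s', hs'⟩ := hX.exists_level (v := x) (by rw [nrm_coe]; exact LT.lt.ne hx) hδ2
  refine ⟨s + s', ?_⟩
  have h1 : D.measure {t | s + s' < ‖(y + x) t‖₊} ≤
      D.measure ({t | (s : ℝ≥0∞) < ‖y t‖ₑ} ∪ {t | (s' : ℝ≥0∞) < ‖x t‖ₑ}) := by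
    refine measure_mono_ae ?_
    filter_upwards [AEEqFun.coeFn_add y x] with t ht hlt
    have hlt' : s + s' < ‖(y + x) t‖₊ := hlt
    rw [ht, Pi.add_apply] at hlt'
    by_contra hcon
    have h2 : ¬ ((s : ℝ≥0∞) < ‖y t‖ₑ ∨ (s' : ℝ≥0∞) < ‖x t‖ₑ) := hcon
    push Not at h2
    have h3 : ‖y t‖₊ ≤ s := ENNReal.coe_le_coe.1 h2.1
    have h4 : ‖x t‖₊ ≤ s' := ENNReal.coe_le_coe.1 h2.2
    exact absurd (hlt'.trans_le ((nnnorm_add_le _ _).trans (add_le_add h3 h4))) (lt_irrefl _)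
  refine h1.trans ((measure_union_le _ _).trans ((add_le_add hs hs').trans (ENNReal.add_halves δ).le))

section Rearr

variable {h : ℝ →ₘ[D.measure] ℝ}

theorem lt_measure_of_lt_rearr {k : D.index} {s : ℝ≥0} (hs : s < rearr h k) :
    ENNReal.ofReal ((2 : ℝ) ^ ((k : ℤ) - 1)) < D.measure {t | s < ‖h t‖₊} := by
  have := notMem_of_lt_csInf hs (OrderBot.bddBelow _)
  exact not_le.1 this

/-- The infimum that defines the rearrangement is attained, as the distribution function is
continuous from the right. -/
theorem Levelled.measure_le (hh : Levelled h) (k : D.index) :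
    D.measure {t | rearr h k < ‖h t‖₊} ≤ ENNReal.ofReal ((2 : ℝ) ^ ((k : ℤ) - 1)) := by
  obtain ⟨s, hs⟩ := hh (ENNReal.ofReal ((2 : ℝ) ^ ((k : ℤ) - 1)))
    (ENNReal.ofReal_pos.2 (by positivity)).ne'
  have hne : {s : ℝ≥0 | D.measure {t | s < ‖h t‖₊} ≤ ENNReal.ofReal ((2 : ℝ) ^ ((k : ℤ) - 1))}.Nonempty :=
    ⟨s, hs⟩
  obtain ⟨u, hu1, hu2, hu3⟩ := exists_seq_tendsto_sInf hne (OrderBot.bddBelow _)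
  have h1 : {t | rearr h k < ‖h t‖₊} = ⋃ n, {t | u n < ‖h t‖₊} := by
    ext t
    simp only [Set.mem_ofPred_eq, Set.mem_iUnion]
    constructor
    · intro ht
      exact (hu2.eventually (gt_mem_nhds ht)).exists
    · rintro ⟨n, hn⟩
      exact (csInf_le (OrderBot.bddBelow _) (hu3 n)).trans_lt hn
  rw [h1]
  refine le_of_tendsto' (tendsto_measure_iUnion_atTop fun m n hmn t ht => ?_) fun n => hu3 n
  exact (hu1 hmn).trans_lt ht

theorem Levelled.rearr_antitone (hh : Levelled h) : Antitone (rearr h) := fun k l hkl => by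
  by_contra hcon
  have h1 := lt_measure_of_lt_rearr (not_le.1 hcon)
  have h2 := h1.trans_le (hh.measure_le k)
  have h3 : (2 : ℝ) ^ ((k : ℤ) - 1) ≤ (2 : ℝ) ^ ((l : ℤ) - 1) :=
    zpow_le_zpow_right₀ one_le_two (sub_le_sub_right (show (k : ℤ) ≤ l from hkl) 1)
  exact absurd h2 (not_lt.2 (ENNReal.ofReal_le_ofReal h3))

theorem Levelled.ae_exists_le (hh : Levelled h) : ∀ᵐ t ∂D.measure, ∃ k, ‖h t‖₊ ≤ rearr h k := by
  have hidx : ∀ n : ℕ, (-(n : ℤ) - 1) ∈ D.index := fun n => by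
    cases D
    · change -(n : ℤ) - 1 < 0
      omega
    · exact Set.mem_univ _
  rw [ae_iff]
  refine le_antisymm (ge_of_tendsto' (x := atTop)
    (f := fun n : ℕ => ENNReal.ofReal ((2 : ℝ) ^ ((-(n : ℤ) - 1) - 1))) ?_ fun n => ?_) zero_le
  · have h1 : Tendsto (fun n : ℕ => (2 : ℝ) ^ ((-(n : ℤ) - 1) - 1)) atTop (𝓝 0) := by
      have h2 : ∀ n : ℕ, (2 : ℝ) ^ ((-(n : ℤ) - 1) - 1) = (1 / 4) * (1 / 2) ^ n := fun n => by
        rw [sub_sub, sub_eq_add_neg, zpow_add₀ two_ne_zero, zpow_neg, zpow_natCast]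
        rw [one_div (2 : ℝ), inv_pow, mul_comm]
        norm_num
      simp only [h2]
      have := (tendsto_pow_atTop_nhds_zero_of_lt_one (r := (1 / 2 : ℝ)) (by norm_num)
        (by norm_num)).const_mul (1 / 4 : ℝ)
      simpa using this
    have := (ENNReal.continuous_ofReal.tendsto 0).comp h1
    rwa [ENNReal.ofReal_zero] at this
  · refine le_trans (measure_mono fun t ht => ?_) (hh.measure_le ⟨_, hidx n⟩)
    by_contra hcon
    exact ht ⟨_, not_lt.1 hcon⟩

theorem exists_glueFun_eq {A : D.index → Set ℝ} (x : D.index → ℝ) (t : ℝ) :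
    (∃ k, t ∈ A k ∧ glueFun A (fun k _ => x k) t = x k) ∨ glueFun A (fun k _ => x k) t = 0 := by
  rw [glueFun]
  split_ifs with h
  · exact Or.inl ⟨_, h.choose_spec, rfl⟩
  · exact Or.inr rfl

/-- A function is the image of the sequence of values of its rearrangement under an operator that
is bounded for all rearrangement invariant norms. -/
theorem Levelled.exists_expansion (hh : Levelled h) :
    ∃ R : (D.index → ℝ) →ₗ[ℝ] (ℝ →ₘ[D.measure] ℝ),
      (∀ Z : KotheSpace D.measure, Z.DistMono → ∀ x, Z.eNorm (R x) ≤ 2 * Z.dyadicNorm x) ∧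
      R (fun k => rearr h k) = h := by
  set r := rearr h with hr
  -- The level c separates two regimes. Where |h| > c the points are sorted by consecutive values of
  -- r; the set where |h| ≤ c may have infinite measure and is cut dyadically instead.
  set c : ℝ≥0 := ⨅ k, r k with hc
  have hcr : ∀ k, c ≤ r k := fun k => ciInf_le (OrderBot.bddBelow _) k
  have hnm : Measurable fun t => ‖h t‖₊ := h.measurable.nnnorm
  have hgt : ∀ s : ℝ≥0, MeasurableSet {t | s < ‖h t‖₊} := fun s => measurableSet_lt measurable_const hnm
  have hle : ∀ s : ℝ≥0, MeasurableSet {t | ‖h t‖₊ ≤ s} := fun s => measurableSet_le hnm measurable_const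
  set A : D.index → Set ℝ := fun k =>
    {t | c < ‖h t‖₊} ∩ ({t | ‖h t‖₊ ≤ r k} ∩ ⋂ l : Ioi k, {t | r l < ‖h t‖₊}) with hA
  set A' : D.index → Set ℝ := fun k => dyadic (k : ℤ) ∩ {t | ‖h t‖₊ ≤ c} with hA'
  have hAm : ∀ k, MeasurableSet (A k) := fun k =>
    (hgt c).inter ((hle _).inter (MeasurableSet.iInter fun l => hgt _))
  have hA'm : ∀ k, MeasurableSet (A' k) := fun k => (measurableSet_dyadic _).inter (hle c)
  have hAlt : ∀ {k l : D.index}, k < l → Disjoint (A k) (A l) := fun {k l} hkl =>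
    Set.disjoint_left.2 fun t h1 h2 =>
      absurd (show ‖h t‖₊ ≤ r l from h2.2.1)
        (not_le.2 (show r l < ‖h t‖₊ from Set.mem_iInter.1 h1.2.2 ⟨l, hkl⟩))
  have hAd : Pairwise (Function.onFun Disjoint A) := fun k l hkl => by
    rcases lt_or_gt_of_ne hkl with h1 | h1
    · exact hAlt h1
    · exact (hAlt h1).symm
  have hA'd : Pairwise (Function.onFun Disjoint A') := fun k l hkl =>
    (pairwise_dyadic hkl).mono Set.inter_subset_left Set.inter_subset_left
  -- A point of A k has |h| > c, so some r l with l > k lies below |h|; hence k+1 is an admissible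
  -- index. Then A k lies in {|h| > r (k+1)}, whose measure is at most 2^k because r is sampled at
  -- 2^(k-1).
  have hAμ : ∀ k, D.measure (A k) ≤ ENNReal.ofReal ((2 : ℝ) ^ (k : ℤ)) := fun k => by
    rcases (A k).eq_empty_or_nonempty with h0 | ⟨t, ht⟩
    · rw [h0, measure_empty]
      exact zero_le
    obtain ⟨l, hl⟩ := exists_lt_of_ciInf_lt (show c < ‖h t‖₊ from ht.1)
    have hkl : k < l := by
      by_contra hcon
      exact absurd (hl.trans_le (ht.2.1.trans (hh.rearr_antitone (not_lt.1 hcon)))) (lt_irrefl _)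
    have hk1 : (k : ℤ) + 1 ∈ D.index := RIDomain.add_one_mem_index l.2 hkl
    refine (measure_mono fun t ht => ?_).trans ((hh.measure_le ⟨_, hk1⟩).trans_eq ?_)
    · exact Set.mem_iInter.1 ht.2.2 ⟨⟨_, hk1⟩, show (k : ℤ) < k + 1 by omega⟩
    · simp
  have hA'μ : ∀ k, D.measure (A' k) ≤ ENNReal.ofReal ((2 : ℝ) ^ (k : ℤ)) := fun k =>
    (measure_mono Set.inter_subset_left).trans (measure_dyadic k).le
  set G : (D.index → Set ℝ) → (D.index → ℝ) → ℝ → ℝ := fun A x => glueFun A fun k _ => x k with hG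
  have hGadd : ∀ A x y t, G A (x + y) t = G A x t + G A y t := fun A x y t => by
    simp only [hG, glueFun]
    split_ifs <;> simp
  have hGsmul : ∀ A (a : ℝ) x t, G A (a • x) t = a * G A x t := fun A a x t => by
    simp only [hG, glueFun]
    split_ifs <;> simp
  have hGm : ∀ x, Measurable (G A x) := fun x => measurable_glueFun hAd hAm fun _ => measurable_const
  have hG'm : ∀ x, Measurable (G A' x) := fun x =>
    measurable_glueFun hA'd hA'm fun _ => measurable_const
  -- On A k and A' k one has |h| ≤ r k, so h is the glued sequence r times a multiplier of modulus
  -- at most 1. The two regimes give the constant 2.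
  set ω : (D.index → Set ℝ) → ℝ → ℝ := fun A t => h t / G A (fun k => r k) t with hω
  have hω1 : ∀ B : D.index → Set ℝ, (∀ k, ∀ t ∈ B k, ‖h t‖₊ ≤ r k) → ∀ t, |ω B t| ≤ 1 := by
    intro B hB t
    rcases exists_glueFun_eq (A := B) (fun k => (r k : ℝ)) t with ⟨k, hk, h1⟩ | h1
    · simp only [hω, hG, h1, abs_div, NNReal.abs_eq]
      refine div_le_one_of_le₀ ?_ (r k).coe_nonneg
      exact_mod_cast hB k t hk
    · simp only [hω, hG, h1, div_zero, abs_zero]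
      exact zero_le_one
  have hωm : Measurable (ω A) := h.measurable.div (hGm _)
  have hω'm : Measurable (ω A') := h.measurable.div (hG'm _)
  have hωA := hω1 A fun k t ht => ht.2.1
  have hωA' := hω1 A' fun k t ht => le_trans ht.2 (hcr k)
  set Φ : (D.index → ℝ) → ℝ → ℝ := fun x => (fun t => ω A t * G A x t) + fun t => ω A' t * G A' x t with hΦ
  have hΦm : ∀ x, Measurable (Φ x) := fun x => (hωm.mul (hGm x)).add (hω'm.mul (hG'm x))
  refine ⟨{ toFun := fun x => AEEqFun.mk (Φ x) (hΦm x).aestronglyMeasurable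
            map_add' := fun x y => ?_
            map_smul' := fun a x => ?_ }, fun Z hZ x => ?_, ?_⟩
  · rw [AEEqFun.mk_add_mk]
    refine AEEqFun.mk_eq_mk.2 (Eventually.of_forall fun t => ?_)
    simp only [hΦ, Pi.add_apply, hGadd]
    ring
  · rw [RingHom.id_apply, AEEqFun.smul_mk]
    refine AEEqFun.mk_eq_mk.2 (Eventually.of_forall fun t => ?_)
    simp only [hΦ, Pi.add_apply, Pi.smul_apply, smul_eq_mul, hGsmul]
    ring
  · change Z.eNorm (AEEqFun.mk (Φ x) _) ≤ _
    rw [← Z.nrm_eq, two_mul]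
    exact (Z.nrm_add_le _ _).trans (add_le_add (hZ.nrm_glue_le hAd hAm hAμ hωm hωA x)
      (hZ.nrm_glue_le hA'd hA'm hA'μ hω'm hωA' x))
  · refine AEEqFun.ext ?_
    refine (AEEqFun.coeFn_mk _ _).trans ?_
    filter_upwards [hh.ae_exists_le, D.ae_mem_dyadic] with t ht1 ht2
    have hval : ∀ (B : D.index → Set ℝ) (hBd : Pairwise (Function.onFun Disjoint B)) (k : D.index),
        t ∈ B k → ‖h t‖₊ ≤ r k → ω B t * G B (fun k => (r k : ℝ)) t = h t := by
      intro B hBd k hk hle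
      simp only [hω, hG]
      rw [glueFun_of_mem hBd _ hk]
      refine div_mul_cancel_of_imp fun h0 => ?_
      have : r k = 0 := by exact_mod_cast h0
      rw [this] at hle
      exact nnnorm_eq_zero.1 (le_antisymm hle zero_le)
    simp only [hΦ, Pi.add_apply]
    rcases lt_or_ge c ‖h t‖₊ with hlt | hge
    · have h0 : G A' (fun k => (r k : ℝ)) t = 0 :=
        glueFun_of_notMem _ fun k hk => absurd hk.2 (not_le.2 hlt)
      rw [h0, mul_zero, add_zero]
      obtain ⟨l, hl⟩ := exists_lt_of_ciInf_lt hlt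
      obtain ⟨k₀, hk₀⟩ := ht1
      obtain ⟨k, ⟨hk, hkr⟩, hmax⟩ := Int.exists_greatest_of_bdd
        (P := fun k => ∃ hk : k ∈ D.index, ‖h t‖₊ ≤ r ⟨k, hk⟩)
        ⟨l, fun z ⟨hz, hzr⟩ => by
          by_contra hcon
          have : l ≤ ⟨z, hz⟩ := (not_le.1 hcon).le
          exact absurd (hl.trans_le (hzr.trans (hh.rearr_antitone this))) (lt_irrefl _)⟩
        ⟨k₀, k₀.2, hk₀⟩
      refine hval A hAd ⟨k, hk⟩ ⟨hlt, hkr, Set.mem_iInter.2 fun m => ?_⟩ hkr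
      by_contra hcon
      have hm : (m : D.index).1 ≤ k := hmax _ ⟨(m : D.index).2, not_lt.1 hcon⟩
      have hm' : k < (m : D.index).1 := m.2
      omega
    · have h0 : G A (fun k => (r k : ℝ)) t = 0 :=
        glueFun_of_notMem _ fun k hk => absurd hk.1 (not_lt.2 hge)
      rw [h0, mul_zero, zero_add]
      obtain ⟨k, hk⟩ := ht2
      exact hval A' hA'd k ⟨hk, hge⟩ (hge.trans (hcr k))

end Rearr

end KotheSpace

namespace KotheSpace

variable {D : RIDomain} {h : ℝ →ₘ[D.measure] ℝ}

/-- The summands are the lengths of disjoint dyadic intervals contained in [0, 2^(k-2)). -/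
theorem tsum_zpow_le {k : ℤ} (P : Set ℤ) (hP : ∀ j ∈ P, j + 2 ≤ k) :
    ∑' j : P, ENNReal.ofReal ((2 : ℝ) ^ ((j : ℤ) - 1)) ≤ ENNReal.ofReal ((2 : ℝ) ^ (k - 2)) := by
  have h1 : ∀ j : P, ENNReal.ofReal ((2 : ℝ) ^ ((j : ℤ) - 1)) = volume (dyadic ((j : ℤ) - 1)) := fun j => by
    rw [dyadic, Real.volume_Ico, add_sub_cancel_left]
  simp only [h1]
  rw [← measure_iUnion (fun i j hij => dyadic_disjoint fun h => hij (Subtype.ext (by omega)))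
    fun j => measurableSet_dyadic _]
  refine (measure_mono (Set.iUnion_subset fun j t ht => ?_)).trans
    (?_ : volume (Ico (0 : ℝ) ((2 : ℝ) ^ (k - 2))) ≤ _)
  · rw [dyadic_eq] at ht
    refine ⟨le_trans (by positivity) ht.1, ht.2.trans_le (zpow_le_zpow_right₀ one_le_two ?_)⟩
    have := hP j j.2
    omega
  · rw [Real.volume_Ico, sub_zero]

/-- Sets, disjoint up to neighbours and comparable with the dyadic intervals, on which a function
is not much smaller than its rearrangement. -/
theorem exists_level_sets (h : ℝ →ₘ[D.measure] ℝ) :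
    ∃ B : D.index → Set ℝ, (∀ k, MeasurableSet (B k)) ∧
      (∀ k l : D.index, (k : ℤ) + 2 ≤ l → Disjoint (B k) (B l)) ∧
      (∀ k, D.measure (B k) ≠ ∞) ∧
      (∀ k : D.index, ENNReal.ofReal ((2 : ℝ) ^ ((k : ℤ) - 2)) ≤ D.measure (B k)) ∧
      ∀ k, ∀ t ∈ B k, rearr h k ≤ 2 * ‖h t‖₊ := by
  have hN : ∀ k : D.index, ∃ N ⊆ {t | rearr h k ≤ 2 * ‖h t‖₊}, MeasurableSet N ∧
      D.measure N = ENNReal.ofReal ((2 : ℝ) ^ ((k : ℤ) - 1)) := fun k => by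
    refine exists_subset_measure_eq
      (measurableSet_le measurable_const (h.measurable.nnnorm.const_mul 2)) (by positivity) ?_
    -- Half of a positive r k lies strictly below the infimum, so |h| exceeds it on a set of measure
    -- greater than 2^(k-1). If r k = 0 there is no constraint and the k-th dyadic interval is large
    -- enough.
    rcases eq_or_ne (rearr h k) 0 with h0 | h0
    · refine lt_of_lt_of_le ?_ (measure_mono (s := dyadic (k : ℤ)) fun t _ => ?_)
      · rw [measure_dyadic]
        exact (ENNReal.ofReal_lt_ofReal_iff (by positivity)).2
          (zpow_lt_zpow_right₀ one_lt_two (by omega))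
      · change rearr h k ≤ _
        rw [h0]
        exact zero_le
    · have h1 : rearr h k / 2 < rearr h k := NNReal.half_lt_self h0
      refine (lt_measure_of_lt_rearr h1).trans_le (measure_mono fun t ht => ?_)
      have h2 : rearr h k / 2 < ‖h t‖₊ := ht
      rw [div_lt_iff₀ two_pos, mul_comm] at h2
      exact h2.le
  choose N hN1 hN2 hN3 using hN
  -- The sets with index at most k-2 have total measure at most 2^(k-2), half of that of N k.
  -- Removing the neighbour k-1 too could exhaust N k, which is why the sets are disjoint only up to
  -- neighbours.
  set U : D.index → Set ℝ := fun k => ⋃ j : {j : D.index // (j : ℤ) + 2 ≤ k}, N j with hU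
  have hUm : ∀ k, MeasurableSet (U k) := fun k => MeasurableSet.iUnion fun j => hN2 j
  refine ⟨fun k => N k \ U k, fun k => (hN2 k).diff (hUm k), fun k l hkl => ?_, fun k => ?_, fun k => ?_,
    fun k t ht => hN1 k ht.1⟩
  · exact Set.disjoint_left.2 fun t h1 h2 => h2.2 (Set.mem_iUnion.2 ⟨⟨k, hkl⟩, h1.1⟩)
  · refine ne_top_of_le_ne_top ?_ (measure_mono Set.sdiff_subset)
    rw [hN3]
    exact ENNReal.ofReal_ne_top
  · have h1 : D.measure (U k) ≤ ENNReal.ofReal ((2 : ℝ) ^ ((k : ℤ) - 2)) := by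
      refine (measure_iUnion_le _).trans ?_
      simp only [hN3]
      refine le_trans ?_ (tsum_zpow_le {j : ℤ | j + 2 ≤ k} fun j hj => hj)
      let e : {j : D.index // (j : ℤ) + 2 ≤ k} → {j : ℤ | j + 2 ≤ k} := fun j => ⟨j.1.1, j.2⟩
      have he : Function.Injective e := fun i j hij => by
        have h : (e i : ℤ) = e j := by rw [hij]
        exact Subtype.ext (Subtype.ext h)
      exact ENNReal.tsum_comp_le_tsum_of_injective he
        fun j : {j : ℤ | j + 2 ≤ k} => ENNReal.ofReal ((2 : ℝ) ^ ((j : ℤ) - 1))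
    have h2 : D.measure (N k) ≤ D.measure (N k \ U k) + D.measure (U k) :=
      (measure_mono fun t ht => by
        by_cases h : t ∈ U k
        · exact Or.inr h
        · exact Or.inl ⟨ht, h⟩).trans (measure_union_le _ _)
    have h3 : ENNReal.ofReal ((2 : ℝ) ^ ((k : ℤ) - 1)) =
        ENNReal.ofReal ((2 : ℝ) ^ ((k : ℤ) - 2)) + ENNReal.ofReal ((2 : ℝ) ^ ((k : ℤ) - 2)) := by
      rw [← ENNReal.ofReal_add (by positivity) (by positivity), ← two_mul, ← zpow_one_add₀ two_ne_zero]
      congr 2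
      ring
    rw [hN3, h3] at h2
    exact (ENNReal.add_le_add_iff_right ENNReal.ofReal_ne_top).1 (h2.trans (add_le_add le_rfl h1))

/-- The sequence of values of the rearrangement is the image of the function under an operator that
is bounded for all rearrangement invariant norms. -/
theorem exists_compression {X Y : KotheSpace D.measure} (hY : Y.DistMono) (hX : X.DistMono)
    (h : sum Y X) :
    ∃ S : sum Y X →ₗ[ℝ] (D.index → ℝ),
      (∀ Z : KotheSpace D.measure, Z.DistMono → ∀ u, Z.dyadicNorm (S u) ≤ 16 * Z.eNorm u) ∧
      S h = fun k => (rearr h.1 k : ℝ) := by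
  obtain ⟨B, hB, hBd, hBtop, hBμ, hBh⟩ := exists_level_sets h.1
  set r := rearr h.1 with hr
  have hB0 : ∀ k, 0 < D.measure.real (B k) := fun k =>
    ENNReal.toReal_pos ((ENNReal.ofReal_pos.2 (by positivity)).trans_le (hBμ k)).ne' (hBtop k)
  have hbd : ∀ k, ∀ t ∈ B k, ∀ a : ℝ, |(r k / h.1 t) * a| ≤ 2 * |a| := fun k t ht a => by
    rw [abs_mul, abs_div, NNReal.abs_eq]
    refine mul_le_mul_of_nonneg_right (div_le_of_le_mul₀ (abs_nonneg _) zero_le_two ?_) (abs_nonneg a)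
    exact_mod_cast hBh k t ht
  have hint : ∀ u : sum Y X, ∀ k, IntegrableOn (fun t => (r k / h.1 t) * u.1 t) (B k) D.measure := by
    intro u k
    refine Integrable.mono' ((integrableOn_of_mem_sum hY hX (hB k) (hBtop k) u.2).abs.const_mul 2)
      ((measurable_const.div h.1.measurable).mul u.1.measurable).aestronglyMeasurable ?_
    filter_upwards [ae_restrict_mem (hB k)] with t ht
    exact hbd k t ht _
  -- Multiplication by r k/h, of modulus at most 2 on B k, followed by averaging over B k. The
  -- averaging constant 8 makes the bound 16.
  refine ⟨{ toFun := fun u k => (D.measure.real (B k))⁻¹ * ∫ t in B k, (r k / h.1 t) * u.1 t ∂D.measure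
            map_add' := fun u v => ?_
            map_smul' := fun a u => ?_ }, fun Z hZ u => ?_, ?_⟩
  · ext k
    rw [Pi.add_apply, ← mul_add, ← integral_add (hint u k) (hint v k)]
    congr 1
    refine integral_congr_ae (ae_restrict_of_ae ?_)
    filter_upwards [AEEqFun.coeFn_add u.1 v.1] with t ht
    rw [Submodule.coe_add, ht, Pi.add_apply, mul_add]
  · ext k
    rw [RingHom.id_apply, Pi.smul_apply, smul_eq_mul, mul_left_comm, ← integral_const_mul a]
    congr 1
    refine integral_congr_ae (ae_restrict_of_ae ?_)
    filter_upwards [AEEqFun.coeFn_smul a u.1] with t ht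
    rw [Submodule.coe_smul, ht, Pi.smul_apply, smul_eq_mul, mul_left_comm]
  · have h1 := hZ.dyadicNorm_le_of_average hB hBd hBtop hBμ (v := (2 : ℝ) • ⇑u.1)
      (u.1.measurable.const_smul (2 : ℝ))
      (fun k => (D.measure.real (B k))⁻¹ * ∫ t in B k, (r k / h.1 t) * u.1 t ∂D.measure) fun k => by
        have h2 : ‖(D.measure.real (B k))⁻¹‖ₑ = (D.measure (B k))⁻¹ := by
          rw [Real.enorm_eq_ofReal (inv_nonneg.2 (hB0 k).le), ENNReal.ofReal_inv_of_pos (hB0 k),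
            measureReal_def, ENNReal.ofReal_toReal (hBtop k)]
        have h3 : D.measure (B k) ≠ 0 := fun h0 => (hB0 k).ne' (by rw [measureReal_def, h0]; rfl)
        rw [enorm_mul, h2, mul_right_comm, ENNReal.inv_mul_cancel h3 (hBtop k), one_mul]
        refine (enorm_integral_le_lintegral_enorm _).trans (setLIntegral_mono'  (hB k) fun t ht => ?_)
        rw [enorm_le_iff_norm_le, Real.norm_eq_abs, Real.norm_eq_abs, Pi.smul_apply, smul_eq_mul,
          abs_mul 2, abs_two]
        exact hbd k t ht _
    rw [Z.nrm_smul u.1.aestronglyMeasurable, Z.nrm_coe] at h1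
    refine h1.trans (le_of_eq ?_)
    rw [← mul_assoc]
    congr 1
    rw [Real.enorm_eq_ofReal zero_le_two]
    norm_num
  · ext k
    change (D.measure.real (B k))⁻¹ * ∫ t in B k, (r k / h.1 t) * h.1 t ∂D.measure = r k
    have h1 : ∫ t in B k, (r k / h.1 t) * h.1 t ∂D.measure = ∫ _t in B k, (r k : ℝ) ∂D.measure := by
      refine setIntegral_congr_fun (hB k) fun t ht => ?_
      refine div_mul_cancel_of_imp fun h0 => ?_
      have h2 := hBh k t ht
      rw [h0, nnnorm_zero, mul_zero] at h2
      exact_mod_cast le_antisymm h2 zero_le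
    rw [h1, setIntegral_const, smul_eq_mul, inv_mul_cancel_left₀ (hB0 k).ne']

end KotheSpace

/-! ### Sufficiency of elasticity. -/

namespace SeqNorm

variable {ι : Type*} [LinearOrder ι] {N M : SeqNorm ι} {t : ι → ℝ≥0} {c : ℝ≥0}

theorem Compat.mul_indicator_Ici_le (hc : Compat N M t c) (ht : Monotone t) {m n : ι} (h : m ≤ n)
    (u : ι → ℝ) : t m * N ((Ici n).indicator u) ≤ c * M ((Ici n).indicator u) :=
  hc.high _ _ fun i hi => ht (h.trans (by
    by_contra h'
    exact hi (Set.indicator_of_notMem h' _)))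

theorem Compat.indicator_Iic_le (hc : Compat N M t c) (ht : Monotone t) {m n : ι} (h : n ≤ m)
    (u : ι → ℝ) : M ((Iic n).indicator u) ≤ t m * N ((Iic n).indicator u) :=
  hc.low _ _ fun i hi => ht (le_trans (b := n) (by
    by_contra h'
    exact hi (Set.indicator_of_notMem (s := Iic n) h' _)) h)

theorem Compat.indicator_Ici_ne_top (hc : Compat N M t c) (ht : Monotone t) {u : ι → ℝ}
    (hu : M u ≠ ∞) (n : ι) : N ((Ici n).indicator u) ≠ ∞ := fun h => by
  have h1 := hc.mul_indicator_Ici_le ht le_rfl u (n := n)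
  rw [h, ENNReal.mul_top (by exact_mod_cast (hc.pos n).ne'), top_le_iff] at h1
  exact ENNReal.mul_ne_top ENNReal.coe_ne_top (ne_top_of_le_ne_top hu (M.indicator_le _ _)) h1

theorem bddAbove_add {u v : ι → ℝ} [Nonempty ι]
    (hu : ∀ ε : ℝ≥0∞, 0 < ε → BddAbove {n | ε < N ((Ici n).indicator u)})
    (hv : ∀ ε : ℝ≥0∞, 0 < ε → BddAbove {n | ε < N ((Ici n).indicator v)}) (ε : ℝ≥0∞) (hε : 0 < ε) :
    BddAbove {n | ε < N ((Ici n).indicator (u + v))} := by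
  have hε2 : 0 < ε / 2 := ENNReal.div_pos hε.ne' (by simp)
  refine ((hu _ hε2).union (hv _ hε2)).mono fun n hn => ?_
  by_contra hcon
  rw [Set.mem_union, not_or] at hcon
  have h1 : N ((Ici n).indicator u) ≤ ε / 2 := not_lt.1 hcon.1
  have h2 : N ((Ici n).indicator v) ≤ ε / 2 := not_lt.1 hcon.2
  have h3 : ε < N ((Ici n).indicator (u + v)) := hn
  rw [Set.indicator_add'] at h3
  exact absurd (h3.trans_le ((N.add_le _ _).trans (add_le_add h1 h2))) (by
    rw [ENNReal.add_halves]
    exact lt_irrefl _)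

theorem bddBelow_add {u v : ι → ℝ} [Nonempty ι]
    (hu : ∀ ε : ℝ≥0∞, 0 < ε → BddBelow {n | ε < N ((Iic n).indicator u)})
    (hv : ∀ ε : ℝ≥0∞, 0 < ε → BddBelow {n | ε < N ((Iic n).indicator v)}) (ε : ℝ≥0∞) (hε : 0 < ε) :
    BddBelow {n | ε < N ((Iic n).indicator (u + v))} :=
  bddAbove_add (N := N.dual) (u := u ∘ OrderDual.ofDual) (v := v ∘ OrderDual.ofDual) hu hv ε hε

/-- Calderón operators between the elements of the sum of two order continuous sequence spaces
with both shift properties. -/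
theorem exists_operator_of_orderCont [LocallyFiniteOrder ι] [Nonempty ι] {C K₁ K₂ K₃ K₄ : ℝ≥0}
    (hc : Compat N M t c) (hc0 : 0 < c) (ht : Monotone t) (hN : N.LeftShift K₁)
    (hM : M.LeftShift K₂) (hN' : N.dual.LeftShift K₃) (hM' : M.dual.LeftShift K₄)
    (hNc : N.OrderCont) (hMc : M.OrderCont) (f : ι → ℝ) {u v : ι → ℝ} (hu : M u ≠ ∞) (hv : N v ≠ ∞)
    (hK : ∀ n, kSeq M N (t n) f ≤ C * kSeq M N (t n) (u + v)) :
    ∃ (T : (ι → ℝ) →ₗ[ℝ] (ι → ℝ)) (C' : ℝ≥0), (∀ u, N (T u) ≤ C' * N u) ∧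
      (∀ u, M (T u) ≤ C' * M u) ∧ T (u + v) = f := by
  obtain ⟨n₀⟩ := ‹Nonempty ι›
  have ht0 : (t n₀ : ℝ≥0∞) ≠ 0 := by exact_mod_cast (hc.pos n₀).ne'
  refine exists_operator_of_kSeq_le hc hc0 ht hN hM hN' hM' f (u + v) hK (fun n => ?_) (fun n => ?_)
    (bddAbove_add (fun ε hε => ?_) fun ε hε => hNc.bddAbove hv hε)
    (bddBelow_add (fun ε hε => hMc.bddBelow hu hε) fun ε hε => ?_)
  · rw [Set.indicator_add']
    exact ne_top_of_le_ne_top (ENNReal.add_ne_top.2 ⟨hc.indicator_Ici_ne_top ht hu n,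
      ne_top_of_le_ne_top hv (N.indicator_le _ _)⟩) (N.add_le _ _)
  · rw [Set.indicator_add']
    refine ne_top_of_le_ne_top (ENNReal.add_ne_top.2 ⟨ne_top_of_le_ne_top hu (M.indicator_le _ _),
      ne_top_of_le_ne_top ?_ (hc.indicator_Iic_le ht le_rfl v)⟩) (M.add_le _ _)
    exact ENNReal.mul_ne_top ENNReal.coe_ne_top (ne_top_of_le_ne_top hv (N.indicator_le _ _))
  -- For u the decay is known in M. To the right of n₀ compatibility bounds the N-tail of u by a
  -- multiple of its M-tail; the left tails of v are treated in the mirrored way.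
  · have hpos : 0 < t n₀ * ε / c := ENNReal.div_pos (mul_ne_zero ht0 hε.ne') ENNReal.coe_ne_top
    refine (bddAbove_Iic (a := n₀).union (hMc.bddAbove hu hpos)).mono fun n hn => ?_
    rcases le_or_gt n n₀ with h | h
    · exact Or.inl h
    · refine Or.inr ?_
      change t n₀ * ε / c < _
      rw [ENNReal.div_lt_iff (Or.inl (by exact_mod_cast hc0.ne')) (Or.inl ENNReal.coe_ne_top), mul_comm _ (c : ℝ≥0∞)]
      exact ((ENNReal.mul_lt_mul_iff_right ht0 ENNReal.coe_ne_top).2 hn).trans_le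
        (hc.mul_indicator_Ici_le ht h.le u)
  · have hpos : 0 < ε / t n₀ := ENNReal.div_pos hε.ne' ENNReal.coe_ne_top
    refine (bddBelow_Ici (a := n₀).union (hNc.bddBelow hv hpos)).mono fun n hn => ?_
    rcases le_or_gt n₀ n with h | h
    · exact Or.inl h
    · refine Or.inr ?_
      change ε / t n₀ < _
      rw [ENNReal.div_lt_iff (Or.inl ht0) (Or.inl ENNReal.coe_ne_top), mul_comm]
      exact lt_of_lt_of_le hn (hc.indicator_Iic_le ht h.le v)

end SeqNorm

namespace KotheSpace

variable {D : RIDomain} {X Y : KotheSpace D.measure}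

/-- The Calderón property follows from its analogue for decreasing sequences. -/
theorem IsCalderonCouple.of_antitone (hY : Y.DistMono) (hX : X.DistMono)
    (H : ∀ f u v : D.index → ℝ, Y.dyadicNorm u ≠ ∞ → X.dyadicNorm v ≠ ∞ → Antitone (u + v) →
      (∀ k, 0 ≤ (u + v) k) →
      (∀ τ : ℝ≥0, 0 < τ → SeqNorm.kSeq Y.dyadicNorm X.dyadicNorm τ f ≤
        (32 : ℝ≥0) * SeqNorm.kSeq Y.dyadicNorm X.dyadicNorm τ (u + v)) →
      ∃ (T : (D.index → ℝ) →ₗ[ℝ] (D.index → ℝ)) (C : ℝ≥0),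
        (∀ w, X.dyadicNorm (T w) ≤ C * X.dyadicNorm w) ∧
        (∀ w, Y.dyadicNorm (T w) ≤ C * Y.dyadicNorm w) ∧ T (u + v) = f) :
    IsCalderonCouple Y X := by
  intro f g hfg
  have hf := levelled_of_mem_sum hY hX f.2
  have hg := levelled_of_mem_sum hY hX g.2
  obtain ⟨Sf, hSf, hSff⟩ := exists_compression hY hX f
  obtain ⟨Sg, hSg, hSgg⟩ := exists_compression hY hX g
  obtain ⟨Rf, hRf, hRff⟩ := hf.exists_expansion
  obtain ⟨Rg, hRg, hRgg⟩ := hg.exists_expansion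
  obtain ⟨y, hy, x, hx, hyx⟩ := Submodule.mem_sup.1 g.2
  have hy' : Y.eNorm y ≠ ∞ := LT.lt.ne hy
  have hx' : X.eNorm x ≠ ∞ := LT.lt.ne hx
  have hg' : (⟨y, mem_sum_left hy'⟩ + ⟨x, mem_sum_right hx'⟩ : sum Y X) = g := Subtype.ext hyx
  have hsum : Sg ⟨y, mem_sum_left hy'⟩ + Sg ⟨x, mem_sum_right hx'⟩ = fun k => (rearr g.1 k : ℝ) := by
    rw [← _root_.map_add, hg', hSgg]
  -- Sampling f costs the factor 16 in the K-functional and rebuilding g from its samples costs 2;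
  -- this is the 32 in the hypothesis on sequences.
  have hK1 : ∀ τ : ℝ≥0, 0 < τ → SeqNorm.kSeq Y.dyadicNorm X.dyadicNorm τ (fun k => (rearr f.1 k : ℝ)) ≤
      16 * kFunctional Y X τ f := fun τ hτ => by
    rw [kFunctional]
    simp only [ENNReal.mul_iInf_of_ne (a := (16 : ℝ≥0∞)) (by simp) (by simp)]
    refine le_iInf fun a => le_iInf fun b => le_iInf fun hab => ?_
    by_cases ha : Y.eNorm a = ∞
    · simp [ha]
    by_cases hb : X.eNorm b = ∞
    · rw [hb, ENNReal.mul_top (by exact_mod_cast hτ.ne'), add_top, ENNReal.mul_top (by simp)]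
      exact le_top
    refine (iInf₂_le (Sf ⟨a, mem_sum_left ha⟩) (Sf ⟨b, mem_sum_right hb⟩)).trans ((iInf_le _ ?_).trans ?_)
    · rw [← _root_.map_add, ← hSff]
      congr 1
      exact Subtype.ext hab
    · rw [mul_add, mul_left_comm]
      exact add_le_add (hSf Y hY ⟨a, _⟩) (mul_le_mul_right (hSf X hX ⟨b, _⟩) _)
  have hK2 : ∀ τ : ℝ≥0, kFunctional Y X τ g ≤
      2 * SeqNorm.kSeq Y.dyadicNorm X.dyadicNorm τ (fun k => (rearr g.1 k : ℝ)) := fun τ => by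
    rw [SeqNorm.kSeq]
    simp only [ENNReal.mul_iInf_of_ne (a := (2 : ℝ≥0∞)) (by simp) (by simp)]
    refine le_iInf fun a => le_iInf fun b => le_iInf fun hab => ?_
    refine (iInf₂_le (Rg a) (Rg b)).trans ((iInf_le _ ?_).trans ?_)
    · rw [← _root_.map_add, hab, hRgg]
    · rw [mul_add, mul_left_comm]
      exact add_le_add (hRg Y hY a) (mul_le_mul_right (hRg X hX b) _)
  have hmul : ∀ a : ℝ≥0∞, a ≠ ∞ → 16 * a ≠ ∞ := fun a ha => ENNReal.mul_ne_top (by simp) ha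
  obtain ⟨T, C, hTX, hTY, hTg⟩ := H (fun k => (rearr f.1 k : ℝ)) (Sg ⟨y, mem_sum_left hy'⟩)
    (Sg ⟨x, mem_sum_right hx'⟩) (ne_top_of_le_ne_top (hmul _ hy') (hSg Y hY _))
    (ne_top_of_le_ne_top (hmul _ hx') (hSg X hX _))
    (by rw [hsum]; exact fun k l hkl => NNReal.coe_le_coe.2 (hg.rearr_antitone hkl))
    (fun k => by rw [hsum]; exact NNReal.coe_nonneg _) fun τ hτ => by
      rw [hsum]
      refine (hK1 τ hτ).trans ((mul_le_mul_right ((hfg τ hτ).trans (hK2 τ)) _).trans (le_of_eq ?_))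
      rw [← mul_assoc]
      norm_num
  rw [hsum, ← hSgg] at hTg
  have hbound : ∀ Z : KotheSpace D.measure, Z.DistMono →
      (∀ w, Z.dyadicNorm (T w) ≤ C * Z.dyadicNorm w) → ∀ u : sum Y X,
      Z.eNorm (Rf (T (Sg u))) ≤ (2 * (C * 16)) * Z.eNorm u := fun Z hZ hT u => by
    refine (hRf Z hZ _).trans ?_
    rw [mul_assoc, mul_assoc]
    exact mul_le_mul_right ((hT _).trans (mul_le_mul_right (hSg Z hZ u) _)) _
  have hCt : (2 * (C * 16) : ℝ≥0∞) ≠ ∞ := by finiteness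
  have hmem : ∀ u : sum Y X, Rf (T (Sg u)) ∈ sum Y X := fun u => by
    obtain ⟨a, ha, b, hb, hab⟩ := Submodule.mem_sup.1 u.2
    have ha' : Y.eNorm a ≠ ∞ := LT.lt.ne ha
    have hb' : X.eNorm b ≠ ∞ := LT.lt.ne hb
    have hu : (⟨a, mem_sum_left ha'⟩ + ⟨b, mem_sum_right hb'⟩ : sum Y X) = u := Subtype.ext hab
    rw [← hu, _root_.map_add, _root_.map_add, _root_.map_add]
    exact add_mem (mem_sum_left (ne_top_of_le_ne_top (ENNReal.mul_ne_top hCt ha') (hbound Y hY hTY _)))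
      (mem_sum_right (ne_top_of_le_ne_top (ENNReal.mul_ne_top hCt hb') (hbound X hX hTX _)))
  -- The route is g → samples of g* → samples of f* → f.
  refine ⟨(Rf ∘ₗ T ∘ₗ Sg).codRestrict _ hmem, ?_, ?_, Subtype.ext ?_⟩
  · exact (opNorm_le Y _ fun u => hbound Y hY hTY u).trans_lt hCt.lt_top
  · exact (opNorm_le X _ fun u => hbound X hX hTX u).trans_lt hCt.lt_top
  · change Rf (T (Sg g)) = f
    rw [hTg, hRff]

end KotheSpace

namespace KotheSpace

variable {D : RIDomain} {X : KotheSpace D.measure}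

theorem IsElastic.isCalderonCouple_one (hX : X.DistMono) (h : X.IsElastic)
    (hc : X.dyadicNorm.OrderCont) : IsCalderonCouple (lebesgue D.measure 1 le_rfl) X := by
  classical
  obtain ⟨K₁, hK₁⟩ := (SeqNorm.leftShiftProperty_iff X.dyadicNorm).1 h.2
  obtain ⟨K₂, hK₂⟩ := (SeqNorm.rightShiftProperty_iff X.dyadicNorm).1 h.1
  refine IsCalderonCouple.of_antitone (lebesgue_one_distMono _) hX fun f u v hu hv _ _ hK => ?_
  exact SeqNorm.exists_operator_of_orderCont hX.compat_one two_pos hX.weightOne_mono hK₁ leftShift_one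
    hK₂ leftShift_one_dual hc orderCont_one f hu hv fun n => hK _ (hX.compat_one.pos n)

theorem IsElastic.isCalderonCouple_top (hX : X.DistMono) (h : X.IsElastic)
    (hc : X.dyadicNorm.OrderCont) : IsCalderonCouple (lebesgue D.measure ∞ le_top) X := by
  classical
  obtain ⟨K, hK'⟩ := (SeqNorm.rightShiftProperty_iff X.dyadicNorm).1 h.1
  refine IsCalderonCouple.of_antitone (lebesgue_top_distMono _) hX fun f u v hu hv hanti hnn hK => ?_
  set M := (lebesgue D.measure ∞ le_top).dyadicNorm with hM
  have hcomp := hX.compat_top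
  have hmono := hX.weightTop_mono
  have huk : ∀ k, ‖u k‖ₑ ≤ M u := (dyadicNorm_top_le_iff u _).1 le_rfl
  have hne : Nonempty (D.index)ᵒᵈ := D.nonempty_index
  suffices H : ∃ (T : ((D.index)ᵒᵈ → ℝ) →ₗ[ℝ] ((D.index)ᵒᵈ → ℝ)) (C : ℝ≥0),
      (∀ w, X.dyadicNorm.dual (T w) ≤ C * X.dyadicNorm.dual w) ∧
      (∀ w, M.dual (T w) ≤ C * M.dual w) ∧ T (u + v) = Set.univ.indicator f by
    obtain ⟨T, C, hT1, hT2, hT3⟩ := H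
    exact ⟨T, C, hT1, hT2, hT3.trans (Set.indicator_univ _)⟩
  -- L_∞ is not order continuous, so left tails could not be used. For the decreasing sequence g
  -- they are not needed: the E_X part of the K-functional governs at every index.
  refine SeqNorm.exists_operator_of_tail (C := 32) hcomp hmono hK'
    leftShift_top_dual (f : (D.index)ᵒᵈ → ℝ) (u + v : (D.index)ᵒᵈ → ℝ) Set.univ
    (fun n => hK _ (hcomp.pos n)) (fun n _ => ?_) (SeqNorm.bddAbove_add (fun ε hε => ?_) fun ε hε => ?_)
    fun n _ => ?_
  · change X.dyadicNorm ((Iic (OrderDual.ofDual n)).indicator (u + v)) ≠ ∞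
    rw [Set.indicator_add']
    exact ne_top_of_le_ne_top (ENNReal.add_ne_top.2 ⟨hcomp.indicator_Ici_ne_top hmono hu n,
      ne_top_of_le_ne_top hv (X.dyadicNorm.indicator_le _ _)⟩) (X.dyadicNorm.add_le _ _)
  · obtain ⟨n₀⟩ := D.nonempty_index
    set P : ℝ≥0 := (M u).toNNReal with hP
    have hPM : (P : ℝ≥0∞) = M u := ENNReal.coe_toNNReal hu
    -- Near 0 the bounded sequence u is dominated by a constant cut off at n₀. This constant has
    -- finite norm in E_X, whose order continuity gives the decay.
    set w : D.index → ℝ := (Iic n₀).indicator ((P : ℝ) • 1) with hw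
    have hwt : X.dyadicNorm w ≠ ∞ := by
      refine hcomp.indicator_Ici_ne_top hmono (u := ((P : ℝ) • 1 : D.index → ℝ)) ?_ n₀
      refine ne_top_of_le_ne_top (b := (P : ℝ≥0∞)) ENNReal.coe_ne_top
        ((dyadicNorm_top_le_iff _ _).2 fun k => ?_)
      rw [Pi.smul_apply, Pi.one_apply, smul_eq_mul, mul_one, Real.enorm_eq_ofReal P.coe_nonneg,
        ENNReal.ofReal_coe_nnreal]
    refine BddAbove.mono ?_ ((bddAbove_Iic (a := OrderDual.toDual n₀)).union
      (hc.dual.bddAbove (u := w ∘ OrderDual.ofDual) hwt hε))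
    intro n hn
    rcases le_or_gt n (OrderDual.toDual n₀) with h1 | h1
    · exact Or.inl h1
    · refine Or.inr (lt_of_lt_of_le hn (X.dyadicNorm.dual.mono fun k => ?_))
      change |(Ici n).indicator (u ∘ OrderDual.ofDual) k| ≤
        |(Ici n).indicator (w ∘ OrderDual.ofDual) k|
      by_cases hk : k ∈ Ici n
      · rw [Set.indicator_of_mem hk, Set.indicator_of_mem hk]
        have h2 : OrderDual.ofDual k ∈ Iic n₀ := h1.le.trans hk
        simp only [Function.comp_apply, hw]
        rw [Set.indicator_of_mem h2, Pi.smul_apply, Pi.one_apply, smul_eq_mul, mul_one,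
          abs_of_nonneg P.coe_nonneg]
        have h3 := huk k
        rw [← hPM, ← Real.enorm_abs, Real.enorm_eq_ofReal (abs_nonneg _),
          ← ENNReal.ofReal_coe_nnreal] at h3
        exact (ENNReal.ofReal_le_ofReal_iff P.coe_nonneg).1 h3
      · rw [Set.indicator_of_notMem hk, Set.indicator_of_notMem hk]
  · exact hc.dual.bddAbove hv hε
  -- For decreasing nonnegative g the supremum from k on is g(k), and g(k)φ(2^k) is the norm of one
  -- coordinate of g, hence at most the norm of g up to k.
  · set k : D.index := OrderDual.ofDual n with hk
    change M ((Ici k).indicator (u + v)) ≤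
      ((X.fundam k)⁻¹ : ℝ≥0) * X.dyadicNorm ((Iic k).indicator (u + v))
    have h1 : ‖(u + v) k‖ₑ * X.fundam k ≤ X.dyadicNorm ((Iic k).indicator (u + v)) := by
      rw [coe_fundam, ← SeqNorm.indicator_singleton]
      exact X.dyadicNorm.indicator_mono (Set.singleton_subset_iff.2 (Set.mem_Iic.2 le_rfl)) _
    refine le_trans ?_ (mul_le_mul_right h1 _)
    rw [mul_left_comm, ← ENNReal.coe_mul, inv_mul_cancel₀ (fundam_pos k).ne', ENNReal.coe_one, mul_one]
    refine (dyadicNorm_top_le_iff _ _).2 fun l => ?_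
    by_cases hl : l ∈ Ici k
    · rw [Set.indicator_of_mem hl, enorm_le_iff_norm_le, Real.norm_eq_abs, Real.norm_eq_abs,
        abs_of_nonneg (hnn l), abs_of_nonneg (hnn k)]
      exact hanti hl
    · rw [Set.indicator_of_notMem hl, enorm_zero]
      exact zero_le

end KotheSpace

theorem corollary5p10 (D : RIDomain) (X : KotheSpace D.measure)
    (hX : X.IsRearrangementInvariant) (hconc : ∃ r : ℝ, 1 ≤ r ∧ X.IsConcave r) :
    ((KotheSpace.lebesgue D.measure 1 le_rfl).IsCalderonCouple X ∧
      (KotheSpace.lebesgue D.measure ∞ le_top).IsCalderonCouple X) ↔ X.IsElastic := by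
  obtain ⟨r, hr, hconc⟩ := hconc
  exact ⟨fun h => ⟨hX.distMono.isStretchable h.2, hX.distMono.isCompressible h.1⟩,
    fun h => ⟨h.isCalderonCouple_one hX.distMono (hconc.orderCont hr),
      h.isCalderonCouple_top hX.distMono (hconc.orderCont hr)⟩⟩
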